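/- **Conventions.** Let $k$ be a field. All categories and functors are $k$-linear. A monoidal category is a locally presentable $k$-linear category with a $k$-bilinear monoidal structure whose tensor product preserves small colimits in each variable. $\mathrm{Fun}^L(\mathcal C,\mathcal D)$ is the category of colimit-preserving functors and natural transformations. For locally presentable $\mathcal C,\mathcal D$, the tensor product $\boxtimes\colon\mathcal C\times\mathcal D\to\mathcal C\otimes\mathcal D$ is the universal bifunctor into a locally presentable category that preserves colimits in each variable. For $V\in\mathrm{Vect}_k$ and $x\in\mathcal C$, $V\otimes x$ denotes the object representing $\mathrm{Hom}_k(V,\mathrm{Hom}_{\mathcal C}(x,-))$. $\mathcal C^{\otimes\mathrm{op}}$ is $\mathcal C$ with the opposite tensor product. An object $x$ is compact projective if $\mathrm{Hom}(x,-)\colon\mathcal C\to\mathrm{Vect}_k$ preserves small colimits; $\mathcal C^{cp}$ is the full subcategory of such objects. A monoidal category $\mathcal C$ is cp-rigid if $\mathcal C^{cp}$ is a strong generator (that is, $f$ is an isomorphism whenever $\mathrm{Hom}(x,f)$ is bijective for all $x\in\mathcal C^{cp}$) and every object of $\mathcal C^{cp}$ has a left and a right dual. A *duoidal category* is a category with two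 monoidal structures $(\circ,I)$ and $(\otimes,J)$ such that $\circ$ and $I$ are lax monoidal with respect to $(\otimes,J)$, and the associativity and unit constraints of $\circ$ are monoidal; explicitly, it has natural maps $(A\circ B)\otimes(C\circ D)\to(A\otimes C)\circ(B\otimes D)$ and maps $J\to J\circ J$, $I\otimes I\to I$, $J\to I$ satisfying the usual axioms. An equivalence of duoidal categories is an equivalence that is strong monoidal for both structures and compatible with these maps. Let $\mathcal C$ be a cp-rigid monoidal category whose unit $\mathbf 1$ is compact projective. Put $\mathrm{ev}(c,d)=\mathrm{Hom}_{\mathcal C}(\mathbf 1,c\otimes d)$, let $T\colon\mathcal C\otimes\mathcal C\to\mathcal C$ be the colimit-preserving functor with $T(c\boxtimes d)=c\otimes d$, and let $T^R$ be its right adjoint. * $\mathrm{Fun}^L(\mathcal C,\mathcal C)$ carries the composition product $\circ$ with unit $\mathrm{id}$, and the Day convolution $(F\otimes_{\mathrm{Day}}G)(x)=\int^{x_1,x_2\in\mathcal C^{cp}}\mathrm{Hom}(x_1\otimes x_2,x)\otimes F(x_1)\otimes G(x_2)$ with unit $x\mapsto\mathrm{Hom}(\mathbf 1,x)\otimes\mathbf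 1$. The interchange is induced by $F(Gx)\otimes F'(G'y)\to(F\otimes_{\mathrm{Day}}F')(Gx\otimes G'y)\to(F\otimes_{\mathrm{Day}}F')\bigl((G\otimes_{\mathrm{Day}}G')(x\otimes y)\bigr)$. * $\mathcal C\otimes\mathcal C$ carries the convolution product, colimit-preserving in each variable, with $(m_1\boxtimes m_2)\circ(n_1\boxtimes n_2)=\mathrm{ev}(m_2,n_1)\otimes(m_1\boxtimes n_2)$ and unit $T^R(\mathbf 1)$, and the pointwise product of $\mathcal C\otimes\mathcal C^{\otimes\mathrm{op}}$, colimit-preserving in each variable, with $(a_1\boxtimes a_2)\otimes(b_1\boxtimes b_2)=(a_1\otimes b_1)\boxtimes(b_2\otimes a_2)$ and unit $\mathbf 1\boxtimes\mathbf 1$. The interchange is induced by the lax monoidal structure $\mathrm{ev}(a_2,b_1)\otimes\mathrm{ev}(c_2,d_1)\to\mathrm{ev}(c_2\otimes a_2,b_1\otimes d_1)$, and the maps involving the unit $T^R(\mathbf 1)$ by its algebra structure in $\mathcal C\otimes\mathcal C^{\otimes\mathrm{op}}$. * $\mathcal C$ is a module category over $(\mathcal C\otimes\mathcal C,\circ)$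 by $(c_1\boxtimes c_2)\cdot d=\mathrm{ev}(c_2,d)\otimes c_1$, and over $(\mathrm{Fun}^L(\mathcal C,\mathcal C),\circ)$ by $F\cdot d=F(d)$. **Theorem.** Let $\mathcal C$ be a cp-rigid monoidal category with compact projective unit. With the canonical constraints, the above structures make $\mathcal C\otimes\mathcal C$ and $\mathrm{Fun}^L(\mathcal C,\mathcal C)$ duoidal categories and $\mathcal C$ a module category over each of them with respect to $\circ$. The colimit-preserving functor $$\Phi\colon\mathcal C\otimes\mathcal C\longrightarrow\mathrm{Fun}^L(\mathcal C,\mathcal C),\qquad c_1\boxtimes c_2\longmapsto\bigl(d\mapsto\mathrm{ev}(c_2,d)\otimes c_1\bigr)$$ is an equivalence and upgrades to an equivalence of duoidal categories, matching convolution with composition and the pointwise product of $\mathcal C\otimes\mathcal C^{\otimes\mathrm{op}}$ with Day convolution. It intertwines the two module structures on $\mathcal C$: there is a natural isomorphism $t\cdot d\cong\Phi(t)(d)$, compatible with the associativity and unit constraints of the actions, which on pure tensors is the identity of $\mathrm{ev}(c_2,d)\otimes c_1$. -/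

import Mathlib

open CategoryTheory MonoidalCategory Limits Opposite

universe w v u v' u'

namespace PrL

section Linear

variable (k : Type w) [Field k]
variable {C D E T : Type (w + 1)} [Category.{w} C] [Category.{w} D] [Category.{w} E] [Category.{w} T]
variable [Preadditive C] [Preadditive D] [Preadditive E] [Preadditive T]
variable [Linear k C] [Linear k D] [Linear k E] [Linear k T]

/-! ### Colimit-preserving linear functors -/

/-- A `1`-morphism between locally presentable `k`-linear categories: a `k`-linear functor that
preserves all small colimits. -/
structure IsCocontLinear (F : C ⥤ D) : Prop where
  additive : F.Additive
  linear : F.Linear k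
  cocontinuous : PreservesColimitsOfSize.{w, w} F

/-- A bifunctor that is `k`-linear and preserves small colimits in each variable. -/
structure IsCocontBilinear (B : C ⥤ D ⥤ E) : Prop where
  left : ∀ Y : D, IsCocontLinear k (B.flip.obj Y)
  right : ∀ X : C, IsCocontLinear k (B.obj X)

theorem IsCocontLinear.id : IsCocontLinear k (𝟭 C) :=
  ⟨inferInstance, inferInstance, inferInstance⟩

variable {k} in
theorem IsCocontLinear.comp {F : C ⥤ D} {G : D ⥤ E}
    (hF : IsCocontLinear k F) (hG : IsCocontLinear k G) : IsCocontLinear k (F ⋙ G) := by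
  obtain ⟨_, _, _⟩ := hF
  obtain ⟨_, _, _⟩ := hG
  exact ⟨inferInstance, inferInstance, inferInstance⟩

variable (C D) in
/-- The category `Fun^L(C, D)` of colimit-preserving `k`-linear functors and natural
transformations. -/
abbrev FunL : Type (w + 1) :=
  ObjectProperty.FullSubcategory (fun F : C ⥤ D => IsCocontLinear k F)

variable (C D E) in
/-- The category of bifunctors `C × D → E` that are `k`-linear and preserve colimits in each
variable. -/
abbrev BilinL : Type (w + 1) :=
  ObjectProperty.FullSubcategory (fun B : C ⥤ D ⥤ E => IsCocontBilinear k B)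

/-! ### The tensor product of locally presentable categories -/

variable {k} in
theorem IsCocontBilinear.postcomp {B : C ⥤ D ⥤ T} (hB : IsCocontBilinear k B) {F : T ⥤ E}
    (hF : IsCocontLinear k F) :
    IsCocontBilinear k (B ⋙ (Functor.whiskeringRight D T E).obj F) :=
  ⟨fun Y => (hB.left Y).comp hF, fun X => (hB.right X).comp hF⟩

variable {k} in
/-- Restriction along a bifunctor `B : C × D → T`, sending `F : T → E` to the bifunctor
`(X, Y) ↦ F (B (X, Y))`. -/
def restrictAlong {B : C ⥤ D ⥤ T} (hB : IsCocontBilinear k B)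
    (E : Type (w + 1)) [Category.{w} E] [Preadditive E] [Linear k E] :
    FunL k T E ⥤ BilinL k C D E where
  obj F := ⟨B ⋙ (Functor.whiskeringRight D T E).obj F.obj, hB.postcomp F.property⟩
  map α := ObjectProperty.homMk (Functor.whiskerLeft B ((Functor.whiskeringRight D T E).map α.hom))

/-- `B : C × D → T`, `(X, Y) ↦ X ⊠ Y`, exhibits `T` as the tensor product `C ⊗ D` of locally
presentable `k`-linear categories: it is the universal bifunctor that is linear and
colimit-preserving in each variable. -/
structure IsTensorProduct (B : C ⥤ D ⥤ T) : Prop where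
  bilinear : IsCocontBilinear k B
  universal : ∀ (E : Type (w + 1)) [Category.{w} E] [Preadditive E] [Linear k E]
    [IsLocallyPresentable.{w} E], (restrictAlong bilinear E).IsEquivalence

/-- The map `f ⊠ g` between pure tensors. -/
def boxMap (B : C ⥤ D ⥤ T) {X X' : C} {Y Y' : D} (f : X ⟶ X') (g : Y ⟶ Y') :
    (B.obj X).obj Y ⟶ (B.obj X').obj Y' :=
  (B.map f).app Y ≫ (B.obj X').map g

/-- The family `ι : V → Hom(X, P)` exhibits `P` as the tensor `V ⊗ X` of the object `X` with the
`k`-vector space `V`: it is the universal `k`-linear map out of `V` into morphisms out of `X`. -/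
structure IsCopower {V : Type w} [AddCommGroup V] [Module k V] {X P : C} (ι : V → (X ⟶ P)) :
    Prop where
  linear : IsLinearMap k ι
  existsUnique_desc : ∀ (W : C) (φ : V →ₗ[k] (X ⟶ W)), ∃! h : P ⟶ W, ∀ v, ι v ≫ h = φ v

/-! ### Cp-rigid monoidal categories -/

/-- `P` is compact projective: `Hom(P, -) : C ⥤ Vect` preserves small colimits. -/
def IsCompactProjective (P : C) : Prop :=
  PreservesColimitsOfSize.{w, w} ((linearCoyoneda k C).obj (op P))

variable (C) in
/-- The full subcategory of compact projective objects. -/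
abbrev Cp : Type (w + 1) := ObjectProperty.FullSubcategory (fun P : C => IsCompactProjective k P)

variable (C) in
/-- The standing convention on monoidal categories: the tensor product is `k`-bilinear and preserves
small colimits in each variable. -/
class CocontMonoidal [MonoidalCategory C] : Prop where
  bilinear : IsCocontBilinear k (curriedTensor C)

variable (C) in
/-- `C` is cp-rigid: it is generated by its compact projective objects, and each of them has a left
and a right dual. -/
structure IsCpRigid [MonoidalCategory C] : Prop where
  enough : ObjectProperty.IsStrongGenerator (fun P : C => IsCompactProjective k P)
  leftDual : ∀ P : C, IsCompactProjective k P → Nonempty (HasLeftDual P)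
  rightDual : ∀ P : C, IsCompactProjective k P → Nonempty (HasRightDual P)

end Linear

/-! ### Duoidal categories -/

section Duoidal

variable {D : Type u} [Category.{v} D]

/-- A duoidal structure on a category with two monoidal structures, `cmp` (written `(∘, I)`) and
`ptw` (written `(⊗, J)`): the functor `∘` and the object `I` are lax monoidal with respect to `⊗`,
compatibly with the associativity and unit constraints of `∘`. -/
structure Duoidal (cmp ptw : MonoidalCategory D) where
  /-- the interchange map `(W ∘ X) ⊗ (Y ∘ Z) ⟶ (W ⊗ Y) ∘ (X ⊗ Z)` -/
  interchange : ∀ W X Y Z : D, ptw.tensorObj (cmp.tensorObj W X) (cmp.tensorObj Y Z) ⟶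
    cmp.tensorObj (ptw.tensorObj W Y) (ptw.tensorObj X Z)
  /-- `J ⟶ J ∘ J` -/
  comul : ptw.tensorUnit ⟶ cmp.tensorObj ptw.tensorUnit ptw.tensorUnit
  /-- `I ⊗ I ⟶ I` -/
  mul : ptw.tensorObj cmp.tensorUnit cmp.tensorUnit ⟶ cmp.tensorUnit
  /-- `J ⟶ I` -/
  unitMap : ptw.tensorUnit ⟶ cmp.tensorUnit
  interchange_natural : ∀ {W W' X X' Y Y' Z Z' : D}
    (a : W ⟶ W') (b : X ⟶ X') (c : Y ⟶ Y') (d : Z ⟶ Z'),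
    ptw.tensorHom (cmp.tensorHom a b) (cmp.tensorHom c d) ≫ interchange W' X' Y' Z' =
      interchange W X Y Z ≫ cmp.tensorHom (ptw.tensorHom a c) (ptw.tensorHom b d)
  -- `∘` is lax monoidal with respect to `⊗`
  interchange_assoc : ∀ U V W X Y Z : D,
    ptw.whiskerRight (interchange U V W X) (cmp.tensorObj Y Z) ≫
        interchange (ptw.tensorObj U W) (ptw.tensorObj V X) Y Z ≫
        cmp.tensorHom (ptw.associator U W Y).hom (ptw.associator V X Z).hom =
      (ptw.associator (cmp.tensorObj U V) (cmp.tensorObj W X) (cmp.tensorObj Y Z)).hom ≫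
        ptw.whiskerLeft (cmp.tensorObj U V) (interchange W X Y Z) ≫
        interchange U V (ptw.tensorObj W Y) (ptw.tensorObj X Z)
  interchange_left_unit : ∀ X Y : D,
    ptw.whiskerRight comul (cmp.tensorObj X Y) ≫
        interchange ptw.tensorUnit ptw.tensorUnit X Y ≫
        cmp.tensorHom (ptw.leftUnitor X).hom (ptw.leftUnitor Y).hom =
      (ptw.leftUnitor (cmp.tensorObj X Y)).hom
  interchange_right_unit : ∀ X Y : D,
    ptw.whiskerLeft (cmp.tensorObj X Y) comul ≫
        interchange X Y ptw.tensorUnit ptw.tensorUnit ≫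
        cmp.tensorHom (ptw.rightUnitor X).hom (ptw.rightUnitor Y).hom =
      (ptw.rightUnitor (cmp.tensorObj X Y)).hom
  -- `I` is a monoid with respect to `⊗`
  mul_assoc : ptw.whiskerRight mul cmp.tensorUnit ≫ mul =
    (ptw.associator cmp.tensorUnit cmp.tensorUnit cmp.tensorUnit).hom ≫
      ptw.whiskerLeft cmp.tensorUnit mul ≫ mul
  unit_mul : ptw.whiskerRight unitMap cmp.tensorUnit ≫ mul = (ptw.leftUnitor cmp.tensorUnit).hom
  mul_unit : ptw.whiskerLeft cmp.tensorUnit unitMap ≫ mul = (ptw.rightUnitor cmp.tensorUnit).hom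
  -- the associator and the unitors of `∘` are monoidal transformations with respect to `⊗`
  associator_interchange : ∀ U V W X Y Z : D,
    interchange (cmp.tensorObj U V) W (cmp.tensorObj X Y) Z ≫
        cmp.whiskerRight (interchange U V X Y) (ptw.tensorObj W Z) ≫
        (cmp.associator (ptw.tensorObj U X) (ptw.tensorObj V Y) (ptw.tensorObj W Z)).hom =
      ptw.tensorHom (cmp.associator U V W).hom (cmp.associator X Y Z).hom ≫
        interchange U (cmp.tensorObj V W) X (cmp.tensorObj Y Z) ≫
        cmp.whiskerLeft (ptw.tensorObj U X) (interchange V W Y Z)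
  leftUnitor_interchange : ∀ X Y : D,
    interchange cmp.tensorUnit X cmp.tensorUnit Y ≫
        cmp.whiskerRight mul (ptw.tensorObj X Y) ≫ (cmp.leftUnitor (ptw.tensorObj X Y)).hom =
      ptw.tensorHom (cmp.leftUnitor X).hom (cmp.leftUnitor Y).hom
  rightUnitor_interchange : ∀ X Y : D,
    interchange X cmp.tensorUnit Y cmp.tensorUnit ≫
        cmp.whiskerLeft (ptw.tensorObj X Y) mul ≫ (cmp.rightUnitor (ptw.tensorObj X Y)).hom =
      ptw.tensorHom (cmp.rightUnitor X).hom (cmp.rightUnitor Y).hom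
  comul_assoc : comul ≫ cmp.whiskerRight comul ptw.tensorUnit ≫
      (cmp.associator ptw.tensorUnit ptw.tensorUnit ptw.tensorUnit).hom =
    comul ≫ cmp.whiskerLeft ptw.tensorUnit comul
  comul_unitMap_left : comul ≫ cmp.whiskerRight unitMap ptw.tensorUnit ≫
    (cmp.leftUnitor ptw.tensorUnit).hom = 𝟙 _
  comul_unitMap_right : comul ≫ cmp.whiskerLeft ptw.tensorUnit unitMap ≫
    (cmp.rightUnitor ptw.tensorUnit).hom = 𝟙 _

/-- The structure of a (strong) duoidal functor on `F`: strong monoidal structures with respect to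
both products, compatible with the four structure maps of the duoidal categories. A duoidal
equivalence is a duoidal functor whose underlying functor is an equivalence. -/
structure DuoidalFunctor {D' : Type u'} [Category.{v'} D'] {cmp ptw : MonoidalCategory D}
    {cmp' ptw' : MonoidalCategory D'} (S : Duoidal cmp ptw) (S' : Duoidal cmp' ptw')
    (F : D ⥤ D') where
  /-- strong monoidality for `∘` -/
  cmpMonoidal : @Functor.Monoidal D _ cmp D' _ cmp' F
  /-- strong monoidality for `⊗` -/
  ptwMonoidal : @Functor.Monoidal D _ ptw D' _ ptw' F
  map_interchange : ∀ W X Y Z : D,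
    ptw'.tensorHom (cmpMonoidal.μ W X) (cmpMonoidal.μ Y Z) ≫
        ptwMonoidal.μ (cmp.tensorObj W X) (cmp.tensorObj Y Z) ≫ F.map (S.interchange W X Y Z) =
      S'.interchange (F.obj W) (F.obj X) (F.obj Y) (F.obj Z) ≫
        cmp'.tensorHom (ptwMonoidal.μ W Y) (ptwMonoidal.μ X Z) ≫
        cmpMonoidal.μ (ptw.tensorObj W Y) (ptw.tensorObj X Z)
  map_comul : ptwMonoidal.ε ≫ F.map S.comul =
    S'.comul ≫ cmp'.tensorHom ptwMonoidal.ε ptwMonoidal.ε ≫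
      cmpMonoidal.μ ptw.tensorUnit ptw.tensorUnit
  map_mul : ptw'.tensorHom cmpMonoidal.ε cmpMonoidal.ε ≫
      ptwMonoidal.μ cmp.tensorUnit cmp.tensorUnit ≫ F.map S.mul = S'.mul ≫ cmpMonoidal.ε
  map_unitMap : ptwMonoidal.ε ≫ F.map S.unitMap = S'.unitMap ≫ cmpMonoidal.ε

end Duoidal

/-! ### Module categories -/

section Module

open MonoidalLeftAction

/-- A natural isomorphism `θ : m · c ≅ F(m) · c` intertwines the actions of `M` and `N` on `C` along
the monoidal functor `F : M → N`: it is compatible with the associativity and unit constraints, so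
it makes the identity of `C` an equivalence of `M`-module categories. -/
structure Intertwines {M : Type u} [Category.{v} M] [MonoidalCategory M]
    {N : Type u'} [Category.{v'} N] [MonoidalCategory N] {C : Type (w + 1)} [Category.{w} C]
    [MonoidalLeftAction M C] [MonoidalLeftAction N C] (F : M ⥤ N) [F.Monoidal]
    (θ : curriedAction M C ≅ F ⋙ curriedAction N C) : Prop where
  tensor : ∀ (m m' : M) (c : C),
    (θ.hom.app (m ⊗ m')).app c =
      (αₗ m m' c).hom ≫ m ⊴ₗ (θ.hom.app m').app c ≫ (θ.hom.app m).app (F.obj m' ⊙ₗ c) ≫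
        (αₗ (F.obj m) (F.obj m') c).inv ≫ Functor.LaxMonoidal.μ F m m' ⊵ₗ c
  unit : ∀ c : C, (θ.hom.app (𝟙_ M)).app c =
    (λₗ[M] c).hom ≫ (λₗ[N] c).inv ≫ Functor.LaxMonoidal.ε F ⊵ₗ c

end Module

section Monoidal

variable (k : Type w) [Field k]
variable {C T : Type (w + 1)} [Category.{w} C] [Category.{w} T]
variable [Preadditive C] [Preadditive T] [Linear k C] [Linear k T]

/-! ### The duoidal category of endofunctors -/

variable (C) in
/-- Composition of endofunctors, `F ∘ G = (d ↦ F (G d))`, with unit the identity functor. -/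
@[reducible]
def compMonoidal : MonoidalCategory (FunL k C C) where
  tensorObj F G := ⟨G.obj ⋙ F.obj, G.property.comp F.property⟩
  whiskerLeft F _ _ β := ObjectProperty.homMk (Functor.whiskerRight β.hom F.obj)
  whiskerRight α G := ObjectProperty.homMk (Functor.whiskerLeft G.obj α.hom)
  tensorHom α β := ObjectProperty.homMk (β.hom ◫ α.hom)
  tensorUnit := ⟨𝟭 C, IsCocontLinear.id k⟩
  associator F G H := ObjectProperty.isoMk _ (Functor.associator H.obj G.obj F.obj).symm
  leftUnitor F := ObjectProperty.isoMk _ F.obj.rightUnitor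
  rightUnitor F := ObjectProperty.isoMk _ F.obj.leftUnitor

variable (C) in
/-- `C` is a module category over `Fun^L(C, C)` by evaluation, `F · d = F d`. -/
@[reducible]
def evaluationAction : @MonoidalLeftAction (FunL k C C) C _ _ (compMonoidal k C) :=
  letI := compMonoidal k C
  { actionObj := fun F d => F.obj.obj d
    actionHomLeft := fun α d => α.hom.app d
    actionHomRight := fun F _ _ f => F.obj.map f
    actionAssocIso := fun F G d => Iso.refl (F.obj.obj (G.obj.obj d))
    actionUnitIso := fun d => Iso.refl d
    actionAssocIso_hom_naturality := fun {F F' G G' d d'} α β f => by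
      change ((α.hom.app (G.obj.obj d) ≫ F'.obj.map (β.hom.app d)) ≫
        F'.obj.map (G'.obj.map f)) ≫ 𝟙 _ = 𝟙 _ ≫ α.hom.app (G.obj.obj d) ≫
          F'.obj.map (β.hom.app d ≫ G'.obj.map f)
      simp
    actionUnitIso_hom_naturality := fun f => by
      change 𝟙 _ ≫ f = f ≫ 𝟙 _
      simp
    whiskerLeft_actionHomLeft := fun F _ _ β d => by
      change F.obj.map (β.hom.app d) = 𝟙 _ ≫ F.obj.map (β.hom.app d) ≫ 𝟙 _
      simp
    whiskerRight_actionHomLeft := fun G α d => by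
      change α.hom.app (G.obj.obj d) = 𝟙 _ ≫ α.hom.app (G.obj.obj d) ≫ 𝟙 _
      simp
    associator_actionHom := fun F G H d => by
      change 𝟙 _ ≫ 𝟙 _ ≫ F.obj.map (𝟙 _) = 𝟙 _ ≫ 𝟙 _
      simp
    leftUnitor_actionHom := fun F d => by
      change 𝟙 _ = 𝟙 _ ≫ 𝟙 _
      simp
    rightUnitor_actionHom := fun F d => by
      change 𝟙 _ = 𝟙 _ ≫ F.obj.map (𝟙 _)
      simp }

variable [MonoidalCategory C]

variable (C) in
/-- The Day convolution product on `Fun^L(C, C)`. The natural maps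
`F x ⊗ G y ⟶ (F ⊗_Day G) (x ⊗ y)` exhibit `(F ⊗_Day G) x` as the coend
`∫^{x₁, x₂ ∈ C^cp} Hom(x₁ ⊗ x₂, x) ⊗ F x₁ ⊗ G x₂`, the unit is `x ↦ Hom(𝟙, x) ⊗ 𝟙`, and the
action on morphisms and the constraints are the ones induced by those of `C`. By the universal
properties these data determine the monoidal structure up to unique isomorphism. -/
structure DayProduct where
  monoidal : MonoidalCategory (FunL k C C)
  /-- the coend inclusions, at the identity of `x ⊗ y` -/
  incl : ∀ (F G : FunL k C C) (x y : C),
    F.obj.obj x ⊗ G.obj.obj y ⟶ (monoidal.tensorObj F G).obj.obj (x ⊗ y)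
  incl_natural : ∀ (F G : FunL k C C) {x x' y y' : C} (a : x ⟶ x') (b : y ⟶ y'),
    (F.obj.map a ⊗ₘ G.obj.map b) ≫ incl F G x' y' =
      incl F G x y ≫ (monoidal.tensorObj F G).obj.map (a ⊗ₘ b)
  /-- every dinatural family of linear maps `Hom(x₁ ⊗ x₂, x) → Hom(F x₁ ⊗ G x₂, W)`, for `x₁`, `x₂`
  compact projective, factors uniquely through `(F ⊗_Day G) x` -/
  isCoend : ∀ (F G : FunL k C C) (x W : C)
    (φ : ∀ x₁ x₂ : Cp k C, (x₁.obj ⊗ x₂.obj ⟶ x) →ₗ[k] (F.obj.obj x₁.obj ⊗ G.obj.obj x₂.obj ⟶ W)),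
    (∀ (x₁ x₂ y₁ y₂ : Cp k C) (a : x₁ ⟶ y₁) (b : x₂ ⟶ y₂) (f : y₁.obj ⊗ y₂.obj ⟶ x),
      φ x₁ x₂ ((a.hom ⊗ₘ b.hom) ≫ f) = (F.obj.map a.hom ⊗ₘ G.obj.map b.hom) ≫ φ y₁ y₂ f) →
    ∃! t : (monoidal.tensorObj F G).obj.obj x ⟶ W,
      ∀ (x₁ x₂ : Cp k C) (f : x₁.obj ⊗ x₂.obj ⟶ x),
        incl F G x₁.obj x₂.obj ≫ (monoidal.tensorObj F G).obj.map f ≫ t = φ x₁ x₂ f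
  tensorHom_app : ∀ {F F' G G' : FunL k C C} (α : F ⟶ F') (β : G ⟶ G') (x y : C),
    incl F G x y ≫ (monoidal.tensorHom α β).hom.app (x ⊗ y) =
      (α.hom.app x ⊗ₘ β.hom.app y) ≫ incl F' G' x y
  /-- the unit `J` is `x ↦ Hom(𝟙, x) ⊗ 𝟙`; this is the element of `Hom(𝟙, J 𝟙)` given by `id` -/
  unitElt : 𝟙_ C ⟶ monoidal.tensorUnit.obj.obj (𝟙_ C)
  unit_isCopower : ∀ x : C, IsCopower k
    (fun f : 𝟙_ C ⟶ x => unitElt ≫ monoidal.tensorUnit.obj.map f)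
  associator_app : ∀ (F G H : FunL k C C) (x y z : C),
    incl F G x y ▷ H.obj.obj z ≫ incl (monoidal.tensorObj F G) H (x ⊗ y) z ≫
        (monoidal.associator F G H).hom.hom.app ((x ⊗ y) ⊗ z) ≫
        (monoidal.tensorObj F (monoidal.tensorObj G H)).obj.map (α_ x y z).hom =
      (α_ (F.obj.obj x) (G.obj.obj y) (H.obj.obj z)).hom ≫ F.obj.obj x ◁ incl G H y z ≫
        incl F (monoidal.tensorObj G H) x (y ⊗ z)
  leftUnitor_app : ∀ (F : FunL k C C) (x : C),
    unitElt ▷ F.obj.obj x ≫ incl monoidal.tensorUnit F (𝟙_ C) x ≫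
        (monoidal.leftUnitor F).hom.hom.app (𝟙_ C ⊗ x) ≫ F.obj.map (λ_ x).hom =
      (λ_ (F.obj.obj x)).hom
  rightUnitor_app : ∀ (F : FunL k C C) (x : C),
    F.obj.obj x ◁ unitElt ≫ incl F monoidal.tensorUnit x (𝟙_ C) ≫
        (monoidal.rightUnitor F).hom.hom.app (x ⊗ 𝟙_ C) ≫ F.obj.map (ρ_ x).hom =
      (ρ_ (F.obj.obj x)).hom

variable (C) in
/-- The duoidal category `Fun^L(C, C)`: composition and Day convolution, with the structure maps
induced by the universal property of Day convolution. -/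
structure FunDuoidal where
  day : DayProduct k C
  duoidal : Duoidal (compMonoidal k C) day.monoidal
  /-- the interchange map is induced by
  `F (G x) ⊗ F' (G' y) ⟶ (F ⊗ F') (G x ⊗ G' y) ⟶ (F ⊗ F') ((G ⊗ G') (x ⊗ y))` -/
  interchange_app : ∀ (F G F' G' : FunL k C C) (x y : C),
    day.incl ((compMonoidal k C).tensorObj F G) ((compMonoidal k C).tensorObj F' G') x y ≫
        (duoidal.interchange F G F' G').hom.app (x ⊗ y) =
      day.incl F F' (G.obj.obj x) (G'.obj.obj y) ≫
        (day.monoidal.tensorObj F F').obj.map (day.incl G G' x y)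
  comul_app : day.unitElt ≫ duoidal.comul.hom.app (𝟙_ C) =
    day.unitElt ≫ day.monoidal.tensorUnit.obj.map day.unitElt
  mul_app : ∀ x y : C,
    day.incl (compMonoidal k C).tensorUnit (compMonoidal k C).tensorUnit x y ≫
      duoidal.mul.hom.app (x ⊗ y) = 𝟙 (x ⊗ y)
  unitMap_app : day.unitElt ≫ duoidal.unitMap.hom.app (𝟙_ C) = 𝟙 (𝟙_ C)

/-! ### The duoidal category `C ⊗ C` -/

/-- `A : T × C → C` is the colimit-preserving functor given on pure tensors by
`(c₁ ⊠ c₂, d) ↦ ev(c₂, d) ⊗ c₁`, where `ev(c₂, d) = Hom(𝟙, c₂ ⊗ d)`. -/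
structure PairingKernel (B : C ⥤ C ⥤ T) (A : T ⥤ C ⥤ C) where
  bilinear : IsCocontBilinear k A
  /-- the universal linear map `ev(c₂, d) → Hom(c₁, A (c₁ ⊠ c₂, d))` -/
  incl : ∀ c₁ c₂ d : C, (𝟙_ C ⟶ c₂ ⊗ d) → (c₁ ⟶ (A.obj ((B.obj c₁).obj c₂)).obj d)
  isCopower : ∀ c₁ c₂ d : C, IsCopower k (incl c₁ c₂ d)
  natural : ∀ {c₁ c₁' c₂ c₂' d d' : C} (a : c₁ ⟶ c₁') (b : c₂ ⟶ c₂') (e : d ⟶ d')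
    (f : 𝟙_ C ⟶ c₂ ⊗ d),
    incl c₁ c₂ d f ≫ (A.map (boxMap B a b)).app d ≫ (A.obj ((B.obj c₁').obj c₂')).map e =
      a ≫ incl c₁' c₂' d' (f ≫ (b ⊗ₘ e))

/-- The bifunctor `⊠` as a functor on the monoidal category `C × C^{⊗op}`. -/
abbrev boxRev (B : C ⥤ C ⥤ T) : C × Cᴹᵒᵖ ⥤ T :=
  (𝟭 C).prod (unmopFunctor C) ⋙ Functor.uncurry.obj B

/-- The pointwise product on `C ⊗ C^{⊗op}`: the colimit-preserving monoidal structure for which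
`⊠ : C × C^{⊗op} → C ⊗ C^{⊗op}` is strong monoidal, so that
`(a₁ ⊠ a₂) ⊗ (b₁ ⊠ b₂) = (a₁ ⊗ b₁) ⊠ (b₂ ⊗ a₂)` with the componentwise constraints and with unit
`𝟙 ⊠ 𝟙`. -/
structure PointwiseProduct (B : C ⥤ C ⥤ T) where
  monoidal : MonoidalCategory T
  bilinear : IsCocontBilinear k (@curriedTensor T _ monoidal)
  boxMonoidal : @Functor.Monoidal (C × Cᴹᵒᵖ) _ _ T _ monoidal (boxRev B)

namespace PointwiseProduct

variable {k} {B : C ⥤ C ⥤ T} (P : PointwiseProduct k B)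

/-- `(a₁ ⊠ a₂) ⊗ (b₁ ⊠ b₂) ≅ (a₁ ⊗ b₁) ⊠ (b₂ ⊗ a₂)` -/
def tensorIso (a₁ a₂ b₁ b₂ : C) :
    P.monoidal.tensorObj ((B.obj a₁).obj a₂) ((B.obj b₁).obj b₂) ≅
      (B.obj (a₁ ⊗ b₁)).obj (b₂ ⊗ a₂) :=
  letI := P.monoidal
  letI := P.boxMonoidal
  Functor.Monoidal.μIso (boxRev B) (a₁, ⟨a₂⟩) (b₁, ⟨b₂⟩)

/-- `J ≅ 𝟙 ⊠ 𝟙` -/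
def unitIso : P.monoidal.tensorUnit ≅ (B.obj (𝟙_ C)).obj (𝟙_ C) :=
  letI := P.monoidal
  letI := P.boxMonoidal
  Functor.Monoidal.εIso (boxRev B)

end PointwiseProduct

section Convolution

variable {k} [IsLocallyPresentable.{w} C] [CocontMonoidal k C] {B : C ⥤ C ⥤ T}

/-- The colimit-preserving functor `C ⊗ C → C`, `X ⊠ Y ↦ X ⊗ Y`, induced by the tensor product. -/
noncomputable def tensorFunctor (h : IsTensorProduct k B) : T ⥤ C :=
  haveI := h.universal C
  ((restrictAlong h.bilinear C).inv.obj ⟨curriedTensor C, CocontMonoidal.bilinear⟩).obj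

/-- The defining isomorphism of bifunctors between `(X, Y) ↦ tensorFunctor (X ⊠ Y)` and the tensor
product of `C`. -/
noncomputable def tensorFunctorIso (h : IsTensorProduct k B) :
    B ⋙ (Functor.whiskeringRight C T C).obj (tensorFunctor h) ≅ curriedTensor C :=
  haveI := h.universal C
  (ObjectProperty.ι _).mapIso
    ((restrictAlong h.bilinear C).asEquivalence.counitIso.app
      ⟨curriedTensor C, CocontMonoidal.bilinear⟩)

/-- The convolution product on `C ⊗ C`: the colimit-preserving monoidal structure given on pure
tensors by `(m₁ ⊠ m₂) ∘ (n₁ ⊠ n₂) = ev(m₂, n₁) ⊗ (m₁ ⊠ n₂)`, where `ev(m₂, n₁) = Hom(𝟙, m₂ ⊗ n₁)`,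
with unit `coev(k) = T^R(𝟙)`, where `T^R` is right adjoint to the tensor functor. The constraints
are the ones of the endomorphism algebra of a self-dual object. As `C ⊗ C` is generated under
colimits by pure tensors, these data determine the monoidal structure up to unique isomorphism. -/
structure ConvolutionProduct (h : IsTensorProduct k B) where
  monoidal : MonoidalCategory T
  bilinear : IsCocontBilinear k (@curriedTensor T _ monoidal)
  /-- the universal linear map `ev(m₂, n₁) → Hom(m₁ ⊠ n₂, (m₁ ⊠ m₂) ∘ (n₁ ⊠ n₂))` -/
  incl : ∀ m₁ m₂ n₁ n₂ : C, (𝟙_ C ⟶ m₂ ⊗ n₁) →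
    ((B.obj m₁).obj n₂ ⟶ monoidal.tensorObj ((B.obj m₁).obj m₂) ((B.obj n₁).obj n₂))
  isCopower : ∀ m₁ m₂ n₁ n₂ : C, IsCopower k (incl m₁ m₂ n₁ n₂)
  natural : ∀ {m₁ m₁' m₂ m₂' n₁ n₁' n₂ n₂' : C} (a : m₁ ⟶ m₁') (b : m₂ ⟶ m₂')
    (c : n₁ ⟶ n₁') (d : n₂ ⟶ n₂') (f : 𝟙_ C ⟶ m₂ ⊗ n₁),
    incl m₁ m₂ n₁ n₂ f ≫ monoidal.tensorHom (boxMap B a b) (boxMap B c d) =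
      boxMap B a d ≫ incl m₁' m₂' n₁' n₂' (f ≫ (b ⊗ₘ c))
  /-- the counit `T(T^R(𝟙)) ⟶ 𝟙` -/
  counit : (tensorFunctor h).obj monoidal.tensorUnit ⟶ 𝟙_ C
  /-- the unit object of the convolution product is the value of `T^R` at `𝟙` -/
  counit_universal : ∀ (t : T) (f : (tensorFunctor h).obj t ⟶ 𝟙_ C),
    ∃! g : t ⟶ monoidal.tensorUnit, (tensorFunctor h).map g ≫ counit = f
  /-- both bracketings of a triple product are `ev(m₂, n₁) ⊗ ev(n₂, p₁) ⊗ (m₁ ⊠ p₂)` -/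
  associator_incl : ∀ (m₁ m₂ n₁ n₂ p₁ p₂ : C) (f : 𝟙_ C ⟶ m₂ ⊗ n₁) (g : 𝟙_ C ⟶ n₂ ⊗ p₁),
    incl m₁ n₂ p₁ p₂ g ≫ monoidal.whiskerRight (incl m₁ m₂ n₁ n₂ f) ((B.obj p₁).obj p₂) ≫
        (monoidal.associator ((B.obj m₁).obj m₂) ((B.obj n₁).obj n₂) ((B.obj p₁).obj p₂)).hom =
      incl m₁ m₂ n₁ p₂ f ≫ monoidal.whiskerLeft ((B.obj m₁).obj m₂) (incl n₁ n₂ p₁ p₂ g)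
  /-- the left unitor, given by the duality `(id ⊗ ev) ∘ (coev ⊗ id) ≅ id` -/
  leftUnitor_incl : ∀ (c₁ c₂ n₁ n₂ : C) (g : (B.obj c₁).obj c₂ ⟶ monoidal.tensorUnit)
    (f : 𝟙_ C ⟶ c₂ ⊗ n₁),
    incl c₁ c₂ n₁ n₂ f ≫ monoidal.whiskerRight g ((B.obj n₁).obj n₂) ≫
        (monoidal.leftUnitor ((B.obj n₁).obj n₂)).hom =
      boxMap B ((ρ_ c₁).inv ≫ c₁ ◁ f ≫ (α_ c₁ c₂ n₁).inv ≫
        (((tensorFunctorIso h).inv.app c₁).app c₂ ≫ (tensorFunctor h).map g ≫ counit) ▷ n₁ ≫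
        (λ_ n₁).hom) (𝟙 n₂)
  /-- the right unitor, given by the duality `(ev ⊗ id) ∘ (id ⊗ coev) ≅ id` -/
  rightUnitor_incl : ∀ (m₁ m₂ c₁ c₂ : C) (g : (B.obj c₁).obj c₂ ⟶ monoidal.tensorUnit)
    (f : 𝟙_ C ⟶ m₂ ⊗ c₁),
    incl m₁ m₂ c₁ c₂ f ≫ monoidal.whiskerLeft ((B.obj m₁).obj m₂) g ≫
        (monoidal.rightUnitor ((B.obj m₁).obj m₂)).hom =
      boxMap B (𝟙 m₁) ((λ_ c₂).inv ≫ f ▷ c₂ ≫ (α_ m₂ c₁ c₂).hom ≫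
        m₂ ◁ (((tensorFunctorIso h).inv.app c₁).app c₂ ≫ (tensorFunctor h).map g ≫ counit) ≫
        (ρ_ m₂).hom)

/-- The morphism `X ⊗ Y ⟶ 𝟙` adjunct to `X ⊠ Y ⟶ T^R(𝟙)`. -/
noncomputable def ConvolutionProduct.adjunct {h : IsTensorProduct k B} (S : ConvolutionProduct h)
    {X Y : C} (g : (B.obj X).obj Y ⟶ S.monoidal.tensorUnit) : X ⊗ Y ⟶ 𝟙_ C :=
  ((tensorFunctorIso h).inv.app X).app Y ≫ (tensorFunctor h).map g ≫ S.counit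

/-- The lax monoidal structure `ev(a₂, b₁) ⊗ ev(c₂, d₁) → ev(c₂ ⊗ a₂, b₁ ⊗ d₁)` of the evaluation
pairing `C^{⊗op} ⊗ C → Vect`. -/
def evMul {a₂ b₁ c₂ d₁ : C} (f : 𝟙_ C ⟶ a₂ ⊗ b₁) (g : 𝟙_ C ⟶ c₂ ⊗ d₁) :
    𝟙_ C ⟶ (c₂ ⊗ a₂) ⊗ (b₁ ⊗ d₁) :=
  g ≫ c₂ ◁ ((λ_ d₁).inv ≫ f ▷ d₁ ≫ (α_ a₂ b₁ d₁).hom) ≫ (α_ c₂ a₂ (b₁ ⊗ d₁)).inv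

/-- The duoidal category `C ⊗ C`: the convolution product and the pointwise product of
`C ⊗ C^{⊗op}`, with the structure maps given by the lax monoidal structures of `ev` and `coev`, the
latter being the algebra structure of `T^R(𝟙)`. -/
structure TensorDuoidal (h : IsTensorProduct k B) where
  conv : ConvolutionProduct h
  ptw : PointwiseProduct k B
  duoidal : Duoidal conv.monoidal ptw.monoidal
  interchange_incl : ∀ (a₁ a₂ b₁ b₂ c₁ c₂ d₁ d₂ : C) (f : 𝟙_ C ⟶ a₂ ⊗ b₁) (g : 𝟙_ C ⟶ c₂ ⊗ d₁),
    ptw.monoidal.tensorHom (conv.incl a₁ a₂ b₁ b₂ f) (conv.incl c₁ c₂ d₁ d₂ g) ≫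
        duoidal.interchange ((B.obj a₁).obj a₂) ((B.obj b₁).obj b₂)
          ((B.obj c₁).obj c₂) ((B.obj d₁).obj d₂) =
      (ptw.tensorIso a₁ b₂ c₁ d₂).hom ≫
        conv.incl (a₁ ⊗ c₁) (c₂ ⊗ a₂) (b₁ ⊗ d₁) (d₂ ⊗ b₂) (evMul f g) ≫
        conv.monoidal.tensorHom (ptw.tensorIso a₁ a₂ c₁ c₂).inv (ptw.tensorIso b₁ b₂ d₁ d₂).inv
  comul_incl : duoidal.comul = ptw.unitIso.hom ≫
    conv.incl (𝟙_ C) (𝟙_ C) (𝟙_ C) (𝟙_ C) (λ_ (𝟙_ C)).inv ≫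
      conv.monoidal.tensorHom ptw.unitIso.inv ptw.unitIso.inv
  mul_adjunct : ∀ (c₁ c₂ d₁ d₂ : C) (f : (B.obj c₁).obj c₂ ⟶ conv.monoidal.tensorUnit)
    (g : (B.obj d₁).obj d₂ ⟶ conv.monoidal.tensorUnit),
    conv.adjunct ((ptw.tensorIso c₁ c₂ d₁ d₂).inv ≫ ptw.monoidal.tensorHom f g ≫ duoidal.mul) =
      (α_ c₁ d₁ (d₂ ⊗ c₂)).hom ≫
        c₁ ◁ ((α_ d₁ d₂ c₂).inv ≫ conv.adjunct g ▷ c₂ ≫ (λ_ c₂).hom) ≫ conv.adjunct f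
  unitMap_adjunct : conv.adjunct (ptw.unitIso.inv ≫ duoidal.unitMap) = (λ_ (𝟙_ C)).hom

/-- `C` as a module category over `C ⊗ C` with respect to convolution,
`(c₁ ⊠ c₂) · d = ev(c₂, d) ⊗ c₁`. -/
structure ConvolutionModule {h : IsTensorProduct k B} (S : ConvolutionProduct h) where
  action : @MonoidalLeftAction T C _ _ S.monoidal
  kernel : PairingKernel k B
    (@MonoidalLeftAction.curriedAction T C _ _ S.monoidal action)
  assoc_incl : ∀ (m₁ m₂ n₁ n₂ d : C) (f : 𝟙_ C ⟶ m₂ ⊗ n₁) (g : 𝟙_ C ⟶ n₂ ⊗ d),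
    kernel.incl m₁ n₂ d g ≫ action.actionHomLeft (S.incl m₁ m₂ n₁ n₂ f) d ≫
        (action.actionAssocIso ((B.obj m₁).obj m₂) ((B.obj n₁).obj n₂) d).hom =
      kernel.incl m₁ m₂ (action.actionObj ((B.obj n₁).obj n₂) d)
        (f ≫ m₂ ◁ kernel.incl n₁ n₂ d g)
  unit_incl : ∀ (c₁ c₂ d : C) (g : (B.obj c₁).obj c₂ ⟶ S.monoidal.tensorUnit)
    (f : 𝟙_ C ⟶ c₂ ⊗ d),
    kernel.incl c₁ c₂ d f ≫ action.actionHomLeft g d ≫ (action.actionUnitIso d).hom =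
      (ρ_ c₁).inv ≫ c₁ ◁ f ≫ (α_ c₁ c₂ d).inv ≫ S.adjunct g ▷ d ≫ (λ_ d).hom

end Convolution

end Monoidal

end PrL

set_option linter.unusedSectionVars false

namespace PrL

/-! ### Colimits and compact projective generators -/

section Generation

/-! The functor `Φ` is the analogue of the isomorphism between `V ⊗ V*` and `End V`, and duality in
`C` makes `ev` a perfect pairing. If `q` has right dual `y`, then `ev(q, d) = Hom(𝟙, q ⊗ d)` is
`Hom(y, d)`, so `Φ(c ⊠ q)` is `d ↦ Hom(y, d) ⊗ c`. By Yoneda, its maps to a colimit-preserving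
linear functor `F` are `Hom(c, F y)` (`bijective_evaluation_fun`). On the other side, coevaluation
and contraction with the evaluation identify `Hom(c ⊠ q, t)` with `Hom(c, Φ(t)(y))`
(`bijective_evaluation_tensor`). So `Φ` is bijective on maps out of such pure tensors.

To reach all objects one needs these pure tensors to generate `C ⊗ C` under colimits, which the
universal property does not say directly. `tensor_induction` proves it by writing the identity
functor of `C ⊗ C` as the colimit of the functors `t ↦ Φ(t)(p) ⊠ q`, indexed by pairs of compact
projectives with a pairing `p ⊗ q ⟶ 𝟙`. The colimit of the objects `F p ⊠ q` over the same index
category is a preimage of `F` (`exists_obj_iso`), so `Φ` is an equivalence. Compact projectivity of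
`𝟙` is what makes `ev` cocontinuous and dualizable objects compact projective.

The right adjoint `T^R` sends `x` to the object representing `x ⊗ -` (`exists_rightAdjoint`); in
particular `T^R(𝟙)` represents the identity functor. Day convolution of `F` and `G` is `T^R`
followed by the extension to `C ⊗ C` of `(x, y) ↦ F x ⊗ G y` (`exists_dayConvolution`). Its
universal property yields the constraints and the interchange map.

Both products and all duoidal structure maps on `C ⊗ C` are then obtained by transport along `Φ`,
and the work lies in showing that they have the prescribed form on pure tensors. All identities are
checked on generalized elements `X ⟶ F x`. Composition and Day convolution both have a product of
elements, and the interchange map is the rule `(f ∘ g)(f' ∘ g') = (f f') ∘ (g g')`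
(`mulElt_interchange`). Elements of `Φ(c₁ ⊠ c₂)` at `d` come from `f ∈ ev(c₂, d)`; in these terms
`convIncl` and `boxMul` compute the transported products, and `boxMul_isIso` gives strong
monoidality of `⊠` by reduction to dualizable second factors. The action of `C ⊗ C` on `C` is
evaluation restricted along `Φ`, so the intertwining isomorphism consists of identities. -/

theorem hasColimitsOfSize_of_isLocallyPresentable (C : Type (w + 1)) [Category.{w} C]
    [IsLocallyPresentable.{w} C] : HasColimitsOfSize.{w, w} C := by
  obtain ⟨κ, hκ, h⟩ := IsLocallyPresentable.exists_cardinal.{w} C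
  exact h.toHasColimitsOfSize

variable (k : Type w) [Field k]
variable {C : Type (w + 1)} [Category.{w} C] [Preadditive C] [Linear k C]

/-- Filtered colimits are small colimits, and the forgetful functor from vector spaces preserves
them. This bounds the compact projectives by the presentable objects of a fixed rank, of which there
is essentially a set. -/
theorem IsCompactProjective.isCardinalPresentable {P : C} (hP : IsCompactProjective k P)
    (κ : Cardinal.{w}) [Fact κ.IsRegular] : IsCardinalPresentable P κ where
  preservesColimitOfShape J _ _ := by
    have : IsFiltered J := isFiltered_of_isCardinalFiltered J κ
    have := hP
    rw [IsCompactProjective] at this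
    change PreservesColimitsOfShape J
      ((linearCoyoneda k C).obj (op P) ⋙ forget (ModuleCat.{w} k))
    infer_instance

variable (C) in
theorem essentiallySmall_cp [IsLocallyPresentable.{w} C] : EssentiallySmall.{w} (Cp k C) := by
  obtain ⟨κ, hκ, h⟩ := IsLocallyPresentable.exists_cardinal.{w} C
  have : ObjectProperty.EssentiallySmall.{w} (fun P : C => IsCompactProjective k P) :=
    ObjectProperty.EssentiallySmall.of_le (Q := isCardinalPresentable C κ)
      (fun P hP => IsCompactProjective.isCardinalPresentable k hP κ)
  infer_instance

/-- A property of objects is closed under small colimits. -/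
def ColimitClosed {D : Type u} [Category.{v} D] (P : D → Prop) : Prop :=
  ∀ (J : Type w) [SmallCategory J] (F : J ⥤ D) (c : Cocone F), IsColimit c →
    (∀ j, P (F.obj j)) → P c.pt

/-- Parallel pairs and one-point diagrams live in the lowest universe; `AsSmall` lifts them to the
universe of the definition. -/
theorem ColimitClosed.of_shape {D : Type u} [Category.{v} D] {P : D → Prop}
    (hP : ColimitClosed.{w} P) (J : Type) [SmallCategory J] (F : J ⥤ D) (c : Cocone F)
    (hc : IsColimit c) (h : ∀ j, P (F.obj j)) : P c.pt :=
  hP (AsSmall.{w} J) ((AsSmall.equiv (C := J)).inverse ⋙ F)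
    (c.whisker (AsSmall.equiv (C := J)).inverse)
    (hc.whiskerEquivalence (AsSmall.equiv (C := J)).symm) (fun _ => h _)

/-- Being an epimorphism is a pushout condition, so `Hom(P, -)` preserves it, and epimorphisms of
vector spaces are surjective. -/
theorem IsCompactProjective.comp_surjective {P X Y : C} (hP : IsCompactProjective k P) (q : X ⟶ Y)
    [Epi q] (u : P ⟶ Y) : ∃ g : P ⟶ X, g ≫ q = u := by
  have := hP
  rw [IsCompactProjective] at this
  have : PreservesColimitsOfShape WalkingSpan ((linearCoyoneda k C).obj (op P)) :=
    PreservesColimitsOfSize.preservesFiniteColimits _ |>.preservesFiniteColimits _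
  have h : Epi (((linearCoyoneda k C).obj (op P)).map q) := inferInstance
  exact (ModuleCat.epi_iff_surjective _).1 h u

/-- If the compact projective objects strongly generate, every object is a cokernel of a map between
coproducts of them. -/
theorem cp_induction [IsLocallyPresentable.{w} C]
    (hgen : ObjectProperty.IsStrongGenerator (fun P : C => IsCompactProjective k P))
    {P : C → Prop} (hP : ColimitClosed.{w} P) (h : ∀ X, IsCompactProjective k X → P X) (X : C) :
    P X := by
  have := hasColimitsOfSize_of_isLocallyPresentable C
  have := essentiallySmall_cp k C
  let A := SmallModel.{w} (Cp k C)
  let ι : A ⥤ C := (equivSmallModel (Cp k C)).inverse ⋙ ObjectProperty.ι _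
  have hι (a : A) : IsCompactProjective k (ι.obj a) :=
    ((equivSmallModel (Cp k C)).inverse.obj a).property
  have lift {Q Y : C} (hQ : IsCompactProjective k Q) : ∃ a : A, Nonempty (Q ≅ ι.obj a) :=
    ⟨(equivSmallModel (Cp k C)).functor.obj ⟨Q, hQ⟩, ⟨(ObjectProperty.ι _).mapIso
      ((equivSmallModel (Cp k C)).unitIso.app ⟨Q, hQ⟩)⟩⟩
  have hco {β : Type w} (f : β → A) : P (∐ fun b => ι.obj (f b)) :=
    hP (Discrete β) _ _ (colimit.isColimit _) (fun b => h _ (hι _))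
  -- Generators: one summand for each map to `X` from a small set of representatives of the compact
  -- projectives.
  let P₀ := ∐ fun i : (Σ a : A, ι.obj a ⟶ X) => ι.obj i.1
  let π : P₀ ⟶ X := Sigma.desc fun i => i.2
  -- Relations: one summand for each map from such an object into `P₀` that is killed by `π`.
  let P₁ := ∐ fun i : (Σ a : A, {g : ι.obj a ⟶ P₀ // g ≫ π = 0}) => ι.obj i.1
  let ψ : P₁ ⟶ P₀ := Sigma.desc fun i => i.2.1
  have hψ : ψ ≫ π = 0 := by
    refine Sigma.hom_ext _ _ fun i => ?_
    simp only [ψ, colimit.ι_desc_assoc, Cofan.mk_pt, Cofan.mk_ι_app, comp_zero]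
    exact i.2.2
  let ρ : cokernel ψ ⟶ X := cokernel.desc ψ π hψ
  have hcok : P (cokernel ψ) :=
    hP.of_shape _ _ _ (colimit.isColimit (parallelPair ψ 0)) (by rintro (_ | _) <;> exact hco _)
  -- Projectivity lifts `u` to a map `Q ⟶ P₀`. The lift is killed by `π`, so up to isomorphism it is
  -- one of the summands of `P₁` and dies in the cokernel.
  have hinj {Q : C} (hQ : IsCompactProjective k Q) (u : Q ⟶ cokernel ψ) (hu : u ≫ ρ = 0) :
      u = 0 := by
    obtain ⟨g, rfl⟩ := IsCompactProjective.comp_surjective k hQ (cokernel.π ψ) u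
    obtain ⟨a, ⟨e⟩⟩ := lift (Y := X) hQ
    have hg : (e.inv ≫ g) ≫ π = 0 := by
      simpa [ρ] using congrArg (fun t => e.inv ≫ t) hu
    have h1 : Sigma.ι (fun i : (Σ a : A, {g : ι.obj a ⟶ P₀ // g ≫ π = 0}) => ι.obj i.1)
        ⟨a, e.inv ≫ g, hg⟩ ≫ ψ = e.inv ≫ g := by simp [ψ]
    have h2 : g = e.hom ≫ Sigma.ι (fun i : (Σ a : A, {g : ι.obj a ⟶ P₀ // g ≫ π = 0}) =>
      ι.obj i.1) ⟨a, e.inv ≫ g, hg⟩ ≫ ψ := by simp [h1]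
    rw [h2]; simp
  have : Mono ρ := by
    refine Preadditive.mono_of_cancel_zero _ fun {Q} g hg => ?_
    refine hgen.isSeparating _ _ fun G hG f => ?_
    rw [comp_zero]
    exact hinj hG _ (by rw [Category.assoc, hg, comp_zero])
  -- A monomorphism is invertible as soon as maps from a strong generator lift through it; here
  -- every such map is already a summand of `P₀`.
  have : IsIso ρ := by
    refine hgen.isIso_of_mono ρ fun G hG f => ?_
    obtain ⟨a, ⟨e⟩⟩ := lift (Y := X) hG
    refine ⟨e.hom ≫ Sigma.ι (fun i : (Σ a : A, ι.obj a ⟶ X) => ι.obj i.1) ⟨a, e.inv ≫ f⟩ ≫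
      cokernel.π ψ, ?_⟩
    simp [ρ, π]
  have hone := hP.of_shape (Discrete PUnit) (Discrete.functor fun _ => cokernel ψ)
    { pt := X, ι := Discrete.natTrans fun _ => ρ }
    { desc := fun s => inv ρ ≫ s.ι.app ⟨⟨⟩⟩
      fac := by rintro s ⟨⟨⟩⟩; simp
      uniq := by intro s m hm; simp [← hm ⟨⟨⟩⟩] } (fun _ => hcok)
  exact hone

theorem ColimitClosed.of_iso {D : Type u} [Category.{v} D] {P : D → Prop}
    (hP : ColimitClosed.{w} P) {X Y : D} (e : X ≅ Y) (h : P X) : P Y :=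
  hP.of_shape (Discrete PUnit) (Discrete.functor fun _ => X)
    { pt := Y, ι := Discrete.natTrans fun _ => e.hom }
    { desc := fun s => e.inv ≫ s.ι.app ⟨⟨⟩⟩
      fac := by rintro s ⟨⟨⟩⟩; simp
      uniq := by intro s m hm; simp [← hm ⟨⟨⟩⟩] } (fun _ => h)

/-- At the colimit, `α` is the map induced between the colimits of two diagrams that `α` makes
isomorphic. -/
theorem colimitClosed_isIso {D : Type u} [Category.{v} D] {E : Type u'} [Category.{v'} E]
    {L M : D ⥤ E} [PreservesColimitsOfSize.{w, w} L] [PreservesColimitsOfSize.{w, w} M]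
    (α : L ⟶ M) : ColimitClosed.{w} (fun X => IsIso (α.app X)) := by
  intro J _ F c hc h
  have : α.app c.pt = ((isColimitOfPreserves L hc).coconePointsIsoOfNatIso
      (isColimitOfPreserves M hc) (NatIso.ofComponents (fun j => @asIso _ _ _ _ _ (h j))
        (fun f => by simp))).hom := by
    refine (isColimitOfPreserves L hc).hom_ext fun j => ?_
    rw [IsColimit.comp_coconePointsIsoOfNatIso_hom]
    exact α.naturality _
  rw [this]
  infer_instance

/-- The property of objects `t` that a natural map `Hom(L t, X) → Hom(M t, Y)` is bijective. -/
theorem colimitClosed_bijective {D : Type u} [Category.{v} D] {E : Type u'} [Category.{v'} E]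
    {E' : Type*} [Category* E'] {L : D ⥤ E} {M : D ⥤ E'}
    [PreservesColimitsOfSize.{w, w} L] [PreservesColimitsOfSize.{w, w} M] {X : E} {Y : E'}
    (f : ∀ t, (L.obj t ⟶ X) → (M.obj t ⟶ Y))
    (hf : ∀ {t t'} (a : t ⟶ t') (g : L.obj t' ⟶ X), f t (L.map a ≫ g) = M.map a ≫ f t' g) :
    ColimitClosed.{w} (fun t => Function.Bijective (f t)) := by
  intro J _ F c hc h
  constructor
  · intro a b hab
    refine (isColimitOfPreserves L hc).hom_ext fun j => (h j).1 ?_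
    dsimp
    rw [hf, hf, hab]
  · intro g
    -- The preimages over the diagram are unique, hence compatible, hence a cocone.
    choose s hs using fun j => (h j).2 (M.map (c.ι.app j) ≫ g)
    let cc : Cocone (F ⋙ L) :=
      { pt := X
        ι := { app := s
               naturality := fun i j u => by
                dsimp
                rw [Category.comp_id]
                apply (h i).1
                rw [hf, hs, hs, ← M.map_comp_assoc, c.w] } }
    refine ⟨(isColimitOfPreserves L hc).desc cc, (isColimitOfPreserves M hc).hom_ext fun j => ?_⟩
    have := (isColimitOfPreserves L hc).fac cc j
    dsimp at this ⊢
    rw [← hf, this, hs]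

end Generation

end PrL

namespace PrL

/-! ### Tensors of objects with vector spaces -/

section Copower

variable {k : Type w} [Field k]
variable {C D : Type (w + 1)} [Category.{w} C] [Category.{w} D] [Preadditive C] [Preadditive D]
  [Linear k C] [Linear k D]
variable {V : Type w} [AddCommGroup V] [Module k V] {X P : C} {ι : V → (X ⟶ P)}

namespace IsCopower

theorem isLinearMap_comp (h : IsCopower k ι) {W : C} (f : P ⟶ W) :
    IsLinearMap k fun v => ι v ≫ f :=
  ⟨fun a b => by simp [h.linear.map_add], fun c a => by simp [h.linear.map_smul]⟩

theorem hom_ext (h : IsCopower k ι) {W : C} {f g : P ⟶ W} (hfg : ∀ v, ι v ≫ f = ι v ≫ g) :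
    f = g :=
  (h.existsUnique_desc W (h.isLinearMap_comp f).mk').unique (fun _ => rfl)
    (fun v => (hfg v).symm)

/-- The map out of a tensor `V ⊗ X` induced by a linear map. -/
noncomputable def desc (h : IsCopower k ι) {W : C} (φ : V → (X ⟶ W)) (hφ : IsLinearMap k φ) :
    P ⟶ W :=
  (h.existsUnique_desc W hφ.mk').choose

@[simp]
theorem fac (h : IsCopower k ι) {W : C} (φ : V → (X ⟶ W)) (hφ : IsLinearMap k φ) (v : V) :
    ι v ≫ h.desc φ hφ = φ v :=
  (h.existsUnique_desc W hφ.mk').choose_spec.1 v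

@[simp]
theorem fac_assoc (h : IsCopower k ι) {W Z : C} (φ : V → (X ⟶ W)) (hφ : IsLinearMap k φ) (v : V)
    (g : W ⟶ Z) : ι v ≫ h.desc φ hφ ≫ g = φ v ≫ g := by
  rw [← Category.assoc, fac]

/-- A tensor with `V` is a coproduct indexed by a basis of `V`. -/
noncomputable def isColimit (h : IsCopower k ι) {I : Type*} (b : Module.Basis I k V) :
    IsColimit (Cofan.mk P fun i => ι (b i)) :=
  Cofan.IsColimit.mk _ (fun s => h.desc (b.constr k s.inj) (b.constr k s.inj).isLinear)
    (fun s i => by simp)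
    (fun s m hm => h.hom_ext fun v => by
      rw [fac]
      exact LinearMap.congr_fun (b.ext (f₁ := (h.isLinearMap_comp m).mk') fun i => by
        simpa using hm i) v)

theorem of_isColimit (hι : IsLinearMap k ι) {I : Type*} (b : Module.Basis I k V)
    (hc : IsColimit (Cofan.mk P fun i => ι (b i))) : IsCopower k ι := by
  refine ⟨hι, fun W φ => ⟨Cofan.IsColimit.desc hc fun i => φ (b i), fun v => ?_, fun m hm => ?_⟩⟩
  · let ψ : V →ₗ[k] (X ⟶ W) := ⟨⟨fun v => ι v ≫ Cofan.IsColimit.desc hc fun i => φ (b i),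
      fun a b => by simp [hι.map_add]⟩, fun c a => by simp [hι.map_smul]⟩
    refine LinearMap.congr_fun (b.ext (f₁ := ψ) (f₂ := φ) fun i => ?_) v
    exact Cofan.IsColimit.fac hc (fun i => φ (b i)) i
  · refine Cofan.IsColimit.hom_ext hc _ _ fun i => ?_
    rw [Cofan.IsColimit.fac]
    exact hm _

/-- Over a field, tensoring with `V` is a coproduct of copies indexed by a basis, and `L` preserves
coproducts. -/
theorem map (h : IsCopower k ι) {L : C ⥤ D} (hL : IsCocontLinear k L) :
    IsCopower k fun v => L.map (ι v) := by
  obtain ⟨_, _, _⟩ := hL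
  let b := Module.Basis.ofVectorSpace k V
  refine of_isColimit ⟨fun a b => by simp [h.linear.map_add], fun c a => by
    simp [h.linear.map_smul, Functor.map_smul]⟩ b ?_
  exact isColimitCofanMkObjOfIsColimit L _ _ (h.isColimit b)

theorem comp_iso (h : IsCopower k ι) {Q : C} (e : P ≅ Q) : IsCopower k fun v => ι v ≫ e.hom :=
  ⟨h.isLinearMap_comp _, fun W φ => ⟨e.inv ≫ h.desc φ φ.isLinear, fun v => by simp,
    fun m hm => by
      rw [Iso.eq_inv_comp]
      exact h.hom_ext fun v => by simpa using hm v⟩⟩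

theorem exists_desc (h : IsCopower k ι) {W : C} (φ : V → (X ⟶ W)) (hφ : IsLinearMap k φ) :
    ∃ g : P ⟶ W, ∀ v, ι v ≫ g = φ v :=
  ⟨h.desc φ hφ, h.fac φ hφ⟩

theorem exists_iso {Q : C} {ι' : V → (X ⟶ Q)} (h : IsCopower k ι) (h' : IsCopower k ι') :
    ∃ e : P ≅ Q, ∀ v, ι v ≫ e.hom = ι' v :=
  ⟨⟨h.desc ι' h'.linear, h'.desc ι h.linear, h.hom_ext fun v => by simp,
    h'.hom_ext fun v => by simp⟩, fun v => by simp⟩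

/-- A tensor with `V` of a tensor with `U` can be computed in the other order. -/
theorem swap {U : Type w} [AddCommGroup U] [Module k U] {Y R : C} {ιU : U → (X ⟶ Y)}
    (hU : IsCopower k ιU) (hV : IsCopower k ι) {κV : V → (Y ⟶ R)} (hκ : IsCopower k κV)
    {κU : U → (P ⟶ R)} (hκU : ∀ u v, ιU u ≫ κV v = ι v ≫ κU u) : IsCopower k κU := by
  have lin : IsLinearMap k κU :=
    ⟨fun a b => hV.hom_ext fun v => by simp [← hκU, hU.linear.map_add],
      fun c a => hV.hom_ext fun v => by simp [← hκU, hU.linear.map_smul]⟩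
  refine ⟨lin, fun W φ => ?_⟩
  let ψ (v : V) : Y ⟶ W := hU.desc (fun u => ι v ≫ φ u)
    ⟨fun a b => by simp, fun c a => by simp⟩
  have hψ : IsLinearMap k ψ :=
    ⟨fun a b => hU.hom_ext fun u => by simp [ψ, hV.linear.map_add],
      fun c a => hU.hom_ext fun u => by simp [ψ, hV.linear.map_smul]⟩
  refine ⟨hκ.desc ψ hψ, fun u => hV.hom_ext fun v => ?_, fun m hm => hκ.hom_ext fun v =>
    hU.hom_ext fun u => ?_⟩
  · rw [← Category.assoc, ← hκU]; simp [ψ]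
  · rw [← Category.assoc, hκU]; simp [ψ, hm]

end IsCopower

variable [HasColimitsOfSize.{w, w} C]

variable (k V X) in
theorem exists_isCopower : ∃ (P : C) (ι : V → (X ⟶ P)), IsCopower k ι := by
  let b := Module.Basis.ofVectorSpace k V
  let P := ∐ fun _ : Module.Basis.ofVectorSpaceIndex k V => X
  let φ : V →ₗ[k] (X ⟶ P) := b.constr k fun i => Sigma.ι (fun _ => X) i
  refine ⟨P, φ, IsCopower.of_isColimit φ.isLinear b ?_⟩
  have : (Cofan.mk P fun i => φ (b i)) = Cofan.mk P fun i => Sigma.ι (fun _ => X) i := by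
    congr 1; ext i; simp [φ]
  rw [this]
  exact coproductIsCoproduct _

variable (k V X) in
/-- The tensor `V ⊗ X`. -/
noncomputable def cop : C := (exists_isCopower k V X).choose

variable (k V X) in
/-- The universal linear map `V → Hom(X, V ⊗ X)`. -/
noncomputable def copι : V → (X ⟶ cop k V X) := (exists_isCopower k V X).choose_spec.choose

variable (k V X) in
theorem isCopower_copι : IsCopower k (copι k V X) :=
  (exists_isCopower k V X).choose_spec.choose_spec

variable (k C) in
/-- Tensors as a bifunctor. -/
noncomputable def copFunctor : ModuleCat.{w} k ⥤ C ⥤ C where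
  obj V :=
    { obj := fun X => cop k V X
      map := fun {X Y} f => (isCopower_copι k V X).desc (fun v => f ≫ copι k V Y v)
        ⟨fun a b => by simp [(isCopower_copι k V Y).linear.map_add],
          fun c a => by simp [(isCopower_copι k V Y).linear.map_smul]⟩
      map_id := fun X => (isCopower_copι k V X).hom_ext fun v => by simp
      map_comp := fun f g => (isCopower_copι k V _).hom_ext fun v => by simp }
  map {V W} φ :=
    { app := fun X => (isCopower_copι k V X).desc (fun v => copι k W X (φ v))
        ⟨fun a b => by simp [(isCopower_copι k W X).linear.map_add],
          fun c a => by simp [(isCopower_copι k W X).linear.map_smul]⟩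
      naturality := fun X Y f => (isCopower_copι k V _).hom_ext fun v => by simp }
  map_id V := by ext X; exact (isCopower_copι k V X).hom_ext fun v => by simp
  map_comp φ ψ := by ext X; exact (isCopower_copι k _ X).hom_ext fun v => by simp

/-- The universal linear map `V → Hom(X, V ⊗ X)`. -/
noncomputable def copInc (V : ModuleCat.{w} k) (X : C) :
    V → (X ⟶ ((copFunctor k C).obj V).obj X) := copι k V X

theorem isCopower_copInc (V : ModuleCat.{w} k) (X : C) : IsCopower k (copInc V X) :=
  isCopower_copι k V X

@[simp]
theorem copInc_map {V : ModuleCat.{w} k} {X Y : C} (f : X ⟶ Y) (v : V) :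
    copInc V X v ≫ ((copFunctor k C).obj V).map f = f ≫ copInc V Y v :=
  (isCopower_copι k V X).fac _ _ v

@[simp]
theorem copInc_app {V W : ModuleCat.{w} k} (φ : V ⟶ W) (X : C) (v : V) :
    copInc V X v ≫ ((copFunctor k C).map φ).app X = copInc W X (φ v) :=
  (isCopower_copι k V X).fac _ _ v

/-- A cocone on the objects `V ⊗ F j` amounts to a linear family, indexed by `V`, of cocones on `F`;
each of these descends separately to the colimit. -/
theorem copFunctor_obj_isCocontLinear (V : ModuleCat.{w} k) :
    IsCocontLinear k ((copFunctor k C).obj V) where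
  additive := ⟨fun {X Y f g} => (isCopower_copInc V X).hom_ext fun v => by simp⟩
  linear := ⟨fun {X Y} f r => (isCopower_copInc V X).hom_ext fun v => by simp⟩
  cocontinuous := ⟨⟨fun {F} => ⟨fun {c} hc => ⟨by
    let d (s : Cocone (F ⋙ (copFunctor k C).obj V)) (v : V) : c.pt ⟶ s.pt :=
      hc.desc ⟨s.pt, { app := fun j => copInc V (F.obj j) v ≫ s.ι.app j
                       naturality := fun i j f => by
                        have h := s.w f
                        rw [← h]
                        exact ((reassoc_of% copInc_map (F.map f) v) _).symm.trans
                          (Category.comp_id _).symm }⟩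
    have hd (s v j) : c.ι.app j ≫ d s v = copInc V (F.obj j) v ≫ s.ι.app j := hc.fac _ j
    have hlin (s) : IsLinearMap k (d s) :=
      ⟨fun a b => hc.hom_ext fun j => by
          rw [hd, Preadditive.comp_add, hd, hd, (isCopower_copInc V _).linear.map_add]
          exact Preadditive.add_comp _ _ _ _ _ _,
        fun r a => hc.hom_ext fun j => by
          rw [hd, Linear.comp_smul, hd, (isCopower_copInc V _).linear.map_smul]
          exact Linear.smul_comp _ _ _ _ _ _⟩
    exact
      { desc := fun s => (isCopower_copInc V c.pt).desc (d s) (hlin s)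
        fac := fun s j => (isCopower_copInc V _).hom_ext fun v =>
          ((reassoc_of% @copInc_map) _ _ _).trans (by rw [IsCopower.fac, hd])
        uniq := fun s m hm => (isCopower_copInc V _).hom_ext fun v => by
          rw [IsCopower.fac]
          refine hc.hom_ext fun j => ?_
          rw [hd, ← hm j]
          exact ((reassoc_of% @copInc_map) _ _ _).symm }⟩⟩⟩⟩

/-- The functor `V ↦ V ⊗ X` is left adjoint to `Hom(X, -)`. -/
instance copFunctor_flip_preservesColimits (X : C) :
    PreservesColimitsOfSize.{w, w} ((copFunctor k C).flip.obj X) := by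
  refine (Adjunction.leftAdjoint_preservesColimits
    (G := (linearCoyoneda k C).obj (op X)) (Adjunction.mkOfHomEquiv
    { homEquiv := fun V Y =>
        { toFun := fun f => ModuleCat.ofHom (Y := ((X ⟶ Y : Type w)))
            ((isCopower_copInc V X).isLinearMap_comp f).mk'
          invFun := fun φ => (isCopower_copInc V X).desc (fun v => φ v)
            ⟨fun a b => map_add φ.hom a b, fun c a => map_smul φ.hom c a⟩
          left_inv := fun f => (isCopower_copInc V X).hom_ext fun v =>
            (isCopower_copInc V X).fac _ _ _
          right_inv := fun φ => by ext v; exact (isCopower_copInc V X).fac _ _ v }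
      homEquiv_naturality_left_symm := fun {V V' Y} f g =>
        (isCopower_copInc V X).hom_ext fun v =>
          ((isCopower_copInc V X).fac _ _ _).trans
            (((reassoc_of% copInc_app f X v) _).trans ((isCopower_copInc V' X).fac _ _ _)).symm
      homEquiv_naturality_right := fun {V Y Y'} f g => by
        ext v
        exact (Category.assoc _ _ _).symm }))

end Copower

/-! ### Maps out of a tensor product of categories -/

section Universal

variable {k : Type w} [Field k]
variable {C D T E : Type (w + 1)} [Category.{w} C] [Category.{w} D] [Category.{w} T]
  [Category.{w} E] [Preadditive C] [Preadditive D] [Preadditive T] [Preadditive E]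
  [Linear k C] [Linear k D] [Linear k T] [Linear k E] [IsLocallyPresentable.{w} E]
  {B : C ⥤ D ⥤ T}

theorem IsCocontLinear.of_iso {F G : C ⥤ D} (hF : IsCocontLinear k F) (e : F ≅ G) :
    IsCocontLinear k G := by
  obtain ⟨_, _, _⟩ := hF
  exact ⟨Functor.additive_of_iso e, Functor.linear_of_iso k e, preservesColimits_of_natIso e⟩

theorem boxMap_comp {X X' X'' : C} {Y Y' Y'' : D} (f : X ⟶ X') (g : Y ⟶ Y') (f' : X' ⟶ X'')
    (g' : Y' ⟶ Y'') : boxMap B f g ≫ boxMap B f' g' = boxMap B (f ≫ f') (g ≫ g') := by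
  simp [boxMap]

theorem boxMap_id (X : C) (Y : D) : boxMap B (𝟙 X) (𝟙 Y) = 𝟙 _ := by simp [boxMap]

theorem map_app_eq_boxMap {X X' : C} (f : X ⟶ X') (Y : D) :
    (B.map f).app Y = boxMap B f (𝟙 Y) := by simp [boxMap]

theorem obj_map_eq_boxMap (X : C) {Y Y' : D} (g : Y ⟶ Y') :
    (B.obj X).map g = boxMap B (𝟙 X) g := by simp [boxMap]

namespace IsTensorProduct

theorem hom_ext (h : IsTensorProduct k B) {L M : T ⥤ E} (hL : IsCocontLinear k L)
    (hM : IsCocontLinear k M) {α β : L ⟶ M}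
    (hαβ : ∀ X Y, α.app ((B.obj X).obj Y) = β.app ((B.obj X).obj Y)) : α = β := by
  have := h.universal E
  let α' : (⟨L, hL⟩ : FunL k T E) ⟶ ⟨M, hM⟩ := ObjectProperty.homMk α
  let β' : (⟨L, hL⟩ : FunL k T E) ⟶ ⟨M, hM⟩ := ObjectProperty.homMk β
  have : α' = β' := (restrictAlong h.bilinear E).map_injective (by
    ext X Y; exact hαβ X Y)
  exact congrArg (fun t => t.hom) this

/-- This is fullness of restriction along `⊠`. Together with `hom_ext`, its faithfulness, it is the
form in which the universal property is used for natural transformations. -/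
theorem exists_hom (h : IsTensorProduct k B) {L M : T ⥤ E} (hL : IsCocontLinear k L)
    (hM : IsCocontLinear k M)
    (φ : ∀ X Y, L.obj ((B.obj X).obj Y) ⟶ M.obj ((B.obj X).obj Y))
    (hφ : ∀ {X X' Y Y'} (f : X ⟶ X') (g : Y ⟶ Y'),
      L.map (boxMap B f g) ≫ φ X' Y' = φ X Y ≫ M.map (boxMap B f g)) :
    ∃ α : L ⟶ M, ∀ X Y, α.app ((B.obj X).obj Y) = φ X Y := by
  have := h.universal E
  let L' : FunL k T E := ⟨L, hL⟩
  let M' : FunL k T E := ⟨M, hM⟩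
  let γ : (restrictAlong h.bilinear E).obj L' ⟶ (restrictAlong h.bilinear E).obj M' :=
    ObjectProperty.homMk
      { app := fun X =>
          { app := fun Y => φ X Y
            naturality := fun Y Y' g => by have := hφ (𝟙 X) g; simp [boxMap] at this; exact this }
        naturality := fun X X' f => by
          ext Y; have := hφ f (𝟙 Y); simp [boxMap] at this; exact this }
  refine ⟨((restrictAlong h.bilinear E).preimage γ).hom, fun X Y => ?_⟩
  have := (restrictAlong h.bilinear E).map_preimage γ
  exact congrArg (fun t => (t.hom.app X).app Y) this

/-- The inverses on pure tensors are natural, so they extend to all of `T`, and uniqueness of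
extensions makes the result a two-sided inverse. No generation statement about pure tensors is
needed. -/
theorem isIso (h : IsTensorProduct k B) {L M : T ⥤ E} (hL : IsCocontLinear k L)
    (hM : IsCocontLinear k M) (α : L ⟶ M) (hα : ∀ X Y, IsIso (α.app ((B.obj X).obj Y))) :
    IsIso α := by
  obtain ⟨β, hβ⟩ := h.exists_hom hM hL (fun X Y => inv (α.app ((B.obj X).obj Y)))
    (fun f g => by simp)
  exact ⟨β, h.hom_ext hL hL fun X Y => by simp [hβ], h.hom_ext hM hM fun X Y => by simp [hβ]⟩

/-- The functor out of a tensor product of categories induced by a bilinear functor. -/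
noncomputable def lift (h : IsTensorProduct k B) {G : C ⥤ D ⥤ E} (hG : IsCocontBilinear k G) :
    T ⥤ E :=
  haveI := h.universal E
  ((restrictAlong h.bilinear E).inv.obj ⟨G, hG⟩).obj

theorem lift_isCocontLinear (h : IsTensorProduct k B) {G : C ⥤ D ⥤ E}
    (hG : IsCocontBilinear k G) : IsCocontLinear k (h.lift hG) :=
  haveI := h.universal E
  ((restrictAlong h.bilinear E).inv.obj ⟨G, hG⟩).property

/-- The values of the induced functor on pure tensors. -/
noncomputable def liftIso (h : IsTensorProduct k B) {G : C ⥤ D ⥤ E} (hG : IsCocontBilinear k G) :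
    B ⋙ (Functor.whiskeringRight D T E).obj (h.lift hG) ≅ G :=
  haveI := h.universal E
  (ObjectProperty.ι _).mapIso ((restrictAlong h.bilinear E).asEquivalence.counitIso.app ⟨G, hG⟩)

theorem liftIso_hom_naturality (h : IsTensorProduct k B) {G : C ⥤ D ⥤ E}
    (hG : IsCocontBilinear k G) {X X' Y Y'} (f : X ⟶ X') (g : Y ⟶ Y') :
    (h.lift hG).map (boxMap B f g) ≫ ((h.liftIso hG).hom.app X').app Y' =
      ((h.liftIso hG).hom.app X).app Y ≫ boxMap G f g := by
  have h1 := congrArg (fun t => t.app Y) ((h.liftIso hG).hom.naturality f)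
  have h2 := ((h.liftIso hG).hom.app X').naturality g
  dsimp at h1 h2
  simp only [boxMap, Functor.map_comp, Category.assoc, h2, reassoc_of% h1]

end IsTensorProduct

end Universal

end PrL

namespace PrL

/-! ### The bifunctor `(c₁ ⊠ c₂, d) ↦ ev(c₂, d) ⊗ c₁` -/

section Kernel

variable {k : Type w} [Field k]
variable {C : Type (w + 1)} [Category.{w} C] [Preadditive C] [Linear k C] [MonoidalCategory C]

variable (k C) in
/-- The evaluation pairing `ev(c, d) = Hom(𝟙, c ⊗ d)`. -/
def evFunctor : C ⥤ C ⥤ ModuleCat.{w} k :=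
  curriedTensor C ⋙ (Functor.whiskeringRight C C _).obj ((linearCoyoneda k C).obj (op (𝟙_ C)))

/-- A morphism `𝟙 ⟶ c ⊗ d` as an element of `ev(c, d)`. -/
def evElt {c d : C} (f : 𝟙_ C ⟶ c ⊗ d) : ((evFunctor k C).obj c).obj d := f

variable [CocontMonoidal k C]

theorem tensorLeft_isCocontLinear (X : C) : IsCocontLinear k (tensorLeft X) :=
  (CocontMonoidal.bilinear (k := k)).right X

theorem tensorRight_isCocontLinear (X : C) : IsCocontLinear k (tensorRight X) :=
  (CocontMonoidal.bilinear (k := k)).left X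

theorem monoidalPreadditive (k : Type w) [Field k] (C : Type (w + 1)) [Category.{w} C]
    [Preadditive C] [Linear k C] [MonoidalCategory C] [CocontMonoidal k C] :
    MonoidalPreadditive C where
  whiskerLeft_zero {X Y Z} := by
    have := (tensorLeft_isCocontLinear (k := k) X).additive
    exact (tensorLeft X).map_zero _ _
  zero_whiskerRight {X Y Z} := by
    have := (tensorRight_isCocontLinear (k := k) X).additive
    exact (tensorRight X).map_zero _ _
  whiskerLeft_add {X Y Z} f g := by
    have := (tensorLeft_isCocontLinear (k := k) X).additive
    exact (tensorLeft X).map_add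
  add_whiskerRight {X Y Z} f g := by
    have := (tensorRight_isCocontLinear (k := k) X).additive
    exact (tensorRight X).map_add

theorem monoidalLinear (k : Type w) [Field k] (C : Type (w + 1)) [Category.{w} C]
    [Preadditive C] [Linear k C] [MonoidalCategory C] [CocontMonoidal k C]
    [MonoidalPreadditive C] : MonoidalLinear k C where
  whiskerLeft_smul X {Y Z} r f := by
    have := (tensorLeft_isCocontLinear (k := k) X).linear
    exact (tensorLeft X).map_smul r f
  smul_whiskerRight r {Y Z} f X := by
    have := (tensorRight_isCocontLinear (k := k) X).linear
    exact (tensorRight X).map_smul r f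

variable [HasColimitsOfSize.{w, w} C]

variable (k C) in
/-- The functor `(d, c₁, c₂) ↦ ev(c₂, d) ⊗ c₁`. -/
noncomputable def evTensor : C ⥤ C ⥤ C ⥤ C :=
  (evFunctor k C).flip ⋙ (Functor.whiskeringRight C _ _).obj (copFunctor k C) ⋙ flipFunctor C C C

/-- The elements of `Hom(c₁, ev(c₂, d) ⊗ c₁)`. -/
noncomputable def evInc (c₁ c₂ d : C) (f : 𝟙_ C ⟶ c₂ ⊗ d) :
    c₁ ⟶ (((evTensor k C).obj d).obj c₁).obj c₂ :=
  copInc (((evFunctor k C).obj c₂).obj d) c₁ (evElt f)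

theorem isCopower_evInc (c₁ c₂ d : C) : IsCopower k (evInc (k := k) c₁ c₂ d) :=
  isCopower_copInc (((evFunctor k C).obj c₂).obj d) c₁

theorem evInc_natural_left {c₁ c₁' : C} (c₂ d : C) (a : c₁ ⟶ c₁') (f : 𝟙_ C ⟶ c₂ ⊗ d) :
    evInc (k := k) c₁ c₂ d f ≫ (((evTensor k C).obj d).map a).app c₂ =
      a ≫ evInc (k := k) c₁' c₂ d f :=
  copInc_map (V := ((evFunctor k C).obj c₂).obj d) _ _

theorem evInc_natural_right (c₁ : C) {c₂ c₂' : C} (d : C) (b : c₂ ⟶ c₂') (f : 𝟙_ C ⟶ c₂ ⊗ d) :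
    evInc (k := k) c₁ c₂ d f ≫ (((evTensor k C).obj d).obj c₁).map b =
      evInc (k := k) c₁ c₂' d (f ≫ b ▷ d) :=
  copInc_app (((evFunctor k C).map b).app d) _ _

theorem evInc_natural (c₁ : C) (c₂ : C) {d d' : C} (e : d ⟶ d') (f : 𝟙_ C ⟶ c₂ ⊗ d) :
    evInc (k := k) c₁ c₂ d f ≫ (((evTensor k C).map e).app c₁).app c₂ =
      evInc (k := k) c₁ c₂ d' (f ≫ c₂ ◁ e) :=
  copInc_app (((evFunctor k C).obj c₂).map e) _ _

/-- Compact projectivity of `𝟙` enters through the variable `c₂`: the functor is `- ⊗ d`, followed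
by `Hom(𝟙, -)`, followed by `V ↦ V ⊗ c₁`. -/
theorem evTensor_bilinear (hunit : IsCompactProjective k (𝟙_ C)) (d : C) :
    IsCocontBilinear k ((evTensor k C).obj d) :=
  haveI := monoidalPreadditive k C
  haveI := monoidalLinear k C
 {
  left := fun c₂ => copFunctor_obj_isCocontLinear (((evFunctor k C).obj c₂).obj d)
  right := fun c₁ =>
    { additive := ⟨fun {X Y f g} => (isCopower_evInc c₁ X d).hom_ext fun v => by
        rw [evInc_natural_right, MonoidalPreadditive.add_whiskerRight, Preadditive.comp_add, Preadditive.comp_add,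
          evInc_natural_right, evInc_natural_right, (isCopower_evInc c₁ Y d).linear.map_add]⟩
      linear := ⟨fun {X Y} f r => (isCopower_evInc c₁ X d).hom_ext fun v => by
        rw [evInc_natural_right, MonoidalLinear.smul_whiskerRight, Linear.comp_smul, Linear.comp_smul,
          evInc_natural_right, (isCopower_evInc c₁ Y d).linear.map_smul]⟩
      cocontinuous := by
        have h1 : PreservesColimitsOfSize.{w, w} (tensorRight d) :=
          (tensorRight_isCocontLinear (k := k) d).cocontinuous
        have h2 : PreservesColimitsOfSize.{w, w} ((linearCoyoneda k C).obj (op (𝟙_ C))) := hunit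
        exact inferInstanceAs (PreservesColimitsOfSize.{w, w}
          ((tensorRight d ⋙ (linearCoyoneda k C).obj (op (𝟙_ C))) ⋙
            (copFunctor k C).flip.obj c₁)) } }

theorem evTensor_isCocontLinear (hunit : IsCompactProjective k (𝟙_ C)) (c₁ c₂ : C) :
    IsCocontLinear k (((evTensor k C).flip.obj c₁).flip.obj c₂) :=
  haveI := monoidalPreadditive k C
  haveI := monoidalLinear k C
 {
  additive := ⟨fun {X Y f g} => (isCopower_evInc c₁ c₂ X).hom_ext fun v => by
        dsimp
        rw [evInc_natural, MonoidalPreadditive.whiskerLeft_add, Preadditive.comp_add, Preadditive.comp_add,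
          evInc_natural, evInc_natural, (isCopower_evInc c₁ c₂ Y).linear.map_add]⟩
  linear := ⟨fun {X Y} f r => (isCopower_evInc c₁ c₂ X).hom_ext fun v => by
        dsimp
        rw [evInc_natural, MonoidalLinear.whiskerLeft_smul, Linear.comp_smul, Linear.comp_smul,
          evInc_natural, (isCopower_evInc c₁ c₂ Y).linear.map_smul]⟩
  cocontinuous := by
    have h1 : PreservesColimitsOfSize.{w, w} (tensorLeft c₂) :=
      (tensorLeft_isCocontLinear (k := k) c₂).cocontinuous
    have h2 : PreservesColimitsOfSize.{w, w} ((linearCoyoneda k C).obj (op (𝟙_ C))) := hunit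
    exact inferInstanceAs (PreservesColimitsOfSize.{w, w}
      ((tensorLeft c₂ ⋙ (linearCoyoneda k C).obj (op (𝟙_ C))) ⋙
        (copFunctor k C).flip.obj c₁)) }

variable {T : Type (w + 1)} [Category.{w} T] [Preadditive T] [Linear k T] {B : C ⥤ C ⥤ T}

/-- A functor `A : T × C → C`, `(c₁ ⊠ c₂, d) ↦ ev(c₂, d) ⊗ c₁`, preserving colimits in `T`. -/
structure PreKernel (k : Type w) [Field k] {C : Type (w + 1)} [Category.{w} C] [Preadditive C]
    [Linear k C] [MonoidalCategory C] {T : Type (w + 1)} [Category.{w} T] [Preadditive T]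
    [Linear k T] (B : C ⥤ C ⥤ T) (A : T ⥤ C ⥤ C) where
  left : ∀ d : C, IsCocontLinear k (A.flip.obj d)
  right : ∀ c₁ c₂ : C, IsCocontLinear k (A.obj ((B.obj c₁).obj c₂))
  /-- the universal linear map `ev(c₂, d) → Hom(c₁, A (c₁ ⊠ c₂, d))` -/
  incl : ∀ c₁ c₂ d : C, (𝟙_ C ⟶ c₂ ⊗ d) → (c₁ ⟶ (A.obj ((B.obj c₁).obj c₂)).obj d)
  isCopower : ∀ c₁ c₂ d : C, IsCopower k (incl c₁ c₂ d)
  natural : ∀ {c₁ c₁' c₂ c₂' d d' : C} (a : c₁ ⟶ c₁') (b : c₂ ⟶ c₂') (e : d ⟶ d')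
    (f : 𝟙_ C ⟶ c₂ ⊗ d),
    incl c₁ c₂ d f ≫ (A.map (boxMap B a b)).app d ≫ (A.obj ((B.obj c₁').obj c₂')).map e =
      a ≫ incl c₁' c₂' d' (f ≫ (b ⊗ₘ e))

/-- For each `d` the universal property of `T` extends `(c₁, c₂) ↦ ev(c₂, d) ⊗ c₁`. Cocontinuity in
`d` is visible only at pure tensors so far, which is why `PreKernel` asks for no more; the general
case needs generation by pure tensors. -/
theorem exists_preKernel [IsLocallyPresentable.{w} C] (h : IsTensorProduct k B)
    (hunit : IsCompactProjective k (𝟙_ C)) : ∃ A : T ⥤ C ⥤ C, Nonempty (PreKernel k B A) := by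
  have := h.universal C
  let R := restrictAlong h.bilinear C
  -- Viewing the bifunctors as a functor of `d` lets a single inverse of the restriction equivalence
  -- provide functoriality in `d`.
  let G : C ⥤ BilinL k C C C := ObjectProperty.lift _ (evTensor k C) (evTensor_bilinear hunit)
  let A' : C ⥤ T ⥤ C := (G ⋙ R.inv) ⋙ ObjectProperty.ι _
  let e (d : C) : B ⋙ (Functor.whiskeringRight C T C).obj (A'.obj d) ≅ (evTensor k C).obj d :=
    (ObjectProperty.ι _).mapIso (R.asEquivalence.counitIso.app (G.obj d))
  have he {d d' : C} (f : d ⟶ d') (X Y : C) :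
      (((e d).inv.app X).app Y) ≫ (A'.map f).app ((B.obj X).obj Y) =
        (((evTensor k C).map f).app X).app Y ≫ ((e d').inv.app X).app Y := by
    have h1 := R.asEquivalence.counitIso.inv.naturality (G.map f)
    exact (congrArg (fun t => (t.hom.app X).app Y) h1).symm
  have he' (d : C) {X X' Y Y' : C} (a : X ⟶ X') (b : Y ⟶ Y') :
      (((e d).inv.app X).app Y) ≫ (A'.obj d).map (boxMap B a b) =
        ((((evTensor k C).obj d).map a).app Y ≫ (((evTensor k C).obj d).obj X').map b) ≫
          ((e d).inv.app X').app Y' := by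
    have h1 := congrArg (fun t => t.app Y) ((e d).inv.naturality a)
    have h2 := ((e d).inv.app X').naturality b
    rw [boxMap, Functor.map_comp, Category.assoc]
    refine (Category.assoc _ _ _).symm.trans ?_
    refine (congrArg (fun t => t ≫ (A'.obj d).map ((B.obj X').map b)) h1.symm).trans ?_
    exact (Category.assoc _ _ _).trans
      (congrArg (fun t => (((evTensor k C).obj d).map a).app Y ≫ t) h2.symm)
  have hinc (c₁ c₂ d : C) : IsCopower k (fun f => evInc (k := k) c₁ c₂ d f ≫
      ((e d).inv.app c₁).app c₂) :=
    (isCopower_evInc c₁ c₂ d).comp_iso (((e d).symm.app c₁).app c₂)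
  refine ⟨A'.flip, ⟨⟨fun d => (R.inv.obj (G.obj d)).property, fun c₁ c₂ => ?_, fun c₁ c₂ d f =>
    evInc (k := k) c₁ c₂ d f ≫ ((e d).inv.app c₁).app c₂, hinc,
    fun {c₁ c₁' c₂ c₂' d d'} a b f g => ?_⟩⟩⟩
  · refine (evTensor_isCocontLinear hunit c₁ c₂).of_iso (NatIso.ofComponents (fun d =>
      ((e d).symm.app c₁).app c₂) fun {d d'} f => ?_)
    exact (he f c₁ c₂).symm
  · dsimp
    rw [Category.assoc, reassoc_of% he', he, reassoc_of% evInc_natural_left, reassoc_of% evInc_natural_right,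
      reassoc_of% evInc_natural, MonoidalCategory.tensorHom_def, Category.assoc]

end Kernel

/-! ### Pointwise colimits of colimit-preserving functors -/

section Pointwise

variable {C : Type u} [Category.{v} C] {E : Type u'} [Category.{v'} E] {J : Type w}
  [SmallCategory J] {F : J ⥤ C ⥤ E} {c : Cocone F}

/-- Colimits commute with colimits: a cocone on `K ⋙ c.pt` gives, for each `j`, a map out of the
value of `F.obj j` at the colimit of `K`, and these maps are compatible in `j`. -/
theorem preservesColimits_of_pointwise
    (hc : ∀ d, IsColimit (((evaluation C E).obj d).mapCocone c))
    (h : ∀ j, PreservesColimitsOfSize.{w, w} (F.obj j)) :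
    PreservesColimitsOfSize.{w, w} c.pt := by
  refine ⟨⟨fun {K} => ⟨fun {s} hs => ⟨?_⟩⟩⟩⟩
  let D (t : Cocone (K ⋙ c.pt)) (j : J) : Cocone (K ⋙ F.obj j) :=
    { pt := t.pt
      ι := { app := fun i => (c.ι.app j).app (K.obj i) ≫ t.ι.app i
             naturality := fun i i' f => by
              have h1 := t.w f
              have h2 := (c.ι.app j).naturality (K.map f)
              dsimp at h1 h2 ⊢
              rw [Category.comp_id, ← h1, reassoc_of% h2] } }
  let q (t : Cocone (K ⋙ c.pt)) (j : J) := (isColimitOfPreserves (F.obj j) hs).desc (D t j)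
  have hq (t j i) : (F.obj j).map (s.ι.app i) ≫ q t j =
      (c.ι.app j).app (K.obj i) ≫ t.ι.app i :=
    (isColimitOfPreserves (F.obj j) hs).fac (D t j) i
  let D' (t : Cocone (K ⋙ c.pt)) : Cocone (F ⋙ (evaluation C E).obj s.pt) :=
    { pt := t.pt
      ι := { app := q t
             naturality := fun j j' f => (isColimitOfPreserves (F.obj j) hs).hom_ext fun i => by
              have h1 := congrArg (fun t => t.app (K.obj i)) (c.w f)
              dsimp at h1 ⊢
              rw [Category.comp_id, hq, ← h1, NatTrans.naturality_assoc, hq, Category.assoc] } }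
  have hD (t j) : (c.ι.app j).app s.pt ≫ (hc s.pt).desc (D' t) = q t j := (hc s.pt).fac (D' t) j
  exact
    { desc := fun t => (hc s.pt).desc (D' t)
      fac := fun t i => (hc (K.obj i)).hom_ext fun j => by
        dsimp
        rw [← NatTrans.naturality_assoc, hD, hq]
      uniq := fun t m hm => (hc s.pt).hom_ext fun j => by
        refine Eq.trans ?_ (hD t j).symm
        refine (isColimitOfPreserves (F.obj j) hs).hom_ext fun i => ?_
        refine Eq.trans ?_ ((hq t j i).trans
          (congrArg (fun x => (c.ι.app j).app (K.obj i) ≫ x) (hm i).symm)).symm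
        exact NatTrans.naturality_assoc _ _ _ }

theorem isCocontLinear_of_pointwise {k : Type w} [Field k] {C E : Type (w + 1)} [Category.{w} C]
    [Category.{w} E] [Preadditive C] [Preadditive E] [Linear k C] [Linear k E] {F : J ⥤ C ⥤ E}
    {c : Cocone F} (hc : ∀ d, IsColimit (((evaluation C E).obj d).mapCocone c))
    (h : ∀ j, IsCocontLinear k (F.obj j)) : IsCocontLinear k c.pt where
  additive := ⟨fun {X Y f g} => (hc X).hom_ext fun j => by
    have := (h j).additive
    dsimp
    simp only [Preadditive.comp_add, ← NatTrans.naturality, Functor.map_add,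
      Preadditive.add_comp]⟩
  linear := ⟨fun {X Y} f r => (hc X).hom_ext fun j => by
    have := (h j).linear
    dsimp
    simp only [Linear.comp_smul, ← NatTrans.naturality, Functor.map_smul, Linear.smul_comp]⟩
  cocontinuous := preservesColimits_of_pointwise hc fun j => (h j).cocontinuous

end Pointwise

end PrL

namespace PrL

/-! ### Contractions along pairings -/

section Contraction

variable {C : Type u} [Category.{v} C] [MonoidalCategory C]

/-- Contract `f : 𝟙 ⟶ c ⊗ p` with `e : p ⊗ q ⟶ 𝟙` along `p`. -/
def contractRight {c p q : C} (f : 𝟙_ C ⟶ c ⊗ p) (e : p ⊗ q ⟶ 𝟙_ C) : q ⟶ c :=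
  (λ_ q).inv ≫ f ▷ q ≫ (α_ c p q).hom ≫ c ◁ e ≫ (ρ_ c).hom

/-- Contract `e : p ⊗ q ⟶ 𝟙` with `f : 𝟙 ⟶ q ⊗ d` along `q`. -/
def contractLeft {p q d : C} (e : p ⊗ q ⟶ 𝟙_ C) (f : 𝟙_ C ⟶ q ⊗ d) : p ⟶ d :=
  (ρ_ p).inv ≫ p ◁ f ≫ (α_ p q d).inv ≫ e ▷ d ≫ (λ_ d).hom

theorem contractRight_natural {c c' p q q' : C} (a : q' ⟶ q) (b : c ⟶ c') (f : 𝟙_ C ⟶ c ⊗ p)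
    (e : p ⊗ q ⟶ 𝟙_ C) :
    a ≫ contractRight f e ≫ b = contractRight (f ≫ b ▷ p) (p ◁ a ≫ e) := by
  simp only [contractRight, Category.assoc, comp_whiskerRight, whiskerLeft_comp,
    leftUnitor_inv_naturality_assoc, whisker_exchange_assoc, associator_naturality_right_assoc,
    associator_naturality_left_assoc]
  rw [← rightUnitor_naturality, ← whisker_exchange_assoc, ← whisker_exchange_assoc]

theorem contractLeft_natural {p p' q d d' : C} (a : p' ⟶ p) (b : d ⟶ d') (e : p ⊗ q ⟶ 𝟙_ C)
    (f : 𝟙_ C ⟶ q ⊗ d) :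
    a ≫ contractLeft e f ≫ b = contractLeft (a ▷ q ≫ e) (f ≫ q ◁ b) := by
  simp only [contractLeft, Category.assoc, comp_whiskerRight, whiskerLeft_comp,
    rightUnitor_inv_naturality_assoc, ← whisker_exchange_assoc,
    associator_inv_naturality_right_assoc, associator_inv_naturality_left_assoc]
  rw [← leftUnitor_naturality, whisker_exchange_assoc, whisker_exchange_assoc]

/-- A morphism of the contracted object may be absorbed on either side. This dinaturality, with its
counterpart `contractLeft_comp`, is what makes contractions compatible with the index category of
pairings. -/
theorem contractRight_comp {c p p' q : C} (f : 𝟙_ C ⟶ c ⊗ p) (a : p ⟶ p') (e : p' ⊗ q ⟶ 𝟙_ C) :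
    contractRight (f ≫ c ◁ a) e = contractRight f (a ▷ q ≫ e) := by
  simp [contractRight]

theorem contractLeft_comp {p q q' d : C} (e : p ⊗ q' ⟶ 𝟙_ C) (a : q ⟶ q') (f : 𝟙_ C ⟶ q ⊗ d) :
    contractLeft e (f ≫ a ▷ d) = contractLeft (p ◁ a ≫ e) f := by
  simp [contractLeft]

/-- Both sides insert `f` between `a` and `d` and then apply `e` and `e'`. These act on disjoint
tensor factors, so their order is irrelevant; this is the exchange law. -/
theorem contractRight_contractLeft {a c d p : C} (e : a ⊗ c ⟶ 𝟙_ C) (f : 𝟙_ C ⟶ c ⊗ p)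
    (e' : p ⊗ d ⟶ 𝟙_ C) : a ◁ contractRight f e' ≫ e = contractLeft e f ▷ d ≫ e' := by
  have h : a ◁ (α_ c p d).hom ≫ a ◁ c ◁ e' ≫ a ◁ (ρ_ c).hom ≫ e =
      (α_ a (c ⊗ p) d).inv ≫ (α_ a c p).inv ▷ d ≫ e ▷ p ▷ d ≫ (λ_ p).hom ▷ d ≫ e' := by
    calc _ = (α_ a (c ⊗ p) d).inv ≫ (α_ a c p).inv ▷ d ≫ (α_ (a ⊗ c) p d).hom ≫
          ((a ⊗ c) ◁ e' ≫ e ▷ 𝟙_ C) ≫ (λ_ (𝟙_ C)).hom := by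
            rw [unitors_equal]; monoidal
      _ = _ := by rw [whisker_exchange]; monoidal
  simp only [contractRight, contractLeft, whiskerLeft_comp, Category.assoc, h, comp_whiskerRight]
  monoidal

theorem contractLeft_coevaluation {q y : C} [ExactPairing q y] :
    contractLeft (ε_ q y) (η_ q y) = 𝟙 y := by
  have := ExactPairing.coevaluation_evaluation q y
  simp only [contractLeft, reassoc_of% this]
  simp

theorem contractRight_coevaluation {q y : C} [ExactPairing q y] :
    contractRight (η_ q y) (ε_ q y) = 𝟙 q := by
  have := ExactPairing.evaluation_coevaluation q y
  simp only [contractRight, reassoc_of% this]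
  simp

/-- Every element of `ev(q, p)` is the image of the coevaluation under a morphism `y ⟶ p`: the
coevaluation is the universal element exhibiting `y` as representing `ev(q, -)`. -/
theorem coevaluation_contractLeft {q y p : C} [ExactPairing q y] (f : 𝟙_ C ⟶ q ⊗ p) :
    η_ q y ≫ q ◁ contractLeft (ε_ q y) f = f := by
  calc η_ q y ≫ q ◁ contractLeft (ε_ q y) f =
      (η_ q y ≫ (ρ_ _).inv ≫ (q ⊗ y) ◁ f) ≫ (α_ q y (q ⊗ p)).hom ≫ q ◁ (α_ y q p).inv ≫
        q ◁ (ε_ q y) ▷ p ≫ q ◁ (λ_ p).hom := by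
          simp only [contractLeft]; monoidal
    _ = ((λ_ (𝟙_ C)).inv ≫ 𝟙_ C ◁ f ≫ η_ q y ▷ (q ⊗ p)) ≫ (α_ q y (q ⊗ p)).hom ≫
        q ◁ (α_ y q p).inv ≫ q ◁ (ε_ q y) ▷ p ≫ q ◁ (λ_ p).hom := by
          rw [rightUnitor_inv_naturality_assoc, whisker_exchange, unitors_inv_equal]
    _ = (λ_ (𝟙_ C)).inv ≫ 𝟙_ C ◁ f ≫ (α_ _ _ _).inv ≫ (η_ q y ▷ q ≫ (α_ q y q).hom ≫
        q ◁ (ε_ q y)) ▷ p ≫ (α_ _ _ _).hom ≫ q ◁ (λ_ p).hom := by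
          monoidal
    _ = f := by
          rw [ExactPairing.evaluation_coevaluation]; monoidal

/-- Similarly `ev(-, y)` is represented by `q`, with the same universal element. -/
theorem coevaluation_contractRight {q y p : C} [ExactPairing q y] (f : 𝟙_ C ⟶ p ⊗ y) :
    η_ q y ≫ contractRight f (ε_ q y) ▷ y = f := by
  calc η_ q y ≫ contractRight f (ε_ q y) ▷ y =
      (η_ q y ≫ (λ_ _).inv ≫ f ▷ (q ⊗ y)) ≫ (α_ (p ⊗ y) q y).inv ≫ (α_ p y q).hom ▷ y ≫
        (p ◁ (ε_ q y)) ▷ y ≫ (ρ_ p).hom ▷ y := by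
          simp only [contractRight]; monoidal
    _ = ((ρ_ (𝟙_ C)).inv ≫ f ▷ 𝟙_ C ≫ (p ⊗ y) ◁ η_ q y) ≫ (α_ (p ⊗ y) q y).inv ≫
        (α_ p y q).hom ▷ y ≫ (p ◁ (ε_ q y)) ▷ y ≫ (ρ_ p).hom ▷ y := by
          rw [leftUnitor_inv_naturality_assoc, ← whisker_exchange, unitors_inv_equal]
    _ = (ρ_ (𝟙_ C)).inv ≫ f ▷ 𝟙_ C ≫ (α_ _ _ _).hom ≫ p ◁ (y ◁ η_ q y ≫ (α_ y q y).inv ≫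
        (ε_ q y) ▷ y) ≫ (α_ _ _ _).inv ≫ (ρ_ p).hom ▷ y := by
          monoidal
    _ = f := by
          rw [ExactPairing.coevaluation_evaluation]; monoidal

end Contraction

/-! ### Generation of the tensor product -/

section Generation

variable {k : Type w} [Field k]
variable {C : Type (w + 1)} [Category.{w} C] [Preadditive C] [Linear k C] [MonoidalCategory C]
variable {T : Type (w + 1)} [Category.{w} T] [Preadditive T] [Linear k T] {B : C ⥤ C ⥤ T}

theorem contractRight_isLinearMap [MonoidalPreadditive C] [MonoidalLinear k C] {c p q : C}
    (e : p ⊗ q ⟶ 𝟙_ C) : IsLinearMap k fun f : 𝟙_ C ⟶ c ⊗ p => contractRight f e :=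
  ⟨fun a b => by simp [contractRight], fun r a => by simp [contractRight]⟩

theorem contractLeft_isLinearMap [MonoidalPreadditive C] [MonoidalLinear k C] {p q d : C}
    (e : p ⊗ q ⟶ 𝟙_ C) : IsLinearMap k fun f : 𝟙_ C ⟶ q ⊗ d => contractLeft e f :=
  ⟨fun a b => by simp [contractLeft], fun r a => by simp [contractLeft]⟩

theorem boxMap_isLinearMap_right (hB : IsCocontBilinear k B) {X X' Y Y' : C} (f : X ⟶ X') :
    IsLinearMap k fun g : Y ⟶ Y' => boxMap B f g := by
  have := (hB.right X').additive
  have := (hB.right X').linear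
  exact ⟨fun g g' => by simp [boxMap], fun r g => by simp [boxMap, Functor.map_smul]⟩

theorem boxMap_isCopower (hB : IsCocontBilinear k B) {V : Type w} [AddCommGroup V] [Module k V]
    {X P : C} {ι : V → (X ⟶ P)} (hι : IsCopower k ι) (q : C) :
    IsCopower k fun v => boxMap B (ι v) (𝟙 q) := by
  have := hι.map (hB.left q)
  simpa [boxMap] using this

variable {A : T ⥤ C ⥤ C} [CocontMonoidal k C]

/-- The functor `t ↦ A (t, p) ⊠ q`, functorially in `(p, q)`. -/
def boxAction (B : C ⥤ C ⥤ T) (A : T ⥤ C ⥤ C) : C × C ⥤ T ⥤ T where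
  obj x := A.flip.obj x.1 ⋙ B.flip.obj x.2
  map f := A.flip.map f.1 ◫ B.flip.map f.2

theorem boxAction_map_app {x y : C × C} (f : x ⟶ y) (t : T) :
    ((boxAction B A).map f).app t = boxMap B ((A.obj t).map f.1) f.2 := by
  simp [boxAction, boxMap]

/-- On `c₁ ⊠ c₂` the source is the tensor of `c₁ ⊠ q` with `ev(c₂, p)`, and contracting `f : 𝟙 ⟶ c₂
⊗ p` with the pairing gives a morphism `q ⟶ c₂`, linear in `f`. The universal property of `T`
extends this from pure tensors. -/
theorem exists_contraction [IsLocallyPresentable.{w} T] (h : IsTensorProduct k B)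
    (κ : PreKernel k B A) {p q : C} (e : p ⊗ q ⟶ 𝟙_ C) :
    ∃ β : (boxAction B A).obj (p, q) ⟶ 𝟭 T, ∀ c₁ c₂ f,
      boxMap B (κ.incl c₁ c₂ p f) (𝟙 q) ≫ β.app ((B.obj c₁).obj c₂) =
        boxMap B (𝟙 c₁) (contractRight f e) := by
  have := monoidalPreadditive k C
  have := monoidalLinear k C
  have hc (c₁ c₂) := boxMap_isCopower h.bilinear (κ.isCopower c₁ c₂ p) q
  have hl (c₁ c₂ : C) : IsLinearMap k fun f : 𝟙_ C ⟶ c₂ ⊗ p =>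
      boxMap B (𝟙 c₁) (contractRight f e) :=
    ⟨fun a b => by simp only [(contractRight_isLinearMap (k := k) e).map_add,
      (boxMap_isLinearMap_right h.bilinear (𝟙 c₁)).map_add],
    fun r a => by simp only [(contractRight_isLinearMap (k := k) e).map_smul,
      (boxMap_isLinearMap_right h.bilinear (𝟙 c₁)).map_smul]⟩
  choose d hd using fun c₁ c₂ => (show ∃ g : (B.obj ((A.obj ((B.obj c₁).obj c₂)).obj p)).obj q ⟶
      (B.obj c₁).obj c₂, ∀ f, boxMap B (κ.incl c₁ c₂ p f) (𝟙 q) ≫ g =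
        boxMap B (𝟙 c₁) (contractRight f e) from (hc c₁ c₂).exists_desc _ (hl c₁ c₂))
  obtain ⟨β, hβ⟩ := h.exists_hom ((κ.left p).comp (h.bilinear.left q)) (IsCocontLinear.id k) d
    (fun {c₁ c₁' c₂ c₂'} a b => (hc c₁ c₂).hom_ext fun f => by
      have h1 := κ.natural a b (𝟙 p) f
      rw [CategoryTheory.Functor.map_id, Category.comp_id, tensorHom_id] at h1
      change boxMap B (κ.incl c₁ c₂ p f) (𝟙 q) ≫ (B.map ((A.map (boxMap B a b)).app p)).app q ≫
        d c₁' c₂' = boxMap B (κ.incl c₁ c₂ p f) (𝟙 q) ≫ d c₁ c₂ ≫ boxMap B a b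
      have h2 := contractRight_natural (𝟙 q) b f e
      rw [Category.id_comp, whiskerLeft_id, Category.id_comp] at h2
      rw [map_app_eq_boxMap, reassoc_of% boxMap_comp, h1, reassoc_of% hd, boxMap_comp, h2,
        Category.id_comp, Category.id_comp, ← Category.comp_id (𝟙 q), ← reassoc_of% boxMap_comp, hd,
        boxMap_comp, Category.comp_id, Category.id_comp])
  exact ⟨β, fun c₁ c₂ f => by rw [hβ, hd]⟩

/-- The natural map `A (t, p) ⊠ q ⟶ t` induced by a pairing `p ⊗ q ⟶ 𝟙`. -/
noncomputable def contraction [IsLocallyPresentable.{w} T] (h : IsTensorProduct k B)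
    (κ : PreKernel k B A) {p q : C} (e : p ⊗ q ⟶ 𝟙_ C) : (boxAction B A).obj (p, q) ⟶ 𝟭 T :=
  (exists_contraction h κ e).choose

/-- The components of `contraction`. -/
noncomputable def contractionApp [IsLocallyPresentable.{w} T] (h : IsTensorProduct k B)
    (κ : PreKernel k B A) {p q : C} (e : p ⊗ q ⟶ 𝟙_ C) (t : T) :
    (B.obj ((A.obj t).obj p)).obj q ⟶ t :=
  (contraction h κ e).app t

theorem contractionApp_naturality [IsLocallyPresentable.{w} T] (h : IsTensorProduct k B)
    (κ : PreKernel k B A) {p q : C} (e : p ⊗ q ⟶ 𝟙_ C) {t t' : T} (g : t ⟶ t') :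
    boxMap B ((A.map g).app p) (𝟙 q) ≫ contractionApp h κ e t' = contractionApp h κ e t ≫ g := by
  rw [← map_app_eq_boxMap]
  exact (contraction h κ e).naturality g

theorem incl_contraction [IsLocallyPresentable.{w} T] (h : IsTensorProduct k B)
    (κ : PreKernel k B A) {p q : C} (e : p ⊗ q ⟶ 𝟙_ C) (c₁ c₂ : C) (f : 𝟙_ C ⟶ c₂ ⊗ p) :
    boxMap B (κ.incl c₁ c₂ p f) (𝟙 q) ≫ contractionApp h κ e ((B.obj c₁).obj c₂) =
      boxMap B (𝟙 c₁) (contractRight f e) :=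
  (exists_contraction h κ e).choose_spec c₁ c₂ f

theorem boxMap_eq_left {X X' Y Y' : C} (f : X ⟶ X') (g : Y ⟶ Y') :
    boxMap B f g = boxMap B f (𝟙 Y) ≫ boxMap B (𝟙 X') g := by simp [boxMap_comp]

theorem boxMap_eq_right {X X' Y Y' : C} (f : X ⟶ X') (g : Y ⟶ Y') :
    boxMap B f g = boxMap B (𝟙 X) g ≫ boxMap B f (𝟙 Y') := by simp [boxMap_comp]

theorem PreKernel.incl_map (κ : PreKernel k B A) {c₁ c₂ d d' : C} (e : d ⟶ d')
    (f : 𝟙_ C ⟶ c₂ ⊗ d) :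
    κ.incl c₁ c₂ d f ≫ (A.obj ((B.obj c₁).obj c₂)).map e = κ.incl c₁ c₂ d' (f ≫ c₂ ◁ e) := by
  have := κ.natural (𝟙 c₁) (𝟙 c₂) e f
  simpa [boxMap_id] using this

/-- This compatibility says that the contractions, over all pairings, form a cocone with vertex the
identity functor. -/
theorem map_contraction [IsLocallyPresentable.{w} T] (h : IsTensorProduct k B)
    (κ : PreKernel k B A) {p q p' q' : C} (a : p ⟶ p') (b : q ⟶ q') (e : p' ⊗ q' ⟶ 𝟙_ C) :
    (boxAction B A).map (X := (p, q)) (Y := (p', q')) (a, b) ≫ contraction h κ e =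
      contraction h κ ((a ⊗ₘ b) ≫ e) := by
  refine h.hom_ext ((κ.left p).comp (h.bilinear.left q)) (IsCocontLinear.id k) fun c₁ c₂ =>
    (boxMap_isCopower h.bilinear (κ.isCopower c₁ c₂ p) q).hom_ext fun f => ?_
  refine Eq.trans ?_ (incl_contraction h κ _ c₁ c₂ f).symm
  have h1 : ((boxAction B A).map (X := (p, q)) (Y := (p', q')) (a, b)).app
    ((B.obj c₁).obj c₂) = boxMap B ((A.obj ((B.obj c₁).obj c₂)).map a) b :=
    boxAction_map_app (x := (p, q)) (y := (p', q')) (a, b) _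
  rw [NatTrans.comp_app, h1]
  have h2 := contractRight_natural b (𝟙 c₂) f (a ▷ q' ≫ e)
  rw [Category.comp_id, id_whiskerRight, Category.comp_id, ← contractRight_comp] at h2
  change boxMap B (κ.incl c₁ c₂ p f) (𝟙 q) ≫ boxMap B ((A.obj ((B.obj c₁).obj c₂)).map a) b ≫
    contractionApp h κ e ((B.obj c₁).obj c₂) = _
  rw [reassoc_of% boxMap_comp, κ.incl_map, boxMap_eq_right, Category.assoc, Category.id_comp,
    incl_contraction, boxMap_comp, h2, MonoidalCategory.tensorHom_def', Category.assoc,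
    Category.comp_id]

section Index

variable {I : Type w} [SmallCategory I] (ι : I ⥤ C)

/-- The index category of the colimit computing the copairing of `C`: pairs of objects with a
pairing `p ⊗ q ⟶ 𝟙`. -/
abbrev CoevIndex : Type w := CostructuredArrow (ι.prod ι ⋙ tensor C) (𝟙_ C)

/-- The underlying pair of objects. -/
abbrev CoevIndex.proj : CoevIndex ι ⥤ C × C := CostructuredArrow.proj _ _ ⋙ ι.prod ι

variable {ι}

variable (ι) in
/-- A pair of objects with a pairing. -/
def CoevIndex.mk (a b : I) (e : ι.obj a ⊗ ι.obj b ⟶ 𝟙_ C) : CoevIndex ι :=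
  CostructuredArrow.mk (Y := (a, b)) (S := ι.prod ι ⋙ tensor C) e

/-- The legs of a cocone over the index category. -/
def CoevIndex.leg {E : Type*} [Category* E] {G : C × C ⥤ E} (c : Cocone (CoevIndex.proj ι ⋙ G))
    (a b : I) (e : ι.obj a ⊗ ι.obj b ⟶ 𝟙_ C) : G.obj (ι.obj a, ι.obj b) ⟶ c.pt :=
  c.ι.app (CoevIndex.mk ι a b e)

/-- Fullness of `ι` allows arbitrary morphisms of `C` between the indexing objects, in particular
contractions, to be slid through the legs. -/
theorem CoevIndex.map_leg [ι.Full] {E : Type*} [Category* E] {G : C × C ⥤ E}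
    (c : Cocone (CoevIndex.proj ι ⋙ G)) {a b a' b' : I} (u : ι.obj a ⟶ ι.obj a')
    (v : ι.obj b ⟶ ι.obj b') (e : ι.obj a' ⊗ ι.obj b' ⟶ 𝟙_ C) :
    G.map (X := (ι.obj a, ι.obj b)) (Y := (ι.obj a', ι.obj b')) (u, v) ≫ CoevIndex.leg c a' b' e =
      CoevIndex.leg c a b ((u ⊗ₘ v) ≫ e) := by
  obtain ⟨u, rfl⟩ := ι.map_surjective u
  obtain ⟨v, rfl⟩ := ι.map_surjective v
  exact c.w (CostructuredArrow.homMk (f := CoevIndex.mk ι a b ((ι.map u ⊗ₘ ι.map v) ≫ e))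
    (f' := CoevIndex.mk ι a' b' e) (u, v) rfl)

/-- A cocone from its legs. -/
def CoevIndex.mkCocone {E : Type*} [Category* E] {G : C × C ⥤ E} (X : E)
    (l : ∀ a b, (ι.obj a ⊗ ι.obj b ⟶ 𝟙_ C) → (G.obj (ι.obj a, ι.obj b) ⟶ X))
    (hl : ∀ {a b a' b'} (u : ι.obj a ⟶ ι.obj a') (v : ι.obj b ⟶ ι.obj b')
      (e : ι.obj a' ⊗ ι.obj b' ⟶ 𝟙_ C), G.map (X := (ι.obj a, ι.obj b))
        (Y := (ι.obj a', ι.obj b')) (u, v) ≫ l a' b' e = l a b ((u ⊗ₘ v) ≫ e)) :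
    Cocone (CoevIndex.proj ι ⋙ G) where
  pt := X
  ι :=
    { app := fun j => l j.left.1 j.left.2 j.hom
      naturality := fun j j' f => by
        refine ((hl (ι.map f.left.1) (ι.map f.left.2) j'.hom).trans ?_).trans
          (Category.comp_id _).symm
        exact congrArg _ (CostructuredArrow.w f) }

end Index

end Generation

end PrL

namespace PrL

/-! ### Generation of the tensor product by pure tensors with dualizable second factor -/

section Generation

variable {k : Type w} [Field k]
variable {C : Type (w + 1)} [Category.{w} C] [Preadditive C] [Linear k C] [MonoidalCategory C]
  [CocontMonoidal k C]

/-- Duality gives `Hom(y, -) ≅ Hom(𝟙, q ⊗ -)`, a composite of colimit-preserving functors. -/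
theorem isCompactProjective_right (hunit : IsCompactProjective k (𝟙_ C)) (q y : C)
    [ExactPairing q y] : IsCompactProjective k y := by
  have := monoidalPreadditive k C
  have := monoidalLinear k C
  have h1 : PreservesColimitsOfSize.{w, w} (tensorLeft q) :=
    (tensorLeft_isCocontLinear (k := k) q).cocontinuous
  have h2 : PreservesColimitsOfSize.{w, w} ((linearCoyoneda k C).obj (op (𝟙_ C))) := hunit
  refine preservesColimits_of_natIso (F := tensorLeft q ⋙ (linearCoyoneda k C).obj (op (𝟙_ C)))
    (NatIso.ofComponents (fun X => LinearEquiv.toModuleIso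
      { toFun := fun f : 𝟙_ C ⟶ q ⊗ X => contractLeft (ε_ q y) f
        invFun := fun g : y ⟶ X => η_ q y ≫ q ◁ g
        map_add' := (contractLeft_isLinearMap (k := k) _).map_add
        map_smul' := (contractLeft_isLinearMap _).map_smul
        left_inv := fun f => coevaluation_contractLeft f
        right_inv := fun g => by
          have := contractLeft_natural (𝟙 y) g (ε_ q y) (η_ q y)
          rw [contractLeft_coevaluation, id_whiskerRight, Category.id_comp, Category.id_comp,
            Category.id_comp] at this
          exact this.symm }) fun {X Y} g => ?_)
  ext f
  have := contractLeft_natural (𝟙 y) g (ε_ q y) f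
  rw [id_whiskerRight, Category.id_comp, Category.id_comp] at this
  exact this.symm

/-- Duality gives `Hom(q, -) ≅ Hom(𝟙, - ⊗ y)`. -/
theorem isCompactProjective_left (hunit : IsCompactProjective k (𝟙_ C)) (q y : C)
    [ExactPairing q y] : IsCompactProjective k q := by
  have := monoidalPreadditive k C
  have := monoidalLinear k C
  have h1 : PreservesColimitsOfSize.{w, w} (tensorRight y) :=
    (tensorRight_isCocontLinear (k := k) y).cocontinuous
  have h2 : PreservesColimitsOfSize.{w, w} ((linearCoyoneda k C).obj (op (𝟙_ C))) := hunit
  refine preservesColimits_of_natIso (F := tensorRight y ⋙ (linearCoyoneda k C).obj (op (𝟙_ C)))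
    (NatIso.ofComponents (fun X => LinearEquiv.toModuleIso
      { toFun := fun f : 𝟙_ C ⟶ X ⊗ y => contractRight f (ε_ q y)
        invFun := fun g : q ⟶ X => η_ q y ≫ g ▷ y
        map_add' := (contractRight_isLinearMap (k := k) _).map_add
        map_smul' := (contractRight_isLinearMap _).map_smul
        left_inv := fun f => coevaluation_contractRight f
        right_inv := fun g => by
          have := contractRight_natural (𝟙 q) g (η_ q y) (ε_ q y)
          rw [contractRight_coevaluation, whiskerLeft_id, Category.id_comp, Category.id_comp,
            Category.id_comp] at this
          exact this.symm }) fun {X Y} g => ?_)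
  ext f
  have := contractRight_natural (𝟙 q) g f (ε_ q y)
  rw [whiskerLeft_id, Category.id_comp, Category.id_comp] at this
  exact this.symm

variable {T : Type (w + 1)} [Category.{w} T] [Preadditive T] [Linear k T] {B : C ⥤ C ⥤ T}
  {A : T ⥤ C ⥤ C} [IsLocallyPresentable.{w} C] [IsLocallyPresentable.{w} T]

/-- `C ⊗ C` is generated under colimits by pure tensors whose second factor has a right dual. -/
theorem tensor_induction (hC : IsCpRigid k C) (hunit : IsCompactProjective k (𝟙_ C))
    (h : IsTensorProduct k B) (κ : PreKernel k B A) {P : T → Prop} (hP : ColimitClosed.{w} P)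
    (hbox : ∀ (c q y : C) [ExactPairing q y], P ((B.obj c).obj q)) (t : T) : P t := by
  have := hasColimitsOfSize_of_isLocallyPresentable C
  have := hasColimitsOfSize_of_isLocallyPresentable T
  have := essentiallySmall_cp k C
  let ι : SmallModel.{w} (Cp k C) ⥤ C := (equivSmallModel (Cp k C)).inverse ⋙ ObjectProperty.ι _
  have hι (a) : IsCompactProjective k (ι.obj a) :=
    ((equivSmallModel (Cp k C)).inverse.obj a).property
  have lift {Q : C} (hQ : IsCompactProjective k Q) : ∃ a, Nonempty (Q ≅ ι.obj a) :=
    ⟨(equivSmallModel (Cp k C)).functor.obj ⟨Q, hQ⟩, ⟨(ObjectProperty.ι _).mapIso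
      ((equivSmallModel (Cp k C)).unitIso.app ⟨Q, hQ⟩)⟩⟩
  let D : CoevIndex ι ⥤ T ⥤ T := CoevIndex.proj ι ⋙ boxAction B A
  have hD (j : CoevIndex ι) : IsCocontLinear k (D.obj j) := (κ.left _).comp (h.bilinear.left _)
  -- `N` is the colimit of the functors `t ↦ A (t, p) ⊠ q` over all pairings `p ⊗ q ⟶ 𝟙`. The goal
  -- is `N ≅ 𝟭 T`, which presents each `t` as a colimit of pure tensors.
  let N := colimit D
  have hN (t : T) : IsColimit (((evaluation T T).obj t).mapCocone (colimit.cocone D)) :=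
    isColimitOfPreserves _ (colimit.isColimit D)
  have hNl : IsCocontLinear k N := isCocontLinear_of_pointwise hN hD
  let cc : Cocone D := CoevIndex.mkCocone (𝟭 T) (fun a b e => contraction h κ e)
    fun u v e => map_contraction h κ u v e
  let δ : N ⟶ 𝟭 T := colimit.desc D cc
  let leg (X : T) (a b) (e : ι.obj a ⊗ ι.obj b ⟶ 𝟙_ C) :
      (B.obj ((A.obj X).obj (ι.obj a))).obj (ι.obj b) ⟶ N.obj X :=
    (CoevIndex.leg (colimit.cocone D) a b e).app X
  have hδ (X : T) (a b e) : leg X a b e ≫ δ.app X = contractionApp h κ e X :=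
    congrArg (fun x => x.app X) (colimit.ι_desc cc (CoevIndex.mk ι a b e))
  have hmap (X : T) {a b a' b'} (u : ι.obj a ⟶ ι.obj a') (v : ι.obj b ⟶ ι.obj b')
      (e : ι.obj a' ⊗ ι.obj b' ⟶ 𝟙_ C) : boxMap B ((A.obj X).map u) v ≫ leg X a' b' e =
        leg X a b ((u ⊗ₘ v) ≫ e) := by
    exact (congrArg (fun x => x ≫ leg X a' b' e) (boxAction_map_app
      (x := (ι.obj a, ι.obj b)) (y := (ι.obj a', ι.obj b')) (u, v) X).symm).trans
      (congrArg (fun x => x.app X) (CoevIndex.map_leg (colimit.cocone D) u v e))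
  have hmapL (X : T) {a a' b'} (u : ι.obj a ⟶ ι.obj a') (e : ι.obj a' ⊗ ι.obj b' ⟶ 𝟙_ C) :
      boxMap B ((A.obj X).map u) (𝟙 _) ≫ leg X a' b' e = leg X a b' (u ▷ _ ≫ e) := by
    rw [hmap, tensorHom_id]
  have hmapR (X : T) {a b b'} (v : ι.obj b ⟶ ι.obj b') (e : ι.obj a ⊗ ι.obj b' ⟶ 𝟙_ C) :
      boxMap B (𝟙 ((A.obj X).obj (ι.obj a))) v ≫ leg X a b' e = leg X a b (_ ◁ v ≫ e) := by
    rw [← CategoryTheory.Functor.map_id, hmap, id_tensorHom]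
  have hext (X Y : T) (f g : N.obj X ⟶ Y) (hfg : ∀ a b e, leg X a b e ≫ f = leg X a b e ≫ g) :
      f = g := (hN X).hom_ext fun j => hfg j.left.1 j.left.2 j.hom
  have hpure (c : C) (a b) [ExactPairing (ι.obj a) (ι.obj b)] :
      IsIso (δ.app ((B.obj c).obj (ι.obj a))) := by
    let X := (B.obj c).obj (ι.obj a)
    -- The candidate inverse inserts the coevaluation and uses the leg indexed by the evaluation
    -- pairing.
    let σ : X ⟶ N.obj X := boxMap B (κ.incl c (ι.obj a) (ι.obj b) (η_ _ _)) (𝟙 (ι.obj a)) ≫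
      leg X b a (ε_ _ _)
    have hσ : σ ≫ δ.app X = 𝟙 X := by
      rw [Category.assoc, hδ, incl_contraction, contractRight_coevaluation, boxMap_id]
    -- Tested on the leg of a pairing `e` and on an element `f`: the morphism contracted from `f`
    -- slides into the pairing, changes sides by `contractRight_contractLeft`, and is absorbed by
    -- the coevaluation.
    refine ⟨σ, hext _ _ _ _ fun a' b' e => ?_, hσ⟩
    rw [reassoc_of% hδ, Category.comp_id]
    refine (boxMap_isCopower h.bilinear (κ.isCopower c (ι.obj a) (ι.obj a'))
      (ι.obj b')).hom_ext fun f => ?_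
    rw [reassoc_of% incl_contraction, reassoc_of% boxMap_comp, Category.id_comp, Category.comp_id,
      boxMap_eq_left, Category.assoc, hmapR, contractRight_contractLeft, ← hmapL,
      reassoc_of% boxMap_comp, κ.incl_map, coevaluation_contractLeft, Category.comp_id]
  have : IsIso δ := by
    -- By the universal property it suffices to treat pure tensors, and by cocontinuity in the
    -- second factor those with compact projective, hence dualizable, second factor.
    refine h.isIso hNl (IsCocontLinear.id k) δ fun c₁ c₂ => ?_
    have h1 := (h.bilinear.right c₁).cocontinuous
    have h2 := hNl.cocontinuous
    have hcl := colimitClosed_isIso (Functor.whiskerLeft (B.obj c₁) δ)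
    refine cp_induction k hC.enough hcl (fun q hq => ?_) c₂
    obtain ⟨⟨y, _⟩⟩ := hC.rightDual q hq
    obtain ⟨a, ⟨ea⟩⟩ := lift hq
    obtain ⟨b, ⟨eb⟩⟩ := lift (isCompactProjective_right hunit q y)
    have := exactPairingCongr ea.symm eb.symm
    exact hcl.of_iso ea.symm (hpure c₁ a b)
  -- The presentation of `t` is by pure tensors whose second factor is a compact projective from the
  -- index, which has a right dual by rigidity.
  refine hP.of_iso (asIso (δ.app t)) (hP _ _ _ (hN t) fun j => ?_)
  obtain ⟨hd⟩ := hC.rightDual _ (hι j.left.2)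
  exact hbox _ (ι.obj j.left.2) (ι.obj j.left.2)ᘁ

end Generation

end PrL

namespace PrL

/-! ### The functor from the tensor product to endofunctors is an equivalence -/

section Equivalence

variable {k : Type w} [Field k]
variable {C : Type (w + 1)} [Category.{w} C] [Preadditive C] [Linear k C] [MonoidalCategory C]
  [CocontMonoidal k C]
variable {T : Type (w + 1)} [Category.{w} T] [Preadditive T] [Linear k T] {B : C ⥤ C ⥤ T}
  {A : T ⥤ C ⥤ C} [IsLocallyPresentable.{w} C] [IsLocallyPresentable.{w} T]

/-- Cocontinuity in `d` holds at pure tensors and is inherited by pointwise colimits, so generation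
upgrades a `PreKernel`. -/
theorem exists_pairingKernel (hC : IsCpRigid k C) (hunit : IsCompactProjective k (𝟙_ C))
    (h : IsTensorProduct k B) : ∃ A : T ⥤ C ⥤ C, Nonempty (PairingKernel k B A) := by
  have := hasColimitsOfSize_of_isLocallyPresentable C
  obtain ⟨A, ⟨κ⟩⟩ := exists_preKernel h hunit
  refine ⟨A, ⟨⟨⟨κ.left, ?_⟩, κ.incl, κ.isCopower, κ.natural⟩⟩⟩
  refine tensor_induction hC hunit h κ (fun J _ F c hc hF => ?_) fun c q y _ => κ.right c q
  exact isCocontLinear_of_pointwise (F := F ⋙ A) (c := A.mapCocone c)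
    (fun d => by
      have := (κ.left d).cocontinuous
      exact isColimitOfPreserves (A.flip.obj d) hc) hF

namespace PairingKernel

variable (κ : PairingKernel k B A)

/-- A pairing kernel preserves colimits in the first variable. -/
def toPreKernel : PreKernel k B A :=
  ⟨κ.bilinear.left, fun _ _ => κ.bilinear.right _, κ.incl, κ.isCopower, κ.natural⟩

theorem incl_obj_map {c₁ c₂ d d' : C} (e : d ⟶ d') (f : 𝟙_ C ⟶ c₂ ⊗ d) :
    κ.incl c₁ c₂ d f ≫ (A.obj ((B.obj c₁).obj c₂)).map e = κ.incl c₁ c₂ d' (f ≫ c₂ ◁ e) :=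
  κ.toPreKernel.incl_map e f

theorem incl_map_app {c₁ c₁' c₂ c₂' d : C} (a : c₁ ⟶ c₁') (b : c₂ ⟶ c₂') (f : 𝟙_ C ⟶ c₂ ⊗ d) :
    κ.incl c₁ c₂ d f ≫ (A.map (boxMap B a b)).app d = a ≫ κ.incl c₁' c₂' d (f ≫ b ▷ d) := by
  have := κ.natural a b (𝟙 d) f
  simpa using this

theorem hom_ext {c₁ c₂ : C} {F : C ⥤ C} {α β : A.obj ((B.obj c₁).obj c₂) ⟶ F}
    (hαβ : ∀ d f, κ.incl c₁ c₂ d f ≫ α.app d = κ.incl c₁ c₂ d f ≫ β.app d) : α = β := by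
  ext d
  exact (κ.isCopower c₁ c₂ d).hom_ext (hαβ d)

theorem preservesColimits (κ : PairingKernel k B A) : PreservesColimitsOfSize.{w, w} A :=
  ⟨⟨fun {K} => ⟨fun {c} hc => ⟨evaluationJointlyReflectsColimits _ fun d => by
    have := (κ.bilinear.left d).cocontinuous
    exact isColimitOfPreserves (A.flip.obj d) hc⟩⟩⟩⟩

/-- A natural map out of `d ↦ ev(c₂, d) ⊗ c₁` from a natural linear family. -/
theorem exists_hom {c₁ c₂ : C} {F : C ⥤ C} (φ : ∀ d, (𝟙_ C ⟶ c₂ ⊗ d) → (c₁ ⟶ F.obj d))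
    (hφ : ∀ d, IsLinearMap k (φ d))
    (hnat : ∀ {d d'} (e : d ⟶ d') f, φ d f ≫ F.map e = φ d' (f ≫ c₂ ◁ e)) :
    ∃ α : A.obj ((B.obj c₁).obj c₂) ⟶ F, ∀ d f, κ.incl c₁ c₂ d f ≫ α.app d = φ d f := by
  choose α hα using fun d => (κ.isCopower c₁ c₂ d).exists_desc (φ d) (hφ d)
  exact ⟨⟨α, fun d d' e => (κ.isCopower c₁ c₂ d).hom_ext fun f => by
    rw [reassoc_of% hα, hnat, reassoc_of% incl_obj_map, hα]⟩, hα⟩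

/-- The functor attached to `c ⊠ q` is `d ↦ Hom(y, d) ⊗ c`, since `ev(q, -)` is represented by `y`;
the claim is the linear Yoneda lemma with coefficients in `c`. -/
theorem bijective_evaluation_fun (c q y : C) [ExactPairing q y] {F : C ⥤ C}
    (hF : IsCocontLinear k F) :
    Function.Bijective fun α : A.obj ((B.obj c).obj q) ⟶ F =>
      κ.incl c q y (η_ q y) ≫ α.app y := by
  have := monoidalPreadditive k C
  have := monoidalLinear k C
  have := hF.additive
  have := hF.linear
  constructor
  · intro α β hαβ
    refine κ.hom_ext fun d f => ?_
    have h1 : κ.incl c q d f = κ.incl c q y (η_ q y) ≫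
        (A.obj ((B.obj c).obj q)).map (contractLeft (ε_ q y) f) := by
      rw [incl_obj_map, coevaluation_contractLeft]
    dsimp at hαβ
    rw [h1, Category.assoc, Category.assoc, α.naturality, β.naturality, reassoc_of% hαβ]
  · intro s
    have hlin (d : C) := contractLeft_isLinearMap (k := k) (d := d) (ε_ q y)
    obtain ⟨α, hα⟩ := κ.exists_hom (c₁ := c) (c₂ := q) (F := F)
      (fun d f => s ≫ F.map (contractLeft (ε_ q y) f))
      (fun d => ⟨fun a b => by simp [(hlin d).map_add], fun r a => by
        simp [(hlin d).map_smul, Functor.map_smul]⟩)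
      (fun {d d'} e f => by
        have := contractLeft_natural (𝟙 y) e (ε_ q y) f
        rw [id_whiskerRight, Category.id_comp, Category.id_comp] at this
        rw [Category.assoc, ← F.map_comp, this])
    exact ⟨α, by
      dsimp
      rw [hα, contractLeft_coevaluation, CategoryTheory.Functor.map_id, Category.comp_id]⟩

/-- This is one triangle identity for `- ⊠ q` being left adjoint to `A (-, y)`. Both sides are
natural in `t`, so it can be checked on pure tensors, where it is a zigzag identity. -/
theorem incl_map_contraction (h : IsTensorProduct k B) (q y : C) [ExactPairing q y] (t : T) :
    κ.incl ((A.obj t).obj y) q y (η_ q y) ≫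
      (A.map (contractionApp h κ.toPreKernel (ε_ q y) t)).app y = 𝟙 _ := by
  let α : A.flip.obj y ⟶ A.flip.obj y :=
    { app := fun t => κ.incl ((A.obj t).obj y) q y (η_ q y) ≫
        (A.map (contractionApp h κ.toPreKernel (ε_ q y) t)).app y
      naturality := fun t t' g => by
        have h1 := κ.incl_map_app ((A.map g).app y) (𝟙 q) (η_ q y)
        rw [id_whiskerRight, Category.comp_id] at h1
        dsimp
        rw [← reassoc_of% h1, Category.assoc, ← NatTrans.comp_app, ← NatTrans.comp_app,
          ← A.map_comp, ← A.map_comp, contractionApp_naturality] }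
  have : α = 𝟙 _ := by
    refine h.hom_ext (κ.bilinear.left y) (κ.bilinear.left y) fun c₁ c₂ =>
      (κ.isCopower c₁ c₂ y).hom_ext fun f => ?_
    have h1 := κ.incl_map_app (κ.incl c₁ c₂ y f) (𝟙 q) (η_ q y)
    have h2 := incl_contraction h κ.toPreKernel (ε_ q y) c₁ c₂ f
    rw [id_whiskerRight, Category.comp_id] at h1
    change κ.incl c₁ c₂ y f ≫ κ.incl _ q y (η_ q y) ≫ (A.map _).app y = κ.incl c₁ c₂ y f ≫ 𝟙 _
    rw [← reassoc_of% h1, ← NatTrans.comp_app, ← A.map_comp]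
    refine (congrArg (fun x => κ.incl c₁ q y (η_ q y) ≫ (A.map x).app y) h2).trans ?_
    rw [incl_map_app, coevaluation_contractRight, Category.id_comp, Category.comp_id]
  exact congrArg (fun x => x.app t) this

/-- The adjunction bijection: coevaluation is the unit, and the inverse uses contraction with the
evaluation as counit. -/
theorem bijective_evaluation_tensor (h : IsTensorProduct k B) (c q y : C) [ExactPairing q y]
    (t : T) : Function.Bijective fun g : (B.obj c).obj q ⟶ t =>
      κ.incl c q y (η_ q y) ≫ (A.map g).app y := by
  refine Function.bijective_iff_has_inverse.2
    ⟨fun s => boxMap B s (𝟙 q) ≫ contractionApp h κ.toPreKernel (ε_ q y) t, fun g => ?_,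
      fun s => ?_⟩
  · dsimp
    have h1 := incl_contraction h κ.toPreKernel (ε_ q y) c q (η_ q y)
    rw [contractRight_coevaluation, boxMap_id] at h1
    rw [← Category.comp_id (𝟙 q), ← boxMap_comp, Category.assoc, contractionApp_naturality]
    exact (Category.assoc _ _ _).symm.trans ((congrArg (fun x => x ≫ g) h1).trans
      (Category.id_comp g))
  · dsimp
    have h1 := κ.incl_map_app s (𝟙 q) (η_ q y)
    rw [id_whiskerRight, Category.comp_id] at h1
    rw [A.map_comp, NatTrans.comp_app, reassoc_of% h1, incl_map_contraction, Category.comp_id]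

/-- For `t = c ⊠ q` with `q` dualizable, evaluating at the coevaluation identifies both sides with
`Hom(c, A (t', y))`, so the map is bijective by two out of three. Generation extends this to every
`t`. -/
theorem bijective_map (κ : PairingKernel k B A) (hC : IsCpRigid k C) (hunit : IsCompactProjective k (𝟙_ C))
    (h : IsTensorProduct k B) (t t' : T) :
    Function.Bijective fun g : t ⟶ t' => A.map g := by
  have := κ.preservesColimits
  refine tensor_induction hC hunit h κ.toPreKernel (colimitClosed_bijective (L := 𝟭 T) (M := A)
    (X := t') (Y := A.obj t') (fun t g => A.map g) fun a g => A.map_comp a g) ?_ t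
  intro c q y _
  refine Function.Bijective.of_comp_iff' (κ.bijective_evaluation_fun c q y
    (κ.bilinear.right t')) _ |>.1 ?_
  exact κ.bijective_evaluation_tensor h c q y t'

/-- The preimage is the coend-like colimit of `F p ⊠ q` over pairings `p ⊗ q ⟶ 𝟙`, which for `F` the
identity is the copairing of `C`. -/
theorem exists_obj_iso (κ : PairingKernel k B A) (hC : IsCpRigid k C) (hunit : IsCompactProjective k (𝟙_ C))
    {F : C ⥤ C} (hF : IsCocontLinear k F) :
    ∃ t, Nonempty (A.obj t ≅ F) := by
  have := monoidalPreadditive k C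
  have := monoidalLinear k C
  have := hF.additive
  have := hF.linear
  have := hasColimitsOfSize_of_isLocallyPresentable C
  have := hasColimitsOfSize_of_isLocallyPresentable T
  have := essentiallySmall_cp k C
  let ι : SmallModel.{w} (Cp k C) ⥤ C := (equivSmallModel (Cp k C)).inverse ⋙ ObjectProperty.ι _
  have lift {Q : C} (hQ : IsCompactProjective k Q) : ∃ a, Nonempty (Q ≅ ι.obj a) :=
    ⟨(equivSmallModel (Cp k C)).functor.obj ⟨Q, hQ⟩, ⟨(ObjectProperty.ι _).mapIso
      ((equivSmallModel (Cp k C)).unitIso.app ⟨Q, hQ⟩)⟩⟩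
  let G : C × C ⥤ T := F.prod (𝟭 C) ⋙ Functor.uncurry.obj B
  let t := colimit (CoevIndex.proj ι ⋙ G)
  have hG {p q p' q' : C} (u : p ⟶ p') (v : q ⟶ q') : G.map (X := (p, q)) (Y := (p', q')) (u, v) =
    boxMap B (F.map u) v := rfl
  have hlin {p q d : C} (e : p ⊗ q ⟶ 𝟙_ C) := contractLeft_isLinearMap (k := k) (d := d) e
  -- The leg at a pairing `e` sends `f : 𝟙 ⟶ q ⊗ d` to `F` applied to its contraction `p ⟶ d` with
  -- `e`.
  choose l hl using fun (p q : C) (e : p ⊗ q ⟶ 𝟙_ C) => κ.exists_hom (c₁ := F.obj p) (c₂ := q)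
    (F := F) (fun d f => F.map (contractLeft e f))
    (fun d => ⟨fun a b => by simp [(hlin e).map_add], fun r a => by
        simp [(hlin e).map_smul, Functor.map_smul]⟩)
    (fun {d d'} a f => by
        have := contractLeft_natural (𝟙 p) a e f
        rw [id_whiskerRight, Category.id_comp, Category.id_comp] at this
        rw [← F.map_comp, this])
  let cc : Cocone (CoevIndex.proj ι ⋙ (G ⋙ A)) := CoevIndex.mkCocone F
    (fun a b e => l (ι.obj a) (ι.obj b) e) (fun {a b a' b'} u v e => by
      refine κ.hom_ext fun d f => ?_
      have h1 := κ.incl_map_app (F.map u) v f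
      have h2 := contractLeft_natural u (𝟙 d) (ι.obj a' ◁ v ≫ e) f
      rw [Category.comp_id, whiskerLeft_id, Category.comp_id, ← contractLeft_comp,
        ← tensorHom_def_assoc] at h2
      refine Eq.trans ?_ (hl _ _ _ d f).symm
      rw [← h2, F.map_comp, ← hl]
      exact (Category.assoc _ _ _).symm.trans ((congrArg (fun x => x ≫ _) h1).trans
        (Category.assoc _ _ _)))
  have := κ.preservesColimits
  have hA : IsColimit (A.mapCocone (colimit.cocone (CoevIndex.proj ι ⋙ G))) :=
    isColimitOfPreserves A (colimit.isColimit _)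
  let δ : A.obj t ⟶ F := hA.desc cc
  let leg (a b) (e : ι.obj a ⊗ ι.obj b ⟶ 𝟙_ C) : (B.obj (F.obj (ι.obj a))).obj (ι.obj b) ⟶ t :=
    CoevIndex.leg (colimit.cocone (CoevIndex.proj ι ⋙ G)) a b e
  have hmap {a b a' b'} (u : ι.obj a ⟶ ι.obj a') (v : ι.obj b ⟶ ι.obj b')
      (e : ι.obj a' ⊗ ι.obj b' ⟶ 𝟙_ C) : boxMap B (F.map u) v ≫ leg a' b' e =
        leg a b ((u ⊗ₘ v) ≫ e) :=
    CoevIndex.map_leg (colimit.cocone (CoevIndex.proj ι ⋙ G)) u v e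
  have hδ (a b e) : A.map (leg a b e) ≫ δ = l (ι.obj a) (ι.obj b) e :=
    hA.fac cc (CoevIndex.mk ι a b e)
  have hcl : ColimitClosed.{w} fun d => IsIso (δ.app d) := by
    have := (κ.bilinear.right t).cocontinuous
    have := hF.cocontinuous
    exact colimitClosed_isIso δ
  have hδa (a b e d) : (A.map (leg a b e)).app d ≫ δ.app d = (l (ι.obj a) (ι.obj b) e).app d :=
    congrArg (fun x => x.app d) (hδ a b e)
  have : ∀ d, IsIso (δ.app d) := by
    refine cp_induction k hC.enough hcl fun y hy => ?_
    -- Here the object of evaluation is the second member of the exact pairing, so a left dual is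
    -- needed.
    obtain ⟨hd⟩ := hC.leftDual y hy
    obtain ⟨b, ⟨eb⟩⟩ := lift hy
    obtain ⟨a, ⟨ea⟩⟩ := lift (isCompactProjective_left hunit (ᘁy) y)
    have := exactPairingCongr ea.symm eb.symm
    refine hcl.of_iso eb.symm ?_
    let σ : F.obj (ι.obj b) ⟶ (A.obj t).obj (ι.obj b) :=
      κ.incl (F.obj (ι.obj b)) (ι.obj a) (ι.obj b) (η_ _ _) ≫
        (A.map (leg b a (ε_ _ _))).app (ι.obj b)
    refine ⟨σ, ?_, ?_⟩
    -- As in `tensor_induction`, the contracted morphism slides from the functor side into the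
    -- pairing by `h3`, changes sides by `contractRight_contractLeft`, and leaves on the `q` side by
    -- `h4`, where `h2` turns the coevaluation back into `f`.
    · have key (a' b') (e : ι.obj a' ⊗ ι.obj b' ⟶ 𝟙_ C) (f : 𝟙_ C ⟶ ι.obj b' ⊗ ι.obj b) :
          κ.incl (F.obj (ι.obj a')) (ι.obj b') (ι.obj b) f ≫
            (A.map (leg a' b' e)).app (ι.obj b) ≫ δ.app (ι.obj b) ≫ σ =
          κ.incl (F.obj (ι.obj a')) (ι.obj b') (ι.obj b) f ≫
            (A.map (leg a' b' e)).app (ι.obj b) ≫ 𝟙 _ := by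
        have h1 := κ.incl_map_app (F.map (contractLeft e f)) (𝟙 (ι.obj a)) (η_ (ι.obj a) (ι.obj b))
        have h2 := κ.incl_map_app (𝟙 (F.obj (ι.obj a')))
          (contractRight f (ε_ (ι.obj a) (ι.obj b))) (η_ (ι.obj a) (ι.obj b))
        rw [id_whiskerRight, Category.comp_id] at h1
        rw [coevaluation_contractRight, Category.id_comp] at h2
        have h3 := hmap (contractLeft e f) (𝟙 (ι.obj a)) (ε_ (ι.obj a) (ι.obj b))
        have h4 := hmap (𝟙 (ι.obj a')) (contractRight f (ε_ (ι.obj a) (ι.obj b))) e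
        rw [tensorHom_id] at h3
        rw [id_tensorHom, contractRight_contractLeft, ← h3, CategoryTheory.Functor.map_id] at h4
        rw [reassoc_of% hδa, reassoc_of% hl, Category.comp_id]
        change F.map (contractLeft e f) ≫ κ.incl _ _ _ _ ≫ _ = _
        rw [← reassoc_of% h1, ← h2, Category.assoc, ← NatTrans.comp_app, ← NatTrans.comp_app,
          ← A.map_comp, ← A.map_comp, h4]
      have hA' : IsColimit ((A ⋙ (evaluation C C).obj (ι.obj b)).mapCocone
          (colimit.cocone (CoevIndex.proj ι ⋙ G))) := isColimitOfPreserves _ (colimit.isColimit _)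
      exact hA'.hom_ext fun j => (κ.isCopower _ _ _).hom_ext fun f => key _ _ j.hom f
    · rw [Category.assoc, hδa, hl, contractLeft_coevaluation, F.map_id]
  exact ⟨t, ⟨NatIso.ofComponents (fun d => asIso (δ.app d)) fun f => δ.naturality f⟩⟩

end PairingKernel

end Equivalence

end PrL

namespace PrL

/-! ### The right adjoint of the tensor functor -/

section Adjoint

/-- Insertion of a copairing next to an object. -/
def pairingInsert {C : Type u} [Category.{v} C] [MonoidalCategory C] (c₁ : C) {c₂ d : C}
    (f : 𝟙_ C ⟶ c₂ ⊗ d) : c₁ ⟶ (c₁ ⊗ c₂) ⊗ d :=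
  (ρ_ c₁).inv ≫ c₁ ◁ f ≫ (α_ c₁ c₂ d).inv

theorem pairingInsert_natural {C : Type u} [Category.{v} C] [MonoidalCategory C]
    {c₁ c₁' c₂ c₂' d d' : C} (a : c₁ ⟶ c₁') (b : c₂ ⟶ c₂') (e : d ⟶ d') (f : 𝟙_ C ⟶ c₂ ⊗ d) :
    pairingInsert c₁ f ≫ ((a ⊗ₘ b) ⊗ₘ e) = a ≫ pairingInsert c₁' (f ≫ (b ⊗ₘ e)) := by
  simp only [pairingInsert, Category.assoc, ← associator_inv_naturality]
  rw [MonoidalCategory.tensorHom_def a, Category.assoc, whisker_exchange_assoc]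
  simp

variable {k : Type w} [Field k]
variable {C : Type (w + 1)} [Category.{w} C] [Preadditive C] [Linear k C] [MonoidalCategory C]
  [CocontMonoidal k C]
variable {T : Type (w + 1)} [Category.{w} T] [Preadditive T] [Linear k T] {B : C ⥤ C ⥤ T}
  {A : T ⥤ C ⥤ C} [IsLocallyPresentable.{w} C] [IsLocallyPresentable.{w} T]

theorem tensorFunctor_isCocontLinear (h : IsTensorProduct k B) :
    IsCocontLinear k (tensorFunctor h) :=
  haveI := h.universal C
  ((restrictAlong h.bilinear C).inv.obj ⟨curriedTensor C, CocontMonoidal.bilinear⟩).property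

/-- The isomorphism from `X ⊗ Y` to the value of the tensor functor at `X ⊠ Y`. -/
noncomputable def tensorFunctorMk (h : IsTensorProduct k B) (X Y : C) :
    X ⊗ Y ⟶ (tensorFunctor h).obj ((B.obj X).obj Y) :=
  ((tensorFunctorIso h).inv.app X).app Y

instance (h : IsTensorProduct k B) (X Y : C) : IsIso (tensorFunctorMk h X Y) :=
  inferInstanceAs (IsIso ((((tensorFunctorIso h).symm.app X).app Y).hom))

theorem tensorFunctorMk_natural (h : IsTensorProduct k B) {X X' Y Y' : C} (a : X ⟶ X')
    (b : Y ⟶ Y') : (a ⊗ₘ b) ≫ tensorFunctorMk h X' Y' =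
      tensorFunctorMk h X Y ≫ (tensorFunctor h).map (boxMap B a b) := by
  have h1 := congrArg (fun t => t.app Y) ((tensorFunctorIso h).inv.naturality a)
  have h2 := ((tensorFunctorIso h).inv.app X').naturality b
  dsimp at h1 h2
  rw [MonoidalCategory.tensorHom_def, boxMap, Functor.map_comp, Category.assoc]
  change _ ≫ _ ≫ ((tensorFunctorIso h).inv.app X').app Y' =
    ((tensorFunctorIso h).inv.app X).app Y ≫ _
  rw [← reassoc_of% h1, h2]

/-- On a pure tensor, an element `f` of `ev(c₂, d)` is inserted to give `c₁ ⟶ (c₁ ⊗ c₂) ⊗ d`. The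
extension over `T` is made for each fixed `d`; naturality in `d` is then checked on pure tensors. -/
theorem exists_tensorTransform (h : IsTensorProduct k B) (κ : PairingKernel k B A) :
    ∃ σ : A ⟶ tensorFunctor h ⋙ curriedTensor C, ∀ c₁ c₂ d f,
      κ.incl c₁ c₂ d f ≫ (σ.app ((B.obj c₁).obj c₂)).app d =
        pairingInsert c₁ f ≫ tensorFunctorMk h c₁ c₂ ▷ d := by
  have := monoidalPreadditive k C
  have := monoidalLinear k C
  have hM (d : C) : IsCocontLinear k (tensorFunctor h ⋙ tensorRight d) :=
    (tensorFunctor_isCocontLinear h).comp (tensorRight_isCocontLinear d)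
  choose φ hφ using fun c₁ c₂ d => (κ.isCopower c₁ c₂ d).exists_desc
    (fun f => pairingInsert c₁ f ≫ tensorFunctorMk h c₁ c₂ ▷ d)
    ⟨fun a b => by simp [pairingInsert], fun r a => by simp [pairingInsert]⟩
  choose σ hσ using fun d => h.exists_hom (κ.bilinear.left d) (hM d) (fun c₁ c₂ => φ c₁ c₂ d)
    (fun {X X' Y Y'} f g => (κ.isCopower X Y d).hom_ext fun v => by
      have h1 := (reassoc_of% κ.incl_map_app f g v) (φ X' Y' d)
      refine h1.trans ?_
      rw [hφ, reassoc_of% hφ]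
      change _ = _ ≫ _ ≫ (tensorFunctor h).map (boxMap B f g) ▷ d
      have h2 := pairingInsert_natural f g (𝟙 d) v
      rw [tensorHom_id, tensorHom_id] at h2
      rw [← reassoc_of% h2, ← comp_whiskerRight, ← comp_whiskerRight, tensorFunctorMk_natural])
  have hnat {d d' : C} (e : d ⟶ d') : A.flip.map e ≫ σ d' =
      σ d ≫ Functor.whiskerLeft (tensorFunctor h) ((curriedTensor C).flip.map e) := by
    refine h.hom_ext (κ.bilinear.left d) (hM d') fun c₁ c₂ => (κ.isCopower _ _ _).hom_ext fun f => ?_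
    rw [NatTrans.comp_app, NatTrans.comp_app, hσ, hσ]
    refine ((reassoc_of% κ.incl_obj_map e f) _).trans ?_
    rw [hφ, reassoc_of% hφ]
    change _ = _ ≫ _ ≫ _ ◁ e
    have h2 := pairingInsert_natural (𝟙 c₁) (𝟙 c₂) e f
    rw [id_tensorHom_id, id_tensorHom, id_tensorHom, Category.id_comp] at h2
    rw [← h2, Category.assoc, whisker_exchange]
  refine ⟨⟨fun t => ⟨fun d => (σ d).app t, fun d d' e => congrArg (fun x => x.app t) (hnat e)⟩,
    fun t t' g => ?_⟩, fun c₁ c₂ d f => ?_⟩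
  · ext d
    exact (σ d).naturality g
  · dsimp only
    rw [hσ, hφ]

/-- The natural map `A (t, d) ⟶ T t ⊗ d`, given on pure tensors by insertion of copairings. -/
noncomputable def tensorTransform (h : IsTensorProduct k B) (κ : PairingKernel k B A) (t : T)
    (d : C) : (A.obj t).obj d ⟶ (tensorFunctor h).obj t ⊗ d :=
  ((exists_tensorTransform h κ).choose.app t).app d

theorem tensorTransform_naturality_left (h : IsTensorProduct k B) (κ : PairingKernel k B A)
    {t t' : T} (g : t ⟶ t') (d : C) : (A.map g).app d ≫ tensorTransform h κ t' d =
      tensorTransform h κ t d ≫ (tensorFunctor h).map g ▷ d :=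
  congrArg (fun x => x.app d) ((exists_tensorTransform h κ).choose.naturality g)

theorem tensorTransform_naturality (h : IsTensorProduct k B) (κ : PairingKernel k B A)
    (t : T) {d d' : C} (e : d ⟶ d') : (A.obj t).map e ≫ tensorTransform h κ t d' =
      tensorTransform h κ t d ≫ (tensorFunctor h).obj t ◁ e :=
  ((exists_tensorTransform h κ).choose.app t).naturality e

theorem incl_tensorTransform (h : IsTensorProduct k B) (κ : PairingKernel k B A)
    (c₁ c₂ d : C) (f : 𝟙_ C ⟶ c₂ ⊗ d) :
    κ.incl c₁ c₂ d f ≫ tensorTransform h κ ((B.obj c₁).obj c₂) d =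
      pairingInsert c₁ f ≫ tensorFunctorMk h c₁ c₂ ▷ d :=
  (exists_tensorTransform h κ).choose_spec c₁ c₂ d f

/-- The natural transformation `A t ⟶ x ⊗ -` adjunct to `T t ⟶ x`. -/
noncomputable def tensorAdjunct (h : IsTensorProduct k B) (κ : PairingKernel k B A) (t : T) {x : C}
    (e : (tensorFunctor h).obj t ⟶ x) : A.obj t ⟶ (curriedTensor C).obj x where
  app d := tensorTransform h κ t d ≫ e ▷ d
  naturality d d' a := by
    rw [reassoc_of% tensorTransform_naturality, Category.assoc]
    exact congrArg _ (whisker_exchange e a)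

theorem tensorAdjunct_app (h : IsTensorProduct k B) (κ : PairingKernel k B A) (t : T) {x : C}
    (e : (tensorFunctor h).obj t ⟶ x) (d : C) :
    (tensorAdjunct h κ t e).app d = tensorTransform h κ t d ≫ e ▷ d := rfl

theorem tensorAdjunct_naturality (h : IsTensorProduct k B) (κ : PairingKernel k B A) {t t' : T}
    {x : C} (g : t ⟶ t') (e : (tensorFunctor h).obj t' ⟶ x) :
    tensorAdjunct h κ t ((tensorFunctor h).map g ≫ e) = A.map g ≫ tensorAdjunct h κ t' e := by
  ext d
  rw [NatTrans.comp_app, tensorAdjunct_app, tensorAdjunct_app, comp_whiskerRight]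
  exact ((reassoc_of% tensorTransform_naturality_left h κ g d) _).symm

theorem tensorAdjunct_comp (h : IsTensorProduct k B) (κ : PairingKernel k B A) (t : T)
    {x x' : C} (e : (tensorFunctor h).obj t ⟶ x) (a : x ⟶ x') :
    tensorAdjunct h κ t (e ≫ a) = tensorAdjunct h κ t e ≫ (curriedTensor C).map a := by
  ext d
  rw [NatTrans.comp_app, tensorAdjunct_app, tensorAdjunct_app, comp_whiskerRight]
  exact (Category.assoc _ _ _).symm

/-- For `t = c ⊠ q` with dual `y`, Yoneda turns the target into `Hom(c, x ⊗ y)`, and the composite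
becomes the duality bijection with `Hom(c ⊗ q, x)`. Generation does the rest. -/
theorem tensorAdjunct_bijective (hC : IsCpRigid k C) (hunit : IsCompactProjective k (𝟙_ C))
    (h : IsTensorProduct k B) (κ : PairingKernel k B A) (t : T) (x : C) :
    Function.Bijective (tensorAdjunct h κ t (x := x)) := by
  have := κ.preservesColimits
  have := (tensorFunctor_isCocontLinear h).cocontinuous
  refine tensor_induction hC hunit h κ.toPreKernel (colimitClosed_bijective
    (L := tensorFunctor h) (M := A) (X := x) (Y := (curriedTensor C).obj x)
    (fun t e => tensorAdjunct h κ t e) fun a g => tensorAdjunct_naturality h κ a g) ?_ t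
  intro c q y _
  refine Function.Bijective.of_comp_iff' (κ.bijective_evaluation_fun c q y
    (F := (curriedTensor C).obj x) (tensorLeft_isCocontLinear x)) _ |>.1 ?_
  have : (fun α : A.obj ((B.obj c).obj q) ⟶ (curriedTensor C).obj x =>
      κ.incl c q y (η_ q y) ≫ α.app y) ∘ (fun e => tensorAdjunct h κ ((B.obj c).obj q) e) =
      fun e => tensorRightHomEquiv c q y x (tensorFunctorMk h c q ≫ e) := by
    funext e
    dsimp only [Function.comp]
    rw [tensorAdjunct_app]
    refine ((reassoc_of% incl_tensorTransform h κ c q y) _ _).trans ?_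
    simp [tensorRightHomEquiv, pairingInsert]
  rw [this]
  exact (tensorRightHomEquiv c q y x).bijective.comp
    ((asIso (tensorFunctorMk h c q)).homFromEquiv.symm).bijective

namespace PairingKernel

/-- The functor `t ↦ A (t, -)` into the category of colimit-preserving functors. -/
def toFunL (κ : PairingKernel k B A) : T ⥤ FunL k C C :=
  ObjectProperty.lift _ A κ.bilinear.right

theorem full (κ : PairingKernel k B A) (hC : IsCpRigid k C)
    (hunit : IsCompactProjective k (𝟙_ C)) (h : IsTensorProduct k B) : A.Full :=
  ⟨fun {_ _} => (κ.bijective_map hC hunit h _ _).2⟩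

theorem faithful (κ : PairingKernel k B A) (hC : IsCpRigid k C)
    (hunit : IsCompactProjective k (𝟙_ C)) (h : IsTensorProduct k B) : A.Faithful :=
  ⟨fun {_ _} => @(κ.bijective_map hC hunit h _ _).1⟩

theorem isEquivalence_toFunL (κ : PairingKernel k B A) (hC : IsCpRigid k C)
    (hunit : IsCompactProjective k (𝟙_ C)) (h : IsTensorProduct k B) :
    κ.toFunL.IsEquivalence where
  faithful := ⟨fun {_ _ _ _} hfg => (κ.bijective_map hC hunit h _ _).1
    (congrArg (fun x => x.hom) hfg)⟩
  full := ⟨fun {_ _} f => by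
    obtain ⟨g, hg⟩ := (κ.bijective_map hC hunit h _ _).2 f.hom
    exact ⟨g, ObjectProperty.hom_ext _ hg⟩⟩
  essSurj := ⟨fun F => by
    obtain ⟨t, ⟨e⟩⟩ := κ.exists_obj_iso hC hunit F.property
    exact ⟨t, ⟨ObjectProperty.isoMk _ e⟩⟩⟩

end PairingKernel

/-- The tensor functor has a right adjoint, which preserves colimits. -/
theorem exists_rightAdjoint (hC : IsCpRigid k C) (hunit : IsCompactProjective k (𝟙_ C))
    (h : IsTensorProduct k B) :
    ∃ R : C ⥤ T, Nonempty (tensorFunctor h ⊣ R) ∧ IsCocontLinear k R := by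
  obtain ⟨A, ⟨κ⟩⟩ := exists_pairingKernel hC hunit h
  have := κ.isEquivalence_toFunL hC hunit h
  have hfull := κ.full hC hunit h
  have := κ.faithful hC hunit h
  let τ : C ⥤ FunL k C C :=
    ObjectProperty.lift _ (curriedTensor C) CocontMonoidal.bilinear.right
  -- `R x` is the object of `T` whose associated functor is `x ⊗ -`.
  let R : C ⥤ T := τ ⋙ κ.toFunL.inv
  let e : R ⋙ A ≅ curriedTensor C := Functor.isoWhiskerRight (Functor.associator τ _ _ ≪≫
    Functor.isoWhiskerLeft τ κ.toFunL.asEquivalence.counitIso ≪≫ τ.rightUnitor)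
    (ObjectProperty.ι _)
  -- The chain `Hom(T t, x) ≅ Nat(A t, x ⊗ -) ≅ Nat(A t, A (R x)) ≅ Hom(t, R x)`.
  let E (t : T) (x : C) : ((tensorFunctor h).obj t ⟶ x) ≃ (t ⟶ R.obj x) :=
    (Equiv.ofBijective _ (tensorAdjunct_bijective hC hunit h κ t x)).trans
      ((e.app x).homToEquiv.symm.trans (Functor.FullyFaithful.ofFullyFaithful A).homEquiv.symm)
  have hE (t x f) : A.map (E t x f) = tensorAdjunct h κ t f ≫ e.inv.app x := by
    simp [E]
  let adj : tensorFunctor h ⊣ R := Adjunction.mkOfHomEquiv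
    { homEquiv := E
      homEquiv_naturality_left_symm := fun {t' t x} f g => (E t' x).injective <|
        A.map_injective <| by
          obtain ⟨g, rfl⟩ := (E t x).surjective g
          rw [Equiv.apply_symm_apply, Equiv.symm_apply_apply, hE, tensorAdjunct_naturality,
            A.map_comp, hE, Category.assoc]
      homEquiv_naturality_right := fun {t x x'} f g => A.map_injective <| by
        rw [hE, tensorAdjunct_comp, A.map_comp, hE, Category.assoc, Category.assoc]
        exact congrArg _ (e.inv.naturality g) }
  obtain ⟨_, _, _⟩ := tensorFunctor_isCocontLinear h
  refine ⟨R, ⟨adj⟩, ⟨adj.right_adjoint_additive, ⟨fun {x y} f r => ?_⟩, ?_⟩⟩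
  · refine ((adj.homEquiv _ _).symm).injective ?_
    simp [Adjunction.homEquiv_counit, Functor.map_smul]
  -- The fully faithful functor `A` reflects colimits, and `R ⋙ A` is `x ↦ x ⊗ -`, which is
  -- cocontinuous because the tensor product is.
  · have : PreservesColimitsOfSize.{w, w} (curriedTensor C) :=
      ⟨⟨fun {K} => ⟨fun {c} hc => ⟨evaluationJointlyReflectsColimits _ fun d => by
        have := (CocontMonoidal.bilinear (k := k) (C := C)).left d |>.cocontinuous
        exact isColimitOfPreserves ((curriedTensor C).flip.obj d) hc⟩⟩⟩⟩
    have : PreservesColimitsOfSize.{w, w} (R ⋙ A) := preservesColimits_of_natIso e.symm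
    exact preservesColimits_of_reflects_of_preserves R A

end Adjoint

end PrL

namespace PrL

/-! ### Density of pure tensors of compact projective objects -/

section Density

variable {k : Type w} [Field k]

/-- Linear maps out of `Hom(P, colim F)`, with `P` compact projective, are determined by the
morphisms which factor through the diagram. -/
theorem IsCompactProjective.linearMap_ext {D : Type (w + 1)} [Category.{w} D] [Preadditive D]
    [Linear k D] {P : D} (hP : IsCompactProjective k P) {J : Type w} [SmallCategory J] {F : J ⥤ D}
    {c : Cocone F} (hc : IsColimit c) {M : Type w} [AddCommGroup M] [Module k M]
    {φ ψ : (P ⟶ c.pt) →ₗ[k] M}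
    (h : ∀ j (s : P ⟶ F.obj j), φ (s ≫ c.ι.app j) = ψ (s ≫ c.ι.app j)) : φ = ψ := by
  have : PreservesColimitsOfSize.{w, w} ((linearCoyoneda k D).obj (op P)) := hP
  have hc' := isColimitOfPreserves ((linearCoyoneda k D).obj (op P)) hc
  have : ModuleCat.ofHom φ = ModuleCat.ofHom ψ := hc'.hom_ext fun j => by
    ext s
    exact h j s
  exact congrArg ModuleCat.Hom.hom this

theorem IsCompactProjective.linearMap_ext_copower {D : Type (w + 1)} [Category.{w} D]
    [Preadditive D] [Linear k D] {P : D} (hP : IsCompactProjective k P) {V : Type w}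
    [AddCommGroup V] [Module k V] {X Q : D} {ι : V → (X ⟶ Q)} (hι : IsCopower k ι)
    {M : Type w} [AddCommGroup M] [Module k M] {φ ψ : (P ⟶ Q) →ₗ[k] M}
    (h : ∀ v (s : P ⟶ X), φ (s ≫ ι v) = ψ (s ≫ ι v)) : φ = ψ :=
  hP.linearMap_ext (hι.isColimit (Module.Basis.ofVectorSpace k V)) fun _ s => h _ s

variable {C : Type (w + 1)} [Category.{w} C] [Preadditive C] [Linear k C] [MonoidalCategory C]
  [CocontMonoidal k C]
variable {T : Type (w + 1)} [Category.{w} T] [Preadditive T] [Linear k T] {B : C ⥤ C ⥤ T}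
  {A : T ⥤ C ⥤ C} [IsLocallyPresentable.{w} C] [IsLocallyPresentable.{w} T]

namespace PairingKernel

/-- `Hom(c ⊠ q, t) ≅ Hom(c, A (t, y))` for `y` dual to `q`. -/
noncomputable def evaluationEquiv (κ : PairingKernel k B A) (h : IsTensorProduct k B) (c q y : C)
    [ExactPairing q y] (t : T) : ((B.obj c).obj q ⟶ t) ≃ₗ[k] (c ⟶ (A.obj t).obj y) :=
  LinearEquiv.ofBijective
    ⟨⟨fun g => κ.incl c q y (η_ q y) ≫ (A.map g).app y, fun a b => by
      have := (κ.bilinear.left y).additive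
      exact (congrArg _ ((A.flip.obj y).map_add (f := a) (g := b))).trans
        (Preadditive.comp_add _ _ _ _ _ _)⟩, fun r a => by
      have := (κ.bilinear.left y).linear
      exact (congrArg _ ((A.flip.obj y).map_smul r a)).trans (Linear.comp_smul _ _ _ _ _ _)⟩
    (κ.bijective_evaluation_tensor h c q y t)

theorem evaluationEquiv_apply (κ : PairingKernel k B A) (h : IsTensorProduct k B) (c q y : C)
    [ExactPairing q y] {t : T} (g : (B.obj c).obj q ⟶ t) :
    κ.evaluationEquiv h c q y t g = κ.incl c q y (η_ q y) ≫ (A.map g).app y := rfl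

theorem evaluationEquiv_comp (κ : PairingKernel k B A) (h : IsTensorProduct k B) (c q y : C)
    [ExactPairing q y] {t t' : T} (g : (B.obj c).obj q ⟶ t) (a : t ⟶ t') :
    κ.evaluationEquiv h c q y t' (g ≫ a) = κ.evaluationEquiv h c q y t g ≫ (A.map a).app y := by
  simp [evaluationEquiv_apply]

/-- `Hom(c ⊠ q, -)` is `A (-, y)` followed by `Hom(c, -)`, both of which preserve colimits. -/
theorem isCompactProjective_box (κ : PairingKernel k B A) (h : IsTensorProduct k B) {c : C}
    (hc : IsCompactProjective k c) (q y : C) [ExactPairing q y] :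
    IsCompactProjective k ((B.obj c).obj q) := by
  have := (κ.bilinear.left y).cocontinuous
  have : PreservesColimitsOfSize.{w, w} ((linearCoyoneda k C).obj (op c)) := hc
  let e : (linearCoyoneda k T).obj (op ((B.obj c).obj q)) ≅
      A.flip.obj y ⋙ (linearCoyoneda k C).obj (op c) :=
    NatIso.ofComponents (fun t => (κ.evaluationEquiv h c q y t).toModuleIso) fun {t t'} g => by
      ext a
      exact κ.evaluationEquiv_comp h c q y a g
  exact preservesColimits_of_natIso e.symm

/-- Morphisms between pure tensors of compact projective objects are spanned by pure tensors. -/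
theorem linearMap_ext_box (κ : PairingKernel k B A) (h : IsTensorProduct k B) {p : C}
    (hp : IsCompactProjective k p) (q y : C) [ExactPairing q y] (p' q' : C)
    {M : Type w} [AddCommGroup M] [Module k M]
    {φ ψ : ((B.obj p).obj q ⟶ (B.obj p').obj q') →ₗ[k] M}
    (hφ : ∀ a b, φ (boxMap B a b) = ψ (boxMap B a b)) : φ = ψ := by
  let E := κ.evaluationEquiv h p q y ((B.obj p').obj q')
  have : φ ∘ₗ E.symm.toLinearMap = ψ ∘ₗ E.symm.toLinearMap := by
    -- After the adjunction, morphisms out of `p ⊠ q` become morphisms from `p` into a tensor of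
    -- `p'` with `ev(q', y)`. As `p` is compact projective these are spanned by those factoring
    -- through a single element `v`, which correspond to pure tensors.
    refine hp.linearMap_ext_copower (κ.isCopower p' q' y) fun v s => ?_
    have : E.symm (s ≫ κ.incl p' q' y v) = boxMap B s (contractRight v (ε_ q y)) := by
      rw [LinearEquiv.symm_apply_eq]
      refine Eq.trans ?_ (κ.incl_map_app s (contractRight v (ε_ q y)) (η_ q y)).symm
      rw [coevaluation_contractRight]
    change φ (E.symm _) = ψ (E.symm _)
    rw [this, hφ]
  ext g
  have := LinearMap.congr_fun this (E g)
  simpa using this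

end PairingKernel

/-- Every object of `C ⊗ C` is the colimit of the pure tensors of compact projective objects
over it, and this colimit is preserved by every colimit-preserving functor. -/
theorem existsUnique_desc_box (hC : IsCpRigid k C) (hunit : IsCompactProjective k (𝟙_ C))
    (h : IsTensorProduct k B) {K : T ⥤ C} (hK : IsCocontLinear k K) (W : C) (t : T)
    (φ : ∀ p q : Cp k C, ((B.obj p.obj).obj q.obj ⟶ t) →ₗ[k]
      (K.obj ((B.obj p.obj).obj q.obj) ⟶ W))
    (hφ : ∀ (p q p' q' : Cp k C) (a : p ⟶ p') (b : q ⟶ q') f,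
      φ p q (boxMap B a.hom b.hom ≫ f) = K.map (boxMap B a.hom b.hom) ≫ φ p' q' f) :
    ∃! u : K.obj t ⟶ W, ∀ (p q : Cp k C) f, K.map f ≫ u = φ p q f := by
  obtain ⟨A, ⟨κ⟩⟩ := exists_pairingKernel hC hunit h
  obtain ⟨_, _, _⟩ := hK
  have hcp (p q : Cp k C) : IsCompactProjective k ((B.obj p.obj).obj q.obj) := by
    obtain ⟨_⟩ := hC.rightDual q.obj q.property
    exact κ.isCompactProjective_box h p.property q.obj (q.obj)ᘁ
  -- The family `φ` is quantified inside the property, since the colimit argument restricts it along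
  -- the legs of the cocone.
  let P (t : T) : Prop := ∀ φ : ∀ p q : Cp k C, ((B.obj p.obj).obj q.obj ⟶ t) →ₗ[k]
      (K.obj ((B.obj p.obj).obj q.obj) ⟶ W),
    (∀ (p q p' q' : Cp k C) (a : p ⟶ p') (b : q ⟶ q') f,
      φ p q (boxMap B a.hom b.hom ≫ f) = K.map (boxMap B a.hom b.hom) ≫ φ p' q' f) →
    ∃! u : K.obj t ⟶ W, ∀ (p q : Cp k C) f, K.map f ≫ u = φ p q f
  have hP : ColimitClosed.{w} P := by
    intro J _ F c hc hF φ hφ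
    have hKc := isColimitOfPreserves K hc
    choose v hv hv' using fun j => hF j
      (fun p q => φ p q ∘ₗ ⟨⟨fun f => f ≫ c.ι.app j, fun a b => by simp⟩, fun r a => by simp⟩)
      (fun p q p' q' a b f => by
        change φ p q ((boxMap B a.hom b.hom ≫ f) ≫ c.ι.app j) = _
        rw [Category.assoc, hφ]; rfl)
    have hv (j) (p q) (f : (B.obj p.obj).obj q.obj ⟶ F.obj j) :
      K.map f ≫ v j = φ p q (f ≫ c.ι.app j) := hv j p q f
    have hw {i j} (a : i ⟶ j) : K.map (F.map a) ≫ v j = v i := hv' i _ fun p q f => by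
      change K.map f ≫ K.map (F.map a) ≫ v j = φ p q (f ≫ c.ι.app i)
      rw [← K.map_comp_assoc, hv, Category.assoc, c.w]
    let s : Cocone (F ⋙ K) :=
      ⟨W, ⟨v, fun _ _ a => (hw a).trans (Category.comp_id _).symm⟩⟩
    refine ⟨hKc.desc s, fun p q f => ?_, fun u hu => hKc.hom_ext fun j => ?_⟩
    -- Both sides are linear in `f`, and since `p ⊠ q` is compact projective it is enough to take
    -- `f` factoring through a leg of the cocone.
    · have : (⟨⟨fun f => K.map f ≫ hKc.desc s, fun a b => by simp⟩, fun r a => by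
          simp [Functor.map_smul]⟩ : ((B.obj p.obj).obj q.obj ⟶ c.pt) →ₗ[k]
            (K.obj ((B.obj p.obj).obj q.obj) ⟶ W)) = φ p q := by
        refine (hcp p q).linearMap_ext hc fun j f => ?_
        change K.map (f ≫ c.ι.app j) ≫ hKc.desc s = _
        rw [K.map_comp, Category.assoc, ← hv]
        exact congrArg _ (hKc.fac s j)
      exact LinearMap.congr_fun this f
    · refine Eq.trans ?_ (hKc.fac s j).symm
      refine hv' j _ fun p q f => ?_
      change K.map f ≫ K.map (c.ι.app j) ≫ u = φ p q (f ≫ c.ι.app j)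
      rw [← K.map_comp_assoc, hu]
  suffices P t from this φ hφ
  refine tensor_induction hC hunit h κ.toPreKernel hP (fun c q y _ => ?_) t
  have hq : IsCompactProjective k q := isCompactProjective_left hunit q y
  -- The induction over `T` leaves an arbitrary first factor `c`; a second induction makes it
  -- compact projective.
  have hPq : ColimitClosed.{w} fun c => P ((B.obj c).obj q) := fun J _ F c hc hF => by
    have := (h.bilinear.left q).cocontinuous
    exact hP J (F ⋙ B.flip.obj q) _ (isColimitOfPreserves (B.flip.obj q) hc) hF
  refine cp_induction k hC.enough hPq (fun p hp φ hφ => ?_) c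
  -- Yoneda: at `t = p ⊠ q` the required map is the value of `φ` at the identity. Spanning by pure
  -- tensors lets naturality along pure tensors alone suffice.
  refine ⟨φ ⟨p, hp⟩ ⟨q, hq⟩ (𝟙 _), fun p' q' f => ?_, fun u hu => ?_⟩
  · obtain ⟨_⟩ := hC.rightDual q'.obj q'.property
    have : (⟨⟨fun f => K.map f ≫ φ ⟨p, hp⟩ ⟨q, hq⟩ (𝟙 _), fun a b => by simp⟩, fun r a => by
          simp [Functor.map_smul]⟩ : ((B.obj p'.obj).obj q'.obj ⟶ (B.obj p).obj q) →ₗ[k]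
            (K.obj ((B.obj p'.obj).obj q'.obj) ⟶ W)) = φ p' q' := by
      refine κ.linearMap_ext_box h p'.property q'.obj (q'.obj)ᘁ p q fun a b => ?_
      have := hφ p' q' ⟨p, hp⟩ ⟨q, hq⟩ (ObjectProperty.homMk a) (ObjectProperty.homMk b) (𝟙 _)
      rw [Category.comp_id] at this
      exact this.symm
    exact LinearMap.congr_fun this f
  · rw [← hu, K.map_id, Category.id_comp]

end Density

end PrL

namespace PrL

/-! ### Existence of Day convolution -/

section DayConvolution

variable {k : Type w} [Field k]
variable {C : Type (w + 1)} [Category.{w} C] [Preadditive C] [Linear k C] [MonoidalCategory C]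

/-- `D` is the Day convolution of `F` and `G`. -/
structure DayConvolution (k : Type w) [Field k] {C : Type (w + 1)} [Category.{w} C] [Preadditive C]
    [Linear k C] [MonoidalCategory C] (F G D : C ⥤ C) where
  /-- the universal natural map -/
  incl : ∀ x y : C, F.obj x ⊗ G.obj y ⟶ D.obj (x ⊗ y)
  natural : ∀ {x x' y y' : C} (a : x ⟶ x') (b : y ⟶ y'),
    (F.map a ⊗ₘ G.map b) ≫ incl x' y' = incl x y ≫ D.map (a ⊗ₘ b)
  hom_ext : ∀ {L M : C ⥤ C}, IsCocontLinear k L → IsCocontLinear k M → ∀ {α β : D ⋙ L ⟶ M},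
    (∀ x y, L.map (incl x y) ≫ α.app (x ⊗ y) = L.map (incl x y) ≫ β.app (x ⊗ y)) → α = β
  exists_desc : ∀ {L M : C ⥤ C}, IsCocontLinear k L → IsCocontLinear k M →
    ∀ φ : ∀ x y, L.obj (F.obj x ⊗ G.obj y) ⟶ M.obj (x ⊗ y),
    (∀ {x x' y y' : C} (a : x ⟶ x') (b : y ⟶ y'),
      L.map (F.map a ⊗ₘ G.map b) ≫ φ x' y' = φ x y ≫ M.map (a ⊗ₘ b)) →
    ∃ α : D ⋙ L ⟶ M, ∀ x y, L.map (incl x y) ≫ α.app (x ⊗ y) = φ x y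
  isCoend : ∀ (x W : C)
    (φ : ∀ x₁ x₂ : Cp k C, (x₁.obj ⊗ x₂.obj ⟶ x) →ₗ[k] (F.obj x₁.obj ⊗ G.obj x₂.obj ⟶ W)),
    (∀ (x₁ x₂ y₁ y₂ : Cp k C) (a : x₁ ⟶ y₁) (b : x₂ ⟶ y₂) (f : y₁.obj ⊗ y₂.obj ⟶ x),
      φ x₁ x₂ ((a.hom ⊗ₘ b.hom) ≫ f) = (F.map a.hom ⊗ₘ G.map b.hom) ≫ φ y₁ y₂ f) →
    ∃! t : D.obj x ⟶ W, ∀ (x₁ x₂ : Cp k C) (f : x₁.obj ⊗ x₂.obj ⟶ x),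
      incl x₁.obj x₂.obj ≫ D.map f ≫ t = φ x₁ x₂ f

variable [CocontMonoidal k C]
variable {T : Type (w + 1)} [Category.{w} T] [Preadditive T] [Linear k T] {B : C ⥤ C ⥤ T}
  {A : T ⥤ C ⥤ C} [IsLocallyPresentable.{w} C] [IsLocallyPresentable.{w} T]

/-- The bifunctor `(x, y) ↦ F x ⊗ G y`. -/
abbrev externalProduct (F G : C ⥤ C) : C ⥤ C ⥤ C :=
  F ⋙ curriedTensor C ⋙ (Functor.whiskeringLeft C C C).obj G

theorem externalProduct_bilinear {F G : C ⥤ C} (hF : IsCocontLinear k F)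
    (hG : IsCocontLinear k G) : IsCocontBilinear k (externalProduct F G) :=
  ⟨fun y => hF.comp (tensorRight_isCocontLinear (G.obj y)),
    fun x => hG.comp (tensorLeft_isCocontLinear (F.obj x))⟩

/-- Day convolution is the left Kan extension of `(x, y) ↦ F x ⊗ G y` along the tensor functor `S`.
As `S` has a right adjoint `R`, that extension is `R ⋙ K`, with `K` the induced functor on `T`; it
is cocontinuous because `R` is. -/
theorem exists_dayConvolution (hC : IsCpRigid k C) (hunit : IsCompactProjective k (𝟙_ C))
    (h : IsTensorProduct k B) {F G : C ⥤ C} (hF : IsCocontLinear k F) (hG : IsCocontLinear k G) :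
    ∃ D : C ⥤ C, IsCocontLinear k D ∧ Nonempty (DayConvolution k F G D) := by
  obtain ⟨R, ⟨adj⟩, hR⟩ := exists_rightAdjoint hC hunit h
  let S := tensorFunctor h
  have hS : IsCocontLinear k S := tensorFunctor_isCocontLinear h
  have hFG := externalProduct_bilinear hF hG
  let K : T ⥤ C := h.lift hFG
  have hK : IsCocontLinear k K := h.lift_isCocontLinear hFG
  obtain ⟨u, hu⟩ : ∃ u : ∀ x y, F.obj x ⊗ G.obj y ≅ K.obj ((B.obj x).obj y),
      ∀ {x x' y y' : C} (a : x ⟶ x') (b : y ⟶ y'),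
        (F.map a ⊗ₘ G.map b) ≫ (u x' y').hom = (u x y).hom ≫ K.map (boxMap B a b) := by
    refine ⟨fun x y => (((h.liftIso hFG).app x).app y).symm, fun {x x' y y'} a b => ?_⟩
    have := h.liftIso_hom_naturality hFG a b
    refine (Iso.comp_inv_eq (((h.liftIso hFG).app x').app y')).2 ?_
    rw [Category.assoc]
    refine ((Iso.eq_inv_comp (((h.liftIso hFG).app x).app y)).2 ?_)
    refine Eq.trans ?_ this.symm
    exact congrArg _ (MonoidalCategory.tensorHom_def _ _)
  let m (x y : C) : S.obj ((B.obj x).obj y) ⟶ x ⊗ y := inv (tensorFunctorMk h x y)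
  have hm {x x' y y' : C} (a : x ⟶ x') (b : y ⟶ y') :
      S.map (boxMap B a b) ≫ m x' y' = m x y ≫ (a ⊗ₘ b) := by
    rw [IsIso.comp_inv_eq, Category.assoc, IsIso.eq_inv_comp, tensorFunctorMk_natural]
  -- The transpose of the canonical isomorphism `S (x ⊠ y) ≅ x ⊗ y`; applying `K` to it gives the
  -- universal map of the convolution.
  let θ (x y : C) : (B.obj x).obj y ⟶ R.obj (x ⊗ y) := adj.homEquiv _ _ (m x y)
  have hθ (x y : C) : S.map (θ x y) ≫ adj.counit.app (x ⊗ y) = m x y := by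
    simp [θ, S, Adjunction.homEquiv_unit]
  have hθ' (x y : C) : θ x y = adj.unit.app _ ≫ R.map (m x y) := Adjunction.homEquiv_unit ..
  have hθn {x x' y y' : C} (a : x ⟶ x') (b : y ⟶ y') :
      boxMap B a b ≫ θ x' y' = θ x y ≫ R.map (a ⊗ₘ b) := by
    rw [← adj.homEquiv_naturality_left, hm, adj.homEquiv_naturality_right]
  refine ⟨R ⋙ K, hR.comp hK, ⟨{
    incl := fun x y => (u x y).hom ≫ K.map (θ x y)
    natural := fun {x x' y y'} a b => by
      rw [reassoc_of% hu, ← K.map_comp, hθn, K.map_comp, Category.assoc]; rfl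
    hom_ext := fun {L M} hL hM {α β} hαβ => ?_
    exists_desc := fun {L M} hL hM φ hφ => ?_
    isCoend := fun x W φ hφ => ?_ }⟩⟩
  -- `ψ α` is the mate of `α` under `S ⊣ R`. Its source and target live on `T`, so it is determined
  -- on pure tensors, and `hψ` recovers `α` from it by a triangle identity.
  · let ψ (α : (R ⋙ K) ⋙ L ⟶ M) : K ⋙ L ⟶ S ⋙ M :=
      { app := fun t => L.map (K.map (adj.unit.app t)) ≫ α.app (S.obj t)
        naturality := fun t t' g => by
          have h1 := α.naturality (S.map g)
          dsimp at h1 ⊢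
          rw [Category.assoc, ← h1, ← L.map_comp_assoc, ← K.map_comp, ← L.map_comp_assoc,
            ← K.map_comp]
          exact congrArg (fun s => L.map (K.map s) ≫ _) (adj.unit.naturality g) }
    have hψ (α : (R ⋙ K) ⋙ L ⟶ M) (x : C) : L.map (K.map (adj.unit.app (R.obj x))) ≫ α.app (S.obj (R.obj x)) ≫
        M.map (adj.counit.app x) = α.app x := by
      have h1 := α.naturality (adj.counit.app x)
      dsimp at h1
      rw [← h1, ← L.map_comp_assoc, ← K.map_comp, adj.right_triangle_components]
      simp
    have key : ψ α = ψ β := by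
      refine h.hom_ext (hK.comp hL) (hS.comp hM) fun x y => ?_
      have h1 (α : (R ⋙ K) ⋙ L ⟶ M) : L.map (u x y).hom ≫ (ψ α).app ((B.obj x).obj y) ≫
          M.map (m x y) = L.map ((u x y).hom ≫ K.map (θ x y)) ≫ α.app (x ⊗ y) := by
        have h1 := α.naturality (m x y)
        dsimp [ψ] at h1 ⊢
        rw [Category.assoc, ← h1, L.map_comp, Category.assoc, hθ', K.map_comp, L.map_comp,
          Category.assoc]
      have := (h1 α).trans ((hαβ x y).trans (h1 β).symm)
      rwa [cancel_epi, cancel_mono] at this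
    ext x
    rw [← hψ α, ← hψ β]
    have := congrArg (fun s => s.app (R.obj x)) key
    dsimp [ψ] at this
    rw [reassoc_of% this]
  · obtain ⟨ψ, hψ⟩ := h.exists_hom (hK.comp hL) (hS.comp hM)
      (fun x y => L.map (u x y).inv ≫ φ x y ≫ M.map (tensorFunctorMk h x y))
      (fun {x x' y y'} a b => by
        dsimp
        rw [Category.assoc, Category.assoc, ← M.map_comp, ← tensorFunctorMk_natural, M.map_comp,
          ← reassoc_of% hφ, ← L.map_comp_assoc, ← L.map_comp_assoc, (Iso.comp_inv_eq _).2]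
        rw [Category.assoc, hu, Iso.inv_hom_id_assoc])
    refine ⟨⟨fun x => ψ.app (R.obj x) ≫ M.map (adj.counit.app x), fun x y g => ?_⟩, fun x y => ?_⟩
    · have := ψ.naturality (R.map g)
      dsimp at this ⊢
      rw [reassoc_of% this, Category.assoc, ← M.map_comp, ← M.map_comp]
      exact congrArg (fun s => ψ.app (R.obj x) ≫ M.map s) (adj.counit.naturality g)
    · have := ψ.naturality (θ x y)
      dsimp at this ⊢
      rw [L.map_comp, Category.assoc, reassoc_of% this, ← M.map_comp, hθ, hψ]
      simp only [Category.assoc, ← M.map_comp, m, IsIso.hom_inv_id, M.map_id, Category.comp_id,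
        ← L.map_comp_assoc, Iso.hom_inv_id, L.map_id, Category.id_comp]
  · have := hS.additive
    have := hS.linear
    have := monoidalPreadditive k C
    have := monoidalLinear k C
    -- The linear adjunction bijection `Hom(p ⊠ q, R x) ≅ Hom(p ⊗ q, x)`. It translates the coend at
    -- `x` into density of pure tensors over the object `R x`.
    let E (p q : C) : ((B.obj p).obj q ⟶ R.obj x) →ₗ[k] (p ⊗ q ⟶ x) :=
      ⟨⟨fun f => tensorFunctorMk h p q ≫ S.map f ≫ adj.counit.app x,
        fun a b => by simp [Functor.map_add]⟩, fun r a => by simp [Functor.map_smul]⟩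
    have hE {p q} (f : p ⊗ q ⟶ x) : E p q (θ p q ≫ R.map f) = f := by
      change tensorFunctorMk h p q ≫ S.map (θ p q ≫ R.map f) ≫ adj.counit.app x = f
      have := adj.counit.naturality f
      dsimp at this
      rw [S.map_comp, Category.assoc, this, reassoc_of% hθ, IsIso.hom_inv_id_assoc]
    have hE' {p q} (f : (B.obj p).obj q ⟶ R.obj x) : θ p q ≫ R.map (E p q f) = f := by
      refine (adj.homEquiv _ _).symm.injective ?_
      rw [adj.homEquiv_counit, adj.homEquiv_counit]
      have := hE (E p q f)
      change tensorFunctorMk h p q ≫ _ = tensorFunctorMk h p q ≫ _ at this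
      rwa [cancel_epi] at this
    obtain ⟨t, ht, htu⟩ := existsUnique_desc_box hC hunit h hK W (R.obj x)
      (fun p q => (Linear.leftComp k W (u p.obj q.obj).inv) ∘ₗ φ p q ∘ₗ E p.obj q.obj)
      (fun p q p' q' a b f => by
        change (u _ _).inv ≫ φ p q (tensorFunctorMk h _ _ ≫ S.map _ ≫ _) =
          K.map _ ≫ (u _ _).inv ≫ φ p' q' _
        rw [S.map_comp, Category.assoc, ← reassoc_of% tensorFunctorMk_natural]
        rw [Iso.inv_comp_eq, ← reassoc_of% hu, Iso.hom_inv_id_assoc]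
        exact hφ _ _ _ _ a b _)
    refine ⟨t, fun p q f => ?_, fun t' ht' => htu t' fun p q f => ?_⟩
    · have := ht p q (θ p.obj q.obj ≫ R.map f)
      change _ = (u _ _).inv ≫ φ p q (E _ _ _) at this
      rw [hE, K.map_comp, Category.assoc, Iso.eq_inv_comp] at this
      refine Eq.trans ?_ this
      exact Category.assoc _ _ _
    · change _ = (u _ _).inv ≫ φ p q (E _ _ _)
      rw [← ht', Category.assoc, Iso.inv_hom_id_assoc]
      change _ = K.map _ ≫ K.map (R.map _) ≫ t'
      rw [← K.map_comp_assoc, hE']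

end DayConvolution

end PrL

namespace PrL

/-! ### Universal property of iterated Day convolutions -/

section DayMonoidal

/-- Day convolution products of all pairs of colimit-preserving endofunctors, together with the
unit object `x ↦ Hom(𝟙, x) ⊗ 𝟙`. -/
structure DayData (k : Type w) [Field k] (C : Type (w + 1)) [Category.{w} C] [Preadditive C]
    [Linear k C] [MonoidalCategory C] where
  obj : FunL k C C → FunL k C C → FunL k C C
  conv : ∀ F G, DayConvolution k F.obj G.obj (obj F G).obj
  unit : FunL k C C
  unitElt : 𝟙_ C ⟶ unit.obj.obj (𝟙_ C)
  isCopower : ∀ x : C, IsCopower k (fun f : 𝟙_ C ⟶ x => unitElt ≫ unit.obj.map f)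

variable {k : Type w} [Field k]
variable {C : Type (w + 1)} [Category.{w} C] [Preadditive C] [Linear k C] [MonoidalCategory C]
  [CocontMonoidal k C]

theorem exists_dayUnit [IsLocallyPresentable.{w} C] (hunit : IsCompactProjective k (𝟙_ C)) :
    ∃ (J : FunL k C C) (e : 𝟙_ C ⟶ J.obj.obj (𝟙_ C)),
      ∀ x : C, IsCopower k (fun f : 𝟙_ C ⟶ x => e ≫ J.obj.map f) := by
  have := hasColimitsOfSize_of_isLocallyPresentable C
  let V (x : C) : ModuleCat.{w} k := ((linearCoyoneda k C).obj (op (𝟙_ C))).obj x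
  let J : C ⥤ C := (linearCoyoneda k C).obj (op (𝟙_ C)) ⋙ (copFunctor k C).flip.obj (𝟙_ C)
  let i (x : C) (f : 𝟙_ C ⟶ x) : 𝟙_ C ⟶ J.obj x := copInc (V x) (𝟙_ C) f
  have hi (x : C) : IsCopower k (i x) := isCopower_copInc (V x) (𝟙_ C)
  have hmap {x y : C} (f : 𝟙_ C ⟶ x) (g : x ⟶ y) : i x f ≫ J.map g = i y (f ≫ g) :=
    copInc_app (((linearCoyoneda k C).obj (op (𝟙_ C))).map g) (𝟙_ C) f
  have hJ : IsCocontLinear k J :=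
    { additive := ⟨fun {x y f g} => (hi x).hom_ext fun v => by
        rw [hmap, Preadditive.comp_add, Preadditive.comp_add, hmap, hmap, (hi y).linear.map_add]⟩
      linear := ⟨fun {x y} f r => (hi x).hom_ext fun v => by
        rw [hmap, Linear.comp_smul, Linear.comp_smul, hmap, (hi y).linear.map_smul]⟩
      cocontinuous := by
        have h2 : PreservesColimitsOfSize.{w, w} ((linearCoyoneda k C).obj (op (𝟙_ C))) := hunit
        exact inferInstanceAs (PreservesColimitsOfSize.{w, w}
          ((linearCoyoneda k C).obj (op (𝟙_ C)) ⋙ (copFunctor k C).flip.obj (𝟙_ C))) }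
  refine ⟨⟨J, hJ⟩, i _ (𝟙 _), fun x => ?_⟩
  have : (fun f : 𝟙_ C ⟶ x => i _ (𝟙 _) ≫ J.map f) = i x := by
    funext f
    rw [hmap, Category.id_comp]
  exact this ▸ hi x

theorem exists_dayData {T : Type (w + 1)} [Category.{w} T] [Preadditive T] [Linear k T]
    {B : C ⥤ C ⥤ T} [IsLocallyPresentable.{w} C] [IsLocallyPresentable.{w} T]
    (hC : IsCpRigid k C) (hunit : IsCompactProjective k (𝟙_ C)) (h : IsTensorProduct k B) :
    Nonempty (DayData k C) := by
  choose D hD hconv using fun F G : FunL k C C =>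
    exists_dayConvolution hC hunit h F.property G.property
  obtain ⟨J, e, he⟩ := exists_dayUnit (k := k) (C := C) hunit
  exact ⟨⟨fun F G => ⟨D F G, hD F G⟩, fun F G => (hconv F G).some, J, e, he⟩⟩

theorem FunL.naturality {F G : FunL k C C} (f : F ⟶ G) {x y : C} (a : x ⟶ y) :
    F.obj.map a ≫ f.hom.app y = f.hom.app x ≫ G.obj.map a :=
  f.hom.naturality a

theorem FunL.naturality_assoc {F G : FunL k C C} (f : F ⟶ G) {x y z : C} (a : x ⟶ y)
    (b : G.obj.obj y ⟶ z) :
    F.obj.map a ≫ f.hom.app y ≫ b = f.hom.app x ≫ G.obj.map a ≫ b := by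
  rw [← Category.assoc, FunL.naturality, Category.assoc]

theorem FunL.hom_ext {F G : FunL k C C} {f g : F ⟶ G} (h : ∀ x, f.hom.app x = g.hom.app x) :
    f = g := by
  ext x
  exact h x

theorem FunL.comp_app {F G H : FunL k C C} (f : F ⟶ G) (g : G ⟶ H) (x : C) :
    (f ≫ g).hom.app x = f.hom.app x ≫ g.hom.app x := rfl

theorem FunL.id_app (F : FunL k C C) (x : C) : (𝟙 F : F ⟶ F).hom.app x = 𝟙 (F.obj.obj x) := rfl

namespace DayData

variable (D : DayData k C)

/-- The universal natural map `F x ⊗ G y ⟶ (F ⊗ G) (x ⊗ y)`. -/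
def incl (F G : FunL k C C) (x y : C) :
    F.obj.obj x ⊗ G.obj.obj y ⟶ (D.obj F G).obj.obj (x ⊗ y) :=
  (D.conv F G).incl x y

theorem incl_natural {F G : FunL k C C} {x x' y y' : C} (a : x ⟶ x') (b : y ⟶ y') :
    (F.obj.map a ⊗ₘ G.obj.map b) ≫ D.incl F G x' y' =
      D.incl F G x y ≫ (D.obj F G).obj.map (a ⊗ₘ b) :=
  (D.conv F G).natural a b

theorem incl_natural_left {F G : FunL k C C} {x x' : C} (a : x ⟶ x') (y : C) :
    F.obj.map a ▷ G.obj.obj y ≫ D.incl F G x' y =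
      D.incl F G x y ≫ (D.obj F G).obj.map (a ▷ y) := by
  simpa using D.incl_natural a (𝟙 y)

theorem incl_natural_right {F G : FunL k C C} (x : C) {y y' : C} (b : y ⟶ y') :
    F.obj.obj x ◁ G.obj.map b ≫ D.incl F G x y' =
      D.incl F G x y ≫ (D.obj F G).obj.map (x ◁ b) := by
  simpa using D.incl_natural (𝟙 x) b

/-- The auxiliary functors `L` and `M` allow the variable to occur inside further tensor products,
so that the universal maps of an iterated convolution can be peeled off one at a time. -/
theorem family_ext {F G : FunL k C C} {L M : C ⥤ C} (hL : IsCocontLinear k L)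
    (hM : IsCocontLinear k M) {φ ψ : ∀ p, L.obj ((D.obj F G).obj.obj p) ⟶ M.obj p}
    (hφ : ∀ {p q} (a : p ⟶ q), L.map ((D.obj F G).obj.map a) ≫ φ q = φ p ≫ M.map a)
    (hψ : ∀ {p q} (a : p ⟶ q), L.map ((D.obj F G).obj.map a) ≫ ψ q = ψ p ≫ M.map a)
    (h : ∀ x y, L.map (D.incl F G x y) ≫ φ (x ⊗ y) = L.map (D.incl F G x y) ≫ ψ (x ⊗ y)) (p : C) :
    φ p = ψ p :=
  congrArg (fun α => α.app p) ((D.conv F G).hom_ext hL hM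
    (α := { app := φ, naturality := fun _ _ a => hφ a })
    (β := { app := ψ, naturality := fun _ _ a => hψ a }) h)

/-- The unit is `p ↦ Hom(𝟙, p) ⊗ 𝟙`, so by Yoneda a natural family out of it is determined at the
generic element. -/
theorem unit_family_ext {L M : C ⥤ C} (hL : IsCocontLinear k L)
    {φ ψ : ∀ p, L.obj (D.unit.obj.obj p) ⟶ M.obj p}
    (hφ : ∀ {p q} (a : p ⟶ q), L.map (D.unit.obj.map a) ≫ φ q = φ p ≫ M.map a)
    (hψ : ∀ {p q} (a : p ⟶ q), L.map (D.unit.obj.map a) ≫ ψ q = ψ p ≫ M.map a)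
    (h : L.map D.unitElt ≫ φ (𝟙_ C) = L.map D.unitElt ≫ ψ (𝟙_ C)) (p : C) : φ p = ψ p :=
  ((D.isCopower p).map hL).hom_ext fun f => by
    rw [L.map_comp, Category.assoc, Category.assoc, hφ, hψ, reassoc_of% h]

theorem hom_ext {F G M : FunL k C C} {α β : D.obj F G ⟶ M}
    (h : ∀ x y, D.incl F G x y ≫ α.hom.app (x ⊗ y) = D.incl F G x y ≫ β.hom.app (x ⊗ y)) :
    α = β :=
  FunL.hom_ext <| D.family_ext (L := 𝟭 C) (IsCocontLinear.id k) M.property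
    (FunL.naturality α) (FunL.naturality β) h

/-- A family of morphisms `(F ⊗ G) p ⊗ H z ⟶ M (p ⊗ z)` natural in `p` is determined by its values
on the universal maps. -/
theorem family_ext_left {F G : FunL k C C} {L M : C ⥤ C} (hL : IsCocontLinear k L)
    (hM : IsCocontLinear k M) {Y z : C}
    {φ ψ : ∀ p, L.obj ((D.obj F G).obj.obj p ⊗ Y) ⟶ M.obj (p ⊗ z)}
    (hφ : ∀ {p q} (a : p ⟶ q), L.map ((D.obj F G).obj.map a ▷ Y) ≫ φ q = φ p ≫ M.map (a ▷ z))
    (hψ : ∀ {p q} (a : p ⟶ q), L.map ((D.obj F G).obj.map a ▷ Y) ≫ ψ q = ψ p ≫ M.map (a ▷ z))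
    (h : ∀ x y, L.map (D.incl F G x y ▷ Y) ≫ φ (x ⊗ y) = L.map (D.incl F G x y ▷ Y) ≫ ψ (x ⊗ y))
    (p : C) : φ p = ψ p :=
  D.family_ext (L := tensorRight Y ⋙ L) (M := tensorRight z ⋙ M)
    ((tensorRight_isCocontLinear Y).comp hL) ((tensorRight_isCocontLinear z).comp hM) hφ hψ h p

theorem family_ext_right {F G : FunL k C C} {L M : C ⥤ C} (hL : IsCocontLinear k L)
    (hM : IsCocontLinear k M) {Y z : C}
    {φ ψ : ∀ p, L.obj (Y ⊗ (D.obj F G).obj.obj p) ⟶ M.obj (z ⊗ p)}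
    (hφ : ∀ {p q} (a : p ⟶ q), L.map (Y ◁ (D.obj F G).obj.map a) ≫ φ q = φ p ≫ M.map (z ◁ a))
    (hψ : ∀ {p q} (a : p ⟶ q), L.map (Y ◁ (D.obj F G).obj.map a) ≫ ψ q = ψ p ≫ M.map (z ◁ a))
    (h : ∀ x y, L.map (Y ◁ D.incl F G x y) ≫ φ (x ⊗ y) = L.map (Y ◁ D.incl F G x y) ≫ ψ (x ⊗ y))
    (p : C) : φ p = ψ p :=
  D.family_ext (L := tensorLeft Y ⋙ L) (M := tensorLeft z ⋙ M)
    ((tensorLeft_isCocontLinear Y).comp hL) ((tensorLeft_isCocontLinear z).comp hM) hφ hψ h p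

theorem family_ext_triple {F G H : FunL k C C} {L M : C ⥤ C} (hL : IsCocontLinear k L)
    (hM : IsCocontLinear k M) {φ ψ : ∀ p, L.obj ((D.obj (D.obj F G) H).obj.obj p) ⟶ M.obj p}
    (hφ : ∀ {p q} (a : p ⟶ q), L.map ((D.obj (D.obj F G) H).obj.map a) ≫ φ q = φ p ≫ M.map a)
    (hψ : ∀ {p q} (a : p ⟶ q), L.map ((D.obj (D.obj F G) H).obj.map a) ≫ ψ q = ψ p ≫ M.map a)
    (h : ∀ x y z, L.map (D.incl F G x y ▷ H.obj.obj z ≫ D.incl (D.obj F G) H (x ⊗ y) z) ≫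
        φ ((x ⊗ y) ⊗ z) =
      L.map (D.incl F G x y ▷ H.obj.obj z ≫ D.incl (D.obj F G) H (x ⊗ y) z) ≫ ψ ((x ⊗ y) ⊗ z))
    (p : C) : φ p = ψ p := by
  refine D.family_ext hL hM hφ hψ (fun p z => ?_) p
  refine D.family_ext_left (φ := fun p => L.map (D.incl (D.obj F G) H p z) ≫ φ (p ⊗ z))
    (ψ := fun p => L.map (D.incl (D.obj F G) H p z) ≫ ψ (p ⊗ z)) hL hM (fun {p q} a => ?_)
    (fun {p q} a => ?_) (fun x y => ?_) p
  · rw [← L.map_comp_assoc, incl_natural_left, L.map_comp_assoc, hφ, Category.assoc]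
  · rw [← L.map_comp_assoc, incl_natural_left, L.map_comp_assoc, hψ, Category.assoc]
  · rw [← L.map_comp_assoc, ← L.map_comp_assoc, h]

theorem hom_ext_triple {F G H M : FunL k C C} {α β : D.obj (D.obj F G) H ⟶ M}
    (h : ∀ x y z, D.incl F G x y ▷ H.obj.obj z ≫ D.incl (D.obj F G) H (x ⊗ y) z ≫
        α.hom.app ((x ⊗ y) ⊗ z) =
      D.incl F G x y ▷ H.obj.obj z ≫ D.incl (D.obj F G) H (x ⊗ y) z ≫ β.hom.app ((x ⊗ y) ⊗ z)) :
    α = β :=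
  FunL.hom_ext <| D.family_ext_triple (L := 𝟭 C) (IsCocontLinear.id k) M.property
    (FunL.naturality α) (FunL.naturality β) fun x y z =>
      (Category.assoc _ _ _).trans ((h x y z).trans (Category.assoc _ _ _).symm)

theorem hom_ext_triple_right {F G H M : FunL k C C} {α β : D.obj F (D.obj G H) ⟶ M}
    (h : ∀ x y z, F.obj.obj x ◁ D.incl G H y z ≫ D.incl F (D.obj G H) x (y ⊗ z) ≫
        α.hom.app (x ⊗ y ⊗ z) =
      F.obj.obj x ◁ D.incl G H y z ≫ D.incl F (D.obj G H) x (y ⊗ z) ≫ β.hom.app (x ⊗ y ⊗ z)) :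
    α = β := by
  refine D.hom_ext fun x p => ?_
  refine D.family_ext_right (L := 𝟭 C) (M := M.obj)
    (φ := fun p => D.incl F (D.obj G H) x p ≫ α.hom.app (x ⊗ p))
    (ψ := fun p => D.incl F (D.obj G H) x p ≫ β.hom.app (x ⊗ p)) (IsCocontLinear.id k) M.property
    (fun {p q} a => ?_) (fun {p q} a => ?_) (fun y z => h x y z) p
  · refine (reassoc_of% D.incl_natural_right x a) _ |>.trans ?_
    rw [FunL.naturality, Category.assoc]
  · refine (reassoc_of% D.incl_natural_right x a) _ |>.trans ?_
    rw [FunL.naturality, Category.assoc]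

theorem hom_ext_quadruple {F G H K M : FunL k C C} {α β : D.obj (D.obj (D.obj F G) H) K ⟶ M}
    (h : ∀ x y z t, D.incl F G x y ▷ H.obj.obj z ▷ K.obj.obj t ≫
        D.incl (D.obj F G) H (x ⊗ y) z ▷ K.obj.obj t ≫
          D.incl (D.obj (D.obj F G) H) K ((x ⊗ y) ⊗ z) t ≫ α.hom.app (((x ⊗ y) ⊗ z) ⊗ t) =
      D.incl F G x y ▷ H.obj.obj z ▷ K.obj.obj t ≫
        D.incl (D.obj F G) H (x ⊗ y) z ▷ K.obj.obj t ≫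
          D.incl (D.obj (D.obj F G) H) K ((x ⊗ y) ⊗ z) t ≫ β.hom.app (((x ⊗ y) ⊗ z) ⊗ t)) :
    α = β := by
  refine D.hom_ext fun p t => ?_
  refine D.family_ext_triple (L := tensorRight (K.obj.obj t)) (M := tensorRight t ⋙ M.obj)
    (φ := fun p => D.incl (D.obj (D.obj F G) H) K p t ≫ α.hom.app (p ⊗ t))
    (ψ := fun p => D.incl (D.obj (D.obj F G) H) K p t ≫ β.hom.app (p ⊗ t))
    (tensorRight_isCocontLinear _) ((tensorRight_isCocontLinear t).comp M.property)
    (fun {p q} a => ?_) (fun {p q} a => ?_) (fun x y z => ?_) p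
  · refine (reassoc_of% D.incl_natural_left a t) _ |>.trans ?_
    rw [FunL.naturality, Category.assoc]; rfl
  · refine (reassoc_of% D.incl_natural_left a t) _ |>.trans ?_
    rw [FunL.naturality, Category.assoc]; rfl
  · refine (congrArg (· ≫ _) (comp_whiskerRight _ _ _)).trans ((Category.assoc _ _ _).trans
      ((h x y z t).trans ((Category.assoc _ _ _).symm.trans
        (congrArg (· ≫ _) (comp_whiskerRight _ _ _)).symm)))

theorem exists_desc {F G M : FunL k C C}
    (φ : ∀ x y, F.obj.obj x ⊗ G.obj.obj y ⟶ M.obj.obj (x ⊗ y))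
    (hφ : ∀ {x x' y y'} (a : x ⟶ x') (b : y ⟶ y'),
      (F.obj.map a ⊗ₘ G.obj.map b) ≫ φ x' y' = φ x y ≫ M.obj.map (a ⊗ₘ b)) :
    ∃ α : D.obj F G ⟶ M, ∀ x y, D.incl F G x y ≫ α.hom.app (x ⊗ y) = φ x y := by
  obtain ⟨α, hα⟩ := (D.conv F G).exists_desc (L := 𝟭 C) (IsCocontLinear.id k) M.property φ hφ
  exact ⟨ObjectProperty.homMk ⟨α.app, α.naturality⟩, hα⟩

/-- The family is descended in `(x, y)` for each fixed `z`. Naturality of the result in `z` is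
checked on the inner universal maps, after which a second descent applies. -/
theorem exists_desc_triple {F G H M : FunL k C C}
    (φ : ∀ x y z, (F.obj.obj x ⊗ G.obj.obj y) ⊗ H.obj.obj z ⟶ M.obj.obj ((x ⊗ y) ⊗ z))
    (hφ : ∀ {x x' y y' z z'} (a : x ⟶ x') (b : y ⟶ y') (c : z ⟶ z'),
      ((F.obj.map a ⊗ₘ G.obj.map b) ⊗ₘ H.obj.map c) ≫ φ x' y' z' =
        φ x y z ≫ M.obj.map ((a ⊗ₘ b) ⊗ₘ c)) :
    ∃ α : D.obj (D.obj F G) H ⟶ M, ∀ x y z, D.incl F G x y ▷ H.obj.obj z ≫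
      D.incl (D.obj F G) H (x ⊗ y) z ≫ α.hom.app ((x ⊗ y) ⊗ z) = φ x y z := by
  choose α hα using fun z => (D.conv F G).exists_desc (L := tensorRight (H.obj.obj z))
    (M := tensorRight z ⋙ M.obj) (tensorRight_isCocontLinear _)
    ((tensorRight_isCocontLinear z).comp M.property) (fun x y => φ x y z)
    (fun {x x' y y'} a b => by
      have := hφ a b (𝟙 z)
      rw [CategoryTheory.Functor.map_id, tensorHom_id, tensorHom_id] at this
      exact this)
  have hα (x y z) : D.incl F G x y ▷ H.obj.obj z ≫ (α z).app (x ⊗ y) = φ x y z := hα z x y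
  let β (p z : C) : (D.obj F G).obj.obj p ⊗ H.obj.obj z ⟶ M.obj.obj (p ⊗ z) := (α z).app p
  have hβ (x y z) : D.incl F G x y ▷ H.obj.obj z ≫ β (x ⊗ y) z = φ x y z := hα x y z
  have hn {p q : C} (a : p ⟶ q) (z : C) : (D.obj F G).obj.map a ▷ H.obj.obj z ≫ β q z =
    β p z ≫ M.obj.map (a ▷ z) := (α z).naturality a
  have hc {z z' : C} (c : z ⟶ z') (p : C) : (D.obj F G).obj.obj p ◁ H.obj.map c ≫ β p z' =
      β p z ≫ M.obj.map (p ◁ c) := by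
    refine D.family_ext_left (L := 𝟭 C) (M := M.obj)
      (φ := fun p => (D.obj F G).obj.obj p ◁ H.obj.map c ≫ β p z')
      (ψ := fun p => β p z ≫ M.obj.map (p ◁ c)) (z := z') (IsCocontLinear.id k) M.property
      (fun {p q} a => ?_) (fun {p q} a => ?_) (fun x y => ?_) p
    · change _ ▷ _ ≫ _ ◁ _ ≫ _ = _
      rw [← whisker_exchange_assoc, hn, Category.assoc]
    · change _ ▷ _ ≫ _ = _
      rw [reassoc_of% hn, ← M.obj.map_comp, ← whisker_exchange, M.obj.map_comp, Category.assoc]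
    · change _ ▷ _ ≫ _ ◁ _ ≫ _ = _ ▷ _ ≫ _
      have := hφ (𝟙 x) (𝟙 y) c
      rw [CategoryTheory.Functor.map_id, CategoryTheory.Functor.map_id, id_tensorHom_id,
        id_tensorHom_id, id_tensorHom, id_tensorHom] at this
      rw [← whisker_exchange_assoc, hβ, reassoc_of% hβ, this]
  obtain ⟨γ, hγ⟩ := D.exists_desc (F := D.obj F G) (G := H) (M := M) β fun a c => by
    rw [MonoidalCategory.tensorHom_def, Category.assoc, hc, reassoc_of% hn, ← M.obj.map_comp,
      ← MonoidalCategory.tensorHom_def]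
  exact ⟨γ, fun x y z => by rw [hγ, hβ]⟩

theorem exists_desc_triple_right {F G H M : FunL k C C}
    (φ : ∀ x y z, F.obj.obj x ⊗ (G.obj.obj y ⊗ H.obj.obj z) ⟶ M.obj.obj (x ⊗ (y ⊗ z)))
    (hφ : ∀ {x x' y y' z z'} (a : x ⟶ x') (b : y ⟶ y') (c : z ⟶ z'),
      (F.obj.map a ⊗ₘ (G.obj.map b ⊗ₘ H.obj.map c)) ≫ φ x' y' z' =
        φ x y z ≫ M.obj.map (a ⊗ₘ (b ⊗ₘ c))) :
    ∃ α : D.obj F (D.obj G H) ⟶ M, ∀ x y z, F.obj.obj x ◁ D.incl G H y z ≫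
      D.incl F (D.obj G H) x (y ⊗ z) ≫ α.hom.app (x ⊗ (y ⊗ z)) = φ x y z := by
  choose α hα using fun x => (D.conv G H).exists_desc (L := tensorLeft (F.obj.obj x))
    (M := tensorLeft x ⋙ M.obj) (tensorLeft_isCocontLinear _)
    ((tensorLeft_isCocontLinear x).comp M.property) (fun y z => φ x y z)
    (fun {y y' z z'} b c => by
      have := hφ (𝟙 x) b c
      rw [CategoryTheory.Functor.map_id, id_tensorHom, id_tensorHom] at this
      exact this)
  let β (x p : C) : F.obj.obj x ⊗ (D.obj G H).obj.obj p ⟶ M.obj.obj (x ⊗ p) := (α x).app p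
  have hβ (x y z) : F.obj.obj x ◁ D.incl G H y z ≫ β x (y ⊗ z) = φ x y z := hα x y z
  have hn {p q : C} (a : p ⟶ q) (x : C) : F.obj.obj x ◁ (D.obj G H).obj.map a ≫ β x q =
    β x p ≫ M.obj.map (x ◁ a) := (α x).naturality a
  have hc {x x' : C} (c : x ⟶ x') (p : C) : F.obj.map c ▷ (D.obj G H).obj.obj p ≫ β x' p =
      β x p ≫ M.obj.map (c ▷ p) := by
    refine D.family_ext_right (L := 𝟭 C) (M := M.obj)
      (φ := fun p => F.obj.map c ▷ (D.obj G H).obj.obj p ≫ β x' p)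
      (ψ := fun p => β x p ≫ M.obj.map (c ▷ p)) (z := x') (IsCocontLinear.id k) M.property
      (fun {p q} a => ?_) (fun {p q} a => ?_) (fun y z => ?_) p
    · change _ ◁ _ ≫ _ ▷ _ ≫ _ = _
      rw [whisker_exchange_assoc, hn, Category.assoc]
    · change _ ◁ _ ≫ _ = _
      rw [reassoc_of% hn, ← M.obj.map_comp, whisker_exchange, M.obj.map_comp, Category.assoc]
    · change _ ◁ _ ≫ _ ▷ _ ≫ _ = _ ◁ _ ≫ _
      have := hφ c (𝟙 y) (𝟙 z)
      rw [CategoryTheory.Functor.map_id, CategoryTheory.Functor.map_id, id_tensorHom_id,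
        id_tensorHom_id, tensorHom_id, tensorHom_id] at this
      rw [whisker_exchange_assoc, hβ, reassoc_of% hβ, this]
  obtain ⟨γ, hγ⟩ := D.exists_desc (F := F) (G := D.obj G H) (M := M) β fun a c => by
    rw [MonoidalCategory.tensorHom_def, Category.assoc, hn, reassoc_of% hc, ← M.obj.map_comp,
      ← MonoidalCategory.tensorHom_def]
  exact ⟨γ, fun x y z => by rw [hγ, hβ]⟩

/-- Yoneda for the unit: the morphism `e` is spread to every `f : 𝟙 ⟶ p` by functoriality of `M`. -/
theorem unit_exists_desc {L M : C ⥤ C} (hL : IsCocontLinear k L) (hM : IsCocontLinear k M)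
    (e : L.obj (𝟙_ C) ⟶ M.obj (𝟙_ C)) :
    ∃ α : D.unit.obj ⋙ L ⟶ M, L.map D.unitElt ≫ α.app (𝟙_ C) = e := by
  obtain ⟨_, _, _⟩ := hM
  choose α hα using fun p => ((D.isCopower p).map hL).exists_desc (fun f => e ≫ M.map f)
    ⟨fun f g => by simp [Functor.map_add], fun r f => by simp [Functor.map_smul]⟩
  refine ⟨⟨α, fun p q a => ((D.isCopower p).map hL).hom_ext fun f => ?_⟩, ?_⟩
  · have := hα q (f ≫ a)
    rw [D.unit.obj.map_comp, L.map_comp, L.map_comp, Category.assoc, Category.assoc] at this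
    rw [reassoc_of% hα, ← M.map_comp, ← this, L.map_comp, Category.assoc]
    rfl
  · have := hα (𝟙_ C) (𝟙 _)
    rwa [CategoryTheory.Functor.map_id, Category.comp_id, CategoryTheory.Functor.map_id,
      Category.comp_id] at this

end DayData

end DayMonoidal

end PrL

namespace PrL

/-! ### The constraints and coherence of Day convolution -/

section DayMonoidal

variable {k : Type w} [Field k]
variable {C : Type (w + 1)} [Category.{w} C] [Preadditive C] [Linear k C] [MonoidalCategory C]
  [CocontMonoidal k C]

namespace DayData

variable (D : DayData k C)

theorem exists_map {F F' G G' : FunL k C C} (α : F ⟶ F') (β : G ⟶ G') :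
    ∃ γ : D.obj F G ⟶ D.obj F' G', ∀ x y, D.incl F G x y ≫ γ.hom.app (x ⊗ y) =
      (α.hom.app x ⊗ₘ β.hom.app y) ≫ D.incl F' G' x y :=
  D.exists_desc _ fun {x x' y y'} a b => by
    rw [Category.assoc, ← D.incl_natural, MonoidalCategory.tensorHom_comp_tensorHom_assoc,
      MonoidalCategory.tensorHom_comp_tensorHom_assoc, FunL.naturality, FunL.naturality]

/-- Day convolution of natural transformations. -/
noncomputable def map {F F' G G' : FunL k C C} (α : F ⟶ F') (β : G ⟶ G') :
    D.obj F G ⟶ D.obj F' G' := (D.exists_map α β).choose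

theorem incl_map {F F' G G' : FunL k C C} (α : F ⟶ F') (β : G ⟶ G') (x y : C) :
    D.incl F G x y ≫ (D.map α β).hom.app (x ⊗ y) =
      (α.hom.app x ⊗ₘ β.hom.app y) ≫ D.incl F' G' x y :=
  (D.exists_map α β).choose_spec x y

theorem incl_map_left {F F' : FunL k C C} (α : F ⟶ F') (G : FunL k C C) (x y : C) :
    D.incl F G x y ≫ (D.map α (𝟙 G)).hom.app (x ⊗ y) =
      α.hom.app x ▷ G.obj.obj y ≫ D.incl F' G x y := by
  rw [incl_map, FunL.id_app, tensorHom_id]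

theorem incl_map_right (F : FunL k C C) {G G' : FunL k C C} (β : G ⟶ G') (x y : C) :
    D.incl F G x y ≫ (D.map (𝟙 F) β).hom.app (x ⊗ y) =
      F.obj.obj x ◁ β.hom.app y ≫ D.incl F G' x y := by
  rw [incl_map, FunL.id_app, id_tensorHom]

theorem map_id (F G : FunL k C C) : D.map (𝟙 F) (𝟙 G) = 𝟙 _ :=
  D.hom_ext fun x y => by
    rw [incl_map, FunL.id_app, FunL.id_app, FunL.id_app, id_tensorHom_id, Category.id_comp,
      Category.comp_id]

theorem map_comp {F F' F'' G G' G'' : FunL k C C} (α : F ⟶ F') (α' : F' ⟶ F'') (β : G ⟶ G')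
    (β' : G' ⟶ G'') : D.map α β ≫ D.map α' β' = D.map (α ≫ α') (β ≫ β') :=
  D.hom_ext fun x y => by
    rw [FunL.comp_app, reassoc_of% incl_map, incl_map, incl_map, FunL.comp_app, FunL.comp_app,
      MonoidalCategory.tensorHom_comp_tensorHom_assoc]

/-- Both bracketings classify natural families on triples, up to the associator of `C` in source and
index; the descents in the two directions are mutually inverse because they are so on universal
maps. -/
theorem exists_associator (F G H : FunL k C C) :
    ∃ e : D.obj (D.obj F G) H ≅ D.obj F (D.obj G H),
      (∀ x y z, D.incl F G x y ▷ H.obj.obj z ≫ D.incl (D.obj F G) H (x ⊗ y) z ≫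
        e.hom.hom.app ((x ⊗ y) ⊗ z) =
      (α_ (F.obj.obj x) (G.obj.obj y) (H.obj.obj z)).hom ≫ F.obj.obj x ◁ D.incl G H y z ≫
        D.incl F (D.obj G H) x (y ⊗ z) ≫ (D.obj F (D.obj G H)).obj.map (α_ x y z).inv) := by
  obtain ⟨f, hf⟩ := D.exists_desc_triple (F := F) (G := G) (H := H) (M := D.obj F (D.obj G H))
    (fun x y z => (α_ (F.obj.obj x) (G.obj.obj y) (H.obj.obj z)).hom ≫
      F.obj.obj x ◁ D.incl G H y z ≫ D.incl F (D.obj G H) x (y ⊗ z) ≫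
        (D.obj F (D.obj G H)).obj.map (α_ x y z).inv)
    (fun {x x' y y' z z'} a b c => by
      have h1 : (F.obj.map a ⊗ₘ G.obj.map b ⊗ₘ H.obj.map c) ≫ F.obj.obj x' ◁ D.incl G H y' z' =
          F.obj.obj x ◁ D.incl G H y z ≫ (F.obj.map a ⊗ₘ (D.obj G H).obj.map (b ⊗ₘ c)) := by
        rw [← id_tensorHom, ← id_tensorHom, MonoidalCategory.tensorHom_comp_tensorHom,
          MonoidalCategory.tensorHom_comp_tensorHom, D.incl_natural, Category.id_comp,
          Category.comp_id]
      rw [associator_naturality_assoc, reassoc_of% h1, reassoc_of% D.incl_natural, Category.assoc,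
        Category.assoc, Category.assoc, ← Functor.map_comp, ← Functor.map_comp,
        associator_inv_naturality])
  obtain ⟨g, hg⟩ := D.exists_desc_triple_right (F := F) (G := G) (H := H)
    (M := D.obj (D.obj F G) H)
    (fun x y z => (α_ (F.obj.obj x) (G.obj.obj y) (H.obj.obj z)).inv ≫
      D.incl F G x y ▷ H.obj.obj z ≫ D.incl (D.obj F G) H (x ⊗ y) z ≫
        (D.obj (D.obj F G) H).obj.map (α_ x y z).hom)
    (fun {x x' y y' z z'} a b c => by
      have h1 : ((F.obj.map a ⊗ₘ G.obj.map b) ⊗ₘ H.obj.map c) ≫ D.incl F G x' y' ▷ H.obj.obj z' =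
          D.incl F G x y ▷ H.obj.obj z ≫ ((D.obj F G).obj.map (a ⊗ₘ b) ⊗ₘ H.obj.map c) := by
        rw [← tensorHom_id, ← tensorHom_id, MonoidalCategory.tensorHom_comp_tensorHom,
          MonoidalCategory.tensorHom_comp_tensorHom, D.incl_natural, Category.id_comp,
          Category.comp_id]
      rw [associator_inv_naturality_assoc, reassoc_of% h1, reassoc_of% D.incl_natural,
        Category.assoc, Category.assoc, Category.assoc, ← Functor.map_comp, ← Functor.map_comp,
        associator_naturality])
  refine ⟨⟨f, g, D.hom_ext_triple fun x y z => ?_, D.hom_ext_triple_right fun x y z => ?_⟩, hf⟩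
  · rw [FunL.comp_app, reassoc_of% hf, FunL.naturality, reassoc_of% hg]
    simp [← Functor.map_comp]
  · rw [FunL.comp_app, reassoc_of% hg, FunL.naturality, reassoc_of% hf]
    simp [← Functor.map_comp]

/-- The associativity constraint of Day convolution. -/
noncomputable def assoc (F G H : FunL k C C) : D.obj (D.obj F G) H ≅ D.obj F (D.obj G H) :=
  (D.exists_associator F G H).choose

theorem incl_assoc (F G H : FunL k C C) (x y z : C) :
    D.incl F G x y ▷ H.obj.obj z ≫ D.incl (D.obj F G) H (x ⊗ y) z ≫
        (D.assoc F G H).hom.hom.app ((x ⊗ y) ⊗ z) =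
      (α_ (F.obj.obj x) (G.obj.obj y) (H.obj.obj z)).hom ≫ F.obj.obj x ◁ D.incl G H y z ≫
        D.incl F (D.obj G H) x (y ⊗ z) ≫ (D.obj F (D.obj G H)).obj.map (α_ x y z).inv :=
  (D.exists_associator F G H).choose_spec x y z

theorem incl_assoc_map (F G H : FunL k C C) (x y z : C) :
    D.incl F G x y ▷ H.obj.obj z ≫ D.incl (D.obj F G) H (x ⊗ y) z ≫
        (D.assoc F G H).hom.hom.app ((x ⊗ y) ⊗ z) ≫
        (D.obj F (D.obj G H)).obj.map (α_ x y z).hom =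
      (α_ (F.obj.obj x) (G.obj.obj y) (H.obj.obj z)).hom ≫ F.obj.obj x ◁ D.incl G H y z ≫
        D.incl F (D.obj G H) x (y ⊗ z) := by
  rw [reassoc_of% incl_assoc, ← Functor.map_comp, Iso.inv_hom_id, CategoryTheory.Functor.map_id,
    Category.comp_id]

theorem hom_ext_unit_left {F M : FunL k C C} {α β : D.obj D.unit F ⟶ M}
    (h : ∀ x, D.unitElt ▷ F.obj.obj x ≫ D.incl D.unit F (𝟙_ C) x ≫ α.hom.app (𝟙_ C ⊗ x) =
      D.unitElt ▷ F.obj.obj x ≫ D.incl D.unit F (𝟙_ C) x ≫ β.hom.app (𝟙_ C ⊗ x)) : α = β := by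
  refine D.hom_ext fun p x => ?_
  refine D.unit_family_ext (L := tensorRight (F.obj.obj x)) (M := tensorRight x ⋙ M.obj)
    (φ := fun p => D.incl D.unit F p x ≫ α.hom.app (p ⊗ x))
    (ψ := fun p => D.incl D.unit F p x ≫ β.hom.app (p ⊗ x)) (tensorRight_isCocontLinear _)
    (fun {p q} a => ?_) (fun {p q} a => ?_) (h x) p
  · refine ((reassoc_of% D.incl_natural_left a x) _).trans ?_
    rw [FunL.naturality, Category.assoc]; rfl
  · refine ((reassoc_of% D.incl_natural_left a x) _).trans ?_
    rw [FunL.naturality, Category.assoc]; rfl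

theorem hom_ext_unit_right {F M : FunL k C C} {α β : D.obj F D.unit ⟶ M}
    (h : ∀ x, F.obj.obj x ◁ D.unitElt ≫ D.incl F D.unit x (𝟙_ C) ≫ α.hom.app (x ⊗ 𝟙_ C) =
      F.obj.obj x ◁ D.unitElt ≫ D.incl F D.unit x (𝟙_ C) ≫ β.hom.app (x ⊗ 𝟙_ C)) : α = β := by
  refine D.hom_ext fun x p => ?_
  refine D.unit_family_ext (L := tensorLeft (F.obj.obj x)) (M := tensorLeft x ⋙ M.obj)
    (φ := fun p => D.incl F D.unit x p ≫ α.hom.app (x ⊗ p))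
    (ψ := fun p => D.incl F D.unit x p ≫ β.hom.app (x ⊗ p)) (tensorLeft_isCocontLinear _)
    (fun {p q} a => ?_) (fun {p q} a => ?_) (h x) p
  · refine ((reassoc_of% D.incl_natural_right x a) _).trans ?_
    rw [FunL.naturality, Category.assoc]; rfl
  · refine ((reassoc_of% D.incl_natural_right x a) _).trans ?_
    rw [FunL.naturality, Category.assoc]; rfl

/-- The extensionality needed for the triangle identity: the middle variable of the triple is
reduced to the generic element of the unit. -/
theorem hom_ext_unit_middle {F G M : FunL k C C} {α β : D.obj (D.obj F D.unit) G ⟶ M}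
    (h : ∀ x y, (F.obj.obj x ◁ D.unitElt) ▷ G.obj.obj y ≫ D.incl F D.unit x (𝟙_ C) ▷ G.obj.obj y ≫
        D.incl (D.obj F D.unit) G (x ⊗ 𝟙_ C) y ≫ α.hom.app ((x ⊗ 𝟙_ C) ⊗ y) =
      (F.obj.obj x ◁ D.unitElt) ▷ G.obj.obj y ≫ D.incl F D.unit x (𝟙_ C) ▷ G.obj.obj y ≫
        D.incl (D.obj F D.unit) G (x ⊗ 𝟙_ C) y ≫ β.hom.app ((x ⊗ 𝟙_ C) ⊗ y)) : α = β := by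
  refine D.hom_ext_triple fun x p y => ?_
  have key (γ : D.obj (D.obj F D.unit) G ⟶ M) {p q : C} (a : p ⟶ q) :
      (F.obj.obj x ◁ D.unit.obj.map a) ▷ G.obj.obj y ≫ D.incl F D.unit x q ▷ G.obj.obj y ≫
        D.incl (D.obj F D.unit) G (x ⊗ q) y ≫ γ.hom.app ((x ⊗ q) ⊗ y) =
      (D.incl F D.unit x p ▷ G.obj.obj y ≫ D.incl (D.obj F D.unit) G (x ⊗ p) y ≫
        γ.hom.app ((x ⊗ p) ⊗ y)) ≫ M.obj.map ((x ◁ a) ▷ y) := by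
    rw [← comp_whiskerRight_assoc, incl_natural_right, comp_whiskerRight_assoc,
      reassoc_of% D.incl_natural_left, FunL.naturality]
    simp only [Category.assoc]
  exact D.unit_family_ext (L := tensorLeft (F.obj.obj x) ⋙ tensorRight (G.obj.obj y))
    (M := tensorLeft x ⋙ tensorRight y ⋙ M.obj)
    (φ := fun p => D.incl F D.unit x p ▷ G.obj.obj y ≫ D.incl (D.obj F D.unit) G (x ⊗ p) y ≫
      α.hom.app ((x ⊗ p) ⊗ y))
    (ψ := fun p => D.incl F D.unit x p ▷ G.obj.obj y ≫ D.incl (D.obj F D.unit) G (x ⊗ p) y ≫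
      β.hom.app ((x ⊗ p) ⊗ y))
    ((tensorLeft_isCocontLinear _).comp (tensorRight_isCocontLinear _)) (key α) (key β) (h x y) p

/-- The forward map comes from Yoneda for the unit, once naturality in `x` is checked at the generic
element. The inverse multiplies by the generic element and then cancels `𝟙` in the index. -/
theorem exists_leftUnitor (F : FunL k C C) :
    ∃ e : D.obj D.unit F ≅ F, ∀ x, D.unitElt ▷ F.obj.obj x ≫ D.incl D.unit F (𝟙_ C) x ≫
      e.hom.hom.app (𝟙_ C ⊗ x) = (λ_ (F.obj.obj x)).hom ≫ F.obj.map (λ_ x).inv := by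
  choose α hα using fun x => D.unit_exists_desc (L := tensorRight (F.obj.obj x))
    (M := tensorRight x ⋙ F.obj) (tensorRight_isCocontLinear _)
    ((tensorRight_isCocontLinear x).comp F.property) ((λ_ (F.obj.obj x)).hom ≫ F.obj.map (λ_ x).inv)
  let β (p x : C) : D.unit.obj.obj p ⊗ F.obj.obj x ⟶ F.obj.obj (p ⊗ x) := (α x).app p
  have hβ (x : C) : D.unitElt ▷ F.obj.obj x ≫ β (𝟙_ C) x =
    (λ_ (F.obj.obj x)).hom ≫ F.obj.map (λ_ x).inv := hα x
  have hn {p q : C} (a : p ⟶ q) (x : C) : D.unit.obj.map a ▷ F.obj.obj x ≫ β q x =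
    β p x ≫ F.obj.map (a ▷ x) := (α x).naturality a
  have hc {x x' : C} (b : x ⟶ x') (p : C) : D.unit.obj.obj p ◁ F.obj.map b ≫ β p x' =
      β p x ≫ F.obj.map (p ◁ b) := by
    refine D.unit_family_ext (L := tensorRight (F.obj.obj x)) (M := tensorRight x' ⋙ F.obj)
      (φ := fun p => D.unit.obj.obj p ◁ F.obj.map b ≫ β p x')
      (ψ := fun p => β p x ≫ F.obj.map (p ◁ b)) (tensorRight_isCocontLinear _)
      (fun {p q} a => ?_) (fun {p q} a => ?_) ?_ p
    · change _ ▷ _ ≫ _ ◁ _ ≫ _ = (_ ◁ _ ≫ _) ≫ F.obj.map (_ ▷ _)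
      rw [← whisker_exchange_assoc, hn, Category.assoc]
    · change _ ▷ _ ≫ _ ≫ _ = (_ ≫ F.obj.map (_ ◁ _)) ≫ F.obj.map (_ ▷ _)
      rw [reassoc_of% hn, ← F.obj.map_comp, ← whisker_exchange, F.obj.map_comp, Category.assoc]
    · change _ ▷ _ ≫ _ ◁ _ ≫ _ = _ ▷ _ ≫ _ ≫ _
      rw [← whisker_exchange_assoc, hβ, reassoc_of% hβ, leftUnitor_naturality_assoc,
        ← F.obj.map_comp, ← F.obj.map_comp, leftUnitor_inv_naturality]
  obtain ⟨f, hf⟩ := D.exists_desc (F := D.unit) (G := F) (M := F) β fun a c => by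
    rw [MonoidalCategory.tensorHom_def, Category.assoc, hc, reassoc_of% hn, ← F.obj.map_comp,
      ← MonoidalCategory.tensorHom_def]
  have hf' (x) : D.unitElt ▷ F.obj.obj x ≫ D.incl D.unit F (𝟙_ C) x ≫
      f.hom.app (𝟙_ C ⊗ x) = (λ_ (F.obj.obj x)).hom ≫ F.obj.map (λ_ x).inv := by rw [hf, hβ]
  let g : F ⟶ D.obj D.unit F := ObjectProperty.homMk
    { app := fun x => (λ_ (F.obj.obj x)).inv ≫ D.unitElt ▷ F.obj.obj x ≫
        D.incl D.unit F (𝟙_ C) x ≫ (D.obj D.unit F).obj.map (λ_ x).hom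
      naturality := fun x y a => by
        rw [leftUnitor_inv_naturality_assoc, whisker_exchange_assoc,
          reassoc_of% D.incl_natural_right, Category.assoc, Category.assoc, Category.assoc,
          ← Functor.map_comp, ← Functor.map_comp, leftUnitor_naturality] }
  have hg (x) : g.hom.app x = (λ_ (F.obj.obj x)).inv ≫ D.unitElt ▷ F.obj.obj x ≫
        D.incl D.unit F (𝟙_ C) x ≫ (D.obj D.unit F).obj.map (λ_ x).hom := rfl
  refine ⟨⟨f, g, D.hom_ext_unit_left fun x => ?_, FunL.hom_ext fun x => ?_⟩, hf'⟩
  · rw [FunL.comp_app, reassoc_of% hf', FunL.naturality, hg]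
    simp [← Functor.map_comp]
  · rw [FunL.comp_app, hg]
    simp only [Category.assoc]
    rw [FunL.naturality, reassoc_of% hf']
    simp [← Functor.map_comp]

theorem exists_rightUnitor (F : FunL k C C) :
    ∃ e : D.obj F D.unit ≅ F, ∀ x, F.obj.obj x ◁ D.unitElt ≫ D.incl F D.unit x (𝟙_ C) ≫
      e.hom.hom.app (x ⊗ 𝟙_ C) = (ρ_ (F.obj.obj x)).hom ≫ F.obj.map (ρ_ x).inv := by
  choose α hα using fun x => D.unit_exists_desc (L := tensorLeft (F.obj.obj x))
    (M := tensorLeft x ⋙ F.obj) (tensorLeft_isCocontLinear _)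
    ((tensorLeft_isCocontLinear x).comp F.property) ((ρ_ (F.obj.obj x)).hom ≫ F.obj.map (ρ_ x).inv)
  let β (x p : C) : F.obj.obj x ⊗ D.unit.obj.obj p ⟶ F.obj.obj (x ⊗ p) := (α x).app p
  have hβ (x : C) : F.obj.obj x ◁ D.unitElt ≫ β x (𝟙_ C) =
    (ρ_ (F.obj.obj x)).hom ≫ F.obj.map (ρ_ x).inv := hα x
  have hn {p q : C} (a : p ⟶ q) (x : C) : F.obj.obj x ◁ D.unit.obj.map a ≫ β x q =
    β x p ≫ F.obj.map (x ◁ a) := (α x).naturality a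
  have hc {x x' : C} (b : x ⟶ x') (p : C) : F.obj.map b ▷ D.unit.obj.obj p ≫ β x' p =
      β x p ≫ F.obj.map (b ▷ p) := by
    refine D.unit_family_ext (L := tensorLeft (F.obj.obj x)) (M := tensorLeft x' ⋙ F.obj)
      (φ := fun p => F.obj.map b ▷ D.unit.obj.obj p ≫ β x' p)
      (ψ := fun p => β x p ≫ F.obj.map (b ▷ p)) (tensorLeft_isCocontLinear _)
      (fun {p q} a => ?_) (fun {p q} a => ?_) ?_ p
    · change _ ◁ _ ≫ _ ▷ _ ≫ _ = (_ ▷ _ ≫ _) ≫ F.obj.map (_ ◁ _)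
      rw [whisker_exchange_assoc, hn, Category.assoc]
    · change _ ◁ _ ≫ _ ≫ _ = (_ ≫ F.obj.map (_ ▷ _)) ≫ F.obj.map (_ ◁ _)
      rw [reassoc_of% hn, ← F.obj.map_comp, whisker_exchange, F.obj.map_comp, Category.assoc]
    · change _ ◁ _ ≫ _ ▷ _ ≫ _ = _ ◁ _ ≫ _ ≫ _
      rw [whisker_exchange_assoc, hβ, reassoc_of% hβ, rightUnitor_naturality_assoc,
        ← F.obj.map_comp, ← F.obj.map_comp, rightUnitor_inv_naturality]
  obtain ⟨f, hf⟩ := D.exists_desc (F := F) (G := D.unit) (M := F) β fun a c => by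
    rw [MonoidalCategory.tensorHom_def, Category.assoc, hn, reassoc_of% hc, ← F.obj.map_comp,
      ← MonoidalCategory.tensorHom_def]
  have hf' (x) : F.obj.obj x ◁ D.unitElt ≫ D.incl F D.unit x (𝟙_ C) ≫
      f.hom.app (x ⊗ 𝟙_ C) = (ρ_ (F.obj.obj x)).hom ≫ F.obj.map (ρ_ x).inv := by rw [hf, hβ]
  let g : F ⟶ D.obj F D.unit := ObjectProperty.homMk
    { app := fun x => (ρ_ (F.obj.obj x)).inv ≫ F.obj.obj x ◁ D.unitElt ≫
        D.incl F D.unit x (𝟙_ C) ≫ (D.obj F D.unit).obj.map (ρ_ x).hom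
      naturality := fun x y a => by
        rw [rightUnitor_inv_naturality_assoc, ← whisker_exchange_assoc,
          reassoc_of% D.incl_natural_left, Category.assoc, Category.assoc, Category.assoc,
          ← Functor.map_comp, ← Functor.map_comp, rightUnitor_naturality] }
  have hg (x) : g.hom.app x = (ρ_ (F.obj.obj x)).inv ≫ F.obj.obj x ◁ D.unitElt ≫
        D.incl F D.unit x (𝟙_ C) ≫ (D.obj F D.unit).obj.map (ρ_ x).hom := rfl
  refine ⟨⟨f, g, D.hom_ext_unit_right fun x => ?_, FunL.hom_ext fun x => ?_⟩, hf'⟩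
  · rw [FunL.comp_app, reassoc_of% hf', FunL.naturality, hg]
    simp [← Functor.map_comp]
  · rw [FunL.comp_app, hg]
    simp only [Category.assoc]
    rw [FunL.naturality, reassoc_of% hf']
    simp [← Functor.map_comp]

/-- The left unit constraint of Day convolution. -/
noncomputable def left (F : FunL k C C) : D.obj D.unit F ≅ F := (D.exists_leftUnitor F).choose

theorem incl_left (F : FunL k C C) (x : C) : D.unitElt ▷ F.obj.obj x ≫
    D.incl D.unit F (𝟙_ C) x ≫ (D.left F).hom.hom.app (𝟙_ C ⊗ x) =
      (λ_ (F.obj.obj x)).hom ≫ F.obj.map (λ_ x).inv :=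
  (D.exists_leftUnitor F).choose_spec x

/-- The right unit constraint of Day convolution. -/
noncomputable def right (F : FunL k C C) : D.obj F D.unit ≅ F := (D.exists_rightUnitor F).choose

theorem incl_right (F : FunL k C C) (x : C) : F.obj.obj x ◁ D.unitElt ≫
    D.incl F D.unit x (𝟙_ C) ≫ (D.right F).hom.hom.app (x ⊗ 𝟙_ C) =
      (ρ_ (F.obj.obj x)).hom ≫ F.obj.map (ρ_ x).inv :=
  (D.exists_rightUnitor F).choose_spec x

theorem assoc_naturality {F F' G G' H H' : FunL k C C} (α : F ⟶ F') (β : G ⟶ G') (γ : H ⟶ H') :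
    D.map (D.map α β) γ ≫ (D.assoc F' G' H').hom =
      (D.assoc F G H).hom ≫ D.map α (D.map β γ) := by
  refine D.hom_ext_triple fun x y z => ?_
  have h1 : D.incl F G x y ▷ H.obj.obj z ≫ ((D.map α β).hom.app (x ⊗ y) ⊗ₘ γ.hom.app z) =
      ((α.hom.app x ⊗ₘ β.hom.app y) ⊗ₘ γ.hom.app z) ≫ D.incl F' G' x y ▷ H'.obj.obj z := by
    rw [← tensorHom_id, ← tensorHom_id, MonoidalCategory.tensorHom_comp_tensorHom,
      MonoidalCategory.tensorHom_comp_tensorHom, incl_map, Category.id_comp, Category.comp_id]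
  have h2 : F.obj.obj x ◁ D.incl G H y z ≫ (α.hom.app x ⊗ₘ (D.map β γ).hom.app (y ⊗ z)) =
      (α.hom.app x ⊗ₘ (β.hom.app y ⊗ₘ γ.hom.app z)) ≫ F'.obj.obj x ◁ D.incl G' H' y z := by
    rw [← id_tensorHom, ← id_tensorHom, MonoidalCategory.tensorHom_comp_tensorHom,
      MonoidalCategory.tensorHom_comp_tensorHom, incl_map, Category.id_comp, Category.comp_id]
  rw [FunL.comp_app, FunL.comp_app, reassoc_of% D.incl_map, reassoc_of% h1, incl_assoc,
    reassoc_of% incl_assoc, FunL.naturality, reassoc_of% D.incl_map, reassoc_of% h2,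
    associator_naturality_assoc]

/-- On the fourfold universal map, each associator contributes one of `C` on the source and an
inverse one inside the functor. The identity splits into the pentagon of `C` and its inverse form.
-/
theorem pentagon (F G H K : FunL k C C) :
    D.map (D.assoc F G H).hom (𝟙 K) ≫ (D.assoc F (D.obj G H) K).hom ≫
        D.map (𝟙 F) (D.assoc G H K).hom =
      (D.assoc (D.obj F G) H K).hom ≫ (D.assoc F G (D.obj H K)).hom := by
  refine D.hom_ext_quadruple fun x y z t => ?_
  simp only [FunL.comp_app]
  have h1 : D.incl F G x y ▷ H.obj.obj z ▷ K.obj.obj t ≫ D.incl (D.obj F G) H (x ⊗ y) z ▷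
      K.obj.obj t ≫ (D.assoc F G H).hom.hom.app ((x ⊗ y) ⊗ z) ▷ K.obj.obj t =
      (α_ (F.obj.obj x) (G.obj.obj y) (H.obj.obj z)).hom ▷ K.obj.obj t ≫
        (F.obj.obj x ◁ D.incl G H y z) ▷ K.obj.obj t ≫
        D.incl F (D.obj G H) x (y ⊗ z) ▷ K.obj.obj t ≫
          (D.obj F (D.obj G H)).obj.map (α_ x y z).inv ▷ K.obj.obj t := by
    simp only [← comp_whiskerRight, incl_assoc]
  have h2 : F.obj.obj x ◁ (D.incl G H y z ▷ K.obj.obj t) ≫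
      F.obj.obj x ◁ D.incl (D.obj G H) K (y ⊗ z) t ≫
        F.obj.obj x ◁ (D.assoc G H K).hom.hom.app ((y ⊗ z) ⊗ t) =
      F.obj.obj x ◁ (α_ (G.obj.obj y) (H.obj.obj z) (K.obj.obj t)).hom ≫
        F.obj.obj x ◁ (G.obj.obj y ◁ D.incl H K z t) ≫
        F.obj.obj x ◁ D.incl G (D.obj H K) y (z ⊗ t) ≫
          F.obj.obj x ◁ (D.obj G (D.obj H K)).obj.map (α_ y z t).inv := by
    simp only [← MonoidalCategory.whiskerLeft_comp, incl_assoc]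
  rw [reassoc_of% D.incl_map_left, reassoc_of% h1, reassoc_of% D.incl_natural_left,
    FunL.naturality_assoc, FunL.naturality, reassoc_of% incl_assoc, FunL.naturality_assoc,
    reassoc_of% D.incl_map_right, associator_naturality_middle_assoc, reassoc_of% h2,
    reassoc_of% D.incl_natural_right, reassoc_of% D.incl_assoc (D.obj F G), FunL.naturality,
    associator_naturality_left_assoc, ← whisker_exchange_assoc, reassoc_of% incl_assoc,
    MonoidalCategory.tensor_whiskerLeft]
  simp only [Category.assoc, Iso.inv_hom_id_assoc, ← Functor.map_comp]
  rw [pentagon_assoc]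
  simp only [pentagon_inv]

theorem triangle (F G : FunL k C C) :
    (D.assoc F D.unit G).hom ≫ D.map (𝟙 F) (D.left G).hom = D.map (D.right F).hom (𝟙 G) := by
  refine D.hom_ext_unit_middle fun x y => ?_
  have h1 : F.obj.obj x ◁ (D.unitElt ▷ G.obj.obj y) ≫ F.obj.obj x ◁ D.incl D.unit G (𝟙_ C) y ≫
      F.obj.obj x ◁ (D.left G).hom.hom.app (𝟙_ C ⊗ y) =
      F.obj.obj x ◁ (λ_ (G.obj.obj y)).hom ≫ F.obj.obj x ◁ G.obj.map (λ_ y).inv := by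
    simp only [← MonoidalCategory.whiskerLeft_comp, incl_left]
  have h2 : (F.obj.obj x ◁ D.unitElt) ▷ G.obj.obj y ≫ D.incl F D.unit x (𝟙_ C) ▷ G.obj.obj y ≫
      (D.right F).hom.hom.app (x ⊗ 𝟙_ C) ▷ G.obj.obj y =
      (ρ_ (F.obj.obj x)).hom ▷ G.obj.obj y ≫ F.obj.map (ρ_ x).inv ▷ G.obj.obj y := by
    simp only [← comp_whiskerRight, incl_right]
  rw [FunL.comp_app, reassoc_of% incl_assoc, FunL.naturality, reassoc_of% D.incl_map_right,
    D.incl_map_left, reassoc_of% h2, associator_naturality_middle_assoc, reassoc_of% h1,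
    reassoc_of% D.incl_natural_right, D.incl_natural_left, MonoidalCategory.triangle_assoc,
    ← Functor.map_comp, triangle_assoc_comp_left_inv]

/-- The Day convolution monoidal structure. -/
@[reducible]
noncomputable def monoidal : MonoidalCategory (FunL k C C) where
  tensorObj F G := D.obj F G
  whiskerLeft F _ _ β := D.map (𝟙 F) β
  whiskerRight α G := D.map α (𝟙 G)
  tensorHom α β := D.map α β
  tensorUnit := D.unit
  associator F G H := D.assoc F G H
  leftUnitor F := D.left F
  rightUnitor F := D.right F
  tensorHom_def α β := by
    rw [map_comp, Category.comp_id, Category.id_comp]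
  id_tensorHom_id F G := D.map_id F G
  tensorHom_comp_tensorHom α β α' β' := D.map_comp α α' β β'
  whiskerLeft_id F G := D.map_id F G
  id_whiskerRight F G := D.map_id F G
  associator_naturality α β γ := D.assoc_naturality α β γ
  leftUnitor_naturality {F G} α := D.hom_ext_unit_left fun x => by
    rw [FunL.comp_app, FunL.comp_app, reassoc_of% D.incl_map_right, ← whisker_exchange_assoc,
      incl_left, reassoc_of% incl_left, FunL.naturality, leftUnitor_naturality_assoc]
  rightUnitor_naturality {F G} α := D.hom_ext_unit_right fun x => by
    rw [FunL.comp_app, FunL.comp_app, reassoc_of% D.incl_map_left, whisker_exchange_assoc,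
      incl_right, reassoc_of% incl_right, FunL.naturality, rightUnitor_naturality_assoc]
  pentagon F G H K := D.pentagon F G H K
  triangle F G := D.triangle F G

/-- The Day convolution product on colimit-preserving endofunctors. -/
noncomputable def dayProduct : DayProduct k C where
  monoidal := D.monoidal
  incl := D.incl
  incl_natural F G _ _ _ _ a b := D.incl_natural a b
  isCoend F G := (D.conv F G).isCoend
  tensorHom_app := D.incl_map
  unitElt := D.unitElt
  unit_isCopower := D.isCopower
  associator_app := D.incl_assoc_map
  leftUnitor_app F x := by
    refine ((reassoc_of% D.incl_left F x) _).trans ?_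
    rw [← Functor.map_comp, Iso.inv_hom_id, CategoryTheory.Functor.map_id, Category.comp_id]
  rightUnitor_app F x := by
    refine ((reassoc_of% D.incl_right F x) _).trans ?_
    rw [← Functor.map_comp, Iso.inv_hom_id, CategoryTheory.Functor.map_id, Category.comp_id]

end DayData

end DayMonoidal

end PrL

namespace PrL

/-! ### Composition and Day convolution as a duoidal structure -/

section FunDuoidal

variable {k : Type w} [Field k]
variable {C : Type (w + 1)} [Category.{w} C] [Preadditive C] [Linear k C]

/-! ### Generalized elements of composites of functors -/

namespace FunL

/-- The composite of two functors. -/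
abbrev comp (F G : FunL k C C) : FunL k C C := (compMonoidal k C).tensorObj F G

variable (k C) in
/-- The identity functor. -/
abbrev one : FunL k C C := (compMonoidal k C).tensorUnit

/-- The horizontal composite of natural transformations. -/
abbrev hcomp {F F' G G' : FunL k C C} (α : F ⟶ F') (β : G ⟶ G') : comp F G ⟶ comp F' G' :=
  (compMonoidal k C).tensorHom α β

/-- The generalized element of a composite given by generalized elements of the two functors. -/
def compElt {F G : FunL k C C} {X y x : C} (f : X ⟶ F.obj.obj y) (g : y ⟶ G.obj.obj x) :
    X ⟶ (comp F G).obj.obj x := f ≫ F.obj.map g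

/-- The second factor can be an identity, but the flexible form with an intermediate object makes
the elements stable under all structure maps. -/
theorem exists_compElt {F G : FunL k C C} {X x : C} (a : X ⟶ (comp F G).obj.obj x) :
    ∃ (y : C) (f : X ⟶ F.obj.obj y) (g : y ⟶ G.obj.obj x), a = compElt f g :=
  ⟨G.obj.obj x, a, 𝟙 _, ((congrArg (fun t => a ≫ t) (F.obj.map_id _)).trans
    (Category.comp_id a)).symm⟩

theorem comp_compElt {F G : FunL k C C} {W X y x : C} (t : W ⟶ X) (f : X ⟶ F.obj.obj y)
    (g : y ⟶ G.obj.obj x) : t ≫ compElt f g = compElt (t ≫ f) g :=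
  (Category.assoc _ _ _).symm

/-- The balancing relation: a morphism of the intermediate object may pass from one factor to the
other. -/
theorem compElt_map_left {F G : FunL k C C} {X y y' x : C} (f : X ⟶ F.obj.obj y) (t : y ⟶ y')
    (g : y' ⟶ G.obj.obj x) : compElt (f ≫ F.obj.map t) g = compElt f (t ≫ g) := by
  rw [compElt, compElt, Category.assoc, F.obj.map_comp]

theorem compElt_map {F G : FunL k C C} {X y x x' : C} (f : X ⟶ F.obj.obj y)
    (g : y ⟶ G.obj.obj x) (t : x ⟶ x') :
    compElt f g ≫ (comp F G).obj.map t = compElt f (g ≫ G.obj.map t) :=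
  (Category.assoc _ _ _).trans (congrArg (fun s => f ≫ s) (F.obj.map_comp _ _).symm)

theorem compElt_hcomp {F F' G G' : FunL k C C} {X y x : C} (f : X ⟶ F.obj.obj y)
    (g : y ⟶ G.obj.obj x) (α : F ⟶ F') (β : G ⟶ G') :
    compElt f g ≫ (hcomp α β).hom.app x = compElt (f ≫ α.hom.app y) (g ≫ β.hom.app x) := by
  change (f ≫ F.obj.map g) ≫ α.hom.app _ ≫ F'.obj.map (β.hom.app x) =
    (f ≫ α.hom.app y) ≫ F'.obj.map (g ≫ β.hom.app x)
  simp

theorem compElt_whiskerRight {F F' G : FunL k C C} {X y x : C} (f : X ⟶ F.obj.obj y)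
    (g : y ⟶ G.obj.obj x) (α : F ⟶ F') :
    compElt f g ≫ ((compMonoidal k C).whiskerRight α G).hom.app x =
      compElt (f ≫ α.hom.app y) g := by
  change (f ≫ F.obj.map g) ≫ α.hom.app _ = (f ≫ α.hom.app y) ≫ F'.obj.map g
  simp

theorem compElt_whiskerLeft {F G G' : FunL k C C} {X y x : C} (f : X ⟶ F.obj.obj y)
    (g : y ⟶ G.obj.obj x) (β : G ⟶ G') :
    compElt f g ≫ ((compMonoidal k C).whiskerLeft F β).hom.app x =
      compElt f (g ≫ β.hom.app x) := by
  change (f ≫ F.obj.map g) ≫ F.obj.map _ = f ≫ F.obj.map _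
  simp

theorem compElt_associator {F G H : FunL k C C} {X y z x : C} (f : X ⟶ F.obj.obj y)
    (g : y ⟶ G.obj.obj z) (h : z ⟶ H.obj.obj x) :
    compElt (compElt f g) h ≫ ((compMonoidal k C).associator F G H).hom.hom.app x =
      compElt f (compElt g h) := by
  change ((f ≫ F.obj.map g) ≫ F.obj.map (G.obj.map h)) ≫ 𝟙 _ = f ≫ F.obj.map (g ≫ G.obj.map h)
  simp

/-- A morphism as a generalized element of the identity functor. -/
def idElt {X x : C} (f : X ⟶ x) : X ⟶ (one k C).obj.obj x := f ≫ 𝟙 x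

theorem exists_idElt {X x : C} (a : X ⟶ (one k C).obj.obj x) :
    ∃ f : X ⟶ x, a = idElt f := ⟨a, (Category.comp_id a).symm⟩

theorem comp_idElt {W X x : C} (t : W ⟶ X) (f : X ⟶ x) :
    t ≫ idElt (k := k) f = idElt (t ≫ f) :=
  (Category.assoc _ _ _).symm

theorem idElt_map {X x y : C} (f : X ⟶ x) (t : x ⟶ y) :
    idElt (k := k) f ≫ (one k C).obj.map t = idElt (f ≫ t) := by
  change (f ≫ 𝟙 x) ≫ t = (f ≫ t) ≫ 𝟙 y
  simp

theorem compElt_leftUnitor {F : FunL k C C} {X y x : C} (f : X ⟶ y) (g : y ⟶ F.obj.obj x) :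
    compElt (idElt f) g ≫ ((compMonoidal k C).leftUnitor F).hom.hom.app x = f ≫ g := by
  change ((f ≫ 𝟙 y) ≫ g) ≫ 𝟙 _ = _
  simp

theorem compElt_rightUnitor {F : FunL k C C} {X y x : C} (f : X ⟶ F.obj.obj y) (g : y ⟶ x) :
    compElt f (idElt g) ≫ ((compMonoidal k C).rightUnitor F).hom.hom.app x =
      f ≫ F.obj.map g := by
  change (f ≫ F.obj.map (g ≫ 𝟙 x)) ≫ 𝟙 _ = _
  simp

end FunL

open FunL

variable [MonoidalCategory C] [CocontMonoidal k C]

namespace DayData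

variable (D : DayData k C)

/-! ### Generalized elements of Day convolutions -/

/-- The product of generalized elements. -/
def mulElt {F G : FunL k C C} {X Y x y : C} (a : X ⟶ F.obj.obj x) (b : Y ⟶ G.obj.obj y) :
    X ⊗ Y ⟶ (D.obj F G).obj.obj (x ⊗ y) := (a ⊗ₘ b) ≫ D.incl F G x y

theorem mulElt_id (F G : FunL k C C) (x y : C) :
    D.mulElt (𝟙 (F.obj.obj x)) (𝟙 (G.obj.obj y)) = D.incl F G x y := by
  rw [mulElt, id_tensorHom_id, Category.id_comp]

theorem comp_mulElt {F G : FunL k C C} {X X' Y Y' x y : C} (s : X' ⟶ X) (t : Y' ⟶ Y)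
    (a : X ⟶ F.obj.obj x) (b : Y ⟶ G.obj.obj y) :
    (s ⊗ₘ t) ≫ D.mulElt a b = D.mulElt (s ≫ a) (t ≫ b) := by
  rw [mulElt, mulElt, MonoidalCategory.tensorHom_comp_tensorHom_assoc]

theorem mulElt_map {F G : FunL k C C} {X Y x x' y y' : C} (a : X ⟶ F.obj.obj x)
    (b : Y ⟶ G.obj.obj y) (s : x ⟶ x') (t : y ⟶ y') :
    D.mulElt (a ≫ F.obj.map s) (b ≫ G.obj.map t) =
      D.mulElt a b ≫ (D.obj F G).obj.map (s ⊗ₘ t) := by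
  rw [mulElt, mulElt, Category.assoc, ← incl_natural,
    MonoidalCategory.tensorHom_comp_tensorHom_assoc]

theorem mulElt_dayMap {F F' G G' : FunL k C C} {X Y x y : C} (a : X ⟶ F.obj.obj x)
    (b : Y ⟶ G.obj.obj y) (α : F ⟶ F') (β : G ⟶ G') :
    D.mulElt a b ≫ (D.map α β).hom.app (x ⊗ y) =
      D.mulElt (a ≫ α.hom.app x) (b ≫ β.hom.app y) := by
  rw [mulElt, mulElt, Category.assoc, incl_map, MonoidalCategory.tensorHom_comp_tensorHom_assoc]

theorem mulElt_eq_left {F G : FunL k C C} {X Y x y : C} (a : X ⟶ F.obj.obj x)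
    (b : Y ⟶ G.obj.obj y) :
    D.mulElt a b = X ◁ b ≫ a ▷ _ ≫ D.incl F G x y := by
  rw [mulElt, MonoidalCategory.tensorHom_def', Category.assoc]

theorem mulElt_mulElt_id (F G H : FunL k C C) (x y z : C) :
    D.mulElt (D.mulElt (𝟙 (F.obj.obj x)) (𝟙 (G.obj.obj y))) (𝟙 (H.obj.obj z)) =
      D.incl F G x y ▷ H.obj.obj z ≫ D.incl (D.obj F G) H (x ⊗ y) z := by
  rw [mulElt_id, mulElt, tensorHom_id]

theorem mulElt_assoc {F G H : FunL k C C} {X Y Z x y z : C} (a : X ⟶ F.obj.obj x)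
    (b : Y ⟶ G.obj.obj y) (c : Z ⟶ H.obj.obj z) :
    D.mulElt (D.mulElt a b) c ≫ (D.assoc F G H).hom.hom.app ((x ⊗ y) ⊗ z) =
      (α_ X Y Z).hom ≫ D.mulElt a (D.mulElt b c) ≫
        (D.obj F (D.obj G H)).obj.map (α_ x y z).inv := by
  have h1 : D.mulElt (D.mulElt a b) c = ((a ⊗ₘ b) ⊗ₘ c) ≫ D.incl F G x y ▷ H.obj.obj z ≫
      D.incl (D.obj F G) H (x ⊗ y) z := by
    rw [← mulElt_mulElt_id, comp_mulElt, comp_mulElt]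
    simp only [Category.comp_id]
  have h2 : D.mulElt a (D.mulElt b c) = (a ⊗ₘ b ⊗ₘ c) ≫ F.obj.obj x ◁ D.incl G H y z ≫
      D.incl F (D.obj G H) x (y ⊗ z) := by
    rw [mulElt, mulElt, ← id_tensorHom, MonoidalCategory.tensorHom_comp_tensorHom_assoc,
      Category.comp_id]
  rw [h1, h2, Category.assoc, Category.assoc, incl_assoc, associator_naturality_assoc]
  simp only [Category.assoc]

theorem mulElt_left {F : FunL k C C} {Y y : C} (b : Y ⟶ F.obj.obj y) :
    D.mulElt D.unitElt b ≫ (D.left F).hom.hom.app (𝟙_ C ⊗ y) =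
      (λ_ Y).hom ≫ b ≫ F.obj.map (λ_ y).inv := by
  rw [mulElt_eq_left, Category.assoc, Category.assoc, incl_left, leftUnitor_naturality_assoc]

theorem mulElt_right {F : FunL k C C} {X x : C} (a : X ⟶ F.obj.obj x) :
    D.mulElt a D.unitElt ≫ (D.right F).hom.hom.app (x ⊗ 𝟙_ C) =
      (ρ_ X).hom ≫ a ≫ F.obj.map (ρ_ x).inv := by
  rw [mulElt, MonoidalCategory.tensorHom_def, Category.assoc, Category.assoc, incl_right,
    rightUnitor_naturality_assoc]

/-- The universal maps are products of identity elements, so testing on all products of elements is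
no weaker; and products of elements are what the structure maps transform by simple formulas. -/
theorem elt_ext {F G M : FunL k C C} {α β : D.obj F G ⟶ M}
    (h : ∀ {X Y x y : C} (a : X ⟶ F.obj.obj x) (b : Y ⟶ G.obj.obj y),
      D.mulElt a b ≫ α.hom.app (x ⊗ y) = D.mulElt a b ≫ β.hom.app (x ⊗ y)) : α = β :=
  D.hom_ext fun x y => by
    rw [← mulElt_id]
    exact h _ _

theorem elt_ext_triple {F G H M : FunL k C C} {α β : D.obj (D.obj F G) H ⟶ M}
    (h : ∀ {X Y Z x y z : C} (a : X ⟶ F.obj.obj x) (b : Y ⟶ G.obj.obj y) (c : Z ⟶ H.obj.obj z),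
      D.mulElt (D.mulElt a b) c ≫ α.hom.app ((x ⊗ y) ⊗ z) =
        D.mulElt (D.mulElt a b) c ≫ β.hom.app ((x ⊗ y) ⊗ z)) : α = β :=
  D.hom_ext_triple fun x y z => by
    have := h (𝟙 (F.obj.obj x)) (𝟙 (G.obj.obj y)) (𝟙 (H.obj.obj z))
    rwa [mulElt_mulElt_id, Category.assoc, Category.assoc] at this

theorem elt_ext_left {F M : FunL k C C} {α β : D.obj D.unit F ⟶ M}
    (h : ∀ {Y y : C} (b : Y ⟶ F.obj.obj y),
      D.mulElt D.unitElt b ≫ α.hom.app (𝟙_ C ⊗ y) =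
        D.mulElt D.unitElt b ≫ β.hom.app (𝟙_ C ⊗ y)) : α = β :=
  D.hom_ext_unit_left fun x => by
    have := h (𝟙 (F.obj.obj x))
    rwa [mulElt, tensorHom_id, Category.assoc, Category.assoc] at this

theorem elt_ext_right {F M : FunL k C C} {α β : D.obj F D.unit ⟶ M}
    (h : ∀ {X x : C} (a : X ⟶ F.obj.obj x),
      D.mulElt a D.unitElt ≫ α.hom.app (x ⊗ 𝟙_ C) =
        D.mulElt a D.unitElt ≫ β.hom.app (x ⊗ 𝟙_ C)) : α = β :=
  D.hom_ext_unit_right fun x => by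
    have := h (𝟙 (F.obj.obj x))
    rwa [mulElt, id_tensorHom, Category.assoc, Category.assoc] at this

theorem unit_ext {M : FunL k C C} {α β : D.unit ⟶ M}
    (h : D.unitElt ≫ α.hom.app (𝟙_ C) = D.unitElt ≫ β.hom.app (𝟙_ C)) : α = β :=
  FunL.hom_ext <| D.unit_family_ext (L := 𝟭 C) (M := M.obj) (IsCocontLinear.id k)
    (FunL.naturality α) (FunL.naturality β) h

/-! ### The duoidal structure -/

theorem exists_interchange (F G F' G' : FunL k C C) :
    ∃ α : D.obj (comp F G) (comp F' G') ⟶ comp (D.obj F F') (D.obj G G'),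
      ∀ x y, D.incl (comp F G) (comp F' G') x y ≫ α.hom.app (x ⊗ y) =
        compElt (D.incl F F' (G.obj.obj x) (G'.obj.obj y)) (D.incl G G' x y) :=
  D.exists_desc _ fun {x x' y y'} a b => by
    refine Eq.trans ?_ (compElt_map _ _ _).symm
    rw [← incl_natural, ← compElt_map_left, ← incl_natural]
    exact comp_compElt _ _ _

/-- The interchange map between composition and Day convolution. -/
noncomputable def interchange (F G F' G' : FunL k C C) :
    D.obj (comp F G) (comp F' G') ⟶ comp (D.obj F F') (D.obj G G') :=
  (D.exists_interchange F G F' G').choose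

/-- The working form of the interchange map: a product of composites goes to the composite of the
products. With it the duoidal axioms become rearrangements of symbols. -/
theorem mulElt_interchange {F G F' G' : FunL k C C} {X X' y y' x x' : C} (f : X ⟶ F.obj.obj y)
    (g : y ⟶ G.obj.obj x) (f' : X' ⟶ F'.obj.obj y') (g' : y' ⟶ G'.obj.obj x') :
    D.mulElt (compElt f g) (compElt f' g') ≫ (D.interchange F G F' G').hom.app (x ⊗ x') =
      compElt (D.mulElt f f') (D.mulElt g g') := by
  have h1 := (D.exists_interchange F G F' G').choose_spec x x'
  rw [mulElt, Category.assoc]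
  refine (congrArg (fun t => _ ≫ t) h1).trans ?_
  rw [mulElt, mulElt, ← compElt_map_left, Category.assoc, ← incl_natural]
  refine (comp_compElt _ _ _).trans ?_
  refine congrArg (fun t => compElt t _) ?_
  rw [MonoidalCategory.tensorHom_comp_tensorHom_assoc]
  rfl

theorem unit_exists_hom {M : FunL k C C} (e : 𝟙_ C ⟶ M.obj.obj (𝟙_ C)) :
    ∃ α : D.unit ⟶ M, D.unitElt ≫ α.hom.app (𝟙_ C) = e := by
  obtain ⟨α, hα⟩ := D.unit_exists_desc (L := 𝟭 C) (M := M.obj) (IsCocontLinear.id k) M.property e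
  exact ⟨ObjectProperty.homMk ⟨α.app, α.naturality⟩, hα⟩

/-- The comultiplication of the unit for Day convolution. -/
noncomputable def comul : D.unit ⟶ comp D.unit D.unit :=
  (D.unit_exists_hom (compElt D.unitElt D.unitElt)).choose

theorem unitElt_comul :
    D.unitElt ≫ D.comul.hom.app (𝟙_ C) = compElt D.unitElt D.unitElt :=
  (D.unit_exists_hom (compElt D.unitElt D.unitElt)).choose_spec

/-- The map from the unit for Day convolution to the identity functor. -/
noncomputable def unitMap : D.unit ⟶ one k C := (D.unit_exists_hom (idElt (𝟙 _))).choose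

theorem unitElt_unitMap : D.unitElt ≫ D.unitMap.hom.app (𝟙_ C) = idElt (𝟙 _) :=
  (D.unit_exists_hom (idElt (𝟙 _))).choose_spec

theorem exists_mul : ∃ α : D.obj (one k C) (one k C) ⟶ one k C,
    ∀ x y, D.incl (one k C) (one k C) x y ≫ α.hom.app (x ⊗ y) = 𝟙 (x ⊗ y) :=
  D.exists_desc (F := one k C) (G := one k C) (M := one k C) (fun x y => 𝟙 (x ⊗ y))
    fun a b => (Category.comp_id (a ⊗ₘ b)).trans (Category.id_comp (a ⊗ₘ b)).symm

/-- The multiplication of the identity functor with respect to Day convolution. -/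
noncomputable def mul : D.obj (one k C) (one k C) ⟶ one k C := D.exists_mul.choose

theorem mulElt_mul {X Y x y : C} (a : X ⟶ x) (b : Y ⟶ y) :
    D.mulElt (idElt a) (idElt b) ≫ D.mul.hom.app (x ⊗ y) = idElt (a ⊗ₘ b) := by
  rw [mulElt, Category.assoc]
  refine (congrArg (fun t => _ ≫ t) (D.exists_mul.choose_spec x y)).trans ?_
  change ((a ≫ 𝟙 x) ⊗ₘ (b ≫ 𝟙 y)) ≫ 𝟙 _ = (a ⊗ₘ b) ≫ 𝟙 _
  simp

theorem interchange_natural {W W' X X' Y Y' Z Z' : FunL k C C}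
    (a : W ⟶ W') (b : X ⟶ X') (c : Y ⟶ Y') (d : Z ⟶ Z') :
    D.map (hcomp a b) (hcomp c d) ≫ D.interchange W' X' Y' Z' =
      D.interchange W X Y Z ≫ hcomp (D.map a c) (D.map b d) :=
  D.elt_ext fun f g => by
    obtain ⟨y, f, f', rfl⟩ := exists_compElt f
    obtain ⟨z, g, g', rfl⟩ := exists_compElt g
    rw [FunL.comp_app, FunL.comp_app, reassoc_of% mulElt_dayMap, reassoc_of% mulElt_interchange,
      compElt_hcomp, compElt_hcomp, compElt_hcomp, mulElt_interchange, mulElt_dayMap,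
      mulElt_dayMap]

/-- Both sides send a product of three composites to the composite of two triple products. The
associators of `C` produced at the intermediate object cancel through the balancing relation. -/
theorem interchange_assoc (U V W X Y Z : FunL k C C) :
    D.map (D.interchange U V W X) (𝟙 (comp Y Z)) ≫ D.interchange (D.obj U W) (D.obj V X) Y Z ≫
        hcomp (D.assoc U W Y).hom (D.assoc V X Z).hom =
      (D.assoc (comp U V) (comp W X) (comp Y Z)).hom ≫
        D.map (𝟙 (comp U V)) (D.interchange W X Y Z) ≫
        D.interchange U V (D.obj W Y) (D.obj X Z) :=
  D.elt_ext_triple fun f g h => by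
    obtain ⟨y, f, f', rfl⟩ := exists_compElt f
    obtain ⟨z, g, g', rfl⟩ := exists_compElt g
    obtain ⟨t, h, h', rfl⟩ := exists_compElt h
    simp only [FunL.comp_app]
    rw [reassoc_of% mulElt_dayMap, FunL.id_app, Category.comp_id, mulElt_interchange,
      reassoc_of% mulElt_interchange, compElt_hcomp, mulElt_assoc, mulElt_assoc,
      reassoc_of% mulElt_assoc, FunL.naturality_assoc, reassoc_of% mulElt_dayMap, FunL.id_app,
      Category.comp_id, mulElt_interchange, FunL.naturality, reassoc_of% mulElt_interchange,
      compElt_map, comp_compElt, ← Category.assoc, compElt_map_left]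
    simp

theorem interchange_left_unit (X Y : FunL k C C) :
    D.map D.comul (𝟙 (comp X Y)) ≫ D.interchange D.unit D.unit X Y ≫
        hcomp (D.left X).hom (D.left Y).hom = (D.left (comp X Y)).hom :=
  D.elt_ext_left fun f => by
    obtain ⟨y, f, f', rfl⟩ := exists_compElt f
    simp only [FunL.comp_app]
    rw [reassoc_of% mulElt_dayMap, unitElt_comul, FunL.id_app, Category.comp_id,
      reassoc_of% mulElt_interchange, compElt_hcomp, mulElt_left, mulElt_left, mulElt_left,
      compElt_map, comp_compElt, ← Category.assoc, compElt_map_left]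
    simp

theorem interchange_right_unit (X Y : FunL k C C) :
    D.map (𝟙 (comp X Y)) D.comul ≫ D.interchange X Y D.unit D.unit ≫
        hcomp (D.right X).hom (D.right Y).hom = (D.right (comp X Y)).hom :=
  D.elt_ext_right fun f => by
    obtain ⟨y, f, f', rfl⟩ := exists_compElt f
    simp only [FunL.comp_app]
    rw [reassoc_of% mulElt_dayMap, unitElt_comul, FunL.id_app, Category.comp_id,
      reassoc_of% mulElt_interchange, compElt_hcomp, mulElt_right, mulElt_right, mulElt_right,
      compElt_map, comp_compElt, ← Category.assoc, compElt_map_left]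
    simp

theorem mul_assoc : D.map D.mul (𝟙 (one k C)) ≫ D.mul =
    (D.assoc (one k C) (one k C) (one k C)).hom ≫ D.map (𝟙 (one k C)) D.mul ≫ D.mul :=
  D.elt_ext_triple fun f g h => by
    obtain ⟨f, rfl⟩ := exists_idElt f
    obtain ⟨g, rfl⟩ := exists_idElt g
    obtain ⟨h, rfl⟩ := exists_idElt h
    simp only [FunL.comp_app]
    rw [reassoc_of% mulElt_dayMap, mulElt_mul, FunL.id_app, Category.comp_id, mulElt_mul,
      reassoc_of% mulElt_assoc, FunL.naturality_assoc, reassoc_of% mulElt_dayMap, mulElt_mul,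
      FunL.id_app, Category.comp_id, FunL.naturality, reassoc_of% mulElt_mul, idElt_map,
      comp_idElt]
    simp

theorem unit_mul : D.map D.unitMap (𝟙 (one k C)) ≫ D.mul = (D.left (one k C)).hom :=
  D.elt_ext_left fun f => by
    obtain ⟨f, rfl⟩ := exists_idElt f
    rw [FunL.comp_app, reassoc_of% mulElt_dayMap, unitElt_unitMap, FunL.id_app, Category.comp_id,
      mulElt_mul, mulElt_left, idElt_map, comp_idElt]
    simp

theorem mul_unit : D.map (𝟙 (one k C)) D.unitMap ≫ D.mul = (D.right (one k C)).hom :=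
  D.elt_ext_right fun f => by
    obtain ⟨f, rfl⟩ := exists_idElt f
    rw [FunL.comp_app, reassoc_of% mulElt_dayMap, unitElt_unitMap, FunL.id_app, Category.comp_id,
      mulElt_mul, mulElt_right, idElt_map, comp_idElt]
    simp

/-- A product of two threefold composites goes to the composite of three products under either side.
-/
theorem associator_interchange (U V W X Y Z : FunL k C C) :
    D.interchange (comp U V) W (comp X Y) Z ≫
        (compMonoidal k C).whiskerRight (D.interchange U V X Y) (D.obj W Z) ≫
        ((compMonoidal k C).associator (D.obj U X) (D.obj V Y) (D.obj W Z)).hom =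
      D.map ((compMonoidal k C).associator U V W).hom ((compMonoidal k C).associator X Y Z).hom ≫
        D.interchange U (comp V W) X (comp Y Z) ≫
        (compMonoidal k C).whiskerLeft (D.obj U X) (D.interchange V W Y Z) :=
  D.elt_ext fun f g => by
    obtain ⟨y, f, f', rfl⟩ := exists_compElt f
    obtain ⟨z, f, f'', rfl⟩ := exists_compElt f
    obtain ⟨y, g, g', rfl⟩ := exists_compElt g
    obtain ⟨z, g, g'', rfl⟩ := exists_compElt g
    simp only [FunL.comp_app]
    rw [reassoc_of% mulElt_interchange, reassoc_of% compElt_whiskerRight, mulElt_interchange,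
      compElt_associator, reassoc_of% mulElt_dayMap, compElt_associator, compElt_associator,
      reassoc_of% mulElt_interchange, compElt_whiskerLeft, mulElt_interchange]

theorem leftUnitor_interchange (X Y : FunL k C C) :
    D.interchange (one k C) X (one k C) Y ≫ (compMonoidal k C).whiskerRight D.mul (D.obj X Y) ≫
        ((compMonoidal k C).leftUnitor (D.obj X Y)).hom =
      D.map ((compMonoidal k C).leftUnitor X).hom ((compMonoidal k C).leftUnitor Y).hom :=
  D.elt_ext fun f g => by
    obtain ⟨y, f, f', rfl⟩ := exists_compElt f
    obtain ⟨f, rfl⟩ := exists_idElt f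
    obtain ⟨y, g, g', rfl⟩ := exists_compElt g
    obtain ⟨g, rfl⟩ := exists_idElt g
    simp only [FunL.comp_app]
    rw [reassoc_of% mulElt_interchange, reassoc_of% compElt_whiskerRight, mulElt_mul,
      compElt_leftUnitor, mulElt_dayMap, compElt_leftUnitor, compElt_leftUnitor, comp_mulElt]

theorem rightUnitor_interchange (X Y : FunL k C C) :
    D.interchange X (one k C) Y (one k C) ≫ (compMonoidal k C).whiskerLeft (D.obj X Y) D.mul ≫
        ((compMonoidal k C).rightUnitor (D.obj X Y)).hom =
      D.map ((compMonoidal k C).rightUnitor X).hom ((compMonoidal k C).rightUnitor Y).hom :=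
  D.elt_ext fun f g => by
    obtain ⟨y, f, f', rfl⟩ := exists_compElt f
    obtain ⟨f', rfl⟩ := exists_idElt f'
    obtain ⟨y, g, g', rfl⟩ := exists_compElt g
    obtain ⟨g', rfl⟩ := exists_idElt g'
    simp only [FunL.comp_app]
    rw [reassoc_of% mulElt_interchange, reassoc_of% compElt_whiskerLeft, mulElt_mul,
      compElt_rightUnitor, mulElt_dayMap, compElt_rightUnitor, compElt_rightUnitor, mulElt_map]

theorem comul_assoc :
    D.comul ≫ (compMonoidal k C).whiskerRight D.comul D.unit ≫
      ((compMonoidal k C).associator D.unit D.unit D.unit).hom =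
    D.comul ≫ (compMonoidal k C).whiskerLeft D.unit D.comul :=
  D.unit_ext <| by
    simp only [FunL.comp_app]
    rw [reassoc_of% unitElt_comul, reassoc_of% compElt_whiskerRight, unitElt_comul,
      compElt_associator, reassoc_of% unitElt_comul, compElt_whiskerLeft, unitElt_comul]

theorem comul_unitMap_left : D.comul ≫ (compMonoidal k C).whiskerRight D.unitMap D.unit ≫
    ((compMonoidal k C).leftUnitor D.unit).hom = 𝟙 _ :=
  D.unit_ext <| by
    simp only [FunL.comp_app]
    rw [reassoc_of% unitElt_comul, reassoc_of% compElt_whiskerRight, unitElt_unitMap,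
      compElt_leftUnitor, FunL.id_app, Category.id_comp, Category.comp_id]

theorem comul_unitMap_right : D.comul ≫ (compMonoidal k C).whiskerLeft D.unit D.unitMap ≫
    ((compMonoidal k C).rightUnitor D.unit).hom = 𝟙 _ :=
  D.unit_ext <| by
    simp only [FunL.comp_app]
    rw [reassoc_of% unitElt_comul, reassoc_of% compElt_whiskerLeft, unitElt_unitMap,
      compElt_rightUnitor, FunL.id_app, CategoryTheory.Functor.map_id]

/-- Composition and Day convolution make the category of endofunctors duoidal. -/
noncomputable def duoidal : Duoidal (compMonoidal k C) D.monoidal where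
  interchange := D.interchange
  comul := D.comul
  mul := D.mul
  unitMap := D.unitMap
  interchange_natural := D.interchange_natural
  interchange_assoc := D.interchange_assoc
  interchange_left_unit := D.interchange_left_unit
  interchange_right_unit := D.interchange_right_unit
  mul_assoc := D.mul_assoc
  unit_mul := D.unit_mul
  mul_unit := D.mul_unit
  associator_interchange := D.associator_interchange
  leftUnitor_interchange := D.leftUnitor_interchange
  rightUnitor_interchange := D.rightUnitor_interchange
  comul_assoc := D.comul_assoc
  comul_unitMap_left := D.comul_unitMap_left
  comul_unitMap_right := D.comul_unitMap_right

/-- The duoidal category of endofunctors. -/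
noncomputable def funDuoidal : FunDuoidal k C where
  day := D.dayProduct
  duoidal := D.duoidal
  interchange_app F G F' G' x y := (D.exists_interchange F G F' G').choose_spec x y
  comul_app := D.unitElt_comul
  mul_app := D.exists_mul.choose_spec
  unitMap_app := D.unitElt_unitMap.trans (Category.comp_id (𝟙 (𝟙_ C)))

end DayData

end FunDuoidal

end PrL

namespace PrL

/-! ### Transport of monoidal structures along an equivalence -/

section Transport

/-- A monoidal structure on the source of a functor, for which the functor is strong monoidal. -/
structure MonoidalLift {T : Type u} [Category.{v} T] {D : Type u'} [Category.{v'} D]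
    (Φ : T ⥤ D) (m : MonoidalCategory D) where
  source : MonoidalCategory T
  functor : @Functor.Monoidal T _ source D _ m Φ

/-- Products in `T` are `e.functor` of products of images under `e.inverse`, and the unit
isomorphism of `e` supplies the structure isomorphisms. The structure `m` is an explicit argument
because the category of endofunctors carries two. -/
theorem exists_monoidalLift_inverse {T : Type u} [Category.{v} T] {D : Type u'} [Category.{v'} D]
    (m : MonoidalCategory D) (e : D ≌ T) : Nonempty (MonoidalLift e.inverse m) := by
  let _ : MonoidalCategoryStruct T := Monoidal.transportStruct e
  let fData : Monoidal.InducingFunctorData e.inverse :=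
    { μIso := fun _ _ => e.unitIso.app _
      εIso := e.unitIso.app _
      whiskerLeft_eq := by simp +zetaDelta +instances [Monoidal.transportStruct]
      whiskerRight_eq := by simp +zetaDelta +instances [Monoidal.transportStruct]
      tensorHom_eq := by simp +zetaDelta +instances [Monoidal.transportStruct]
      associator_eq := by simp +zetaDelta +instances [Monoidal.transportStruct]
      leftUnitor_eq := by simp +zetaDelta +instances [Monoidal.transportStruct]
      rightUnitor_eq := by simp +zetaDelta +instances [Monoidal.transportStruct] }
  exact ⟨⟨Monoidal.induced e.inverse fData, Monoidal.fromInducedMonoidal e.inverse fData⟩⟩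

theorem exists_monoidalLift {T : Type u} [Category.{v} T] {D : Type u'} [Category.{v'} D]
    (Φ : T ⥤ D) [Φ.IsEquivalence] (m : MonoidalCategory D) : Nonempty (MonoidalLift Φ m) :=
  exists_monoidalLift_inverse m Φ.asEquivalence.symm

variable {k : Type w} [Field k]
variable {C : Type (w + 1)} [Category.{w} C] [Preadditive C] [Linear k C]
variable {T : Type (w + 1)} [Category.{w} T] {Φ : T ⥤ FunL k C C}

open FunL

/-! ### Generalized elements of convolution products -/

namespace MonoidalLift

section Conv

variable (S : MonoidalLift Φ (compMonoidal k C))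

/-- The convolution product of generalized elements. -/
def convElt {t s : T} {X y x : C} (f : X ⟶ (Φ.obj t).obj.obj y) (g : y ⟶ (Φ.obj s).obj.obj x) :
    X ⟶ (Φ.obj (S.source.tensorObj t s)).obj.obj x :=
  compElt f g ≫ (S.functor.μ t s).hom.app x

/-- The generalized elements of the unit for convolution. -/
def oneElt {X x : C} (f : X ⟶ x) : X ⟶ (Φ.obj S.source.tensorUnit).obj.obj x :=
  idElt f ≫ S.functor.ε.hom.app x

theorem isIso_μ_app (t s : T) (x : C) : IsIso ((S.functor.μ t s).hom.app x) := by
  let _ := compMonoidal k C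
  let _ := S.source
  let _ := S.functor
  exact ((ObjectProperty.ι _).mapIso (Functor.Monoidal.μIso Φ t s)).app x |>.isIso_hom

theorem isIso_ε_app (x : C) : IsIso (S.functor.ε.hom.app x) := by
  let _ := compMonoidal k C
  let _ := S.source
  let _ := S.functor
  exact ((ObjectProperty.ι _).mapIso (Functor.Monoidal.εIso Φ)).app x |>.isIso_hom

/-- The structure map of `Φ` is invertible at every object, so elements of a convolution are again
composites of elements. -/
theorem exists_convElt {t s : T} {X x : C}
    (a : X ⟶ (Φ.obj (S.source.tensorObj t s)).obj.obj x) :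
    ∃ (y : C) (f : X ⟶ (Φ.obj t).obj.obj y) (g : y ⟶ (Φ.obj s).obj.obj x),
      a = S.convElt f g := by
  have := S.isIso_μ_app t s x
  obtain ⟨y, f, g, hfg⟩ := exists_compElt (F := Φ.obj t) (G := Φ.obj s)
    (a ≫ inv ((S.functor.μ t s).hom.app x))
  exact ⟨y, f, g, by rw [convElt, ← hfg, Category.assoc, IsIso.inv_hom_id, Category.comp_id]⟩

theorem exists_oneElt {X x : C} (a : X ⟶ (Φ.obj S.source.tensorUnit).obj.obj x) :
    ∃ f : X ⟶ x, a = S.oneElt f := by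
  have := S.isIso_ε_app x
  obtain ⟨f, hf⟩ := exists_idElt (k := k) (a ≫ inv (S.functor.ε.hom.app x))
  exact ⟨f, by rw [oneElt, ← hf, Category.assoc, IsIso.inv_hom_id, Category.comp_id]⟩

theorem comp_convElt {t s : T} {W X y x : C} (r : W ⟶ X) (f : X ⟶ (Φ.obj t).obj.obj y)
    (g : y ⟶ (Φ.obj s).obj.obj x) : r ≫ S.convElt f g = S.convElt (r ≫ f) g := by
  rw [convElt, convElt, ← comp_compElt, Category.assoc]

theorem convElt_map_left {t s : T} {X y y' x : C} (f : X ⟶ (Φ.obj t).obj.obj y) (r : y ⟶ y')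
    (g : y' ⟶ (Φ.obj s).obj.obj x) :
    S.convElt (f ≫ (Φ.obj t).obj.map r) g = S.convElt f (r ≫ g) := by
  rw [convElt, convElt, compElt_map_left]

theorem convElt_map {t s : T} {X y x x' : C} (f : X ⟶ (Φ.obj t).obj.obj y)
    (g : y ⟶ (Φ.obj s).obj.obj x) (r : x ⟶ x') :
    S.convElt f g ≫ (Φ.obj (S.source.tensorObj t s)).obj.map r =
      S.convElt f (g ≫ (Φ.obj s).obj.map r) := by
  rw [convElt, convElt, ← compElt_map, Category.assoc, Category.assoc]
  exact congrArg (fun t => _ ≫ t) ((S.functor.μ t s).hom.naturality r).symm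

theorem convElt_tensorHom {t t' s s' : T} {X y x : C} (f : X ⟶ (Φ.obj t).obj.obj y)
    (g : y ⟶ (Φ.obj s).obj.obj x) (α : t ⟶ t') (β : s ⟶ s') :
    S.convElt f g ≫ (Φ.map (S.source.tensorHom α β)).hom.app x =
      S.convElt (f ≫ (Φ.map α).hom.app y) (g ≫ (Φ.map β).hom.app x) := by
  let _ := compMonoidal k C
  let _ := S.source
  let _ := S.functor
  have h := congrArg (fun α => α.hom.app x) (Functor.LaxMonoidal.μ_natural Φ α β)
  rw [convElt, convElt, ← compElt_hcomp, Category.assoc, Category.assoc]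
  exact congrArg (fun r => _ ≫ r) h.symm

theorem convElt_whiskerRight {t t' s : T} {X y x : C} (f : X ⟶ (Φ.obj t).obj.obj y)
    (g : y ⟶ (Φ.obj s).obj.obj x) (α : t ⟶ t') :
    S.convElt f g ≫ (Φ.map (S.source.whiskerRight α s)).hom.app x =
      S.convElt (f ≫ (Φ.map α).hom.app y) g := by
  let _ := S.source
  have : S.source.whiskerRight α s = S.source.tensorHom α (𝟙 s) := (tensorHom_id α s).symm
  rw [this, convElt_tensorHom, Φ.map_id]
  exact congrArg (S.convElt _) (Category.comp_id g)

theorem convElt_whiskerLeft {t s s' : T} {X y x : C} (f : X ⟶ (Φ.obj t).obj.obj y)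
    (g : y ⟶ (Φ.obj s).obj.obj x) (β : s ⟶ s') :
    S.convElt f g ≫ (Φ.map (S.source.whiskerLeft t β)).hom.app x =
      S.convElt f (g ≫ (Φ.map β).hom.app x) := by
  let _ := S.source
  have : S.source.whiskerLeft t β = S.source.tensorHom (𝟙 t) β := (id_tensorHom t β).symm
  rw [this, convElt_tensorHom, Φ.map_id]
  exact congrArg (fun r => S.convElt r _) (Category.comp_id f)

theorem convElt_associator {t s r : T} {X y z x : C} (f : X ⟶ (Φ.obj t).obj.obj y)
    (g : y ⟶ (Φ.obj s).obj.obj z) (h : z ⟶ (Φ.obj r).obj.obj x) :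
    S.convElt (S.convElt f g) h ≫ (Φ.map (S.source.associator t s r).hom).hom.app x =
      S.convElt f (S.convElt g h) := by
  let _ := compMonoidal k C
  let _ := S.source
  let _ := S.functor
  have h1 := congrArg (fun α => α.hom.app x) (Functor.LaxMonoidal.associativity Φ t s r)
  simp only [convElt]
  rw [← compElt_whiskerRight, ← compElt_whiskerLeft, ← compElt_associator]
  simp only [Category.assoc]
  exact congrArg (fun r => _ ≫ r) h1

theorem comp_oneElt {W X x : C} (t : W ⟶ X) (f : X ⟶ x) :
    t ≫ S.oneElt f = S.oneElt (t ≫ f) := by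
  rw [oneElt, oneElt, ← comp_idElt, Category.assoc]

theorem oneElt_map {X x y : C} (f : X ⟶ x) (t : x ⟶ y) :
    S.oneElt f ≫ (Φ.obj S.source.tensorUnit).obj.map t = S.oneElt (f ≫ t) := by
  rw [oneElt, oneElt, ← idElt_map, Category.assoc, Category.assoc]
  exact congrArg (fun r => _ ≫ r) (S.functor.ε.hom.naturality t).symm

theorem convElt_leftUnitor {t : T} {X y x : C} (f : X ⟶ y) (g : y ⟶ (Φ.obj t).obj.obj x) :
    S.convElt (S.oneElt f) g ≫ (Φ.map (S.source.leftUnitor t).hom).hom.app x = f ≫ g := by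
  let _ := compMonoidal k C
  let _ := S.source
  let _ := S.functor
  have h1 := congrArg (fun α => α.hom.app x) (Functor.LaxMonoidal.left_unitality Φ t)
  rw [← compElt_leftUnitor f g]
  simp only [convElt, oneElt]
  rw [← compElt_whiskerRight]
  simp only [Category.assoc]
  exact congrArg (fun r => _ ≫ r) h1.symm

theorem convElt_rightUnitor {t : T} {X y x : C} (f : X ⟶ (Φ.obj t).obj.obj y) (g : y ⟶ x) :
    S.convElt f (S.oneElt g) ≫ (Φ.map (S.source.rightUnitor t).hom).hom.app x =
      f ≫ (Φ.obj t).obj.map g := by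
  let _ := compMonoidal k C
  let _ := S.source
  let _ := S.functor
  have h1 := congrArg (fun α => α.hom.app x) (Functor.LaxMonoidal.right_unitality Φ t)
  rw [← compElt_rightUnitor f g]
  simp only [convElt, oneElt]
  rw [← compElt_whiskerLeft]
  simp only [Category.assoc]
  exact congrArg (fun r => _ ≫ r) h1.symm

end Conv

/-! ### Generalized elements of pointwise products -/

section Day

variable [MonoidalCategory C] [CocontMonoidal k C] {D : DayData k C}
  (S : MonoidalLift Φ D.monoidal)

/-- The pointwise product of generalized elements. -/
noncomputable def mulElt {t s : T} {X Y x y : C} (a : X ⟶ (Φ.obj t).obj.obj x)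
    (b : Y ⟶ (Φ.obj s).obj.obj y) :
    X ⊗ Y ⟶ (Φ.obj (S.source.tensorObj t s)).obj.obj (x ⊗ y) :=
  D.mulElt a b ≫ (S.functor.μ t s).hom.app (x ⊗ y)

/-- The generic generalized element of the unit for the pointwise product. -/
noncomputable def unitElt : 𝟙_ C ⟶ (Φ.obj S.source.tensorUnit).obj.obj (𝟙_ C) :=
  D.unitElt ≫ S.functor.ε.hom.app (𝟙_ C)

theorem isIso_day_μ (t s : T) : IsIso (S.functor.μ t s) := by
  let _ := D.monoidal
  let _ := S.source
  let _ := S.functor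
  exact (Functor.Monoidal.μIso Φ t s).isIso_hom

theorem isIso_day_ε : IsIso S.functor.ε := by
  let _ := D.monoidal
  let _ := S.source
  let _ := S.functor
  exact (Functor.Monoidal.εIso Φ).isIso_hom

theorem comp_mulElt {t s : T} {X X' Y Y' x y : C} (r : X' ⟶ X) (r' : Y' ⟶ Y)
    (a : X ⟶ (Φ.obj t).obj.obj x) (b : Y ⟶ (Φ.obj s).obj.obj y) :
    (r ⊗ₘ r') ≫ S.mulElt a b = S.mulElt (r ≫ a) (r' ≫ b) := by
  rw [mulElt, mulElt, ← D.comp_mulElt, Category.assoc]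

theorem mulElt_map {t s : T} {X Y x x' y y' : C} (a : X ⟶ (Φ.obj t).obj.obj x)
    (b : Y ⟶ (Φ.obj s).obj.obj y) (r : x ⟶ x') (r' : y ⟶ y') :
    S.mulElt (a ≫ (Φ.obj t).obj.map r) (b ≫ (Φ.obj s).obj.map r') =
      S.mulElt a b ≫ (Φ.obj (S.source.tensorObj t s)).obj.map (r ⊗ₘ r') := by
  rw [mulElt, mulElt, D.mulElt_map, Category.assoc, Category.assoc]
  exact congrArg (fun r => _ ≫ r) (FunL.naturality (S.functor.μ t s) _)

theorem mulElt_tensorHom {t t' s s' : T} {X Y x y : C} (a : X ⟶ (Φ.obj t).obj.obj x)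
    (b : Y ⟶ (Φ.obj s).obj.obj y) (α : t ⟶ t') (β : s ⟶ s') :
    S.mulElt a b ≫ (Φ.map (S.source.tensorHom α β)).hom.app (x ⊗ y) =
      S.mulElt (a ≫ (Φ.map α).hom.app x) (b ≫ (Φ.map β).hom.app y) := by
  let _ := D.monoidal
  let _ := S.source
  let _ := S.functor
  have h := congrArg (fun α => α.hom.app (x ⊗ y)) (Functor.LaxMonoidal.μ_natural Φ α β)
  rw [mulElt, mulElt, ← D.mulElt_dayMap, Category.assoc, Category.assoc]
  exact congrArg (fun r => _ ≫ r) h.symm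

theorem mulElt_whiskerRight {t t' s : T} {X Y x y : C} (a : X ⟶ (Φ.obj t).obj.obj x)
    (b : Y ⟶ (Φ.obj s).obj.obj y) (α : t ⟶ t') :
    S.mulElt a b ≫ (Φ.map (S.source.whiskerRight α s)).hom.app (x ⊗ y) =
      S.mulElt (a ≫ (Φ.map α).hom.app x) b := by
  let _ := S.source
  have : S.source.whiskerRight α s = S.source.tensorHom α (𝟙 s) := (tensorHom_id α s).symm
  rw [this, mulElt_tensorHom, Φ.map_id, FunL.id_app, Category.comp_id]

theorem mulElt_whiskerLeft {t s s' : T} {X Y x y : C} (a : X ⟶ (Φ.obj t).obj.obj x)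
    (b : Y ⟶ (Φ.obj s).obj.obj y) (β : s ⟶ s') :
    S.mulElt a b ≫ (Φ.map (S.source.whiskerLeft t β)).hom.app (x ⊗ y) =
      S.mulElt a (b ≫ (Φ.map β).hom.app y) := by
  let _ := S.source
  have : S.source.whiskerLeft t β = S.source.tensorHom (𝟙 t) β := (id_tensorHom t β).symm
  rw [this, mulElt_tensorHom, Φ.map_id, FunL.id_app, Category.comp_id]

/-- Associativity of the monoidal functor reduces the claim to the same formula for Day convolution;
the index associator passes the structure maps by naturality. -/
theorem mulElt_associator {t s r : T} {X Y Z x y z : C} (a : X ⟶ (Φ.obj t).obj.obj x)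
    (b : Y ⟶ (Φ.obj s).obj.obj y) (c : Z ⟶ (Φ.obj r).obj.obj z) :
    S.mulElt (S.mulElt a b) c ≫ (Φ.map (S.source.associator t s r).hom).hom.app ((x ⊗ y) ⊗ z) =
      (α_ X Y Z).hom ≫ S.mulElt a (S.mulElt b c) ≫
        (Φ.obj (S.source.tensorObj t (S.source.tensorObj s r))).obj.map (α_ x y z).inv := by
  let _ := D.monoidal
  let _ := S.source
  let _ := S.functor
  have h1 := congrArg (fun α => α.hom.app ((x ⊗ y) ⊗ z)) (Functor.LaxMonoidal.associativity Φ t s r)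
  have h2 : D.mulElt (S.mulElt a b) c = D.mulElt (D.mulElt a b) c ≫
      (D.map (S.functor.μ t s) (𝟙 (Φ.obj r))).hom.app _ := by
    rw [D.mulElt_dayMap, FunL.id_app, Category.comp_id]
    rfl
  have h3 : D.mulElt a (S.mulElt b c) = D.mulElt a (D.mulElt b c) ≫
      (D.map (𝟙 (Φ.obj t)) (S.functor.μ s r)).hom.app _ := by
    rw [D.mulElt_dayMap, FunL.id_app, Category.comp_id]
    rfl
  rw [mulElt, h2, mulElt, h3]
  simp only [Category.assoc]
  refine (congrArg (fun r => D.mulElt (D.mulElt a b) c ≫ r) h1).trans ?_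
  refine ((reassoc_of% D.mulElt_assoc a b c) _).trans ?_
  refine congrArg (fun r => _ ≫ _ ≫ r) ?_
  exact FunL.naturality (D.map (𝟙 (Φ.obj t)) (S.functor.μ s r) ≫
    S.functor.μ t (S.source.tensorObj s r)) (α_ x y z).inv |>.trans
    (Category.assoc _ _ _)

theorem mulElt_leftUnitor {t : T} {Y y : C} (b : Y ⟶ (Φ.obj t).obj.obj y) :
    S.mulElt S.unitElt b ≫ (Φ.map (S.source.leftUnitor t).hom).hom.app (𝟙_ C ⊗ y) =
      (λ_ Y).hom ≫ b ≫ (Φ.obj t).obj.map (λ_ y).inv := by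
  let _ := D.monoidal
  let _ := S.source
  let _ := S.functor
  have h1 := congrArg (fun α => α.hom.app (𝟙_ C ⊗ y)) (Functor.LaxMonoidal.left_unitality Φ t)
  have h2 : D.mulElt S.unitElt b = D.mulElt D.unitElt b ≫
      (D.map S.functor.ε (𝟙 (Φ.obj t))).hom.app _ := by
    rw [D.mulElt_dayMap, FunL.id_app, Category.comp_id]
    rfl
  rw [← D.mulElt_left, mulElt, h2]
  simp only [Category.assoc]
  exact congrArg (fun r => _ ≫ r) h1.symm

theorem mulElt_rightUnitor {t : T} {X x : C} (a : X ⟶ (Φ.obj t).obj.obj x) :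
    S.mulElt a S.unitElt ≫ (Φ.map (S.source.rightUnitor t).hom).hom.app (x ⊗ 𝟙_ C) =
      (ρ_ X).hom ≫ a ≫ (Φ.obj t).obj.map (ρ_ x).inv := by
  let _ := D.monoidal
  let _ := S.source
  let _ := S.functor
  have h1 := congrArg (fun α => α.hom.app (x ⊗ 𝟙_ C)) (Functor.LaxMonoidal.right_unitality Φ t)
  have h2 : D.mulElt a S.unitElt = D.mulElt a D.unitElt ≫
      (D.map (𝟙 (Φ.obj t)) S.functor.ε).hom.app _ := by
    rw [D.mulElt_dayMap, FunL.id_app, Category.comp_id]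
    rfl
  rw [← D.mulElt_right, mulElt, h2]
  simp only [Category.assoc]
  exact congrArg (fun r => _ ≫ r) h1.symm

theorem day_ext {t s : T} {M : FunL k C C} {α β : Φ.obj (S.source.tensorObj t s) ⟶ M}
    (h : ∀ {X Y x y : C} (a : X ⟶ (Φ.obj t).obj.obj x) (b : Y ⟶ (Φ.obj s).obj.obj y),
      S.mulElt a b ≫ α.hom.app (x ⊗ y) = S.mulElt a b ≫ β.hom.app (x ⊗ y)) : α = β := by
  have := S.isIso_day_μ t s
  refine (cancel_epi (S.functor.μ t s)).1 (D.elt_ext fun a b => ?_)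
  rw [FunL.comp_app, FunL.comp_app, ← Category.assoc, ← Category.assoc]
  exact h a b

variable [Φ.Faithful]

theorem elt_ext {t s r : T} {α β : S.source.tensorObj t s ⟶ r}
    (h : ∀ {X Y x y : C} (a : X ⟶ (Φ.obj t).obj.obj x) (b : Y ⟶ (Φ.obj s).obj.obj y),
      S.mulElt a b ≫ (Φ.map α).hom.app (x ⊗ y) = S.mulElt a b ≫ (Φ.map β).hom.app (x ⊗ y)) :
    α = β :=
  Φ.map_injective (S.day_ext h)

theorem elt_ext_triple {t s r q : T} {α β : S.source.tensorObj (S.source.tensorObj t s) r ⟶ q}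
    (h : ∀ {X Y Z x y z : C} (a : X ⟶ (Φ.obj t).obj.obj x) (b : Y ⟶ (Φ.obj s).obj.obj y)
      (c : Z ⟶ (Φ.obj r).obj.obj z),
      S.mulElt (S.mulElt a b) c ≫ (Φ.map α).hom.app ((x ⊗ y) ⊗ z) =
        S.mulElt (S.mulElt a b) c ≫ (Φ.map β).hom.app ((x ⊗ y) ⊗ z)) : α = β := by
  refine Φ.map_injective ?_
  have h1 := S.isIso_day_μ (S.source.tensorObj t s) r
  have h2 := S.isIso_day_μ t s
  have h3 : IsIso (D.map (S.functor.μ t s) (𝟙 (Φ.obj r))) := by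
    let _ := D.monoidal
    exact inferInstanceAs (IsIso ((S.functor.μ t s) ⊗ₘ (𝟙 (Φ.obj r))))
  refine (cancel_epi (D.map (S.functor.μ t s) (𝟙 (Φ.obj r)) ≫ S.functor.μ _ _)).1
    (D.elt_ext_triple fun a b c => ?_)
  have h4 : D.mulElt (D.mulElt a b) c ≫
      (D.map (S.functor.μ t s) (𝟙 (Φ.obj r)) ≫ S.functor.μ _ _).hom.app _ =
      S.mulElt (S.mulElt a b) c := by
    rw [FunL.comp_app, reassoc_of% D.mulElt_dayMap, FunL.id_app, Category.comp_id]
    rfl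
  rw [FunL.comp_app _ (Φ.map α), FunL.comp_app _ (Φ.map β), reassoc_of% h4, reassoc_of% h4]
  exact h a b c

/-- Precomposing with the inverse left unitor removes the unit factor, and multiplying the identity
element by the generic unit element recovers the resulting component. -/
theorem elt_ext_left {t s : T} {α β : S.source.tensorObj S.source.tensorUnit t ⟶ s}
    (h : ∀ {Y y : C} (b : Y ⟶ (Φ.obj t).obj.obj y),
      S.mulElt S.unitElt b ≫ (Φ.map α).hom.app (𝟙_ C ⊗ y) =
        S.mulElt S.unitElt b ≫ (Φ.map β).hom.app (𝟙_ C ⊗ y)) : α = β := by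
  let _ := S.source
  have key : (λ_ t).inv ≫ α = (λ_ t).inv ≫ β := Φ.map_injective <| FunL.hom_ext fun y => by
    have h1 := h (𝟙 ((Φ.obj t).obj.obj y))
    have h2 (γ : 𝟙_ T ⊗ t ⟶ s) : S.mulElt S.unitElt (𝟙 ((Φ.obj t).obj.obj y)) ≫
        (Φ.map γ).hom.app (𝟙_ C ⊗ y) =
        (λ_ _).hom ≫ (Φ.map ((λ_ t).inv ≫ γ)).hom.app y ≫ (Φ.obj s).obj.map (λ_ y).inv := by
      have h3 : γ = (λ_ t).hom ≫ (λ_ t).inv ≫ γ := by simp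
      conv_lhs => rw [h3, Φ.map_comp, FunL.comp_app]
      refine ((reassoc_of% S.mulElt_leftUnitor (𝟙 ((Φ.obj t).obj.obj y))) _).trans ?_
      rw [FunL.naturality]
    have h3 := (h2 α).symm.trans (h1.trans (h2 β))
    have h4 := congrArg (fun r => (λ_ _).inv ≫ r ≫ (Φ.obj s).obj.map (λ_ y).hom) h3
    simpa [← Functor.map_comp] using h4
  exact (cancel_epi _).1 key

theorem elt_ext_right {t s : T} {α β : S.source.tensorObj t S.source.tensorUnit ⟶ s}
    (h : ∀ {X x : C} (a : X ⟶ (Φ.obj t).obj.obj x),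
      S.mulElt a S.unitElt ≫ (Φ.map α).hom.app (x ⊗ 𝟙_ C) =
        S.mulElt a S.unitElt ≫ (Φ.map β).hom.app (x ⊗ 𝟙_ C)) : α = β := by
  let _ := S.source
  have key : (ρ_ t).inv ≫ α = (ρ_ t).inv ≫ β := Φ.map_injective <| FunL.hom_ext fun y => by
    have h1 := h (𝟙 ((Φ.obj t).obj.obj y))
    have h2 (γ : t ⊗ 𝟙_ T ⟶ s) : S.mulElt (𝟙 ((Φ.obj t).obj.obj y)) S.unitElt ≫
        (Φ.map γ).hom.app (y ⊗ 𝟙_ C) =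
        (ρ_ _).hom ≫ (Φ.map ((ρ_ t).inv ≫ γ)).hom.app y ≫ (Φ.obj s).obj.map (ρ_ y).inv := by
      have h3 : γ = (ρ_ t).hom ≫ (ρ_ t).inv ≫ γ := by simp
      conv_lhs => rw [h3, Φ.map_comp, FunL.comp_app]
      refine ((reassoc_of% S.mulElt_rightUnitor (𝟙 ((Φ.obj t).obj.obj y))) _).trans ?_
      rw [FunL.naturality]
    have h3 := (h2 α).symm.trans (h1.trans (h2 β))
    have h4 := congrArg (fun r => (ρ_ _).inv ≫ r ≫ (Φ.obj s).obj.map (ρ_ y).hom) h3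
    simpa [← Functor.map_comp] using h4
  exact (cancel_epi _).1 key

theorem unit_ext {s : T} {α β : S.source.tensorUnit ⟶ s}
    (h : S.unitElt ≫ (Φ.map α).hom.app (𝟙_ C) = S.unitElt ≫ (Φ.map β).hom.app (𝟙_ C)) : α = β := by
  have := S.isIso_day_ε
  refine Φ.map_injective ((cancel_epi S.functor.ε).1 (D.unit_ext ?_))
  rw [FunL.comp_app, FunL.comp_app, ← Category.assoc, ← Category.assoc]
  exact h

end Day

end MonoidalLift

end Transport

end PrL

namespace PrL

/-! ### Transport of the duoidal structure -/

section DuoidalLift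

variable {k : Type w} [Field k]
variable {C : Type (w + 1)} [Category.{w} C] [Preadditive C] [Linear k C]
variable [MonoidalCategory C] [CocontMonoidal k C]
variable {T : Type (w + 1)} [Category.{w} T] {Φ : T ⥤ FunL k C C}

open FunL

/-- Monoidal structures on the source of a functor to the duoidal category of endofunctors. -/
structure DuoidalLift (Φ : T ⥤ FunL k C C) (D : DayData k C) where
  conv : MonoidalLift Φ (compMonoidal k C)
  ptw : MonoidalLift Φ D.monoidal

namespace DuoidalLift

variable {D : DayData k C} (S : DuoidalLift Φ D)

theorem isIso_dayMap {F F' G G' : FunL k C C} (α : F ⟶ F') (β : G ⟶ G') [IsIso α] [IsIso β] :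
    IsIso (D.map α β) := by
  let _ := D.monoidal
  exact inferInstanceAs (IsIso (α ⊗ₘ β))

theorem isIso_convμ (t s : T) : IsIso (S.conv.functor.μ t s) := by
  let _ := compMonoidal k C
  let _ := S.conv.source
  let _ := S.conv.functor
  exact (Functor.Monoidal.μIso Φ t s).isIso_hom

theorem isIso_convε : IsIso S.conv.functor.ε := by
  let _ := compMonoidal k C
  let _ := S.conv.source
  let _ := S.conv.functor
  exact (Functor.Monoidal.εIso Φ).isIso_hom

variable [Φ.Full] [Φ.Faithful]

/-- The defining equation is the compatibility required of a duoidal functor. All other maps in it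
are invertible and `Φ` is full, so it can be solved. -/
theorem exists_interchange (W X Y Z : T) :
    ∃ i : S.ptw.source.tensorObj (S.conv.source.tensorObj W X) (S.conv.source.tensorObj Y Z) ⟶
        S.conv.source.tensorObj (S.ptw.source.tensorObj W Y) (S.ptw.source.tensorObj X Z),
      D.map (S.conv.functor.μ W X) (S.conv.functor.μ Y Z) ≫ S.ptw.functor.μ _ _ ≫ Φ.map i =
        D.interchange (Φ.obj W) (Φ.obj X) (Φ.obj Y) (Φ.obj Z) ≫
          hcomp (S.ptw.functor.μ W Y) (S.ptw.functor.μ X Z) ≫ S.conv.functor.μ _ _ := by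
  have h1 := S.isIso_convμ W X
  have h2 := S.isIso_convμ Y Z
  have h3 := isIso_dayMap (D := D) (S.conv.functor.μ W X) (S.conv.functor.μ Y Z)
  have h4 := S.ptw.isIso_day_μ (S.conv.source.tensorObj W X) (S.conv.source.tensorObj Y Z)
  refine ⟨Φ.preimage (inv (S.ptw.functor.μ _ _) ≫
    inv (D.map (S.conv.functor.μ W X) (S.conv.functor.μ Y Z)) ≫
    D.interchange (Φ.obj W) (Φ.obj X) (Φ.obj Y) (Φ.obj Z) ≫
      hcomp (S.ptw.functor.μ W Y) (S.ptw.functor.μ X Z) ≫ S.conv.functor.μ _ _), ?_⟩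
  rw [Functor.map_preimage]
  refine (congrArg (fun r => D.map _ _ ≫ r) (IsIso.hom_inv_id_assoc _ _)).trans ?_
  exact IsIso.hom_inv_id_assoc _ _

/-- The interchange map. -/
noncomputable def interchange (W X Y Z : T) :
    S.ptw.source.tensorObj (S.conv.source.tensorObj W X) (S.conv.source.tensorObj Y Z) ⟶
      S.conv.source.tensorObj (S.ptw.source.tensorObj W Y) (S.ptw.source.tensorObj X Z) :=
  (S.exists_interchange W X Y Z).choose

theorem map_interchange (W X Y Z : T) :
    D.map (S.conv.functor.μ W X) (S.conv.functor.μ Y Z) ≫ S.ptw.functor.μ _ _ ≫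
        Φ.map (S.interchange W X Y Z) =
      D.interchange (Φ.obj W) (Φ.obj X) (Φ.obj Y) (Φ.obj Z) ≫
        hcomp (S.ptw.functor.μ W Y) (S.ptw.functor.μ X Z) ≫ S.conv.functor.μ _ _ :=
  (S.exists_interchange W X Y Z).choose_spec

/-- The transported interchange obeys the same rule on elements as the original, so the duoidal
axioms can be verified by the same computations. -/
theorem mulElt_interchange {W X Y Z : T} {p p' y y' x x' : C} (f : p ⟶ (Φ.obj W).obj.obj y)
    (g : y ⟶ (Φ.obj X).obj.obj x) (f' : p' ⟶ (Φ.obj Y).obj.obj y')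
    (g' : y' ⟶ (Φ.obj Z).obj.obj x') :
    S.ptw.mulElt (S.conv.convElt f g) (S.conv.convElt f' g') ≫
        (Φ.map (S.interchange W X Y Z)).hom.app (x ⊗ x') =
      S.conv.convElt (S.ptw.mulElt f f') (S.ptw.mulElt g g') := by
  have h := congrArg (fun α => α.hom.app (x ⊗ x')) (S.map_interchange W X Y Z)
  rw [MonoidalLift.mulElt, MonoidalLift.convElt, MonoidalLift.convElt, ← D.mulElt_dayMap]
  simp only [Category.assoc]
  refine (congrArg (fun r => _ ≫ r) h).trans ?_
  refine ((reassoc_of% D.mulElt_interchange f g f' g') _).trans ?_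
  exact (reassoc_of% compElt_hcomp (D.mulElt f f') (D.mulElt g g') (S.ptw.functor.μ W Y)
    (S.ptw.functor.μ X Z)) _

theorem exists_comul :
    ∃ i : S.ptw.source.tensorUnit ⟶
        S.conv.source.tensorObj S.ptw.source.tensorUnit S.ptw.source.tensorUnit,
      S.ptw.functor.ε ≫ Φ.map i =
        D.comul ≫ hcomp S.ptw.functor.ε S.ptw.functor.ε ≫ S.conv.functor.μ _ _ := by
  have := S.ptw.isIso_day_ε
  refine ⟨Φ.preimage (inv S.ptw.functor.ε ≫
    D.comul ≫ hcomp S.ptw.functor.ε S.ptw.functor.ε ≫ S.conv.functor.μ _ _), ?_⟩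
  rw [Functor.map_preimage]
  exact IsIso.hom_inv_id_assoc _ _

/-- The comultiplication of the unit for the pointwise product. -/
noncomputable def comul : S.ptw.source.tensorUnit ⟶
    S.conv.source.tensorObj S.ptw.source.tensorUnit S.ptw.source.tensorUnit :=
  S.exists_comul.choose

theorem map_comul : S.ptw.functor.ε ≫ Φ.map S.comul =
    D.comul ≫ hcomp S.ptw.functor.ε S.ptw.functor.ε ≫ S.conv.functor.μ _ _ :=
  S.exists_comul.choose_spec

theorem unitElt_comul : S.ptw.unitElt ≫ (Φ.map S.comul).hom.app (𝟙_ C) =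
    S.conv.convElt S.ptw.unitElt S.ptw.unitElt := by
  have h := congrArg (fun α => α.hom.app (𝟙_ C)) S.map_comul
  rw [MonoidalLift.unitElt, Category.assoc]
  refine (congrArg (fun r => _ ≫ r) h).trans ?_
  refine ((reassoc_of% D.unitElt_comul) _).trans ?_
  exact (reassoc_of% compElt_hcomp D.unitElt D.unitElt S.ptw.functor.ε S.ptw.functor.ε) _

theorem exists_mul :
    ∃ i : S.ptw.source.tensorObj S.conv.source.tensorUnit S.conv.source.tensorUnit ⟶
        S.conv.source.tensorUnit,
      D.map S.conv.functor.ε S.conv.functor.ε ≫ S.ptw.functor.μ _ _ ≫ Φ.map i =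
        D.mul ≫ S.conv.functor.ε := by
  have h1 := S.isIso_convε
  have h3 := isIso_dayMap (D := D) S.conv.functor.ε S.conv.functor.ε
  have h4 := S.ptw.isIso_day_μ S.conv.source.tensorUnit S.conv.source.tensorUnit
  refine ⟨Φ.preimage (inv (S.ptw.functor.μ _ _) ≫
    inv (D.map S.conv.functor.ε S.conv.functor.ε) ≫ D.mul ≫ S.conv.functor.ε), ?_⟩
  rw [Functor.map_preimage]
  refine (congrArg (fun r => D.map _ _ ≫ r) (IsIso.hom_inv_id_assoc _ _)).trans ?_
  exact IsIso.hom_inv_id_assoc _ _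

/-- The multiplication of the unit for convolution. -/
noncomputable def mul : S.ptw.source.tensorObj S.conv.source.tensorUnit S.conv.source.tensorUnit ⟶
    S.conv.source.tensorUnit :=
  S.exists_mul.choose

theorem map_mul : D.map S.conv.functor.ε S.conv.functor.ε ≫ S.ptw.functor.μ _ _ ≫ Φ.map S.mul =
    D.mul ≫ S.conv.functor.ε :=
  S.exists_mul.choose_spec

theorem mulElt_mul {p q x y : C} (a : p ⟶ x) (b : q ⟶ y) :
    S.ptw.mulElt (S.conv.oneElt a) (S.conv.oneElt b) ≫ (Φ.map S.mul).hom.app (x ⊗ y) =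
      S.conv.oneElt (a ⊗ₘ b) := by
  have h := congrArg (fun α => α.hom.app (x ⊗ y)) S.map_mul
  rw [MonoidalLift.mulElt, MonoidalLift.oneElt, MonoidalLift.oneElt, ← D.mulElt_dayMap]
  simp only [Category.assoc]
  refine (congrArg (fun r => _ ≫ r) h).trans ?_
  exact (reassoc_of% D.mulElt_mul a b) _

theorem exists_unitMap : ∃ i : S.ptw.source.tensorUnit ⟶ S.conv.source.tensorUnit,
    S.ptw.functor.ε ≫ Φ.map i = D.unitMap ≫ S.conv.functor.ε := by
  have := S.ptw.isIso_day_ε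
  refine ⟨Φ.preimage (inv S.ptw.functor.ε ≫ D.unitMap ≫ S.conv.functor.ε), ?_⟩
  rw [Functor.map_preimage]
  exact IsIso.hom_inv_id_assoc _ _

/-- The map between the two units. -/
noncomputable def unitMap : S.ptw.source.tensorUnit ⟶ S.conv.source.tensorUnit :=
  S.exists_unitMap.choose

theorem map_unitMap : S.ptw.functor.ε ≫ Φ.map S.unitMap = D.unitMap ≫ S.conv.functor.ε :=
  S.exists_unitMap.choose_spec

theorem unitElt_unitMap : S.ptw.unitElt ≫ (Φ.map S.unitMap).hom.app (𝟙_ C) =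
    S.conv.oneElt (𝟙 _) := by
  have h := congrArg (fun α => α.hom.app (𝟙_ C)) S.map_unitMap
  rw [MonoidalLift.unitElt, Category.assoc]
  refine (congrArg (fun r => _ ≫ r) h).trans ?_
  exact (reassoc_of% D.unitElt_unitMap) _

theorem map_comp_app {r s t : T} (f : r ⟶ s) (g : s ⟶ t) (x : C) :
    (Φ.map (f ≫ g)).hom.app x = (Φ.map f).hom.app x ≫ (Φ.map g).hom.app x := by
  rw [Φ.map_comp, FunL.comp_app]

open MonoidalLift

theorem interchange_natural {W W' X X' Y Y' Z Z' : T}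
    (a : W ⟶ W') (b : X ⟶ X') (c : Y ⟶ Y') (d : Z ⟶ Z') :
    S.ptw.source.tensorHom (S.conv.source.tensorHom a b) (S.conv.source.tensorHom c d) ≫
        S.interchange W' X' Y' Z' =
      S.interchange W X Y Z ≫
        S.conv.source.tensorHom (S.ptw.source.tensorHom a c) (S.ptw.source.tensorHom b d) :=
  S.ptw.elt_ext fun f g => by
    obtain ⟨y, f, f', rfl⟩ := S.conv.exists_convElt f
    obtain ⟨z, g, g', rfl⟩ := S.conv.exists_convElt g
    rw [map_comp_app, map_comp_app, reassoc_of% MonoidalLift.mulElt_tensorHom,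
      reassoc_of% mulElt_interchange, convElt_tensorHom, convElt_tensorHom, convElt_tensorHom,
      mulElt_interchange, MonoidalLift.mulElt_tensorHom, MonoidalLift.mulElt_tensorHom]

theorem interchange_assoc (U V W X Y Z : T) :
    S.ptw.source.whiskerRight (S.interchange U V W X) (S.conv.source.tensorObj Y Z) ≫
        S.interchange (S.ptw.source.tensorObj U W) (S.ptw.source.tensorObj V X) Y Z ≫
        S.conv.source.tensorHom (S.ptw.source.associator U W Y).hom
          (S.ptw.source.associator V X Z).hom =
      (S.ptw.source.associator (S.conv.source.tensorObj U V) (S.conv.source.tensorObj W X)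
          (S.conv.source.tensorObj Y Z)).hom ≫
        S.ptw.source.whiskerLeft (S.conv.source.tensorObj U V) (S.interchange W X Y Z) ≫
        S.interchange U V (S.ptw.source.tensorObj W Y) (S.ptw.source.tensorObj X Z) :=
  S.ptw.elt_ext_triple fun f g h => by
    obtain ⟨y, f, f', rfl⟩ := S.conv.exists_convElt f
    obtain ⟨z, g, g', rfl⟩ := S.conv.exists_convElt g
    obtain ⟨t, h, h', rfl⟩ := S.conv.exists_convElt h
    simp only [map_comp_app]
    rw [reassoc_of% MonoidalLift.mulElt_whiskerRight, mulElt_interchange,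
      reassoc_of% mulElt_interchange, convElt_tensorHom, MonoidalLift.mulElt_associator,
      MonoidalLift.mulElt_associator, reassoc_of% MonoidalLift.mulElt_associator,
      FunL.naturality_assoc, reassoc_of% MonoidalLift.mulElt_whiskerLeft, mulElt_interchange,
      FunL.naturality, reassoc_of% mulElt_interchange, convElt_map, comp_convElt,
      ← Category.assoc, convElt_map_left]
    simp

theorem interchange_left_unit (X Y : T) :
    S.ptw.source.whiskerRight S.comul (S.conv.source.tensorObj X Y) ≫
        S.interchange S.ptw.source.tensorUnit S.ptw.source.tensorUnit X Y ≫
        S.conv.source.tensorHom (S.ptw.source.leftUnitor X).hom (S.ptw.source.leftUnitor Y).hom =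
      (S.ptw.source.leftUnitor (S.conv.source.tensorObj X Y)).hom :=
  S.ptw.elt_ext_left fun f => by
    obtain ⟨y, f, f', rfl⟩ := S.conv.exists_convElt f
    simp only [map_comp_app]
    rw [reassoc_of% MonoidalLift.mulElt_whiskerRight, unitElt_comul,
      reassoc_of% mulElt_interchange, convElt_tensorHom, mulElt_leftUnitor, mulElt_leftUnitor,
      mulElt_leftUnitor, convElt_map, comp_convElt, ← Category.assoc, convElt_map_left]
    simp

theorem interchange_right_unit (X Y : T) :
    S.ptw.source.whiskerLeft (S.conv.source.tensorObj X Y) S.comul ≫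
        S.interchange X Y S.ptw.source.tensorUnit S.ptw.source.tensorUnit ≫
        S.conv.source.tensorHom (S.ptw.source.rightUnitor X).hom (S.ptw.source.rightUnitor Y).hom =
      (S.ptw.source.rightUnitor (S.conv.source.tensorObj X Y)).hom :=
  S.ptw.elt_ext_right fun f => by
    obtain ⟨y, f, f', rfl⟩ := S.conv.exists_convElt f
    simp only [map_comp_app]
    rw [reassoc_of% MonoidalLift.mulElt_whiskerLeft, unitElt_comul,
      reassoc_of% mulElt_interchange, convElt_tensorHom, mulElt_rightUnitor, mulElt_rightUnitor,
      mulElt_rightUnitor, convElt_map, comp_convElt, ← Category.assoc, convElt_map_left]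
    simp

theorem mul_assoc :
    S.ptw.source.whiskerRight S.mul S.conv.source.tensorUnit ≫ S.mul =
      (S.ptw.source.associator S.conv.source.tensorUnit S.conv.source.tensorUnit
          S.conv.source.tensorUnit).hom ≫
        S.ptw.source.whiskerLeft S.conv.source.tensorUnit S.mul ≫ S.mul :=
  S.ptw.elt_ext_triple fun f g h => by
    obtain ⟨f, rfl⟩ := S.conv.exists_oneElt f
    obtain ⟨g, rfl⟩ := S.conv.exists_oneElt g
    obtain ⟨h, rfl⟩ := S.conv.exists_oneElt h
    simp only [map_comp_app]
    rw [reassoc_of% MonoidalLift.mulElt_whiskerRight, mulElt_mul, mulElt_mul,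
      reassoc_of% MonoidalLift.mulElt_associator, FunL.naturality_assoc,
      reassoc_of% MonoidalLift.mulElt_whiskerLeft, mulElt_mul, FunL.naturality,
      reassoc_of% mulElt_mul, oneElt_map, comp_oneElt]
    simp

theorem unit_mul : S.ptw.source.whiskerRight S.unitMap S.conv.source.tensorUnit ≫ S.mul =
    (S.ptw.source.leftUnitor S.conv.source.tensorUnit).hom :=
  S.ptw.elt_ext_left fun f => by
    obtain ⟨f, rfl⟩ := S.conv.exists_oneElt f
    rw [map_comp_app, reassoc_of% MonoidalLift.mulElt_whiskerRight, unitElt_unitMap, mulElt_mul,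
      mulElt_leftUnitor, oneElt_map, comp_oneElt]
    simp

theorem mul_unit : S.ptw.source.whiskerLeft S.conv.source.tensorUnit S.unitMap ≫ S.mul =
    (S.ptw.source.rightUnitor S.conv.source.tensorUnit).hom :=
  S.ptw.elt_ext_right fun f => by
    obtain ⟨f, rfl⟩ := S.conv.exists_oneElt f
    rw [map_comp_app, reassoc_of% MonoidalLift.mulElt_whiskerLeft, unitElt_unitMap, mulElt_mul,
      mulElt_rightUnitor, oneElt_map, comp_oneElt]
    simp

theorem associator_interchange (U V W X Y Z : T) :
    S.interchange (S.conv.source.tensorObj U V) W (S.conv.source.tensorObj X Y) Z ≫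
        S.conv.source.whiskerRight (S.interchange U V X Y) (S.ptw.source.tensorObj W Z) ≫
        (S.conv.source.associator (S.ptw.source.tensorObj U X) (S.ptw.source.tensorObj V Y)
          (S.ptw.source.tensorObj W Z)).hom =
      S.ptw.source.tensorHom (S.conv.source.associator U V W).hom
          (S.conv.source.associator X Y Z).hom ≫
        S.interchange U (S.conv.source.tensorObj V W) X (S.conv.source.tensorObj Y Z) ≫
        S.conv.source.whiskerLeft (S.ptw.source.tensorObj U X) (S.interchange V W Y Z) :=
  S.ptw.elt_ext fun f g => by
    obtain ⟨y, f, f', rfl⟩ := S.conv.exists_convElt f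
    obtain ⟨z, f, f'', rfl⟩ := S.conv.exists_convElt f
    obtain ⟨y, g, g', rfl⟩ := S.conv.exists_convElt g
    obtain ⟨z, g, g'', rfl⟩ := S.conv.exists_convElt g
    simp only [map_comp_app]
    rw [reassoc_of% mulElt_interchange, reassoc_of% convElt_whiskerRight, mulElt_interchange,
      convElt_associator, reassoc_of% MonoidalLift.mulElt_tensorHom, convElt_associator,
      convElt_associator, reassoc_of% mulElt_interchange, convElt_whiskerLeft,
      mulElt_interchange]

/-- Elements of the convolution unit are morphisms of `C`, and `mul` tensors them, so both sides
send a product of `f ∘ f'` and `g ∘ g'` with `f`, `g` from the unit to the product of the plain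
compositions. -/
theorem leftUnitor_interchange (X Y : T) :
    S.interchange S.conv.source.tensorUnit X S.conv.source.tensorUnit Y ≫
        S.conv.source.whiskerRight S.mul (S.ptw.source.tensorObj X Y) ≫
        (S.conv.source.leftUnitor (S.ptw.source.tensorObj X Y)).hom =
      S.ptw.source.tensorHom (S.conv.source.leftUnitor X).hom (S.conv.source.leftUnitor Y).hom :=
  S.ptw.elt_ext fun f g => by
    obtain ⟨y, f, f', rfl⟩ := S.conv.exists_convElt f
    obtain ⟨f, rfl⟩ := S.conv.exists_oneElt f
    obtain ⟨y, g, g', rfl⟩ := S.conv.exists_convElt g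
    obtain ⟨g, rfl⟩ := S.conv.exists_oneElt g
    simp only [map_comp_app]
    rw [reassoc_of% mulElt_interchange, reassoc_of% convElt_whiskerRight, mulElt_mul,
      convElt_leftUnitor, MonoidalLift.mulElt_tensorHom, convElt_leftUnitor, convElt_leftUnitor,
      comp_mulElt]

theorem rightUnitor_interchange (X Y : T) :
    S.interchange X S.conv.source.tensorUnit Y S.conv.source.tensorUnit ≫
        S.conv.source.whiskerLeft (S.ptw.source.tensorObj X Y) S.mul ≫
        (S.conv.source.rightUnitor (S.ptw.source.tensorObj X Y)).hom =
      S.ptw.source.tensorHom (S.conv.source.rightUnitor X).hom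
        (S.conv.source.rightUnitor Y).hom :=
  S.ptw.elt_ext fun f g => by
    obtain ⟨y, f, f', rfl⟩ := S.conv.exists_convElt f
    obtain ⟨f', rfl⟩ := S.conv.exists_oneElt f'
    obtain ⟨y, g, g', rfl⟩ := S.conv.exists_convElt g
    obtain ⟨g', rfl⟩ := S.conv.exists_oneElt g'
    simp only [map_comp_app]
    rw [reassoc_of% mulElt_interchange, reassoc_of% convElt_whiskerLeft, mulElt_mul,
      convElt_rightUnitor, MonoidalLift.mulElt_tensorHom, convElt_rightUnitor,
      convElt_rightUnitor, MonoidalLift.mulElt_map]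

theorem comul_assoc :
    S.comul ≫ S.conv.source.whiskerRight S.comul S.ptw.source.tensorUnit ≫
      (S.conv.source.associator S.ptw.source.tensorUnit S.ptw.source.tensorUnit
        S.ptw.source.tensorUnit).hom =
    S.comul ≫ S.conv.source.whiskerLeft S.ptw.source.tensorUnit S.comul :=
  S.ptw.unit_ext <| by
    simp only [map_comp_app]
    rw [reassoc_of% unitElt_comul, reassoc_of% convElt_whiskerRight, unitElt_comul,
      convElt_associator, reassoc_of% unitElt_comul, convElt_whiskerLeft, unitElt_comul]

theorem comul_unitMap_left :
    S.comul ≫ S.conv.source.whiskerRight S.unitMap S.ptw.source.tensorUnit ≫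
      (S.conv.source.leftUnitor S.ptw.source.tensorUnit).hom = 𝟙 _ :=
  S.ptw.unit_ext <| by
    simp only [map_comp_app]
    rw [reassoc_of% unitElt_comul, reassoc_of% convElt_whiskerRight, unitElt_unitMap,
      convElt_leftUnitor, Φ.map_id, FunL.id_app, Category.id_comp, Category.comp_id]

theorem comul_unitMap_right :
    S.comul ≫ S.conv.source.whiskerLeft S.ptw.source.tensorUnit S.unitMap ≫
      (S.conv.source.rightUnitor S.ptw.source.tensorUnit).hom = 𝟙 _ :=
  S.ptw.unit_ext <| by
    simp only [map_comp_app]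
    rw [reassoc_of% unitElt_comul, reassoc_of% convElt_whiskerLeft, unitElt_unitMap,
      convElt_rightUnitor, Φ.map_id, FunL.id_app, CategoryTheory.Functor.map_id]

/-- The duoidal structure on the source. -/
noncomputable def duoidal : Duoidal S.conv.source S.ptw.source where
  interchange := S.interchange
  comul := S.comul
  mul := S.mul
  unitMap := S.unitMap
  interchange_natural := S.interchange_natural
  interchange_assoc := S.interchange_assoc
  interchange_left_unit := S.interchange_left_unit
  interchange_right_unit := S.interchange_right_unit
  mul_assoc := S.mul_assoc
  unit_mul := S.unit_mul
  mul_unit := S.mul_unit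
  associator_interchange := S.associator_interchange
  leftUnitor_interchange := S.leftUnitor_interchange
  rightUnitor_interchange := S.rightUnitor_interchange
  comul_assoc := S.comul_assoc
  comul_unitMap_left := S.comul_unitMap_left
  comul_unitMap_right := S.comul_unitMap_right

/-- The functor to the category of endofunctors is duoidal. -/
noncomputable def duoidalFunctor : DuoidalFunctor S.duoidal D.duoidal Φ where
  cmpMonoidal := S.conv.functor
  ptwMonoidal := S.ptw.functor
  map_interchange := S.map_interchange
  map_comul := S.map_comul
  map_mul := S.map_mul
  map_unitMap := S.map_unitMap

end DuoidalLift

end DuoidalLift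

end PrL

namespace PrL

/-! ### The transported convolution has the prescribed form -/

section Convolution

/-- Both sides join `f` to `h` through `e`, read once as a change of `c₁` into `d` and once as a
change of `c₂` into `m₂`. This converts the right unitor from an action on the argument into an
action on the second tensor factor. -/
theorem pairing_exchange {C : Type u} [Category.{v} C] [MonoidalCategory C] {m₂ c₁ c₂ d : C}
    (f : 𝟙_ C ⟶ m₂ ⊗ c₁) (h : 𝟙_ C ⟶ c₂ ⊗ d) (e : c₁ ⊗ c₂ ⟶ 𝟙_ C) :
    f ≫ m₂ ◁ (pairingInsert c₁ h ≫ e ▷ d ≫ (λ_ d).hom) =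
      h ≫ ((λ_ c₂).inv ≫ f ▷ c₂ ≫ (α_ m₂ c₁ c₂).hom ≫ m₂ ◁ e ≫ (ρ_ m₂).hom) ▷ d := by
  have h1 : f ≫ m₂ ◁ (ρ_ c₁).inv ≫ m₂ ◁ (c₁ ◁ h) = h ≫ (λ_ _).inv ≫ f ▷ (c₂ ⊗ d) ≫
      (α_ m₂ c₁ (c₂ ⊗ d)).hom := by
    rw [leftUnitor_inv_naturality_assoc, whisker_exchange_assoc]
    simp [unitors_inv_equal]
  simp only [pairingInsert, MonoidalCategory.whiskerLeft_comp, Category.assoc, comp_whiskerRight]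
  rw [reassoc_of% h1]
  monoidal

variable {k : Type w} [Field k]
variable {C : Type (w + 1)} [Category.{w} C] [Preadditive C] [Linear k C]
variable [MonoidalCategory C] [CocontMonoidal k C]
variable {T : Type (w + 1)} [Category.{w} T] [Preadditive T] [Linear k T] {B : C ⥤ C ⥤ T}
variable {Φ : T ⥤ FunL k C C} [IsLocallyPresentable.{w} C] [IsLocallyPresentable.{w} T]

namespace PairingKernel

variable (κ : PairingKernel k B (Φ ⋙ ObjectProperty.ι _))

/-! ### Generalized elements of the functors attached to pure tensors -/

/-- The generalized element of the functor attached to `c₁ ⊠ c₂` given by `f ∈ ev(c₂, d)`. -/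
def elt {c₁ c₂ d : C} (f : 𝟙_ C ⟶ c₂ ⊗ d) : c₁ ⟶ (Φ.obj ((B.obj c₁).obj c₂)).obj.obj d :=
  κ.incl c₁ c₂ d f

theorem elt_isCopower (c₁ c₂ d : C) :
    IsCopower k fun f : 𝟙_ C ⟶ c₂ ⊗ d => κ.elt (c₁ := c₁) f :=
  κ.isCopower c₁ c₂ d

theorem elt_boxMap {c₁ c₁' c₂ c₂' d : C} (a : c₁ ⟶ c₁') (b : c₂ ⟶ c₂') (f : 𝟙_ C ⟶ c₂ ⊗ d) :
    κ.elt f ≫ (Φ.map (boxMap B a b)).hom.app d = a ≫ κ.elt (f ≫ b ▷ d) :=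
  κ.incl_map_app a b f

theorem elt_map {c₁ c₂ d d' : C} (f : 𝟙_ C ⟶ c₂ ⊗ d) (e : d ⟶ d') :
    κ.elt (c₁ := c₁) f ≫ (Φ.obj ((B.obj c₁).obj c₂)).obj.map e = κ.elt (f ≫ c₂ ◁ e) :=
  κ.incl_obj_map e f

theorem elt_hom_ext [Φ.Faithful] {c₁ c₂ : C} {t : T} {α β : (B.obj c₁).obj c₂ ⟶ t}
    (hαβ : ∀ {d} (f : 𝟙_ C ⟶ c₂ ⊗ d),
      κ.elt f ≫ (Φ.map α).hom.app d = κ.elt f ≫ (Φ.map β).hom.app d) : α = β :=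
  (Φ ⋙ ObjectProperty.ι _).map_injective (κ.hom_ext fun _ f => hαβ f)

theorem exists_elt_hom [Φ.Full] {c₁ c₂ : C} {t : T}
    (φ : ∀ d, (𝟙_ C ⟶ c₂ ⊗ d) → (c₁ ⟶ (Φ.obj t).obj.obj d))
    (hφ : ∀ d, IsLinearMap k (φ d))
    (hnat : ∀ {d d'} (e : d ⟶ d') f, φ d f ≫ (Φ.obj t).obj.map e = φ d' (f ≫ c₂ ◁ e)) :
    ∃ α : (B.obj c₁).obj c₂ ⟶ t, ∀ {d} f, κ.elt f ≫ (Φ.map α).hom.app d = φ d f := by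
  obtain ⟨α, hα⟩ := κ.exists_hom (F := (Φ.obj t).obj) φ hφ hnat
  refine ⟨(Φ ⋙ ObjectProperty.ι _).preimage α, fun {d} f => ?_⟩
  have := congrArg (fun r => κ.elt f ≫ r.app d) ((Φ ⋙ ObjectProperty.ι _).map_preimage α)
  exact this.trans (hα d f)

/-- Evaluation of the functor attached to an object. -/
abbrev evalAt (Φ : T ⥤ FunL k C C) (d : C) : T ⥤ C := (Φ ⋙ ObjectProperty.ι _).flip.obj d

theorem evalAt_isCocontLinear (κ : PairingKernel k B (Φ ⋙ ObjectProperty.ι _)) (d : C) :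
    IsCocontLinear k (evalAt Φ d) := κ.bilinear.left d

theorem map_add_app (κ : PairingKernel k B (Φ ⋙ ObjectProperty.ι _)) {t t' : T} (f g : t ⟶ t')
    (d : C) :
    (Φ.map (f + g)).hom.app d = (Φ.map f).hom.app d + (Φ.map g).hom.app d := by
  have := (κ.evalAt_isCocontLinear d).additive
  exact (evalAt Φ d).map_add (f := f) (g := g)

theorem map_smul_app (κ : PairingKernel k B (Φ ⋙ ObjectProperty.ι _)) {t t' : T} (r : k)
    (f : t ⟶ t') (d : C) : (Φ.map (r • f)).hom.app d = r • (Φ.map f).hom.app d := by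
  have := (κ.evalAt_isCocontLinear d).linear
  exact (evalAt Φ d).map_smul r f

/-- Colimits of functors are pointwise and the fully faithful functor to endofunctors reflects them,
so cocontinuity into `T` may be tested after evaluation at each object. -/
theorem isCocontLinear_of_evalAt {E : Type (w + 1)} [Category.{w} E] [Preadditive E] [Linear k E]
    (κ : PairingKernel k B (Φ ⋙ ObjectProperty.ι _)) [Φ.Full] [Φ.Faithful] {G : E ⥤ T}
    (hG : ∀ d, IsCocontLinear k (G ⋙ evalAt Φ d)) : IsCocontLinear k G where
  additive := ⟨fun {X Y f g} => Φ.map_injective <| FunL.hom_ext fun d => by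
    have := (hG d).additive
    rw [κ.map_add_app]
    exact (G ⋙ evalAt Φ d).map_add (f := f) (g := g)⟩
  linear := ⟨fun {X Y} f r => Φ.map_injective <| FunL.hom_ext fun d => by
    have := (hG d).linear
    rw [κ.map_smul_app]
    exact (G ⋙ evalAt Φ d).map_smul r f⟩
  cocontinuous := by
    have : PreservesColimitsOfSize.{w, w} (G ⋙ Φ ⋙ ObjectProperty.ι _) :=
      ⟨⟨fun {K} => ⟨fun {c} hc => ⟨evaluationJointlyReflectsColimits _ fun d => by
        have := (hG d).cocontinuous
        exact isColimitOfPreserves (G ⋙ evalAt Φ d) hc⟩⟩⟩⟩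
    exact preservesColimits_of_reflects_of_preserves G (Φ ⋙ ObjectProperty.ι _)

theorem isIso_of_app [Φ.Full] [Φ.Faithful] {t t' : T} (u : t ⟶ t')
    (hu : ∀ d, IsIso ((Φ.map u).hom.app d)) : IsIso u := by
  have : IsIso ((Φ ⋙ ObjectProperty.ι _).map u) := by
    rw [NatTrans.isIso_iff_isIso_app]
    exact hu
  exact isIso_of_reflects_iso u (Φ ⋙ ObjectProperty.ι _)

/-! ### The convolution product -/

variable (S : MonoidalLift Φ (compMonoidal k C))

/-- Evaluated at `d`, the product of `X` and `Y` is `Φ X (Φ Y d)`: cocontinuous in `X` by evaluation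
at `Φ Y d`, and in `Y` because `Φ X` is cocontinuous. -/
theorem conv_isCocontBilinear (κ : PairingKernel k B (Φ ⋙ ObjectProperty.ι _))
    (S : MonoidalLift Φ (compMonoidal k C)) [Φ.Full] [Φ.Faithful] :
    IsCocontBilinear k (@curriedTensor T _ S.source) where
  left Y := κ.isCocontLinear_of_evalAt fun d => by
    let _ := compMonoidal k C
    let _ := S.source
    let _ := S.functor
    have (X : T) := S.isIso_μ_app X Y d
    exact (κ.evalAt_isCocontLinear ((Φ.obj Y).obj.obj d)).of_iso
      (NatIso.ofComponents (fun X => asIso ((S.functor.μ X Y).hom.app d)) fun f =>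
        congrArg (fun α => α.hom.app d) (Functor.LaxMonoidal.μ_natural_left Φ f Y))
  right X := κ.isCocontLinear_of_evalAt fun d => by
    let _ := compMonoidal k C
    let _ := S.source
    let _ := S.functor
    have (Y : T) := S.isIso_μ_app X Y d
    exact ((κ.evalAt_isCocontLinear d).comp (Φ.obj X).property).of_iso
      (NatIso.ofComponents (fun Y => asIso ((S.functor.μ X Y).hom.app d)) fun f =>
        congrArg (fun α => α.hom.app d) (Functor.LaxMonoidal.μ_natural_right Φ X f))

theorem convElt_isLinearMap_left (S : MonoidalLift Φ (compMonoidal k C)) (t s : T) {X y x : C}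
    (g : y ⟶ (Φ.obj s).obj.obj x) :
    IsLinearMap k fun f : X ⟶ (Φ.obj t).obj.obj y => S.convElt f g :=
  ⟨fun a b => by simp [MonoidalLift.convElt, FunL.compElt],
    fun r a => by simp [MonoidalLift.convElt, FunL.compElt]⟩

theorem convElt_isLinearMap_right (S : MonoidalLift Φ (compMonoidal k C)) (t s : T) {X y x : C}
    (f : X ⟶ (Φ.obj t).obj.obj y) :
    IsLinearMap k fun g : y ⟶ (Φ.obj s).obj.obj x => S.convElt f g := by
  have := (Φ.obj t).property.additive
  have := (Φ.obj t).property.linear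
  exact ⟨fun a b => by simp [MonoidalLift.convElt, FunL.compElt],
    fun r a => by simp [MonoidalLift.convElt, FunL.compElt, Functor.map_smul]⟩

/-- Composing with the element of `m₁ ⊠ m₂` given by `f` is linear and natural in the element of `n₁
⊠ n₂`, so it is induced by a morphism out of `m₁ ⊠ n₂`. -/
theorem exists_convIncl [Φ.Full] (m₁ m₂ n₁ n₂ : C) (f : 𝟙_ C ⟶ m₂ ⊗ n₁) :
    ∃ i : (B.obj m₁).obj n₂ ⟶ S.source.tensorObj ((B.obj m₁).obj m₂) ((B.obj n₁).obj n₂),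
      ∀ {d} (g : 𝟙_ C ⟶ n₂ ⊗ d), κ.elt g ≫ (Φ.map i).hom.app d = S.convElt (κ.elt f) (κ.elt g) :=
  κ.exists_elt_hom (fun d g => S.convElt (κ.elt f) (κ.elt g))
    (fun d => ⟨fun a b => by
        rw [(κ.elt_isCopower n₁ n₂ d).linear.map_add,
          (convElt_isLinearMap_right S _ _ _).map_add],
      fun r a => by
        rw [(κ.elt_isCopower n₁ n₂ d).linear.map_smul,
          (convElt_isLinearMap_right S _ _ _).map_smul]⟩)
    fun e g => by rw [MonoidalLift.convElt_map, elt_map]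

/-- The universal linear map `ev(m₂, n₁) → Hom(m₁ ⊠ n₂, (m₁ ⊠ m₂) ∘ (n₁ ⊠ n₂))`. -/
noncomputable def convIncl [Φ.Full] (m₁ m₂ n₁ n₂ : C) (f : 𝟙_ C ⟶ m₂ ⊗ n₁) :
    (B.obj m₁).obj n₂ ⟶ S.source.tensorObj ((B.obj m₁).obj m₂) ((B.obj n₁).obj n₂) :=
  (κ.exists_convIncl S m₁ m₂ n₁ n₂ f).choose

theorem elt_convIncl [Φ.Full] {m₁ m₂ n₁ n₂ : C} (f : 𝟙_ C ⟶ m₂ ⊗ n₁) {d : C}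
    (g : 𝟙_ C ⟶ n₂ ⊗ d) :
    κ.elt g ≫ (Φ.map (κ.convIncl S m₁ m₂ n₁ n₂ f)).hom.app d = S.convElt (κ.elt f) (κ.elt g) :=
  (κ.exists_convIncl S m₁ m₂ n₁ n₂ f).choose_spec g

variable [Φ.Full] [Φ.Faithful]

theorem convIncl_isLinearMap (m₁ m₂ n₁ n₂ : C) : IsLinearMap k (κ.convIncl S m₁ m₂ n₁ n₂) :=
  ⟨fun a b => κ.elt_hom_ext fun g => by
      rw [κ.map_add_app, Preadditive.comp_add, elt_convIncl, elt_convIncl, elt_convIncl,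
        (κ.elt_isCopower m₁ m₂ n₁).linear.map_add, (convElt_isLinearMap_left S _ _ _).map_add],
    fun r a => κ.elt_hom_ext fun g => by
      rw [κ.map_smul_app, Linear.comp_smul, elt_convIncl, elt_convIncl,
        (κ.elt_isCopower m₁ m₂ n₁).linear.map_smul, (convElt_isLinearMap_left S _ _ _).map_smul]⟩

/-- At `d` the composite functor is the tensor of `m₁` with `ev(m₂, n₁)` and then with `ev(n₂, d)`.
Interchanging the two tensors exhibits it as the tensor with `ev(m₂, n₁)` of the value of `m₁ ⊠ n₂`.
-/
theorem convIncl_app_isCopower (m₁ m₂ n₁ n₂ d : C) :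
    IsCopower k fun f => (Φ.map (κ.convIncl S m₁ m₂ n₁ n₂ f)).hom.app d := by
  have := S.isIso_μ_app ((B.obj m₁).obj m₂) ((B.obj n₁).obj n₂) d
  refine IsCopower.swap (κ.elt_isCopower m₁ m₂ n₁) (κ.elt_isCopower m₁ n₂ d)
    (((κ.elt_isCopower n₁ n₂ d).map (Φ.obj ((B.obj m₁).obj m₂)).property).comp_iso
      (asIso ((S.functor.μ ((B.obj m₁).obj m₂) ((B.obj n₁).obj n₂)).hom.app d))) fun f g => ?_
  rw [elt_convIncl]
  exact (Category.assoc _ _ _).symm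

theorem convIncl_isCopower (m₁ m₂ n₁ n₂ : C) : IsCopower k (κ.convIncl S m₁ m₂ n₁ n₂) := by
  have := hasColimitsOfSize_of_isLocallyPresentable T
  obtain ⟨P, ι, hι⟩ := exists_isCopower (k := k) (V := 𝟙_ C ⟶ m₂ ⊗ n₁) (X := (B.obj m₁).obj n₂)
  obtain ⟨u, hu⟩ := hι.exists_desc _ (κ.convIncl_isLinearMap S m₁ m₂ n₁ n₂)
  -- The comparison from an actual tensor in `T` is tested at each `d`; evaluation preserves the
  -- tensor and the previous statement identifies the target.
  have : IsIso u := isIso_of_app u fun d => by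
    have h1 : IsCopower k fun f => (Φ.map (ι f)).hom.app d := hι.map (κ.evalAt_isCocontLinear d)
    obtain ⟨e, he⟩ := h1.exists_iso (κ.convIncl_app_isCopower S m₁ m₂ n₁ n₂ d)
    have : (Φ.map u).hom.app d = e.hom := h1.hom_ext fun f => by
      rw [he, ← hu, Φ.map_comp, FunL.comp_app]
    rw [this]
    infer_instance
  have h2 := hι.comp_iso (asIso u)
  simp only [asIso_hom, hu] at h2
  exact h2

theorem convIncl_natural {m₁ m₁' m₂ m₂' n₁ n₁' n₂ n₂' : C} (a : m₁ ⟶ m₁') (b : m₂ ⟶ m₂')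
    (c : n₁ ⟶ n₁') (d : n₂ ⟶ n₂') (f : 𝟙_ C ⟶ m₂ ⊗ n₁) :
    κ.convIncl S m₁ m₂ n₁ n₂ f ≫ S.source.tensorHom (boxMap B a b) (boxMap B c d) =
      boxMap B a d ≫ κ.convIncl S m₁' m₂' n₁' n₂' (f ≫ (b ⊗ₘ c)) :=
  κ.elt_hom_ext fun g => by
    rw [Φ.map_comp, Φ.map_comp, FunL.comp_app, FunL.comp_app, reassoc_of% elt_convIncl,
      MonoidalLift.convElt_tensorHom, elt_boxMap, elt_boxMap, reassoc_of% elt_boxMap,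
      elt_convIncl, ← MonoidalLift.convElt_map_left, Category.assoc, elt_map,
      MonoidalCategory.tensorHom_def, Category.assoc, MonoidalLift.comp_convElt]

theorem exists_counit (hC : IsCpRigid k C) (hunit : IsCompactProjective k (𝟙_ C))
    (h : IsTensorProduct k B) :
    ∃ e : (tensorFunctor h).obj S.source.tensorUnit ⟶ 𝟙_ C, ∀ {X x : C} (f : X ⟶ x),
      S.oneElt f ≫ tensorTransform h κ S.source.tensorUnit x ≫ e ▷ x = f ≫ (λ_ x).inv := by
  have (x : C) := S.isIso_ε_app x
  -- The unit object represents the identity functor, which is `𝟙 ⊗ -`; the counit is the morphism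
  -- whose adjunct is this isomorphism.
  let α : (Φ ⋙ ObjectProperty.ι _).obj S.source.tensorUnit ⟶ (curriedTensor C).obj (𝟙_ C) :=
    { app := fun x => inv (S.functor.ε.hom.app x) ≫ (λ_ x).inv
      naturality := fun x y f => by
        rw [← cancel_epi (S.functor.ε.hom.app x)]
        refine ((reassoc_of% (S.functor.ε.hom.naturality f).symm) _).trans ?_
        rw [IsIso.hom_inv_id_assoc, Category.assoc, IsIso.hom_inv_id_assoc]
        exact leftUnitor_inv_naturality f }
  obtain ⟨e, he⟩ := (tensorAdjunct_bijective hC hunit h κ S.source.tensorUnit (𝟙_ C)).2 α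
  refine ⟨e, fun {X x} f => ?_⟩
  rw [← tensorAdjunct_app, he]
  change (((f ≫ 𝟙 x) ≫ S.functor.ε.hom.app x) ≫ inv (S.functor.ε.hom.app x) ≫ (λ_ x).inv) = _
  rw [Category.assoc, IsIso.hom_inv_id_assoc, Category.comp_id]

section Counit

variable (hC : IsCpRigid k C) (hunit : IsCompactProjective k (𝟙_ C)) (h : IsTensorProduct k B)

/-- The counit at the unit object of the adjunction between the tensor functor and its right
adjoint. -/
noncomputable def counit : (tensorFunctor h).obj S.source.tensorUnit ⟶ 𝟙_ C :=
  (κ.exists_counit S hC hunit h).choose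

theorem oneElt_counit {X x : C} (f : X ⟶ x) :
    S.oneElt f ≫ tensorTransform h κ S.source.tensorUnit x ≫ κ.counit S hC hunit h ▷ x =
      f ≫ (λ_ x).inv :=
  (κ.exists_counit S hC hunit h).choose_spec f

/-- The adjunct of the counit is an isomorphism of functors, so composing with it after the fully
faithful `A` is bijective; bijectivity of `tensorAdjunct` then cancels. -/
theorem counit_universal (t : T) (f : (tensorFunctor h).obj t ⟶ 𝟙_ C) :
    ∃! g : t ⟶ S.source.tensorUnit, (tensorFunctor h).map g ≫ κ.counit S hC hunit h = f := by
  let A := Φ ⋙ ObjectProperty.ι (fun F : C ⥤ C => IsCocontLinear k F)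
  have hiso : IsIso (tensorAdjunct h κ _ (κ.counit S hC hunit h)) := by
    rw [NatTrans.isIso_iff_isIso_app]
    intro x
    have := S.isIso_ε_app x
    have h1 := κ.oneElt_counit S hC hunit h (𝟙 x)
    rw [Category.id_comp] at h1
    have h2 : S.functor.ε.hom.app x ≫ (tensorAdjunct h κ _ (κ.counit S hC hunit h)).app x =
        (λ_ x).inv := by
      rw [← h1, MonoidalLift.oneElt, FunL.idElt, Category.id_comp]
      exact congrArg (fun r => r ≫ _) (Category.id_comp _).symm
    exact IsIso.of_isIso_fac_left h2
  have hb : Function.Bijective fun g : t ⟶ S.source.tensorUnit =>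
      (tensorFunctor h).map g ≫ κ.counit S hC hunit h := by
    refine Function.Bijective.of_comp_iff' (tensorAdjunct_bijective hC hunit h κ t (𝟙_ C)) _ |>.1 ?_
    have : tensorAdjunct h κ t (x := 𝟙_ C) ∘ (fun g : t ⟶ S.source.tensorUnit =>
        (tensorFunctor h).map g ≫ κ.counit S hC hunit h) =
      fun g => A.map g ≫ tensorAdjunct h κ _ (κ.counit S hC hunit h) := by
      funext g
      exact tensorAdjunct_naturality h κ g _
    rw [this]
    exact ((asIso (tensorAdjunct h κ _ (κ.counit S hC hunit h))).homToEquiv).bijective.comp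
      (Functor.FullyFaithful.ofFullyFaithful A).homEquiv.bijective
  exact Function.Bijective.existsUnique hb f

/-- The morphism `c₁ ⊗ c₂ ⟶ 𝟙` adjunct to `c₁ ⊠ c₂ ⟶ T^R(𝟙)`. -/
noncomputable def unitAdjunct {c₁ c₂ : C} (g : (B.obj c₁).obj c₂ ⟶ S.source.tensorUnit) :
    c₁ ⊗ c₂ ⟶ 𝟙_ C :=
  tensorFunctorMk h c₁ c₂ ≫ (tensorFunctor h).map g ≫ κ.counit S hC hunit h

/-- Elements of the unit are morphisms of `C`, and the counit formula determines which one. A map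
`c₁ ⊠ c₂ ⟶ T^R(𝟙)` acts on elements by contraction with its adjunct; this is where the duality form
of the unitors originates. -/
theorem elt_map_unit {c₁ c₂ d : C} (g : (B.obj c₁).obj c₂ ⟶ S.source.tensorUnit)
    (f : 𝟙_ C ⟶ c₂ ⊗ d) :
    κ.elt f ≫ (Φ.map g).hom.app d = S.oneElt (pairingInsert c₁ f ≫
      κ.unitAdjunct S hC hunit h g ▷ d ≫ (λ_ d).hom) := by
  obtain ⟨r, hr⟩ := S.exists_oneElt (κ.elt f ≫ (Φ.map g).hom.app d)
  rw [hr]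
  congr 1
  rw [← Category.assoc, ← Iso.comp_inv_eq, ← κ.oneElt_counit S hC hunit h, ← hr, Category.assoc]
  have h1 := tensorTransform_naturality_left h κ g d
  have h2 := incl_tensorTransform h κ c₁ c₂ d f
  refine (congrArg (fun t => _ ≫ t) ((reassoc_of% h1) _)).trans ?_
  refine ((reassoc_of% h2) _).trans ?_
  simp [unitAdjunct]

theorem convIncl_associator (m₁ m₂ n₁ n₂ p₁ p₂ : C) (f : 𝟙_ C ⟶ m₂ ⊗ n₁)
    (g : 𝟙_ C ⟶ n₂ ⊗ p₁) :
    κ.convIncl S m₁ n₂ p₁ p₂ g ≫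
        S.source.whiskerRight (κ.convIncl S m₁ m₂ n₁ n₂ f) ((B.obj p₁).obj p₂) ≫
        (S.source.associator ((B.obj m₁).obj m₂) ((B.obj n₁).obj n₂) ((B.obj p₁).obj p₂)).hom =
      κ.convIncl S m₁ m₂ n₁ p₂ f ≫
        S.source.whiskerLeft ((B.obj m₁).obj m₂) (κ.convIncl S n₁ n₂ p₁ p₂ g) :=
  κ.elt_hom_ext fun l => by
    simp only [Φ.map_comp, FunL.comp_app]
    rw [reassoc_of% elt_convIncl, reassoc_of% MonoidalLift.convElt_whiskerRight, elt_convIncl,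
      MonoidalLift.convElt_associator, reassoc_of% elt_convIncl,
      MonoidalLift.convElt_whiskerLeft, elt_convIncl]

theorem convIncl_leftUnitor (c₁ c₂ n₁ n₂ : C) (g : (B.obj c₁).obj c₂ ⟶ S.source.tensorUnit)
    (f : 𝟙_ C ⟶ c₂ ⊗ n₁) :
    κ.convIncl S c₁ c₂ n₁ n₂ f ≫ S.source.whiskerRight g ((B.obj n₁).obj n₂) ≫
        (S.source.leftUnitor ((B.obj n₁).obj n₂)).hom =
      boxMap B (pairingInsert c₁ f ≫ κ.unitAdjunct S hC hunit h g ▷ n₁ ≫ (λ_ n₁).hom) (𝟙 n₂) :=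
  κ.elt_hom_ext fun l => by
    simp only [Φ.map_comp, FunL.comp_app]
    rw [reassoc_of% elt_convIncl, reassoc_of% MonoidalLift.convElt_whiskerRight,
      κ.elt_map_unit S hC hunit h, MonoidalLift.convElt_leftUnitor, elt_boxMap, id_whiskerRight,
      Category.comp_id]

theorem convIncl_rightUnitor (m₁ m₂ c₁ c₂ : C) (g : (B.obj c₁).obj c₂ ⟶ S.source.tensorUnit)
    (f : 𝟙_ C ⟶ m₂ ⊗ c₁) :
    κ.convIncl S m₁ m₂ c₁ c₂ f ≫ S.source.whiskerLeft ((B.obj m₁).obj m₂) g ≫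
        (S.source.rightUnitor ((B.obj m₁).obj m₂)).hom =
      boxMap B (𝟙 m₁) ((λ_ c₂).inv ≫ f ▷ c₂ ≫ (α_ m₂ c₁ c₂).hom ≫
        m₂ ◁ κ.unitAdjunct S hC hunit h g ≫ (ρ_ m₂).hom) :=
  κ.elt_hom_ext fun l => by
    simp only [Φ.map_comp, FunL.comp_app]
    rw [reassoc_of% elt_convIncl, reassoc_of% MonoidalLift.convElt_whiskerLeft,
      κ.elt_map_unit S hC hunit h, MonoidalLift.convElt_rightUnitor, elt_map, elt_boxMap,
      pairing_exchange, Category.id_comp]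

/-- The convolution product. -/
noncomputable def convolutionProduct : ConvolutionProduct h where
  monoidal := S.source
  bilinear := κ.conv_isCocontBilinear S
  incl := κ.convIncl S
  isCopower := κ.convIncl_isCopower S
  natural := κ.convIncl_natural S
  counit := κ.counit S hC hunit h
  counit_universal := κ.counit_universal S hC hunit h
  associator_incl := κ.convIncl_associator S
  leftUnitor_incl c₁ c₂ n₁ n₂ g f := by
    rw [κ.convIncl_leftUnitor S hC hunit h]
    simp only [pairingInsert, Category.assoc]
    rfl
  rightUnitor_incl := κ.convIncl_rightUnitor S hC hunit h

end Counit

end PairingKernel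

end Convolution

end PrL

namespace PrL

/-! ### Cocontinuity of the transported pointwise product -/

section Pointwise

variable {k : Type w} [Field k]
variable {C : Type (w + 1)} [Category.{w} C] [Preadditive C] [Linear k C]
variable [MonoidalCategory C] [CocontMonoidal k C]

namespace IsCopower

variable {V V' : Type w} [AddCommGroup V] [Module k V] [AddCommGroup V'] [Module k V']
variable {X Y P Q : C} {ι : V → (X ⟶ P)} {κ : V' → (Y ⟶ Q)}

theorem hom_ext_tensor (hι : IsCopower k ι) (hκ : IsCopower k κ) {W : C} {f g : P ⊗ Q ⟶ W}
    (h : ∀ v v', (ι v ⊗ₘ κ v') ≫ f = (ι v ⊗ₘ κ v') ≫ g) : f = g := by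
  refine (hκ.map (tensorLeft_isCocontLinear P)).hom_ext fun v' => ?_
  refine (hι.map (tensorRight_isCocontLinear Y)).hom_ext fun v => ?_
  have := h v v'
  simpa [MonoidalCategory.tensorHom_def] using this

theorem exists_desc_tensor (hι : IsCopower k ι) (hκ : IsCopower k κ) {W : C}
    (φ : V → V' → (X ⊗ Y ⟶ W)) (hφ : ∀ v', IsLinearMap k fun v => φ v v')
    (hφ' : ∀ v, IsLinearMap k (φ v)) :
    ∃ u : P ⊗ Q ⟶ W, ∀ v v', (ι v ⊗ₘ κ v') ≫ u = φ v v' := by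
  have h1 := hι.map (tensorRight_isCocontLinear Y)
  choose ψ hψ using fun v' => h1.exists_desc _ (hφ v')
  obtain ⟨u, hu⟩ := (hκ.map (tensorLeft_isCocontLinear P)).exists_desc ψ
    ⟨fun a b => h1.hom_ext fun v => by
        rw [Preadditive.comp_add, hψ, hψ, hψ, (hφ' v).map_add],
      fun r a => h1.hom_ext fun v => by
        rw [Linear.comp_smul, hψ, hψ, (hφ' v).map_smul]⟩
  refine ⟨u, fun v v' => ?_⟩
  rw [MonoidalCategory.tensorHom_def, Category.assoc]
  exact (congrArg (fun t => _ ≫ t) (hu v')).trans (hψ v' v)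

end IsCopower

variable {T : Type (w + 1)} [Category.{w} T] [Preadditive T] [Linear k T] {B : C ⥤ C ⥤ T}
variable {Φ : T ⥤ FunL k C C} [IsLocallyPresentable.{w} C] [IsLocallyPresentable.{w} T]

namespace MonoidalLift

variable {D : DayData k C} (S : MonoidalLift Φ D.monoidal)

/-- The universal maps into the pointwise product. -/
noncomputable def incl (t s : T) (x y : C) : (Φ.obj t).obj.obj x ⊗ (Φ.obj s).obj.obj y ⟶
    (Φ.obj (S.source.tensorObj t s)).obj.obj (x ⊗ y) :=
  S.mulElt (𝟙 _) (𝟙 _)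

theorem tensorHom_incl {t s : T} {X Y x y : C} (a : X ⟶ (Φ.obj t).obj.obj x)
    (b : Y ⟶ (Φ.obj s).obj.obj y) : (a ⊗ₘ b) ≫ S.incl t s x y = S.mulElt a b := by
  rw [incl, comp_mulElt, Category.comp_id, Category.comp_id]

theorem incl_whiskerRight {t t' s : T} (f : t ⟶ t') (x y : C) :
    S.incl t s x y ≫ (Φ.map (S.source.whiskerRight f s)).hom.app (x ⊗ y) =
      (Φ.map f).hom.app x ▷ (Φ.obj s).obj.obj y ≫ S.incl t' s x y := by
  rw [incl, mulElt_whiskerRight, ← tensorHom_id, tensorHom_incl, Category.id_comp]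

theorem incl_whiskerLeft {t s s' : T} (f : s ⟶ s') (x y : C) :
    S.incl t s x y ≫ (Φ.map (S.source.whiskerLeft t f)).hom.app (x ⊗ y) =
      (Φ.obj t).obj.obj x ◁ (Φ.map f).hom.app y ≫ S.incl t s' x y := by
  rw [incl, mulElt_whiskerLeft, ← id_tensorHom, tensorHom_incl, Category.id_comp]

theorem incl_natural {t s : T} {x x' y y' : C} (a : x ⟶ x') (b : y ⟶ y') :
    ((Φ.obj t).obj.map a ⊗ₘ (Φ.obj s).obj.map b) ≫ S.incl t s x' y' =
      S.incl t s x y ≫ (Φ.obj (S.source.tensorObj t s)).obj.map (a ⊗ₘ b) := by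
  rw [tensorHom_incl, incl, ← mulElt_map, Category.id_comp, Category.id_comp]

theorem incl_hom_ext [Φ.Faithful] {t s r : T} {α β : S.source.tensorObj t s ⟶ r}
    (h : ∀ x y, S.incl t s x y ≫ (Φ.map α).hom.app (x ⊗ y) =
      S.incl t s x y ≫ (Φ.map β).hom.app (x ⊗ y)) : α = β :=
  S.elt_ext fun {X Y x y} a b => by
    rw [← tensorHom_incl, Category.assoc, Category.assoc, h]

/-- Maps out of the pointwise product in `T` are natural families on values, by the universal
property of Day convolution and fullness of `Φ`. -/
theorem exists_desc [Φ.Full] {t s r : T}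
    (φ : ∀ x y, (Φ.obj t).obj.obj x ⊗ (Φ.obj s).obj.obj y ⟶ (Φ.obj r).obj.obj (x ⊗ y))
    (hφ : ∀ {x x' y y'} (a : x ⟶ x') (b : y ⟶ y'),
      ((Φ.obj t).obj.map a ⊗ₘ (Φ.obj s).obj.map b) ≫ φ x' y' =
        φ x y ≫ (Φ.obj r).obj.map (a ⊗ₘ b)) :
    ∃ α : S.source.tensorObj t s ⟶ r, ∀ x y,
      S.incl t s x y ≫ (Φ.map α).hom.app (x ⊗ y) = φ x y := by
  obtain ⟨α, hα⟩ := D.exists_desc φ hφ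
  have := S.isIso_day_μ t s
  refine ⟨Φ.preimage (inv (S.functor.μ t s) ≫ α), fun x y => ?_⟩
  have h1 := congrArg (fun γ => γ.hom.app (x ⊗ y)) (IsIso.hom_inv_id_assoc (S.functor.μ t s) α)
  rw [Functor.map_preimage, incl, mulElt, D.mulElt_id, Category.assoc, ← hα]
  exact congrArg (fun γ => _ ≫ γ) h1

end MonoidalLift

namespace PairingKernel

/-- A map out of `t ⊗ s` is a natural family of maps out of `Φ t x ⊗ Φ s y`, and each of these
objects is cocontinuous in `t`. So a cocone descends for every `(x, y)`, and naturality follows on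
the legs. -/
theorem ptw_preservesColimits_left (κ : PairingKernel k B (Φ ⋙ ObjectProperty.ι _))
    {D : DayData k C} (S : MonoidalLift Φ D.monoidal) [Φ.Full] [Φ.Faithful] (s : T) :
    PreservesColimitsOfSize.{w, w} ((@curriedTensor T _ S.source).flip.obj s) := by
  let _ := S.source
  refine ⟨⟨fun {K} => ⟨fun {c} hc => ⟨?_⟩⟩⟩⟩
  have hL (x y : C) : IsCocontLinear k (evalAt Φ x ⋙ tensorRight ((Φ.obj s).obj.obj y)) :=
    (κ.evalAt_isCocontLinear x).comp (tensorRight_isCocontLinear _)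
  have (x y : C) := (hL x y).cocontinuous
  let hcx (x y : C) := isColimitOfPreserves (evalAt Φ x ⋙ tensorRight ((Φ.obj s).obj.obj y)) hc
  have key (r : Cocone (K ⋙ (curriedTensor T).flip.obj s)) :
      ∃ α : c.pt ⊗ s ⟶ r.pt, ∀ j, c.ι.app j ▷ s ≫ α = r.ι.app j := by
    have h1 (x y) : ∃ u : (Φ.obj c.pt).obj.obj x ⊗ (Φ.obj s).obj.obj y ⟶
        (Φ.obj r.pt).obj.obj (x ⊗ y), ∀ j, (Φ.map (c.ι.app j)).hom.app x ▷ _ ≫ u =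
          S.incl (K.obj j) s x y ≫ (Φ.map (r.ι.app j)).hom.app (x ⊗ y) := by
      let d : Cocone (K ⋙ evalAt Φ x ⋙ tensorRight ((Φ.obj s).obj.obj y)) :=
        { pt := (Φ.obj r.pt).obj.obj (x ⊗ y)
          ι :=
            { app := fun j => S.incl (K.obj j) s x y ≫ (Φ.map (r.ι.app j)).hom.app (x ⊗ y)
              naturality := fun i j a => by
                have h2 : K.map a ▷ s ≫ r.ι.app j = r.ι.app i := r.w a
                refine ((reassoc_of% S.incl_whiskerRight (K.map a) x y) _).symm.trans ?_
                rw [← FunL.comp_app, ← Φ.map_comp]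
                refine Eq.trans ?_ (Category.comp_id _).symm
                exact congrArg (fun t => S.incl (K.obj i) s x y ≫ (Φ.map t).hom.app _) h2 } }
      exact ⟨(hcx x y).desc d, (hcx x y).fac d⟩
    choose u hu using h1
    obtain ⟨α, hα⟩ := S.exists_desc (t := c.pt) (s := s) u fun {x x' y y'} a b =>
      (hcx x y).hom_ext fun j => by
        have h2 {p q : C} (e : p ⟶ q) : (Φ.map (r.ι.app j)).hom.app p ≫ (Φ.obj r.pt).obj.map e =
            (Φ.obj (K.obj j ⊗ s)).obj.map e ≫ (Φ.map (r.ι.app j)).hom.app q :=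
          (FunL.naturality (Φ.map (r.ι.app j)) e).symm
        have h3 {p q : C} (e : p ⟶ q) : (Φ.map (c.ι.app j)).hom.app p ≫ (Φ.obj c.pt).obj.map e =
            (Φ.obj (K.obj j)).obj.map e ≫ (Φ.map (c.ι.app j)).hom.app q :=
          (FunL.naturality (Φ.map (c.ι.app j)) e).symm
        change (Φ.map (c.ι.app j)).hom.app x ▷ _ ≫ _ = (Φ.map (c.ι.app j)).hom.app x ▷ _ ≫ _
        rw [reassoc_of% hu, h2, ← reassoc_of% S.incl_natural, ← hu,
          ← tensorHom_id, ← tensorHom_id, MonoidalCategory.tensorHom_comp_tensorHom_assoc,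
          MonoidalCategory.tensorHom_comp_tensorHom_assoc, h3, Category.id_comp,
          Category.comp_id]
    refine ⟨α, fun j => S.incl_hom_ext fun x y => ?_⟩
    rw [← hu, ← hα, Φ.map_comp, FunL.comp_app]
    exact (reassoc_of% S.incl_whiskerRight (c.ι.app j) x y) _
  choose α hα using key
  refine ⟨α, hα, fun r m hm => S.incl_hom_ext fun x y => (hcx x y).hom_ext fun j => ?_⟩
  have h2 (γ : c.pt ⊗ s ⟶ r.pt) : (Φ.map (c.ι.app j)).hom.app x ▷ _ ≫ S.incl c.pt s x y ≫
      (Φ.map γ).hom.app (x ⊗ y) =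
      S.incl (K.obj j) s x y ≫ (Φ.map (c.ι.app j ▷ s ≫ γ)).hom.app (x ⊗ y) := by
    rw [Φ.map_comp, FunL.comp_app]
    exact ((reassoc_of% S.incl_whiskerRight (c.ι.app j) x y) _).symm
  refine (h2 m).trans (Eq.trans ?_ (h2 (α r)).symm)
  rw [hα]
  exact congrArg (fun t => S.incl (K.obj j) s x y ≫ (Φ.map t).hom.app _) (hm j)

theorem ptw_preservesColimits_right (κ : PairingKernel k B (Φ ⋙ ObjectProperty.ι _))
    {D : DayData k C} (S : MonoidalLift Φ D.monoidal) [Φ.Full] [Φ.Faithful] (s : T) :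
    PreservesColimitsOfSize.{w, w} ((@curriedTensor T _ S.source).obj s) := by
  let _ := S.source
  refine ⟨⟨fun {K} => ⟨fun {c} hc => ⟨?_⟩⟩⟩⟩
  have hL (x y : C) : IsCocontLinear k (evalAt Φ y ⋙ tensorLeft ((Φ.obj s).obj.obj x)) :=
    (κ.evalAt_isCocontLinear y).comp (tensorLeft_isCocontLinear _)
  have (x y : C) := (hL x y).cocontinuous
  let hcx (x y : C) := isColimitOfPreserves (evalAt Φ y ⋙ tensorLeft ((Φ.obj s).obj.obj x)) hc
  have key (r : Cocone (K ⋙ (curriedTensor T).obj s)) :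
      ∃ α : s ⊗ c.pt ⟶ r.pt, ∀ j, s ◁ c.ι.app j ≫ α = r.ι.app j := by
    have h1 (x y) : ∃ u : (Φ.obj s).obj.obj x ⊗ (Φ.obj c.pt).obj.obj y ⟶
        (Φ.obj r.pt).obj.obj (x ⊗ y), ∀ j, _ ◁ (Φ.map (c.ι.app j)).hom.app y ≫ u =
          S.incl s (K.obj j) x y ≫ (Φ.map (r.ι.app j)).hom.app (x ⊗ y) := by
      let d : Cocone (K ⋙ evalAt Φ y ⋙ tensorLeft ((Φ.obj s).obj.obj x)) :=
        { pt := (Φ.obj r.pt).obj.obj (x ⊗ y)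
          ι :=
            { app := fun j => S.incl s (K.obj j) x y ≫ (Φ.map (r.ι.app j)).hom.app (x ⊗ y)
              naturality := fun i j a => by
                have h2 : s ◁ K.map a ≫ r.ι.app j = r.ι.app i := r.w a
                refine ((reassoc_of% S.incl_whiskerLeft (K.map a) x y) _).symm.trans ?_
                rw [← FunL.comp_app, ← Φ.map_comp]
                refine Eq.trans ?_ (Category.comp_id _).symm
                exact congrArg (fun t => S.incl s (K.obj i) x y ≫ (Φ.map t).hom.app _) h2 } }
      exact ⟨(hcx x y).desc d, (hcx x y).fac d⟩
    choose u hu using h1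
    obtain ⟨α, hα⟩ := S.exists_desc (t := s) (s := c.pt) u fun {x x' y y'} a b =>
      (hcx x y).hom_ext fun j => by
        have h2 {p q : C} (e : p ⟶ q) : (Φ.map (r.ι.app j)).hom.app p ≫ (Φ.obj r.pt).obj.map e =
            (Φ.obj (s ⊗ K.obj j)).obj.map e ≫ (Φ.map (r.ι.app j)).hom.app q :=
          (FunL.naturality (Φ.map (r.ι.app j)) e).symm
        have h3 {p q : C} (e : p ⟶ q) : (Φ.map (c.ι.app j)).hom.app p ≫ (Φ.obj c.pt).obj.map e =
            (Φ.obj (K.obj j)).obj.map e ≫ (Φ.map (c.ι.app j)).hom.app q :=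
          (FunL.naturality (Φ.map (c.ι.app j)) e).symm
        change _ ◁ (Φ.map (c.ι.app j)).hom.app y ≫ _ = _ ◁ (Φ.map (c.ι.app j)).hom.app y ≫ _
        rw [reassoc_of% hu, h2, ← reassoc_of% S.incl_natural, ← hu,
          ← id_tensorHom, ← id_tensorHom, MonoidalCategory.tensorHom_comp_tensorHom_assoc,
          MonoidalCategory.tensorHom_comp_tensorHom_assoc, h3, Category.id_comp,
          Category.comp_id]
    refine ⟨α, fun j => S.incl_hom_ext fun x y => ?_⟩
    rw [← hu, ← hα, Φ.map_comp, FunL.comp_app]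
    exact (reassoc_of% S.incl_whiskerLeft (c.ι.app j) x y) _
  choose α hα using key
  refine ⟨α, hα, fun r m hm => S.incl_hom_ext fun x y => (hcx x y).hom_ext fun j => ?_⟩
  have h2 (γ : s ⊗ c.pt ⟶ r.pt) : _ ◁ (Φ.map (c.ι.app j)).hom.app y ≫ S.incl s c.pt x y ≫
      (Φ.map γ).hom.app (x ⊗ y) =
      S.incl s (K.obj j) x y ≫ (Φ.map (s ◁ c.ι.app j ≫ γ)).hom.app (x ⊗ y) := by
    rw [Φ.map_comp, FunL.comp_app]
    exact ((reassoc_of% S.incl_whiskerLeft (c.ι.app j) x y) _).symm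
  refine (h2 m).trans (Eq.trans ?_ (h2 (α r)).symm)
  rw [hα]
  exact congrArg (fun t => S.incl s (K.obj j) x y ≫ (Φ.map t).hom.app _) (hm j)

theorem ptw_isCocontBilinear (κ : PairingKernel k B (Φ ⋙ ObjectProperty.ι _))
    {D : DayData k C} (S : MonoidalLift Φ D.monoidal) [Φ.Full] [Φ.Faithful] :
    IsCocontBilinear k (@curriedTensor T _ S.source) := by
  have := monoidalPreadditive k C
  have := monoidalLinear k C
  let _ := S.source
  exact
    { left := fun s =>
        { additive := ⟨fun {t t' f g} => S.incl_hom_ext fun x y => by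
            change S.incl t s x y ≫ (Φ.map (S.source.whiskerRight (f + g) s)).hom.app _ =
              S.incl t s x y ≫ (Φ.map (S.source.whiskerRight f s +
                S.source.whiskerRight g s)).hom.app _
            rw [κ.map_add_app, Preadditive.comp_add, S.incl_whiskerRight, S.incl_whiskerRight,
              S.incl_whiskerRight, κ.map_add_app, MonoidalPreadditive.add_whiskerRight,
              Preadditive.add_comp]⟩
          linear := ⟨fun {t t'} f r => S.incl_hom_ext fun x y => by
            change S.incl t s x y ≫ (Φ.map (S.source.whiskerRight (r • f) s)).hom.app _ =
              S.incl t s x y ≫ (Φ.map (r • S.source.whiskerRight f s)).hom.app _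
            rw [κ.map_smul_app, Linear.comp_smul, S.incl_whiskerRight, S.incl_whiskerRight,
              κ.map_smul_app, MonoidalLinear.smul_whiskerRight, Linear.smul_comp]⟩
          cocontinuous := κ.ptw_preservesColimits_left S s }
      right := fun s =>
        { additive := ⟨fun {t t' f g} => S.incl_hom_ext fun x y => by
            change S.incl s t x y ≫ (Φ.map (S.source.whiskerLeft s (f + g))).hom.app _ =
              S.incl s t x y ≫ (Φ.map (S.source.whiskerLeft s f +
                S.source.whiskerLeft s g)).hom.app _
            rw [κ.map_add_app, Preadditive.comp_add, S.incl_whiskerLeft, S.incl_whiskerLeft,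
              S.incl_whiskerLeft, κ.map_add_app, MonoidalPreadditive.whiskerLeft_add,
              Preadditive.add_comp]⟩
          linear := ⟨fun {t t'} f r => S.incl_hom_ext fun x y => by
            change S.incl s t x y ≫ (Φ.map (S.source.whiskerLeft s (r • f))).hom.app _ =
              S.incl s t x y ≫ (Φ.map (r • S.source.whiskerLeft s f)).hom.app _
            rw [κ.map_smul_app, Linear.comp_smul, S.incl_whiskerLeft, S.incl_whiskerLeft,
              κ.map_smul_app, MonoidalLinear.whiskerLeft_smul, Linear.smul_comp]⟩
          cocontinuous := κ.ptw_preservesColimits_right S s } }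

end PairingKernel

end Pointwise

end PrL

namespace PrL

/-! ### The multiplication of evaluation pairings -/

section EvMul

variable {C : Type (w + 1)} [Category.{w} C] [Preadditive C] [MonoidalCategory C]
  [IsLocallyPresentable.{w} C]

theorem evMul_comp_left {a₂ b₁ b₁' c₂ d₁ d₁' : C} (f : 𝟙_ C ⟶ a₂ ⊗ b₁) (g : 𝟙_ C ⟶ c₂ ⊗ d₁)
    (s : b₁ ⟶ b₁') (t : d₁ ⟶ d₁') :
    evMul f g ≫ (c₂ ⊗ a₂) ◁ (s ⊗ₘ t) = evMul (f ≫ a₂ ◁ s) (g ≫ c₂ ◁ t) := by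
  have h : ((λ_ d₁).inv ≫ f ▷ d₁ ≫ (α_ a₂ b₁ d₁).hom) ≫ a₂ ◁ (s ⊗ₘ t) =
      t ≫ (λ_ d₁').inv ≫ (f ≫ a₂ ◁ s) ▷ d₁' ≫ (α_ a₂ b₁' d₁').hom := by
    rw [leftUnitor_inv_naturality_assoc, whisker_exchange_assoc, MonoidalCategory.tensorHom_def]
    simp
  rw [evMul, evMul]
  simp only [Category.assoc, ← MonoidalCategory.whiskerLeft_comp_assoc]
  rw [← h]
  simp

theorem evMul_comp_right {a₂ a₂' b₁ c₂ c₂' d₁ : C} (f : 𝟙_ C ⟶ a₂ ⊗ b₁) (g : 𝟙_ C ⟶ c₂ ⊗ d₁)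
    (p : a₂ ⟶ a₂') (q : c₂ ⟶ c₂') :
    evMul f g ≫ (q ⊗ₘ p) ▷ (b₁ ⊗ d₁) = evMul (f ≫ p ▷ b₁) (g ≫ q ▷ d₁) := by
  rw [evMul, evMul, Category.assoc g (q ▷ d₁), ← whisker_exchange_assoc]
  simp only [MonoidalCategory.tensorHom_def']
  simp

theorem evMul_assoc {a x b y c z : C} (f : 𝟙_ C ⟶ a ⊗ x) (g : 𝟙_ C ⟶ b ⊗ y)
    (h : 𝟙_ C ⟶ c ⊗ z) :
    evMul (evMul f g) h ≫ (α_ c b a).inv ▷ ((x ⊗ y) ⊗ z) =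
      evMul f (evMul g h) ≫ ((c ⊗ b) ⊗ a) ◁ (α_ x y z).inv := by
  simp only [evMul]
  monoidal

theorem evMul_leftUnitor {a x : C} (f : 𝟙_ C ⟶ a ⊗ x) :
    evMul (λ_ (𝟙_ C)).inv f ≫ (ρ_ a).hom ▷ (𝟙_ C ⊗ x) = f ≫ a ◁ (λ_ x).inv := by
  simp only [evMul]
  monoidal

theorem evMul_rightUnitor {a x : C} (f : 𝟙_ C ⟶ a ⊗ x) :
    evMul f (λ_ (𝟙_ C)).inv ≫ (λ_ a).hom ▷ (x ⊗ 𝟙_ C) = f ≫ a ◁ (ρ_ x).inv := by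
  simp only [evMul]
  monoidal

/-- The nested coevaluation of a product of dual pairs is the product of the coevaluations; this is
why `evMul` reverses the order of the first factors. -/
theorem coevaluation_tensor {a x b y : C} [ExactPairing a x] [ExactPairing b y] :
    η_ (b ⊗ a) (x ⊗ y) = evMul (η_ a x) (η_ b y) := by
  change η_ b y ⊗≫ (b ◁ η_ a x) ▷ y ⊗≫ 𝟙 _ = _
  simp only [evMul]
  monoidal

/-- Contracting nested elements against nested pairings is done independently on the two layers; the
exchange law moves `e'` past the inserted `u`. -/
theorem pairingInsert_evMul {c₁ c₂ d₁ d₂ x y : C} (u : 𝟙_ C ⟶ c₂ ⊗ x) (v : 𝟙_ C ⟶ d₂ ⊗ y)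
    (e : c₁ ⊗ c₂ ⟶ 𝟙_ C) (e' : d₁ ⊗ d₂ ⟶ 𝟙_ C) :
    pairingInsert (c₁ ⊗ d₁) (evMul u v) ≫ ((α_ c₁ d₁ (d₂ ⊗ c₂)).hom ≫
        c₁ ◁ ((α_ d₁ d₂ c₂).inv ≫ e' ▷ c₂ ≫ (λ_ c₂).hom) ≫ e) ▷ (x ⊗ y) ≫ (λ_ (x ⊗ y)).hom =
      (pairingInsert c₁ u ≫ e ▷ x ≫ (λ_ x).hom) ⊗ₘ (pairingInsert d₁ v ≫ e' ▷ y ≫ (λ_ y).hom) := by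
  have h : (d₁ ⊗ d₂) ◁ ((λ_ y).inv ≫ u ▷ y ≫ (α_ c₂ x y).hom) ≫ e' ▷ (c₂ ⊗ x ⊗ y) =
      e' ▷ y ≫ 𝟙_ C ◁ ((λ_ y).inv ≫ u ▷ y ≫ (α_ c₂ x y).hom) := whisker_exchange _ _
  calc _ = 𝟙 _ ⊗≫ c₁ ◁ (d₁ ◁ v) ⊗≫ c₁ ◁ ((d₁ ⊗ d₂) ◁ ((λ_ y).inv ≫ u ▷ y ≫ (α_ c₂ x y).hom) ≫
        e' ▷ (c₂ ⊗ x ⊗ y)) ⊗≫ e ▷ (x ⊗ y) ⊗≫ 𝟙 _ := by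
        simp only [pairingInsert, evMul]
        monoidal
    _ = _ := by
        rw [h, MonoidalCategory.tensorHom_def']
        simp only [pairingInsert]
        monoidal

end EvMul

/-! ### Strong monoidality of the pure tensor functor for the pointwise product -/

section BoxMonoidal

variable {k : Type w} [Field k]
variable {C : Type (w + 1)} [Category.{w} C] [Preadditive C] [Linear k C]
variable [MonoidalCategory C] [CocontMonoidal k C]

theorem IsCopower.hom_ext_tensor_triple {V V' V'' : Type w} [AddCommGroup V] [Module k V]
    [AddCommGroup V'] [Module k V'] [AddCommGroup V''] [Module k V''] {X Y Z P Q R : C}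
    {ι : V → (X ⟶ P)} {κ : V' → (Y ⟶ Q)} {ζ : V'' → (Z ⟶ R)}
    (hι : IsCopower k ι) (hκ : IsCopower k κ) (hζ : IsCopower k ζ) {W : C}
    {f g : (P ⊗ Q) ⊗ R ⟶ W}
    (h : ∀ v v' v'', ((ι v ⊗ₘ κ v') ⊗ₘ ζ v'') ≫ f = ((ι v ⊗ₘ κ v') ⊗ₘ ζ v'') ≫ g) : f = g := by
  refine (hζ.map (tensorLeft_isCocontLinear (P ⊗ Q))).hom_ext fun v'' => ?_
  refine (hκ.map ((tensorLeft_isCocontLinear P).comp (tensorRight_isCocontLinear Z))).hom_ext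
    fun v' => ?_
  refine (hι.map ((tensorRight_isCocontLinear Y).comp (tensorRight_isCocontLinear Z))).hom_ext
    fun v => ?_
  have := h v v' v''
  simp only [MonoidalCategory.tensorHom_def, comp_whiskerRight, Category.assoc] at this
  exact this

variable {T : Type (w + 1)} [Category.{w} T] [Preadditive T] [Linear k T] {B : C ⥤ C ⥤ T}
variable {Φ : T ⥤ FunL k C C} [IsLocallyPresentable.{w} C] [IsLocallyPresentable.{w} T]

theorem evMul_isLinearMap_left {a₂ b₁ c₂ d₁ : C} (g : 𝟙_ C ⟶ c₂ ⊗ d₁) :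
    IsLinearMap k fun f : 𝟙_ C ⟶ a₂ ⊗ b₁ => evMul f g := by
  have := monoidalPreadditive k C
  have := monoidalLinear k C
  exact ⟨fun a b => by simp [evMul], fun r a => by simp [evMul]⟩

theorem evMul_isLinearMap_right {a₂ b₁ c₂ d₁ : C} (f : 𝟙_ C ⟶ a₂ ⊗ b₁) :
    IsLinearMap k fun g : 𝟙_ C ⟶ c₂ ⊗ d₁ => evMul f g :=
  ⟨fun a b => by simp [evMul], fun r a => by simp [evMul]⟩

namespace PairingKernel

variable (κ : PairingKernel k B (Φ ⋙ ObjectProperty.ι _))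
variable {D : DayData k C} (S : MonoidalLift Φ D.monoidal) [Φ.Full] [Φ.Faithful]

theorem box_hom_ext {a₁ a₂ b₁ b₂ : C} {r : T}
    {α β : S.source.tensorObj ((B.obj a₁).obj a₂) ((B.obj b₁).obj b₂) ⟶ r}
    (h : ∀ {x y} (f : 𝟙_ C ⟶ a₂ ⊗ x) (g : 𝟙_ C ⟶ b₂ ⊗ y),
      S.mulElt (κ.elt f) (κ.elt g) ≫ (Φ.map α).hom.app (x ⊗ y) =
        S.mulElt (κ.elt f) (κ.elt g) ≫ (Φ.map β).hom.app (x ⊗ y)) : α = β :=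
  S.incl_hom_ext fun x y =>
    (κ.elt_isCopower a₁ a₂ x).hom_ext_tensor (κ.elt_isCopower b₁ b₂ y) fun f g => by
      rw [← Category.assoc, ← Category.assoc, S.tensorHom_incl]
      exact h f g

theorem box_hom_ext_triple {a₁ a₂ b₁ b₂ c₁ c₂ : C} {r : T}
    {α β : S.source.tensorObj (S.source.tensorObj ((B.obj a₁).obj a₂) ((B.obj b₁).obj b₂))
      ((B.obj c₁).obj c₂) ⟶ r}
    (h : ∀ {x y z} (f : 𝟙_ C ⟶ a₂ ⊗ x) (g : 𝟙_ C ⟶ b₂ ⊗ y) (l : 𝟙_ C ⟶ c₂ ⊗ z),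
      S.mulElt (S.mulElt (κ.elt f) (κ.elt g)) (κ.elt l) ≫ (Φ.map α).hom.app ((x ⊗ y) ⊗ z) =
        S.mulElt (S.mulElt (κ.elt f) (κ.elt g)) (κ.elt l) ≫ (Φ.map β).hom.app ((x ⊗ y) ⊗ z)) :
    α = β := by
  refine S.elt_ext_triple fun {X Y Z x y z} a b c => ?_
  have h1 {X Y Z : C} (a : X ⟶ (Φ.obj ((B.obj a₁).obj a₂)).obj.obj x)
      (b : Y ⟶ (Φ.obj ((B.obj b₁).obj b₂)).obj.obj y)
      (c : Z ⟶ (Φ.obj ((B.obj c₁).obj c₂)).obj.obj z) :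
      S.mulElt (S.mulElt a b) c = ((a ⊗ₘ b) ⊗ₘ c) ≫ S.mulElt (S.mulElt (𝟙 _) (𝟙 _)) (𝟙 _) := by
    rw [S.comp_mulElt, S.comp_mulElt, Category.comp_id, Category.comp_id, Category.comp_id]
  rw [h1, Category.assoc, Category.assoc]
  congr 1
  refine (κ.elt_isCopower a₁ a₂ x).hom_ext_tensor_triple (κ.elt_isCopower b₁ b₂ y)
    (κ.elt_isCopower c₁ c₂ z) fun f g l => ?_
  rw [← Category.assoc, ← Category.assoc, ← h1]
  exact h f g l

/-- `evMul` is bilinear and natural in the indices, so it descends from pairs of elements to the Day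
convolution of the two functors. -/
theorem exists_boxMul (a₁ a₂ b₁ b₂ : C) :
    ∃ m : S.source.tensorObj ((B.obj a₁).obj a₂) ((B.obj b₁).obj b₂) ⟶
        (B.obj (a₁ ⊗ b₁)).obj (b₂ ⊗ a₂), ∀ {x y} (f : 𝟙_ C ⟶ a₂ ⊗ x) (g : 𝟙_ C ⟶ b₂ ⊗ y),
      S.mulElt (κ.elt f) (κ.elt g) ≫ (Φ.map m).hom.app (x ⊗ y) = κ.elt (evMul f g) := by
  have hE (x y : C) := κ.elt_isCopower (a₁ ⊗ b₁) (b₂ ⊗ a₂) (x ⊗ y)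
  choose u hu using fun x y => (κ.elt_isCopower a₁ a₂ x).exists_desc_tensor
    (κ.elt_isCopower b₁ b₂ y) (fun f g => κ.elt (c₁ := a₁ ⊗ b₁) (evMul f g))
    (fun g => ⟨fun a b => by
        rw [(evMul_isLinearMap_left (k := k) g).map_add, (hE x y).linear.map_add],
      fun r a => by rw [(evMul_isLinearMap_left (k := k) g).map_smul, (hE x y).linear.map_smul]⟩)
    (fun f => ⟨fun a b => by
        rw [(evMul_isLinearMap_right (k := k) f).map_add, (hE x y).linear.map_add],
      fun r a => by rw [(evMul_isLinearMap_right (k := k) f).map_smul, (hE x y).linear.map_smul]⟩)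
  obtain ⟨m, hm⟩ := S.exists_desc u fun {x x' y y'} s t =>
    (κ.elt_isCopower a₁ a₂ x).hom_ext_tensor (κ.elt_isCopower b₁ b₂ y) fun f g => by
      rw [MonoidalCategory.tensorHom_comp_tensorHom_assoc, elt_map, elt_map, hu, reassoc_of% hu,
        elt_map, evMul_comp_left]
  refine ⟨m, fun {x y} f g => ?_⟩
  rw [← S.tensorHom_incl, Category.assoc, hm, hu]

/-- `(a₁ ⊠ a₂) ⊗ (b₁ ⊠ b₂) ⟶ (a₁ ⊗ b₁) ⊠ (b₂ ⊗ a₂)` -/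
noncomputable def boxMul (a₁ a₂ b₁ b₂ : C) :
    S.source.tensorObj ((B.obj a₁).obj a₂) ((B.obj b₁).obj b₂) ⟶
      (B.obj (a₁ ⊗ b₁)).obj (b₂ ⊗ a₂) :=
  (κ.exists_boxMul S a₁ a₂ b₁ b₂).choose

theorem mulElt_boxMul {a₁ a₂ b₁ b₂ x y : C} (f : 𝟙_ C ⟶ a₂ ⊗ x) (g : 𝟙_ C ⟶ b₂ ⊗ y) :
    S.mulElt (κ.elt f) (κ.elt g) ≫ (Φ.map (κ.boxMul S a₁ a₂ b₁ b₂)).hom.app (x ⊗ y) =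
      κ.elt (evMul f g) :=
  (κ.exists_boxMul S a₁ a₂ b₁ b₂).choose_spec f g

theorem boxMul_natural {a₁ a₁' a₂ a₂' b₁ b₁' b₂ b₂' : C} (a : a₁ ⟶ a₁') (b : a₂ ⟶ a₂')
    (c : b₁ ⟶ b₁') (d : b₂ ⟶ b₂') :
    S.source.tensorHom (boxMap B a b) (boxMap B c d) ≫ κ.boxMul S a₁' a₂' b₁' b₂' =
      κ.boxMul S a₁ a₂ b₁ b₂ ≫ boxMap B (a ⊗ₘ c) (d ⊗ₘ b) :=
  κ.box_hom_ext S fun f g => by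
    rw [Φ.map_comp, Φ.map_comp, FunL.comp_app, FunL.comp_app,
      reassoc_of% S.mulElt_tensorHom, elt_boxMap, elt_boxMap, ← S.comp_mulElt, Category.assoc,
      mulElt_boxMul, reassoc_of% κ.mulElt_boxMul, elt_boxMap, evMul_comp_right]

theorem boxMul_natural_left {a₁ a₁' a₂ a₂' : C} (a : a₁ ⟶ a₁') (b : a₂ ⟶ a₂') (b₁ b₂ : C) :
    S.source.whiskerRight (boxMap B a b) ((B.obj b₁).obj b₂) ≫ κ.boxMul S a₁' a₂' b₁ b₂ =
      κ.boxMul S a₁ a₂ b₁ b₂ ≫ boxMap B (a ▷ b₁) (b₂ ◁ b) := by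
  let _ := S.source
  rw [← tensorHom_id a b₁, ← id_tensorHom b₂ b, ← boxMul_natural, boxMap_id]
  exact congrArg (fun t => t ≫ _) (tensorHom_id _ _).symm

theorem boxMul_natural_right (a₁ a₂ : C) {b₁ b₁' b₂ b₂' : C} (c : b₁ ⟶ b₁') (d : b₂ ⟶ b₂') :
    S.source.whiskerLeft ((B.obj a₁).obj a₂) (boxMap B c d) ≫ κ.boxMul S a₁ a₂ b₁' b₂' =
      κ.boxMul S a₁ a₂ b₁ b₂ ≫ boxMap B (a₁ ◁ c) (d ▷ a₂) := by
  let _ := S.source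
  rw [← tensorHom_id d a₂, ← id_tensorHom a₁ c, ← boxMul_natural, boxMap_id]
  exact congrArg (fun t => t ≫ _) (id_tensorHom _ _).symm

/-- The objects `b₂ ⊗ a₂` and `x₀ ⊗ y₀` are dual, so a map out of `(a₁ ⊗ b₁) ⊠ (b₂ ⊗ a₂)` is fixed
by its value on the coevaluation. The inverse sends that, a product of coevaluations, to the product
of the two universal elements. -/
theorem boxMul_isIso_of_exactPairing (h : IsTensorProduct k B) (a₁ a₂ b₁ b₂ x₀ y₀ : C)
    [ExactPairing a₂ x₀] [ExactPairing b₂ y₀] : IsIso (κ.boxMul S a₁ a₂ b₁ b₂) := by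
  have hb (t : T) := κ.bijective_evaluation_tensor h (a₁ ⊗ b₁) (b₂ ⊗ a₂) (x₀ ⊗ y₀) t
  obtain ⟨ν, hν⟩ := (hb _).2 (S.mulElt (κ.elt (c₁ := a₁) (η_ a₂ x₀)) (κ.elt (c₁ := b₁) (η_ b₂ y₀)))
  have hν : κ.elt (evMul (η_ a₂ x₀) (η_ b₂ y₀)) ≫ (Φ.map ν).hom.app (x₀ ⊗ y₀) =
      S.mulElt (κ.elt (η_ a₂ x₀)) (κ.elt (η_ b₂ y₀)) := by
    rw [← hν, coevaluation_tensor]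
    rfl
  refine ⟨ν, κ.box_hom_ext S fun {x y} f g => ?_, (hb _).1 ?_⟩
  · rw [Φ.map_comp, FunL.comp_app, reassoc_of% κ.mulElt_boxMul, Φ.map_id, FunL.id_app,
      Category.comp_id]
    -- Arbitrary elements are rewritten as images of the coevaluations, on which the inverse is
    -- known, and are restored at the end by naturality.
    conv_lhs => rw [← coevaluation_contractLeft (y := x₀) f, ← coevaluation_contractLeft (y := y₀) g]
    rw [← evMul_comp_left, ← elt_map, Category.assoc, FunL.naturality, reassoc_of% hν,
      ← S.mulElt_map, elt_map, elt_map, coevaluation_contractLeft, coevaluation_contractLeft]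
  · change κ.elt (η_ (b₂ ⊗ a₂) (x₀ ⊗ y₀)) ≫ (Φ.map (ν ≫ κ.boxMul S a₁ a₂ b₁ b₂)).hom.app _ =
      κ.elt (η_ (b₂ ⊗ a₂) (x₀ ⊗ y₀)) ≫ (Φ.map (𝟙 _)).hom.app _
    rw [Φ.map_comp, FunL.comp_app, Φ.map_id, FunL.id_app, coevaluation_tensor, reassoc_of% hν,
      mulElt_boxMul, Category.comp_id]

/-- Source and target are cocontinuous in `a₂` and in `b₂`, so these may be taken compact
projective, hence with right duals; the first factors stay arbitrary. -/
theorem boxMul_isIso (hC : IsCpRigid k C) (h : IsTensorProduct k B) (a₁ a₂ b₁ b₂ : C) :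
    IsIso (κ.boxMul S a₁ a₂ b₁ b₂) := by
  let _ := S.source
  let α₁ (b₂ : C) : B.obj a₁ ⋙ (curriedTensor T).flip.obj ((B.obj b₁).obj b₂) ⟶
      tensorLeft b₂ ⋙ B.obj (a₁ ⊗ b₁) :=
    { app := fun a₂ => κ.boxMul S a₁ a₂ b₁ b₂
      naturality := fun a₂ a₂' e => by
        have := κ.boxMul_natural_left S (𝟙 a₁) e b₁ b₂
        rw [id_whiskerRight, ← obj_map_eq_boxMap, ← obj_map_eq_boxMap] at this
        exact this }
  let α₂ : B.obj b₁ ⋙ (curriedTensor T).obj ((B.obj a₁).obj a₂) ⟶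
      tensorRight a₂ ⋙ B.obj (a₁ ⊗ b₁) :=
    { app := fun b₂ => κ.boxMul S a₁ a₂ b₁ b₂
      naturality := fun b₂ b₂' e => by
        have := κ.boxMul_natural_right S a₁ a₂ (𝟙 b₁) e
        rw [MonoidalCategory.whiskerLeft_id, ← obj_map_eq_boxMap, ← obj_map_eq_boxMap] at this
        exact this }
  have hb := κ.ptw_isCocontBilinear S
  have h1 (b₂) := ((h.bilinear.right a₁).comp (hb.left ((B.obj b₁).obj b₂))).cocontinuous
  have h2 (b₂) := ((tensorLeft_isCocontLinear (k := k) b₂).comp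
    (h.bilinear.right (a₁ ⊗ b₁))).cocontinuous
  have h3 := ((h.bilinear.right b₁).comp (hb.right ((B.obj a₁).obj a₂))).cocontinuous
  have h4 := ((tensorRight_isCocontLinear (k := k) a₂).comp
    (h.bilinear.right (a₁ ⊗ b₁))).cocontinuous
  refine cp_induction k hC.enough (colimitClosed_isIso α₂) (fun b₂ hb₂ => ?_) b₂
  refine cp_induction k hC.enough (colimitClosed_isIso (α₁ b₂)) (fun a₂ ha₂ => ?_) a₂
  obtain ⟨_⟩ := hC.rightDual a₂ ha₂
  obtain ⟨_⟩ := hC.rightDual b₂ hb₂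
  exact κ.boxMul_isIso_of_exactPairing S h a₁ a₂ b₁ b₂ a₂ᘁ b₂ᘁ

theorem exists_boxUnit : ∃ e : S.source.tensorUnit ≅ (B.obj (𝟙_ C)).obj (𝟙_ C),
    S.unitElt ≫ (Φ.map e.hom).hom.app (𝟙_ C) = κ.elt (λ_ (𝟙_ C)).inv := by
  obtain ⟨e, he⟩ : ∃ e : S.source.tensorUnit ⟶ (B.obj (𝟙_ C)).obj (𝟙_ C),
      S.unitElt ≫ (Φ.map e).hom.app (𝟙_ C) = κ.elt (λ_ (𝟙_ C)).inv := by
    obtain ⟨α, hα⟩ := D.unit_exists_hom (M := Φ.obj ((B.obj (𝟙_ C)).obj (𝟙_ C)))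
      (κ.elt (λ_ (𝟙_ C)).inv)
    have := S.isIso_day_ε
    refine ⟨Φ.preimage (inv S.functor.ε ≫ α), ?_⟩
    have h1 := congrArg (fun γ => γ.hom.app (𝟙_ C)) (IsIso.hom_inv_id_assoc S.functor.ε α)
    rw [Functor.map_preimage, MonoidalLift.unitElt, Category.assoc, ← hα]
    exact congrArg (fun γ => _ ≫ γ) h1
  have := (Φ.obj S.source.tensorUnit).property.additive
  have := (Φ.obj S.source.tensorUnit).property.linear
  -- The inverse: an element of `ev(𝟙, d)` is a morphism `𝟙 ⟶ d` after removing the unit, and such a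
  -- morphism carries the generic element of `J` along.
  obtain ⟨e', he'⟩ := κ.exists_elt_hom (c₁ := 𝟙_ C) (c₂ := 𝟙_ C) (t := S.source.tensorUnit)
    (fun d f => S.unitElt ≫ (Φ.obj S.source.tensorUnit).obj.map (f ≫ (λ_ d).hom))
    (fun d => ⟨fun a b => by simp, fun r a => by simp [Functor.map_smul]⟩)
    (fun a f => by rw [Category.assoc, ← Functor.map_comp, Category.assoc, Category.assoc,
      leftUnitor_naturality])
  refine ⟨⟨e, e', S.unit_ext ?_, κ.elt_hom_ext fun f => ?_⟩, he⟩
  · rw [Φ.map_comp, FunL.comp_app, reassoc_of% he, he', Iso.inv_hom_id,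
      CategoryTheory.Functor.map_id, Φ.map_id, FunL.id_app]
  · rw [Φ.map_comp, FunL.comp_app, reassoc_of% he', FunL.naturality, reassoc_of% he, elt_map,
      MonoidalCategory.whiskerLeft_comp, Φ.map_id, FunL.id_app, Category.comp_id]
    congr 1
    rw [← leftUnitor_inv_naturality_assoc]
    monoidal

/-- `J ≅ 𝟙 ⊠ 𝟙` -/
noncomputable def boxUnit : S.source.tensorUnit ≅ (B.obj (𝟙_ C)).obj (𝟙_ C) :=
  (κ.exists_boxUnit S).choose

theorem unitElt_boxUnit :
    S.unitElt ≫ (Φ.map (κ.boxUnit S).hom).hom.app (𝟙_ C) = κ.elt (λ_ (𝟙_ C)).inv :=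
  (κ.exists_boxUnit S).choose_spec

/-- On three elements both sides multiply the pairings, so this is associativity of `evMul`; the
reversed order in the second factor explains the inverse associator there. -/
theorem boxMul_associator (a₁ a₂ b₁ b₂ c₁ c₂ : C) :
    S.source.whiskerRight (κ.boxMul S a₁ a₂ b₁ b₂) ((B.obj c₁).obj c₂) ≫
        κ.boxMul S (a₁ ⊗ b₁) (b₂ ⊗ a₂) c₁ c₂ ≫
        boxMap B (α_ a₁ b₁ c₁).hom (α_ c₂ b₂ a₂).inv =
      (S.source.associator ((B.obj a₁).obj a₂) ((B.obj b₁).obj b₂) ((B.obj c₁).obj c₂)).hom ≫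
        S.source.whiskerLeft ((B.obj a₁).obj a₂) (κ.boxMul S b₁ b₂ c₁ c₂) ≫
        κ.boxMul S a₁ a₂ (b₁ ⊗ c₁) (c₂ ⊗ b₂) :=
  κ.box_hom_ext_triple S fun f g l => by
    simp only [Φ.map_comp, FunL.comp_app]
    rw [reassoc_of% S.mulElt_whiskerRight, mulElt_boxMul, reassoc_of% κ.mulElt_boxMul, elt_boxMap,
      evMul_assoc, reassoc_of% S.mulElt_associator, FunL.naturality_assoc, FunL.naturality,
      reassoc_of% S.mulElt_whiskerLeft, mulElt_boxMul, reassoc_of% κ.mulElt_boxMul, elt_map]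

theorem boxMul_leftUnitor (a₁ a₂ : C) :
    S.source.whiskerRight (κ.boxUnit S).hom ((B.obj a₁).obj a₂) ≫
        κ.boxMul S (𝟙_ C) (𝟙_ C) a₁ a₂ ≫ boxMap B (λ_ a₁).hom (ρ_ a₂).hom =
      (S.source.leftUnitor ((B.obj a₁).obj a₂)).hom := by
  refine S.elt_ext_left fun {Y y} b => ?_
  -- Factoring an arbitrary element through the identity one lets it be replaced by the elements
  -- attached to `f ∈ ev(a₂, y)`, which suffice by the tensor property.
  have h1 {Y : C} (b : Y ⟶ (Φ.obj ((B.obj a₁).obj a₂)).obj.obj y) :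
      S.mulElt S.unitElt b = (𝟙_ C ◁ b) ≫ S.mulElt S.unitElt (𝟙 _) := by
    rw [← id_tensorHom, S.comp_mulElt, Category.comp_id, Category.id_comp]
  rw [h1, Category.assoc, Category.assoc]
  congr 1
  refine ((κ.elt_isCopower a₁ a₂ y).map (tensorLeft_isCocontLinear (𝟙_ C))).hom_ext fun f => ?_
  change (𝟙_ C ◁ κ.elt f) ≫ _ = (𝟙_ C ◁ κ.elt f) ≫ _
  rw [← Category.assoc (𝟙_ C ◁ κ.elt f), ← Category.assoc (𝟙_ C ◁ κ.elt f), ← h1]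
  simp only [Φ.map_comp, FunL.comp_app]
  rw [reassoc_of% S.mulElt_whiskerRight, unitElt_boxUnit, reassoc_of% κ.mulElt_boxMul, elt_boxMap,
    evMul_leftUnitor, S.mulElt_leftUnitor, elt_map]

theorem boxMul_rightUnitor (a₁ a₂ : C) :
    S.source.whiskerLeft ((B.obj a₁).obj a₂) (κ.boxUnit S).hom ≫
        κ.boxMul S a₁ a₂ (𝟙_ C) (𝟙_ C) ≫ boxMap B (ρ_ a₁).hom (λ_ a₂).hom =
      (S.source.rightUnitor ((B.obj a₁).obj a₂)).hom := by
  refine S.elt_ext_right fun {Y y} b => ?_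
  have h1 {Y : C} (b : Y ⟶ (Φ.obj ((B.obj a₁).obj a₂)).obj.obj y) :
      S.mulElt b S.unitElt = (b ▷ 𝟙_ C) ≫ S.mulElt (𝟙 _) S.unitElt := by
    rw [← tensorHom_id, S.comp_mulElt, Category.comp_id, Category.id_comp]
  rw [h1, Category.assoc, Category.assoc]
  congr 1
  refine ((κ.elt_isCopower a₁ a₂ y).map (tensorRight_isCocontLinear (𝟙_ C))).hom_ext fun f => ?_
  change (κ.elt f ▷ 𝟙_ C) ≫ _ = (κ.elt f ▷ 𝟙_ C) ≫ _
  rw [← Category.assoc (κ.elt f ▷ 𝟙_ C), ← Category.assoc (κ.elt f ▷ 𝟙_ C), ← h1]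
  simp only [Φ.map_comp, FunL.comp_app]
  rw [reassoc_of% S.mulElt_whiskerLeft, unitElt_boxUnit, reassoc_of% κ.mulElt_boxMul, elt_boxMap,
    evMul_rightUnitor, S.mulElt_rightUnitor, elt_map]

section

variable (hC : IsCpRigid k C) (h : IsTensorProduct k B)

/-- The strong monoidal structure on `⊠ : C × C^{⊗op} → C ⊗ C^{⊗op}`. -/
noncomputable def boxCoreMonoidal :
    @Functor.CoreMonoidal (C × Cᴹᵒᵖ) _ _ T _ S.source (boxRev B) :=
  letI := S.source
  { εIso := κ.boxUnit S
    μIso := fun X Y =>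
      @asIso _ _ _ _ (κ.boxMul S X.1 X.2.unmop Y.1 Y.2.unmop)
        (κ.boxMul_isIso S hC h X.1 X.2.unmop Y.1 Y.2.unmop)
    μIso_hom_natural_left := fun f _ => κ.boxMul_natural_left S f.1 f.2.unmop _ _
    μIso_hom_natural_right := fun _ f => κ.boxMul_natural_right S _ _ f.1 f.2.unmop
    associativity := fun _ _ _ => κ.boxMul_associator S _ _ _ _ _ _
    left_unitality := fun _ => (κ.boxMul_leftUnitor S _ _).symm
    right_unitality := fun _ => (κ.boxMul_rightUnitor S _ _).symm }

/-- The pointwise product. -/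
noncomputable def pointwiseProduct : PointwiseProduct k B where
  monoidal := S.source
  bilinear := κ.ptw_isCocontBilinear S
  boxMonoidal := letI := S.source; (κ.boxCoreMonoidal S hC h).toMonoidal

end

end PairingKernel

end BoxMonoidal

end PrL

namespace PrL

/-! ### Restriction of actions along strong monoidal functors -/

section Restriction

open MonoidalLeftAction Functor.LaxMonoidal Functor.OplaxMonoidal Functor.Monoidal

variable {M : Type u} [Category.{v} M] [MonoidalCategory M]
  {N : Type u'} [Category.{v'} N] [MonoidalCategory N] {C : Type (w + 1)} [Category.{w} C]

/-- The restriction of an action along a strong monoidal functor. -/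
@[reducible]
def restrictAction (C : Type (w + 1)) [Category.{w} C] [MonoidalLeftAction N C] (F : M ⥤ N)
    [F.Monoidal] : MonoidalLeftAction M C where
  actionObj m c := F.obj m ⊙ₗ c
  actionHomLeft f c := F.map f ⊵ₗ c
  actionHomRight m _ _ g := F.obj m ⊴ₗ g
  actionAssocIso m m' c :=
    ((curriedAction N C).mapIso (μIso F m m')).symm.app c ≪≫ αₗ (F.obj m) (F.obj m') c
  actionUnitIso c := ((curriedAction N C).mapIso (εIso F)).symm.app c ≪≫ λₗ c
  actionHom_comp {c _ _ d _ _} f₁ f₂ g₁ g₂ := by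
    change F.map (f₁ ≫ f₂) ⊵ₗ d ≫ _ ⊴ₗ (g₁ ≫ g₂) =
      (F.map f₁ ⊵ₗ d ≫ _ ⊴ₗ g₁) ≫ F.map f₂ ⊵ₗ _ ≫ _ ⊴ₗ g₂
    rw [F.map_comp, comp_actionHomLeft, actionHomRight_comp, Category.assoc, Category.assoc,
      action_exchange_assoc]
  actionAssocIso_hom_naturality {c₁ c₂ c₃ c₄ d₁ d₂} f g h := by
    change (F.map (f ⊗ₘ g) ⊵ₗ d₁ ≫ F.obj (c₂ ⊗ c₄) ⊴ₗ h) ≫ δ F c₂ c₄ ⊵ₗ d₂ ≫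
        (αₗ (F.obj c₂) (F.obj c₄) d₂).hom =
      (δ F c₁ c₃ ⊵ₗ d₁ ≫ (αₗ (F.obj c₁) (F.obj c₃) d₁).hom) ≫
        F.map f ⊵ₗ (F.obj c₃ ⊙ₗ d₁) ≫ F.obj c₂ ⊴ₗ (F.map g ⊵ₗ d₁ ≫ F.obj c₄ ⊴ₗ h)
    rw [← actionHom_def (F.map g), ← actionHom_def (F.map f), Category.assoc, Category.assoc,
      ← actionAssocIso_hom_naturality, action_exchange_assoc, ← comp_actionHomLeft_assoc,
      ← δ_natural, comp_actionHomLeft_assoc, actionHom_def, Category.assoc]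
  actionUnitIso_hom_naturality {d d'} f := by
    change (η F ⊵ₗ d ≫ (λₗ d).hom) ≫ f = F.obj (𝟙_ M) ⊴ₗ f ≫ η F ⊵ₗ d' ≫ (λₗ d').hom
    rw [Category.assoc, actionUnitIso_hom_naturality, action_exchange_assoc]
  whiskerLeft_actionHomLeft m m' m'' f c := by
    change F.map (m ◁ f) ⊵ₗ c = (δ F m m' ⊵ₗ c ≫ (αₗ (F.obj m) (F.obj m') c).hom) ≫
      F.obj m ⊴ₗ F.map f ⊵ₗ c ≫ (αₗ (F.obj m) (F.obj m'') c).inv ≫ μ F m m'' ⊵ₗ c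
    rw [Functor.Monoidal.map_whiskerLeft, comp_actionHomLeft, comp_actionHomLeft,
      whiskerLeft_actionHomLeft]
    simp only [Category.assoc]
  whiskerRight_actionHomLeft {m m'} m'' f c := by
    change F.map (f ▷ m'') ⊵ₗ c = (δ F m m'' ⊵ₗ c ≫ (αₗ (F.obj m) (F.obj m'') c).hom) ≫
      F.map f ⊵ₗ (F.obj m'' ⊙ₗ c) ≫ (αₗ (F.obj m') (F.obj m'') c).inv ≫ μ F m' m'' ⊵ₗ c
    rw [Functor.Monoidal.map_whiskerRight, comp_actionHomLeft, comp_actionHomLeft,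
      whiskerRight_actionHomLeft]
    simp only [Category.assoc]
  associator_actionHom m₁ m₂ m₃ c := by
    change F.map (α_ m₁ m₂ m₃).hom ⊵ₗ c ≫ (δ F m₁ (m₂ ⊗ m₃) ⊵ₗ c ≫ (αₗ _ _ c).hom) ≫
        F.obj m₁ ⊴ₗ (δ F m₂ m₃ ⊵ₗ c ≫ (αₗ _ _ c).hom) =
      (δ F (m₁ ⊗ m₂) m₃ ⊵ₗ c ≫ (αₗ _ _ c).hom) ≫
        δ F m₁ m₂ ⊵ₗ (F.obj m₃ ⊙ₗ c) ≫ (αₗ _ _ (F.obj m₃ ⊙ₗ c)).hom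
    have h1 := congrArg (fun t => t ⊵ₗ c) (Functor.OplaxMonoidal.associativity F m₁ m₂ m₃)
    simp only [comp_actionHomLeft, whiskerRight_actionHomLeft, whiskerLeft_actionHomLeft] at h1
    have h2 := congrArg (fun t => t ≫ (αₗ (F.obj m₁) (F.obj m₂ ⊗ F.obj m₃) c).hom ≫
      F.obj m₁ ⊴ₗ (αₗ (F.obj m₂) (F.obj m₃) c).hom) h1
    simp only [Category.assoc, associator_actionHom, Iso.inv_hom_id_assoc] at h2
    simp only [Category.assoc, actionHomRight_comp]
    exact h2.symm
  leftUnitor_actionHom m c := by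
    change F.map (λ_ m).hom ⊵ₗ c = (δ F (𝟙_ M) m ⊵ₗ c ≫ (αₗ _ _ c).hom) ≫
      η F ⊵ₗ (F.obj m ⊙ₗ c) ≫ (λₗ (F.obj m ⊙ₗ c)).hom
    rw [Functor.Monoidal.map_leftUnitor, comp_actionHomLeft, comp_actionHomLeft,
      whiskerRight_actionHomLeft, leftUnitor_actionHom]
    simp
  rightUnitor_actionHom m c := by
    change F.map (ρ_ m).hom ⊵ₗ c = (δ F m (𝟙_ M) ⊵ₗ c ≫ (αₗ _ _ c).hom) ≫
      F.obj m ⊴ₗ (η F ⊵ₗ c ≫ (λₗ c).hom)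
    rw [Functor.Monoidal.map_rightUnitor, comp_actionHomLeft, comp_actionHomLeft,
      whiskerLeft_actionHomLeft, rightUnitor_actionHom]
    simp

/-- The restriction of an action along a strong monoidal functor is intertwined with it by
identities. -/
def restrictActionIso [MonoidalLeftAction N C] (F : M ⥤ N) [F.Monoidal] :
    @curriedAction M C _ _ _ (restrictAction C F) ≅ F ⋙ curriedAction N C :=
  NatIso.ofComponents (fun m => NatIso.ofComponents (fun c => Iso.refl (F.obj m ⊙ₗ c)) (by
    intro c d f
    exact (Category.comp_id _).trans (Category.id_comp _).symm)) (by
    intro m m' f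
    ext c
    exact (Category.comp_id _).trans (Category.id_comp _).symm)

theorem intertwines_restrictActionIso [MonoidalLeftAction N C] (F : M ⥤ N) [F.Monoidal] :
    @Intertwines M _ _ N _ _ C _ (restrictAction C F) _ F _ (restrictActionIso F) := by
  let _ := restrictAction C F
  refine ⟨fun m m' c => ?_, fun c => ?_⟩
  · change 𝟙 (F.obj (m ⊗ m') ⊙ₗ c) = (δ F m m' ⊵ₗ c ≫ (αₗ (F.obj m) (F.obj m') c).hom) ≫
      F.obj m ⊴ₗ 𝟙 _ ≫ 𝟙 _ ≫ (αₗ (F.obj m) (F.obj m') c).inv ≫ μ F m m' ⊵ₗ c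
    rw [actionHomRight_id, Category.id_comp, Category.id_comp, Category.assoc,
      Iso.hom_inv_id_assoc, ← comp_actionHomLeft, δ_μ, id_actionHomLeft]
  · change 𝟙 (F.obj (𝟙_ M) ⊙ₗ c) = (η F ⊵ₗ c ≫ (λₗ c).hom) ≫ (λₗ c).inv ≫ ε F ⊵ₗ c
    rw [Category.assoc, Iso.hom_inv_id_assoc, ← comp_actionHomLeft, η_ε, id_actionHomLeft]

end Restriction

/-! ### The action of the tensor product on `C` -/

section ConvolutionAction

variable {k : Type w} [Field k]
variable {C : Type (w + 1)} [Category.{w} C] [Preadditive C] [Linear k C]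
variable {T : Type (w + 1)} [Category.{w} T] {Φ : T ⥤ FunL k C C}

/-- The action of `C ⊗ C` on `C`. -/
@[reducible]
def convolutionAction (S : MonoidalLift Φ (compMonoidal k C)) :
    @MonoidalLeftAction T C _ _ S.source :=
  @restrictAction T _ S.source (FunL k C C) _ (compMonoidal k C) C _ (evaluationAction k C) Φ
    S.functor

/-- The associativity isomorphism of the restricted action undoes the structure map of `Φ`, and
evaluation itself is strictly associative. -/
theorem MonoidalLift.convElt_actionAssocIso (S : MonoidalLift Φ (compMonoidal k C)) {t s : T}
    {X y x : C} (f : X ⟶ (Φ.obj t).obj.obj y) (g : y ⟶ (Φ.obj s).obj.obj x) :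
    S.convElt f g ≫ ((convolutionAction S).actionAssocIso t s x).hom =
      f ≫ (Φ.obj t).obj.map g := by
  let _ := compMonoidal k C
  let _ := S.source
  let _ := S.functor
  have h := congrArg (fun α => α.hom.app x) (Functor.Monoidal.μ_δ Φ t s)
  refine (Category.assoc _ _ _).trans ?_
  refine (congrArg (fun r => _ ≫ r) ((Category.assoc _ _ _).symm.trans
    (congrArg (fun r => r ≫ _) h))).trans ?_
  exact (congrArg (fun r => _ ≫ r) (Category.id_comp _)).trans (Category.comp_id _)

theorem MonoidalLift.oneElt_actionUnitIso (S : MonoidalLift Φ (compMonoidal k C)) {X x : C}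
    (f : X ⟶ x) : S.oneElt f ≫ ((convolutionAction S).actionUnitIso x).hom = f := by
  let _ := compMonoidal k C
  let _ := S.source
  let _ := S.functor
  have h := congrArg (fun α => α.hom.app x) (Functor.Monoidal.ε_η Φ)
  refine (Category.assoc _ _ _).trans ?_
  refine (congrArg (fun r => _ ≫ r) ((Category.assoc _ _ _).symm.trans
    (congrArg (fun r => r ≫ _) h))).trans ?_
  refine (congrArg (fun r => _ ≫ r) (Category.id_comp _)).trans ((Category.comp_id _).trans ?_)
  exact Category.comp_id f

end ConvolutionAction

/-! ### The duoidal structure on pure tensors -/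

section TensorDuoidal

variable {k : Type w} [Field k]
variable {C : Type (w + 1)} [Category.{w} C] [Preadditive C] [Linear k C]
variable [MonoidalCategory C] [CocontMonoidal k C]
variable {T : Type (w + 1)} [Category.{w} T] [Preadditive T] [Linear k T] {B : C ⥤ C ⥤ T}
variable {Φ : T ⥤ FunL k C C} [IsLocallyPresentable.{w} C] [IsLocallyPresentable.{w} T]

namespace PairingKernel

variable (κ : PairingKernel k B (Φ ⋙ ObjectProperty.ι _)) {D : DayData k C}
variable [Φ.Full] [Φ.Faithful]
variable (hC : IsCpRigid k C) (hunit : IsCompactProjective k (𝟙_ C)) (h : IsTensorProduct k B)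

/-- Surjectivity of the adjunction. To compute an adjunct it is enough to take the morphism with the
expected one and to compare the two morphisms on elements. -/
theorem exists_unitAdjunct_eq (S : MonoidalLift Φ (compMonoidal k C)) {c₁ c₂ : C}
    (e : c₁ ⊗ c₂ ⟶ 𝟙_ C) : ∃ g, κ.unitAdjunct S hC hunit h g = e := by
  obtain ⟨g, hg, -⟩ := κ.counit_universal S hC hunit h ((B.obj c₁).obj c₂)
    (((tensorFunctorIso h).hom.app c₁).app c₂ ≫ e)
  refine ⟨g, ?_⟩
  rw [unitAdjunct, hg]
  have h1 := congrArg (fun α => (α.app c₁).app c₂) (tensorFunctorIso h).inv_hom_id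
  exact (Category.assoc _ _ e).symm.trans
    ((congrArg (fun t => t ≫ e) h1).trans (Category.id_comp e))

/-- `(a₁ ⊠ a₂) ⊗ (b₁ ⊠ b₂) ≅ (a₁ ⊗ b₁) ⊠ (b₂ ⊗ a₂)` -/
noncomputable def boxIso (S : MonoidalLift Φ D.monoidal) (a₁ a₂ b₁ b₂ : C) :
    S.source.tensorObj ((B.obj a₁).obj a₂) ((B.obj b₁).obj b₂) ≅
      (B.obj (a₁ ⊗ b₁)).obj (b₂ ⊗ a₂) :=
  @asIso _ _ _ _ (κ.boxMul S a₁ a₂ b₁ b₂) (κ.boxMul_isIso S hC h a₁ a₂ b₁ b₂)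

theorem boxIso_hom (S : MonoidalLift Φ D.monoidal) (a₁ a₂ b₁ b₂ : C) :
    (κ.boxIso hC h S a₁ a₂ b₁ b₂).hom = κ.boxMul S a₁ a₂ b₁ b₂ := rfl

theorem elt_evMul_boxIso_inv (S : MonoidalLift Φ D.monoidal) {a₁ a₂ b₁ b₂ x y : C}
    (f : 𝟙_ C ⟶ a₂ ⊗ x) (g : 𝟙_ C ⟶ b₂ ⊗ y) :
    κ.elt (evMul f g) ≫ (Φ.map (κ.boxIso hC h S a₁ a₂ b₁ b₂).inv).hom.app (x ⊗ y) =
      S.mulElt (κ.elt f) (κ.elt g) := by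
  rw [← κ.mulElt_boxMul S, ← κ.boxIso_hom hC h, Category.assoc, ← FunL.comp_app, ← Φ.map_comp,
    Iso.hom_inv_id, Φ.map_id, FunL.id_app, Category.comp_id]

theorem elt_boxUnit_inv (S : MonoidalLift Φ D.monoidal) :
    κ.elt (λ_ (𝟙_ C)).inv ≫ (Φ.map (κ.boxUnit S).inv).hom.app (𝟙_ C) = S.unitElt := by
  rw [← κ.unitElt_boxUnit S, Category.assoc, ← FunL.comp_app, ← Φ.map_comp,
    Iso.hom_inv_id, Φ.map_id, FunL.id_app, Category.comp_id]

variable (S : DuoidalLift Φ D)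

/-- On a pair of elements both sides give the composite of two pointwise products of elements; the
multiplicativity of `ev` appears because `boxMul` multiplies elements by `evMul`. -/
theorem interchange_convIncl (a₁ a₂ b₁ b₂ c₁ c₂ d₁ d₂ : C) (f : 𝟙_ C ⟶ a₂ ⊗ b₁)
    (g : 𝟙_ C ⟶ c₂ ⊗ d₁) :
    S.ptw.source.tensorHom (κ.convIncl S.conv a₁ a₂ b₁ b₂ f) (κ.convIncl S.conv c₁ c₂ d₁ d₂ g) ≫
        S.interchange ((B.obj a₁).obj a₂) ((B.obj b₁).obj b₂)
          ((B.obj c₁).obj c₂) ((B.obj d₁).obj d₂) =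
      (κ.boxIso hC h S.ptw a₁ b₂ c₁ d₂).hom ≫
        κ.convIncl S.conv (a₁ ⊗ c₁) (c₂ ⊗ a₂) (b₁ ⊗ d₁) (d₂ ⊗ b₂) (evMul f g) ≫
        S.conv.source.tensorHom (κ.boxIso hC h S.ptw a₁ a₂ c₁ c₂).inv
          (κ.boxIso hC h S.ptw b₁ b₂ d₁ d₂).inv :=
  κ.box_hom_ext S.ptw fun {x y} u v => by
    simp only [Φ.map_comp, FunL.comp_app]
    rw [reassoc_of% MonoidalLift.mulElt_tensorHom, κ.elt_convIncl, κ.elt_convIncl,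
      S.mulElt_interchange]
    rw [boxIso_hom, reassoc_of% κ.mulElt_boxMul, reassoc_of% κ.elt_convIncl,
      MonoidalLift.convElt_tensorHom, elt_evMul_boxIso_inv, elt_evMul_boxIso_inv]

theorem comul_convIncl : S.comul = (κ.boxUnit S.ptw).hom ≫
    κ.convIncl S.conv (𝟙_ C) (𝟙_ C) (𝟙_ C) (𝟙_ C) (λ_ (𝟙_ C)).inv ≫
      S.conv.source.tensorHom (κ.boxUnit S.ptw).inv
        (κ.boxUnit S.ptw).inv :=
  S.ptw.unit_ext <| by
    simp only [Φ.map_comp, FunL.comp_app]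
    rw [S.unitElt_comul]
    rw [reassoc_of% κ.unitElt_boxUnit, reassoc_of% κ.elt_convIncl,
      MonoidalLift.convElt_tensorHom, elt_boxUnit_inv]

theorem unitAdjunct_mul (c₁ c₂ d₁ d₂ : C) (f : (B.obj c₁).obj c₂ ⟶ S.conv.source.tensorUnit)
    (g : (B.obj d₁).obj d₂ ⟶ S.conv.source.tensorUnit) :
    κ.unitAdjunct S.conv hC hunit h
        ((κ.boxIso hC h S.ptw c₁ c₂ d₁ d₂).inv ≫
          S.ptw.source.tensorHom f g ≫ S.mul) =
      (α_ c₁ d₁ (d₂ ⊗ c₂)).hom ≫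
        c₁ ◁ ((α_ d₁ d₂ c₂).inv ≫ κ.unitAdjunct S.conv hC hunit h g ▷ c₂ ≫ (λ_ c₂).hom) ≫
          κ.unitAdjunct S.conv hC hunit h f := by
  -- Once `m` has the prescribed adjunct, the claim is an equality of maps into the convolution
  -- unit. On elements it is the tensor of two contractions on one side and a nested contraction on
  -- the other.
  obtain ⟨m, hm⟩ := κ.exists_unitAdjunct_eq hC hunit h S.conv ((α_ c₁ d₁ (d₂ ⊗ c₂)).hom ≫
    c₁ ◁ ((α_ d₁ d₂ c₂).inv ≫ κ.unitAdjunct S.conv hC hunit h g ▷ c₂ ≫ (λ_ c₂).hom) ≫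
      κ.unitAdjunct S.conv hC hunit h f)
  rw [← hm]
  congr 1
  rw [Iso.inv_comp_eq]
  refine κ.box_hom_ext S.ptw fun {x y} u v => ?_
  simp only [Φ.map_comp, FunL.comp_app]
  rw [reassoc_of% MonoidalLift.mulElt_tensorHom, κ.elt_map_unit S.conv hC hunit h,
    κ.elt_map_unit S.conv hC hunit h, S.mulElt_mul]
  rw [boxIso_hom, reassoc_of% κ.mulElt_boxMul, κ.elt_map_unit S.conv hC hunit h, hm, pairingInsert_evMul]

theorem unitAdjunct_unitMap : κ.unitAdjunct S.conv hC hunit h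
    ((κ.boxUnit S.ptw).inv ≫ S.unitMap) = (λ_ (𝟙_ C)).hom := by
  obtain ⟨m, hm⟩ := κ.exists_unitAdjunct_eq hC hunit h S.conv (λ_ (𝟙_ C)).hom
  rw [← hm]
  congr 1
  rw [Iso.inv_comp_eq]
  refine S.ptw.unit_ext ?_
  simp only [Φ.map_comp, FunL.comp_app]
  rw [S.unitElt_unitMap]
  rw [reassoc_of% κ.unitElt_boxUnit, κ.elt_map_unit S.conv hC hunit h, hm]
  congr 1
  rw [pairingInsert]
  monoidal

/-- The duoidal category `C ⊗ C`. -/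
noncomputable def tensorDuoidal : TensorDuoidal h where
  conv := κ.convolutionProduct S.conv hC hunit h
  ptw := κ.pointwiseProduct S.ptw hC h
  duoidal := S.duoidal
  interchange_incl := κ.interchange_convIncl hC h S
  comul_incl := κ.comul_convIncl S
  mul_adjunct := κ.unitAdjunct_mul hC hunit h S
  unitMap_adjunct := κ.unitAdjunct_unitMap hC hunit h S

/-- `C` as a module category over `C ⊗ C`. -/
noncomputable def convolutionModule (S : MonoidalLift Φ (compMonoidal k C)) :
    ConvolutionModule (κ.convolutionProduct S hC hunit h) where
  action := convolutionAction S
  kernel := ⟨κ.bilinear, κ.incl, κ.isCopower, κ.natural⟩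
  assoc_incl m₁ m₂ n₁ n₂ d f g := (Category.assoc _ _ _).symm.trans
    ((congrArg (fun t => t ≫ _) (κ.elt_convIncl S f g)).trans
      ((S.convElt_actionAssocIso _ _).trans (κ.elt_map f (κ.elt g))))
  unit_incl c₁ c₂ d g f := by
    refine (Category.assoc _ _ _).symm.trans
      ((congrArg (fun t => t ≫ _) (κ.elt_map_unit S hC hunit h g f)).trans
        ((S.oneElt_actionUnitIso _).trans ?_))
    simp only [pairingInsert, Category.assoc]
    rfl

end PairingKernel

end TensorDuoidal

end PrL

theorem mainTheorem12 (k : Type w) [Field k]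
    (C : Type (w + 1)) [Category.{w} C] [Preadditive C] [Linear k C] [IsLocallyPresentable.{w} C]
    [MonoidalCategory C] [PrL.CocontMonoidal k C]
    (hC : PrL.IsCpRigid k C) (hunit : PrL.IsCompactProjective k (𝟙_ C))
    (T : Type (w + 1)) [Category.{w} T] [Preadditive T] [Linear k T] [IsLocallyPresentable.{w} T]
    (B : C ⥤ C ⥤ T) (h : PrL.IsTensorProduct k B) :
    ∃ (S : PrL.TensorDuoidal h) (R : PrL.FunDuoidal k C) (A : PrL.ConvolutionModule S.conv)
      (Φ : T ⥤ PrL.FunL k C C) (κ : PrL.PairingKernel k B (Φ ⋙ ObjectProperty.ι _))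
      (M : PrL.DuoidalFunctor S.duoidal R.duoidal Φ)
      (θ : @MonoidalLeftAction.curriedAction T C _ _ S.conv.monoidal A.action ≅
        Φ ⋙ @MonoidalLeftAction.curriedAction (PrL.FunL k C C) C _ _ (PrL.compMonoidal k C)
          (PrL.evaluationAction k C)),
      Φ.IsEquivalence ∧
      @PrL.Intertwines T _ S.conv.monoidal (PrL.FunL k C C) _ (PrL.compMonoidal k C) C _
        A.action (PrL.evaluationAction k C) Φ M.cmpMonoidal θ ∧
      ∀ (c₁ c₂ d : C) (f : 𝟙_ C ⟶ c₂ ⊗ d),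
        A.kernel.incl c₁ c₂ d f ≫ (θ.hom.app ((B.obj c₁).obj c₂)).app d = κ.incl c₁ c₂ d f := by
  obtain ⟨A, ⟨κ₀⟩⟩ := PrL.exists_pairingKernel hC hunit h
  have := κ₀.isEquivalence_toFunL hC hunit h
  let Φ := κ₀.toFunL
  -- The data of `κ₀` retyped, as `Φ ⋙ ObjectProperty.ι _` unfolds to `A`.
  let κ : PrL.PairingKernel k B (Φ ⋙ ObjectProperty.ι _) :=
    ⟨κ₀.bilinear, κ₀.incl, κ₀.isCopower, κ₀.natural⟩
  -- One choice of Day convolution serves both the duoidal category of endofunctors and the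
  -- pointwise product transported to `T`, so `Φ` is compatible with the two by construction.
  obtain ⟨D⟩ := PrL.exists_dayData hC hunit h
  obtain ⟨S₁⟩ := PrL.exists_monoidalLift Φ (PrL.compMonoidal k C)
  obtain ⟨S₂⟩ := PrL.exists_monoidalLift Φ D.monoidal
  let S : PrL.DuoidalLift Φ D := ⟨S₁, S₂⟩
  refine ⟨κ.tensorDuoidal hC hunit h S, D.funDuoidal, κ.convolutionModule hC hunit h S₁, Φ, κ,
    S.duoidalFunctor, ?_, inferInstance, ?_, ?_⟩
  · exact @PrL.restrictActionIso T _ S₁.source (PrL.FunL k C C) _ (PrL.compMonoidal k C) C _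
      (PrL.evaluationAction k C) Φ S₁.functor
  · exact @PrL.intertwines_restrictActionIso T _ S₁.source (PrL.FunL k C C) _
      (PrL.compMonoidal k C) C _ (PrL.evaluationAction k C) Φ S₁.functor
  -- The module structure was given the same universal maps as `κ`, and the intertwining isomorphism
  -- has identity components.
  · exact fun c₁ c₂ d f => Category.comp_id _
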